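/- Let $\alpha\in\mathbb C$ with $\alpha\neq 0,1$, and let $E_\alpha$ be the curve over the function field $\mathbb C(\lambda)$ of $\mathbb P^1$ given by the Weierstrass equation $$v^2=u^3-\lambda^3(\lambda^2+2\lambda+\alpha)^2u .$$ Then $E_\alpha$ is an elliptic curve. Let $\mathcal E_\alpha$ be the associated relatively minimal elliptic fibration over $\mathbb P^1$: its fibre over $t\in\mathbb P^1$ is the special fibre of the minimal proper regular model of $E_\alpha$ over the local ring $\mathcal O_{\mathbb P^1,t}$. The polynomial $\lambda^2+2\lambda+\alpha$ has two distinct roots $\lambda_1,\lambda_2$, and the singular fibres of $\mathcal E_\alpha$ are as follows: - a fibre of type $III^*$ over $\lambda=0$; - a fibre of type $I_0^*$ over each of $\lambda_1$ and $\lambda_2$; - a fibre of type $III$ over $\lambda=\infty$. The fibration is smooth over all other points of $\mathbb P^1$. Here a fibre is said to be of one of the following types if its irreducible components are smooth rational curves with these multiplicities and intersections. Type $III$: two components of multiplicity $1$ that meet in exactly one point, with intersection multiplicity $2$. Type $I_0^*$: one component of multiplicity $2$ and four components of multiplicity $1$; each of the four meets the double component transversally in one point, and the four are pairwise disjoint.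 Type $III^*$: seven components of multiplicities $1,2,3,4,3,2,1$ forming a chain, and an eighth component of multiplicity $2$ that meets only the component of multiplicity $4$; components that meet do so transversally in one point. -/

import Mathlib

open CategoryTheory AlgebraicGeometry IsLocalRing Polynomial

noncomputable section

namespace EllipticFibre

universe u

/-! ### Schemes over a ring, and curves on them -/

/-- The structure homomorphism `R → 𝒪_{X,x}` of a scheme `π : X ⟶ Spec R` at a point `x`. -/
def toStalk {R : CommRingCat.{u}} {X : Scheme.{u}} (π : X ⟶ Spec R) (x : X) :
    R →+* X.presheaf.stalk x :=
  ((Scheme.ΓSpecIso R).inv ≫ π.appTop ≫ X.presheaf.germ ⊤ x trivial).hom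

/-- For a point `g` of `X` and a point `x` of its closure, the prime ideal of `𝒪_{X,x}` which
cuts out the closure of `g` (with its reduced structure) near `x`. -/
def curveIdeal {X : Scheme.{u}} {g x : X} (h : g ⤳ x) : Ideal (X.presheaf.stalk x) :=
  (maximalIdeal (X.presheaf.stalk g)).comap (X.presheaf.stalkSpecializes h).hom

/-- The local intersection multiplicity at `x` of the closures of `g` and `g'`: the length of
`𝒪_{X,x} / (I + I')`, where `I`, `I'` are the ideals of the two curves. -/
def localIntersection {X : Scheme.{u}} {g g' x : X} (h : g ⤳ x) (h' : g' ⤳ x) : ℕ∞ :=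
  Module.length (X.presheaf.stalk x) (X.presheaf.stalk x ⧸ (curveIdeal h ⊔ curveIdeal h'))

/-! ### Regular models of an elliptic curve over a discrete valuation ring -/

variable {K : Type u} [Field K]

/-- A proper regular model, over a discrete valuation ring `O` with fraction field `K`, of the
curve over `K` with Weierstrass equation `W`: a regular integral scheme `X`, proper over `O`,
whose function field is `K`-isomorphic to the function field of `W`.

(The last condition says that the generic fibre of `X` is birational to `W`.  Being regular and
proper over `K`, the generic fibre is then isomorphic to `W` if `W` is an elliptic curve.  Flatness
over `O` is automatic, as `X` is integral and dominates `Spec O`.) -/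
structure RegularModel (O : ValuationSubring K) [IsDiscreteValuationRing O]
    (W : WeierstrassCurve K) where
  X : Scheme.{u}
  π : X ⟶ Spec (CommRingCat.of O)
  isIntegral : IsIntegral X
  isProper : IsProper π
  regular : ∀ x : X, IsRegularLocalRing (X.presheaf.stalk x)
  functionFieldEquiv : X.functionField ≃+* W.toAffine.FunctionField
  functionFieldEquiv_comp :
    functionFieldEquiv.toRingHom.comp (toStalk π (genericPoint X)) =
      (algebraMap K W.toAffine.FunctionField).comp (algebraMap O K)

/-! ### Configurations of rational curves -/

/-- The combinatorial type of a singular fibre consisting of `n` smooth rational curves, any two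
of which meet in at most one point: `mult i` is the multiplicity of the `i`-th curve in the fibre
and, for `i ≠ j`, `inter i j` is the intersection number of the `i`-th and the `j`-th curve.

As the intersection number of a component with the whole fibre vanishes, the field `minimal` says
that all components have self-intersection `-2`.  In particular there is no exceptional curve, so
that a regular model with such a fibre is (relatively) minimal. -/
structure FibreConfiguration where
  n : ℕ
  mult : Fin n → ℕ
  inter : Fin n → Fin n → ℕ
  symm : ∀ i j, inter i j = inter j i
  diag : ∀ i, inter i i = 0
  minimal : ∀ i, ∑ j, mult j * inter i j = 2 * mult i

/-- Type `III`: two smooth rational curves that are tangent to each other in one point. -/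
def typeIII : FibreConfiguration where
  n := 2
  mult := ![1, 1]
  inter := ![![0, 2],
            ![2, 0]]
  symm := by decide
  diag := by decide
  minimal := by decide

/-- Type `I₀*`: a component of multiplicity two, and four reduced components which meet it
transversally and are pairwise disjoint. -/
def typeI0star : FibreConfiguration where
  n := 5
  mult := ![2, 1, 1, 1, 1]
  inter := ![![0, 1, 1, 1, 1],
            ![1, 0, 0, 0, 0],
            ![1, 0, 0, 0, 0],
            ![1, 0, 0, 0, 0],
            ![1, 0, 0, 0, 0]]
  symm := by decide
  diag := by decide
  minimal := by decide

/-- Type `III*`: eight components, namely a chain of seven curves of multiplicities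
`1, 2, 3, 4, 3, 2, 1` and a curve of multiplicity `2` attached to the middle one; all
intersections are transversal. -/
def typeIIIstar : FibreConfiguration where
  n := 8
  mult := ![1, 2, 3, 4, 3, 2, 1, 2]
  inter := ![![0, 1, 0, 0, 0, 0, 0, 0],
            ![1, 0, 1, 0, 0, 0, 0, 0],
            ![0, 1, 0, 1, 0, 0, 0, 0],
            ![0, 0, 1, 0, 1, 0, 0, 1],
            ![0, 0, 0, 1, 0, 1, 0, 0],
            ![0, 0, 0, 0, 1, 0, 1, 0],
            ![0, 0, 0, 0, 0, 1, 0, 0],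
            ![0, 0, 0, 1, 0, 0, 0, 0]]
  symm := by decide
  diag := by decide
  minimal := by decide

/-! ### The special fibre of a regular model -/

section SpecialFibre

variable {O : ValuationSubring K} [IsDiscreteValuationRing O] {W : WeierstrassCurve K}

/-- The generic points of the irreducible components of the special fibre. -/
def RegularModel.components (M : RegularModel O W) : Set M.X :=
  {g | M.π g = closedPoint O ∧ ∀ y : M.X, M.π y = closedPoint O → y ⤳ g → y = g}

/-- The component with generic point `g` has multiplicity `m` in the special fibre: a uniformizer
of `O` has order `m` along it. -/
def RegularModel.HasMultiplicity (M : RegularModel O W) (g : M.X) (m : ℕ) : Prop :=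
  (maximalIdeal O).map (toStalk M.π g) = maximalIdeal (M.X.presheaf.stalk g) ^ m

/-- The component with generic point `g` is a smooth rational curve: its local rings are regular,
and its function field is a field of rational functions `k(t)` over the residue field `k` of `O`.
(Used when `k` is algebraically closed, where regular and smooth mean the same.) -/
def RegularModel.IsSmoothRational (M : RegularModel O W) (g : M.X) : Prop :=
  (∀ (x : M.X) (h : g ⤳ x), IsRegularLocalRing (M.X.presheaf.stalk x ⧸ curveIdeal h)) ∧
  ∃ e : ResidueField (M.X.presheaf.stalk g) ≃+* RatFunc (ResidueField O),
    (e.toRingHom.comp (residue (M.X.presheaf.stalk g))).comp (toStalk M.π g) =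
      (algebraMap (ResidueField O) (RatFunc (ResidueField O))).comp (residue O)

/-- The special fibre of the model has the configuration `T`: its irreducible components are
smooth rational curves `Γ 0, …, Γ (n - 1)`, with the multiplicities given by `T`; two of them are
disjoint if their intersection number in `T` is zero, and otherwise they meet in exactly one point,
with local intersection multiplicity equal to that number. -/
def RegularModel.HasSpecialFibre (M : RegularModel O W) (T : FibreConfiguration) : Prop :=
  ∃ Γ : Fin T.n → M.X, Function.Injective Γ ∧ Set.range Γ = M.components ∧
    (∀ i, M.HasMultiplicity (Γ i) (T.mult i)) ∧
    (∀ i, M.IsSmoothRational (Γ i)) ∧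
    (∀ i j, i ≠ j → T.inter i j = 0 → ∀ x, ¬ (Γ i ⤳ x ∧ Γ j ⤳ x)) ∧
    (∀ i j, i ≠ j → T.inter i j ≠ 0 →
      ∃ (x : M.X) (hi : Γ i ⤳ x) (hj : Γ j ⤳ x),
        (∀ y, Γ i ⤳ y → Γ j ⤳ y → y = x) ∧ localIntersection hi hj = T.inter i j)

end SpecialFibre

/-- The elliptic fibration with generic fibre `W` has a fibre of type `T` over the place with local
ring `O`: the minimal proper regular model of `W` over `O` (which is unique) has a special fibre of
type `T`. -/
def HasFibre (O : ValuationSubring K) [IsDiscreteValuationRing O] (W : WeierstrassCurve K)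
    (T : FibreConfiguration) : Prop :=
  ∃ M : RegularModel O W, M.HasSpecialFibre T

/-- The elliptic fibration with generic fibre `W` is smooth over the place with local ring `O`. -/
def HasSmoothFibre (O : ValuationSubring K) [IsDiscreteValuationRing O]
    (W : WeierstrassCurve K) : Prop :=
  ∃ M : RegularModel O W, Smooth M.π

/-! ### The points of the projective line over `ℂ` -/

/-- The point `λ = a` of the affine line, as a maximal ideal of `ℂ[λ]`. -/
def affinePoint (a : ℂ) : IsDedekindDomain.HeightOneSpectrum ℂ[X] where
  asIdeal := Ideal.span {X - C a}
  isPrime := (Ideal.span_singleton_prime (X_sub_C_ne_zero a)).mpr (prime_X_sub_C a)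
  ne_bot := by simpa using X_sub_C_ne_zero a

/-- The local ring of `ℙ¹` at `λ = a`, inside the function field `ℂ(λ)`. -/
abbrev localRingAt (a : ℂ) : ValuationSubring (RatFunc ℂ) :=
  ((affinePoint a).valuation (RatFunc ℂ)).valuationSubring

/-- The local ring of `ℙ¹` at `λ = ∞`, inside the function field `ℂ(λ)`. -/
abbrev localRingAtInfty : ValuationSubring (RatFunc ℂ) :=
  open Classical in (RatFunc.inftyValuation ℂ).valuationSubring


/-! ### The family -/

/-- The Weierstrass equation `v² = u³ - λ³ (λ² + 2λ + α)² u` over `ℂ(λ)`. -/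
def weierstrass (α : ℂ) : WeierstrassCurve (RatFunc ℂ) where
  a₁ := 0
  a₂ := 0
  a₃ := 0
  a₄ := -(RatFunc.X ^ 3 * (RatFunc.X ^ 2 + 2 * RatFunc.X + RatFunc.C α) ^ 2)
  a₆ := 0

end EllipticFibre

end

/-!
The fibre over a point of the projective line depends only on the equation over the local ring `O`
at that point. After a change of coordinates the equation is `y² = x³ - πᵏ u x` with a uniformizer
`π` and a unit `u` of `O`, where `k = 3` at `λ = 0`, `k = 2` at the roots of `λ² + 2λ + α`,
`k = 1` at infinity, and `k = 0` elsewhere (`exists_isCurve`, `hasFibre_weierstrass_infty`). The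
value at infinity comes from `λ⁻⁸ · λ³ (λ² + 2λ + α)² = π (1 + 2π + α π²)²` for `π = λ⁻¹`. Thus it
is enough to exhibit regular models for the equations with `k = 0, 1, 2, 3`.

The model is not obtained by successive blowing up, but in one step: it is the closure of the graph
of a rational map from the curve to a product of projective lines, the components of which are
monomials in `π`, `x`, `y`. In algebraic terms it is `Proj (⨁ Iⁿ)` (`blowup`), where `I` is the
product of the `O`-modules generated by `1` and by one of the monomials (`pencilModule`). It is
proper over `O` by construction, and it is covered by spectra of subrings of the function field
which are generated by monomials (`chart_pencilModule`). All statements about it are reduced to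
statements about these rings and about valuation rings of the function field:

* Every point of a chart is the centre of a valuation ring (`exists_centre_eq`). So a family of
  charts covers the model if each valuation ring which contains `O` contains the ring of one of
  them (`exists_mem_range_chartMap`), which is checked by distinguishing for some monomials whether
  they or their inverses are integral.
* The components of the special fibre are the centres of valuation rings which extend the Gauss
  valuation of `O[θ]` for suitable functions `θ` (`exists_isResTranscendental`). The orders of `x`
  and `y` along a component (`HasOrders`) tell on which charts it is visible.
* On a chart where it is visible, a component is an affine line with an explicit coordinate, is cut
  out by an explicit function, and this function divides `π` to an explicit order (`IsLineChart`,
  `IsLine`). This implies that the model is regular along the component, that the component is a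
  smooth rational curve, and its multiplicity. If one component is cut out by a function which is
  the `n`-th power of the coordinate on another one, they meet with multiplicity `n`; if two
  functions, each of which vanishes on one of the components, have a unit as their sum, they do not
  meet (`IsFibreAtlas.hasSpecialFibre`, `IsPencilAtlas.hasFibre`).
* Away from the special fibre, the model is regular because the local rings of the curve
  `y² = x³ - a x` over a field are regular if `2 a ≠ 0` (`isRegularLocalRing_of_weierstrass`).

The translation by the point `(0, 0)` of order two acts on monomials up to units
(`IsCurve.monom_translate`). It is a symmetry of all the configurations, and exchanges the two ends
of the chain of a fibre of type `III*`, the two components of a fibre of type `III`, and in pairs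
the simple components of a fibre of type `I₀*`; so about half of the charts need no separate
treatment.

If `k = 0`, the affine curve and its translate cover the model. They are regular by the Jacobian
criterion (`isRegularRing_weierstrass`), and smooth over `O` because solutions of the equation can
be lifted along square-zero extensions (`formallySmooth_weierstrass`).
-/

open CategoryTheory AlgebraicGeometry IsLocalRing Polynomial

noncomputable section

namespace EllipticFibre

universe u

/-! ### The graded ring of a module of rational functions -/

section SectionRing

variable {R F : Type u} [CommRing R] [Field F] [Algebra R F]

/-- The graded ring `⨁ Iⁿ` of an `R`-submodule `I` of a field `F`, realised inside `F[T]` as the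
ring of polynomials whose `n`-th coefficient lies in `Iⁿ`. -/
def sectionRing (I : Submodule R F) : Subalgebra R F[X] where
  carrier := {f | ∀ n, f.coeff n ∈ I ^ n}
  mul_mem' hf hg n := by
    rw [coeff_mul]
    refine Submodule.sum_mem _ fun ⟨j, k⟩ e ↦ ?_
    rw [← Finset.HasAntidiagonal.mem_antidiagonal.mp e, pow_add]
    exact Submodule.mul_mem_mul (hf j) (hg k)
  add_mem' hf hg n := by
    rw [coeff_add]
    exact Submodule.add_mem _ (hf n) (hg n)
  algebraMap_mem' r n := by
    rw [Polynomial.algebraMap_apply, coeff_C]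
    split_ifs with h
    · subst h
      rw [pow_zero]
      exact Submodule.algebraMap_mem r
    · exact Submodule.zero_mem _

variable {I : Submodule R F}

lemma monomial_mem_sectionRing {n : ℕ} {a : F} (ha : a ∈ I ^ n) :
    monomial n a ∈ sectionRing I := fun m ↦ by
  rw [coeff_monomial]
  split_ifs with h
  · exact h ▸ ha
  · exact Submodule.zero_mem _

variable (I) in
/-- The grading of the section ring by the degree in `T`. -/
def sectionGrading (n : ℕ) : Submodule R (sectionRing I) where
  carrier := {f | ∀ m, m ≠ n → f.1.coeff m = 0}
  add_mem' hf hg m hm := by simp [hf m hm, hg m hm]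
  zero_mem' m _ := by simp
  smul_mem' r f hf m hm := by simp [hf m hm]

/-- The element `a Tⁿ` of the section ring. -/
def sectionMonomial (n : ℕ) (a : F) (ha : a ∈ I ^ n) : sectionRing I :=
  ⟨monomial n a, monomial_mem_sectionRing ha⟩

lemma sectionMonomial_mem (n : ℕ) (a : F) (ha : a ∈ I ^ n) :
    sectionMonomial n a ha ∈ sectionGrading I n :=
  fun m hm ↦ by simp [sectionMonomial, coeff_monomial, hm.symm]

lemma eq_sectionMonomial {n : ℕ} {f : sectionRing I} (hf : f ∈ sectionGrading I n) :
    f = sectionMonomial n (f.1.coeff n) (f.2 n) := by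
  apply Subtype.ext
  ext m
  simp only [sectionMonomial, coeff_monomial]
  split_ifs with h
  · rw [h]
  · exact hf m (Ne.symm h)

instance : SetLike.GradedMonoid (sectionGrading I) where
  one_mem m hm := by simp [coeff_one, hm]
  mul_mem i j f g hf hg m hm := by
    rw [eq_sectionMonomial hf, eq_sectionMonomial hg]
    simp [sectionMonomial, monomial_mul_monomial, coeff_monomial, hm.symm]

lemma coeff_coeAddMonoidHom (x : DirectSum ℕ fun i ↦ sectionGrading I i) (i : ℕ) :
    (DirectSum.coeAddMonoidHom (sectionGrading I) x).1.coeff i = (x i).1.1.coeff i := by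
  induction x using DirectSum.induction_on with
  | zero => simp
  | of j y =>
    rw [DirectSum.coeAddMonoidHom_of]
    by_cases hij : j = i
    · subst hij; rw [DirectSum.of_eq_same]
    · rw [DirectSum.of_eq_of_ne _ _ _ (Ne.symm hij)]
      exact y.2 i (Ne.symm hij)
  | add x y hx hy => simp_all

/-- The homogeneous components of an element of the section ring. -/
def sectionDecompose (f : sectionRing I) : DirectSum ℕ fun i ↦ sectionGrading I i :=
  DirectSum.mk _ f.1.support fun i ↦
    ⟨sectionMonomial i (f.1.coeff i) (f.2 i), sectionMonomial_mem _ _ _⟩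

lemma sectionDecompose_apply (f : sectionRing I) (i : ℕ) :
    (sectionDecompose f i).1 = sectionMonomial i (f.1.coeff i) (f.2 i) := by
  rw [sectionDecompose]
  by_cases hi : i ∈ f.1.support
  · rw [DirectSum.mk_apply_of_mem hi]
  · rw [DirectSum.mk_apply_of_notMem hi]
    refine Subtype.ext ?_
    simp [sectionMonomial, notMem_support_iff.mp hi]

instance : DirectSum.Decomposition (sectionGrading I) where
  decompose' := sectionDecompose
  left_inv f := by
    refine Subtype.ext (Polynomial.ext fun i ↦ ?_)
    rw [coeff_coeAddMonoidHom, sectionDecompose_apply]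
    simp [sectionMonomial]
  right_inv x := by
    refine DFinsupp.ext fun i ↦ Subtype.ext ?_
    rw [sectionDecompose_apply, eq_sectionMonomial (x i).2]
    exact Subtype.ext (congrArg (monomial i) (coeff_coeAddMonoidHom x i))

instance : GradedAlgebra (sectionGrading I) where

lemma monomial_mem_adjoin_sectionRing {n : ℕ} {a : F} (ha : a ∈ I ^ n) :
    monomial n a ∈ Algebra.adjoin R
      (((monomial 1 : F →ₗ[F] F[X]).restrictScalars R) '' (I : Set F)) := by
  induction n generalizing a with
  | zero =>
    rw [pow_zero] at ha
    obtain ⟨r, rfl⟩ := Submodule.mem_one.mp ha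
    exact Subalgebra.algebraMap_mem _ r
  | succ n hn =>
    rw [pow_succ'] at ha
    refine Submodule.mul_induction_on ha ?_ ?_
    · intro r hr s hs
      rw [add_comm n 1, ← monomial_mul_monomial]
      exact Subalgebra.mul_mem _ (Algebra.subset_adjoin (Set.mem_image_of_mem _ hr)) (hn hs)
    · intro x y hx hy
      rw [map_add]
      exact Subalgebra.add_mem _ hx hy

/-- The generators of `I`, placed in degree one, generate `⨁ Iⁿ`. -/
lemma fg_sectionRing (hI : I.FG) : (sectionRing I).FG := by
  classical
  have h : Algebra.adjoin R
      (((monomial 1 : F →ₗ[F] F[X]).restrictScalars R) '' (I : Set F)) = sectionRing I := by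
    apply le_antisymm
    · apply Algebra.adjoin_le _
      rintro _ ⟨r, hr, rfl⟩
      exact monomial_mem_sectionRing (by rwa [pow_one])
    · intro p hp
      rw [p.as_sum_support]
      exact Subalgebra.sum_mem _ fun i _ ↦ monomial_mem_adjoin_sectionRing (hp i)
  obtain ⟨s, hs⟩ := hI
  rw [← h, ← hs]
  use s.image ((monomial 1 : F →ₗ[F] F[X]).restrictScalars R)
  rw [Finset.coe_image, ← Submodule.map_coe, Submodule.map_span, Algebra.adjoin_span]

lemma finiteType_sectionRing (hI : I.FG) :
    Algebra.FiniteType (sectionGrading I 0) (sectionRing I) := by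
  have : Algebra.FiniteType R (sectionRing I) := (sectionRing I).fg_iff_finiteType.mp (fg_sectionRing hI)
  have : IsScalarTower R (sectionGrading I 0) (sectionRing I) :=
    ⟨fun r a b ↦ smul_assoc r (a : sectionRing I) b⟩
  exact .of_restrictScalars_finiteType R (sectionGrading I 0) (sectionRing I)

lemma bijective_algebraMap_sectionGrading_zero (h : Function.Injective (algebraMap R F)) :
    Function.Bijective (algebraMap R (sectionGrading I 0)) := by
  constructor
  · intro a b hab
    have := congrArg (fun z : sectionGrading I 0 ↦ z.1.1.coeff 0) hab
    exact h (by simpa using this)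
  · intro f
    have hf := f.1.2 0
    rw [pow_zero] at hf
    obtain ⟨r, hr⟩ := Submodule.mem_one.mp hf
    refine ⟨r, Subtype.ext ?_⟩
    rw [eq_sectionMonomial f.2]
    apply Subtype.ext
    change C (algebraMap R F r) = monomial 0 _
    rw [hr]; rfl

/-! ### Affine charts -/

/-- The affine chart `R[a / s | a ∈ I]` on which the section `s` of `I` does not vanish. -/
def chart (I : Submodule R F) (s : F) : Subalgebra R F :=
  Algebra.adjoin R ((fun a ↦ a / s) '' (I : Set F))

lemma div_mem_chart {a : F} (s : F) (ha : a ∈ I) : a / s ∈ chart I s :=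
  Algebra.subset_adjoin ⟨a, ha, rfl⟩

lemma div_pow_mem_chart {n : ℕ} {a : F} (s : F) (ha : a ∈ I ^ n) : a / s ^ n ∈ chart I s := by
  induction n generalizing a with
  | zero =>
    rw [pow_zero] at ha
    obtain ⟨r, rfl⟩ := Submodule.mem_one.mp ha
    simp
  | succ n hn =>
    rw [pow_succ'] at ha
    refine Submodule.mul_induction_on ha ?_ ?_
    · intro r hr t ht
      rw [pow_succ', mul_div_mul_comm]
      exact Subalgebra.mul_mem _ (div_mem_chart s hr) (hn ht)
    · intro x y hx hy
      rw [add_div]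
      exact Subalgebra.add_mem _ hx hy

lemma mem_chart_iff {s : F} (hs : s ∈ I) (hs0 : s ≠ 0) {b : F} :
    b ∈ chart I s ↔ ∃ n, ∃ a ∈ I ^ n, b = a / s ^ n := by
  refine ⟨fun hb ↦ ?_, ?_⟩
  · induction hb using Algebra.adjoin_induction with
    | mem x hx =>
      obtain ⟨a, ha, rfl⟩ := hx
      exact ⟨1, a, by rwa [pow_one], by simp⟩
    | algebraMap r => exact ⟨0, algebraMap R F r, by
        rw [pow_zero]; exact Submodule.algebraMap_mem r, by simp⟩
    | add x y _ _ hx hy =>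
      obtain ⟨n, a, ha, rfl⟩ := hx
      obtain ⟨m, b, hb, rfl⟩ := hy
      refine ⟨n + m, a * s ^ m + s ^ n * b, add_mem ?_ ?_, ?_⟩
      · rw [pow_add]; exact Submodule.mul_mem_mul ha (Submodule.pow_mem_pow I hs m)
      · rw [pow_add]; exact Submodule.mul_mem_mul (Submodule.pow_mem_pow I hs n) hb
      · rw [div_add_div _ _ (pow_ne_zero _ hs0) (pow_ne_zero _ hs0), pow_add]
    | mul x y _ _ hx hy =>
      obtain ⟨n, a, ha, rfl⟩ := hx
      obtain ⟨m, b, hb, rfl⟩ := hy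
      exact ⟨n + m, a * b, by rw [pow_add]; exact Submodule.mul_mem_mul ha hb, by
        rw [div_mul_div_comm, pow_add]⟩
  · rintro ⟨n, a, ha, rfl⟩
    exact div_pow_mem_chart s ha

/-- The section `s` of `I`, as an element of degree one of the section ring. -/
abbrev degOne (s : F) (hs : s ∈ I) : sectionRing I :=
  sectionMonomial 1 s (by rwa [pow_one])

variable (I) in
/-- The evaluation `T ↦ 1` of the section ring. -/
def sectionEval : sectionRing I →+* F := (Polynomial.evalRingHom 1).comp (sectionRing I).val.toRingHom

lemma sectionEval_monomial (n : ℕ) (a : F) (ha : a ∈ I ^ n) :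
    sectionEval I (sectionMonomial n a ha) = a := by
  simp [sectionEval, sectionMonomial]

/-- The value in `F` of an element of degree zero of the localised section ring, that is, the
evaluation `T ↦ 1`. -/
def awayToField (x : sectionRing I) (hx : sectionEval I x ≠ 0) :
    HomogeneousLocalization.Away (sectionGrading I) x →+* F :=
  (IsLocalization.Away.lift (S := Localization.Away x) x (g := sectionEval I) hx.isUnit).comp
    (algebraMap (HomogeneousLocalization.Away (sectionGrading I) x) (Localization.Away x))

lemma awayToField_mk {d : ℕ} {x : sectionRing I} (hx : sectionEval I x ≠ 0)
    (hd : x ∈ sectionGrading I d) (n : ℕ) (a : sectionRing I) (ha : a ∈ sectionGrading I (n • d)) :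
    awayToField x hx (.mk _ hd n a ha) = sectionEval I a / sectionEval I x ^ n := by
  have key := fun b ↦ IsLocalization.Away.lift_eq (S := Localization.Away x)
    x (g := sectionEval I) hx.isUnit b
  rw [awayToField, RingHom.comp_apply, HomogeneousLocalization.algebraMap_apply,
    HomogeneousLocalization.Away.val_mk, Localization.mk_eq_mk', eq_div_iff (pow_ne_zero _ hx),
    ← map_pow, ← key (x ^ n), ← map_mul, ← key a]
  congr 1
  exact IsLocalization.mk'_spec _ a (⟨x ^ n, n, rfl⟩ : Submonoid.powers x)

lemma awayToField_comp_awayMap {d e : ℕ} {x y z : sectionRing I} (hx : sectionEval I x ≠ 0)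
    (hz : sectionEval I z ≠ 0) (hd : x ∈ sectionGrading I d) (he : y ∈ sectionGrading I e)
    (h : z = x * y) :
    (awayToField z hz).comp (HomogeneousLocalization.awayMap _ he h) = awayToField x hx := by
  ext b
  obtain ⟨n, a, ha, rfl⟩ := HomogeneousLocalization.Away.mk_surjective _ hd b
  subst h
  have hy : sectionEval I y ≠ 0 := fun h ↦ hz (by rw [map_mul, h, mul_zero])
  rw [RingHom.comp_apply, HomogeneousLocalization.awayMap_mk, awayToField_mk, awayToField_mk,
    map_mul, map_mul, map_pow, mul_pow, mul_div_mul_right _ _ (pow_ne_zero _ hy)]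

lemma awayToField_injective {d : ℕ} {x : sectionRing I} (hx : sectionEval I x ≠ 0)
    (hd : x ∈ sectionGrading I d) : Function.Injective (awayToField x hx) := by
  rw [injective_iff_map_eq_zero]
  intro z hz
  obtain ⟨n, a, ha, rfl⟩ := HomogeneousLocalization.Away.mk_surjective _ hd z
  rw [awayToField_mk, div_eq_zero_iff, or_iff_left (pow_ne_zero _ hx), eq_sectionMonomial ha,
    sectionEval_monomial] at hz
  have ha0 : a = 0 := by
    rw [eq_sectionMonomial ha]
    apply Subtype.ext
    simp only [sectionMonomial, hz, map_zero, ZeroMemClass.coe_zero]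
  subst ha0
  apply HomogeneousLocalization.val_injective
  rw [HomogeneousLocalization.Away.val_mk, HomogeneousLocalization.val_zero, Localization.mk_zero]

variable {s : F} (hs : s ∈ I) (hs0 : s ≠ 0)

include hs0 in
lemma sectionEval_degOne_ne_zero : sectionEval I (degOne s hs) ≠ 0 := by
  rwa [sectionEval_monomial]

lemma awayToField_mem (z) :
    awayToField (degOne s hs) (sectionEval_degOne_ne_zero hs hs0) z ∈ chart I s := by
  obtain ⟨n, a, ha, rfl⟩ := HomogeneousLocalization.Away.mk_surjective _
    (sectionMonomial_mem 1 s (by rwa [pow_one])) z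
  rw [mem_chart_iff hs hs0]
  refine ⟨n, a.1.coeff n, a.2 n, ?_⟩
  rw [awayToField_mk, eq_sectionMonomial ha, sectionEval_monomial, sectionEval_monomial]
  simp [sectionMonomial]

/-- The degree zero part of the section ring localised at `s`, mapped to the affine chart. -/
def awayToChart :
    HomogeneousLocalization.Away (sectionGrading I) (degOne s hs) →+* chart I s :=
  (awayToField _ (sectionEval_degOne_ne_zero hs hs0)).codRestrict (chart I s)
    (awayToField_mem hs hs0)

lemma coe_awayToChart (z) : (awayToChart hs hs0 z : F) =
    awayToField _ (sectionEval_degOne_ne_zero hs hs0) z := rfl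

/-- The ring `chart I s` is the homogeneous localisation of `⨁ Iⁿ` at `s`. -/
lemma bijective_awayToChart : Function.Bijective (awayToChart hs hs0) :=
  ⟨fun a b h ↦ awayToField_injective (sectionEval_degOne_ne_zero hs hs0)
    (sectionMonomial_mem 1 s _) (congrArg Subtype.val h), by
      rintro ⟨b, hb⟩
      obtain ⟨n, a, ha, rfl⟩ := (mem_chart_iff hs hs0).mp hb
      refine ⟨.mk _ (sectionMonomial_mem 1 s (by rwa [pow_one])) n (sectionMonomial n a ha)
        (by simpa using sectionMonomial_mem n a ha), Subtype.ext ?_⟩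
      exact (awayToField_mk ..).trans (by rw [sectionEval_monomial, sectionEval_monomial])⟩

end SectionRing

/-! ### Local rings in an affine chart of a scheme -/

section ChartStalk

variable {A : Type u} [CommRing A] {X : Scheme.{u}} (ι : Spec (.of A) ⟶ X) [IsOpenImmersion ι]

/-- The localisation homomorphism from the coordinate ring of an affine chart to the local ring
at a point of the chart. -/
def chartStalk (y : Spec (.of A)) : A →+* X.presheaf.stalk (ι y) :=
  ((Scheme.ΓSpecIso (.of A)).inv ≫ (Spec (.of A)).presheaf.germ ⊤ y (TopologicalSpace.Opens.mem_top y) ≫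
    inv (ι.stalkMap y)).hom

lemma isLocalization_chartStalk (y : PrimeSpectrum A) :
    letI := (chartStalk ι y).toAlgebra
    IsLocalization.AtPrime (X.presheaf.stalk (ι y)) y.asIdeal := by
  let _ := (chartStalk ι y).toAlgebra
  have h := StructureSheaf.IsLocalization.to_stalk (CommRingCat.of A) y
  let y' : Spec (.of A) := y
  let e := (asIso (ι.stalkMap y')).symm.commRingCatIsoToRingEquiv
  let e' : (Spec.structureSheaf (CommRingCat.of A)).presheaf.stalk y ≃ₐ[A] X.presheaf.stalk (ι y) :=
    AlgEquiv.ofRingEquiv (f := e) fun r ↦ rfl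
  exact IsLocalization.isLocalization_of_algEquiv (M := y.asIdeal.primeCompl)
    (S := (Spec.structureSheaf (CommRingCat.of A)).presheaf.stalk y) e'

lemma stalkSpecializes_chartStalk {y y' : Spec (.of A)} (h : y ⤳ y') (h' : ι y ⤳ ι y') (a : A) :
    X.presheaf.stalkSpecializes h' (chartStalk ι y' a) = chartStalk ι y a := by
  have h1 := Scheme.Hom.stalkSpecializes_stalkMap ι y y' h
  have h3 : ((Scheme.ΓSpecIso (.of A)).inv ≫ (Spec (.of A)).presheaf.germ ⊤ y' (TopologicalSpace.Opens.mem_top y') ≫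
    inv (ι.stalkMap y')) ≫ X.presheaf.stalkSpecializes h' =
      ((Scheme.ΓSpecIso (.of A)).inv ≫ (Spec (.of A)).presheaf.germ ⊤ y (TopologicalSpace.Opens.mem_top y) ≫
    inv (ι.stalkMap y)) := by
    rw [Category.assoc, Category.assoc]
    congr 1
    have : X.presheaf.stalkSpecializes h' = ι.stalkMap y' ≫
      (Spec (.of A)).presheaf.stalkSpecializes h ≫ inv (ι.stalkMap y) := by
      rw [← Category.assoc, IsIso.eq_comp_inv]; exact h1
    rw [this, IsIso.inv_hom_id_assoc, TopCat.Presheaf.germ_stalkSpecializes_assoc]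
  exact congr($(h3).hom a)

lemma toStalk_eq_chartStalk {R : Type u} [CommRing R] [Algebra R A] (π : X ⟶ Spec (.of R))
    (h : ι ≫ π = Spec.map (CommRingCat.ofHom (algebraMap R A))) (y : Spec (.of A)) (r : R) :
    toStalk π (ι y) r = chartStalk ι y (algebraMap R A r) := by
  have h3 : (Scheme.ΓSpecIso (.of R)).inv ≫ π.appTop ≫ X.presheaf.germ ⊤ (ι y) (TopologicalSpace.Opens.mem_top (ι y)) =
     CommRingCat.ofHom (algebraMap R A) ≫ ((Scheme.ΓSpecIso (.of A)).inv ≫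
      (Spec (.of A)).presheaf.germ ⊤ y (TopologicalSpace.Opens.mem_top y) ≫ inv (ι.stalkMap y)) := by
    rw [← Category.assoc, ← Category.assoc, ← Category.assoc, IsIso.eq_comp_inv]
    have h4 := Scheme.Hom.germ_stalkMap ι ⊤ y (TopologicalSpace.Opens.mem_top (ι y))
    rw [Category.assoc, Category.assoc, h4]
    have h5 := congr(Scheme.Hom.appTop $h)
    rw [Scheme.Hom.comp_appTop] at h5
    have h6 := Scheme.ΓSpecIso_inv_naturality (CommRingCat.ofHom (algebraMap R A))
    rw [h6, ← h5]
    simp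
  exact congr($(h3).hom r)

lemma curveIdeal_eq_map {y y' : Spec (.of A)} (h' : ι y ⤳ ι y') :
    curveIdeal h' = (PrimeSpectrum.asIdeal y).map (chartStalk ι y') := by
  let _ := (chartStalk ι y').toAlgebra
  have := isLocalization_chartStalk ι y'
  have h : y ⤳ y' := ι.isOpenEmbedding.isInducing.specializes_iff.mp h'
  have := PrimeSpectrum.isPrime y
  have := PrimeSpectrum.isPrime y'
  rw [← IsLocalization.map_under (PrimeSpectrum.asIdeal y').primeCompl
    (X.presheaf.stalk (ι y')) (curveIdeal h')]
  congr 1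
  ext a
  let _ := (chartStalk ι y).toAlgebra
  have := isLocalization_chartStalk ι y
  change X.presheaf.stalkSpecializes h' (chartStalk ι y' a) ∈ maximalIdeal _ ↔ _
  rw [stalkSpecializes_chartStalk ι h]
  exact IsLocalization.AtPrime.to_map_mem_maximal_iff _ (PrimeSpectrum.asIdeal y) a

end ChartStalk

/-! ### The blowing-up of a module of functions -/

section Blowup

variable {R F : Type u} [CommRing R] [Field F] [Algebra R F]

/-- The scheme `Proj (⨁ Iⁿ)`. -/
abbrev blowup (I : Submodule R F) : Scheme.{u} := Proj (sectionGrading I)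

/-- The homomorphism from `R` to the degree zero part of the section ring. -/
def baseToZero (I : Submodule R F) : CommRingCat.of R ⟶ CommRingCat.of (sectionGrading I 0) :=
  CommRingCat.ofHom (algebraMap R (sectionGrading I 0))

/-- The structure morphism of `Proj (⨁ Iⁿ)` over `R`. -/
def blowupToBase (I : Submodule R F) : blowup I ⟶ Spec (.of R) :=
  Proj.toSpecZero (sectionGrading I) ≫ Spec.map (baseToZero I)

variable {I : Submodule R F}

lemma isProper_blowupToBase (h : Function.Injective (algebraMap R F)) (hI : I.FG) :
    IsProper (blowupToBase I) := by
  have := finiteType_sectionRing hI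
  have h1 : IsIso (baseToZero I) :=
    (ConcreteCategory.isIso_iff_bijective (baseToZero I)).mpr
      (bijective_algebraMap_sectionGrading_zero h)
  unfold blowupToBase
  infer_instance

variable {s : F} (hs : s ∈ I) (hs0 : s ≠ 0)

/-- The affine chart of `Proj (⨁ Iⁿ)` on which the section `s` does not vanish. -/
def chartMap : Spec (.of (chart I s)) ⟶ blowup I :=
  Spec.map (CommRingCat.ofHom (awayToChart hs hs0)) ≫
    Proj.awayι (sectionGrading I) (degOne s hs) (sectionMonomial_mem 1 s _) one_pos

instance : IsIso (CommRingCat.ofHom (awayToChart hs hs0)) :=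
  (ConcreteCategory.isIso_iff_bijective _).mpr (bijective_awayToChart hs hs0)

instance : IsOpenImmersion (chartMap hs hs0) := by
  unfold chartMap
  infer_instance

lemma chartMap_blowupToBase :
    chartMap hs hs0 ≫ blowupToBase I =
      Spec.map (CommRingCat.ofHom (algebraMap R (chart I s))) := by
  rw [chartMap, blowupToBase, Category.assoc, Proj.awayι_toSpecZero_assoc, ← Spec.map_comp,
    ← Spec.map_comp]
  congr 1
  refine CommRingCat.hom_ext (RingHom.ext fun r ↦ Subtype.ext ?_)
  change awayToField _ _ (.mk _ (sectionMonomial_mem 1 s _) 0 (algebraMap R _ r) _) = _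
  refine (awayToField_mk _ _ 0 _ _).trans ?_
  rw [pow_zero, div_one]
  exact (eval₂_C _ _).trans rfl

lemma mem_range_chartMap (x : blowup I) :
    x ∈ Set.range (chartMap hs hs0) ↔ x ∈ Proj.basicOpen (sectionGrading I) (degOne s hs) := by
  have h1 : (chartMap hs hs0).opensRange = Proj.basicOpen (sectionGrading I) (degOne s hs) := by
    delta chartMap
    rw [Scheme.Hom.opensRange_comp_of_isIso, Proj.opensRange_awayι]
  rw [← h1]
  rfl

lemma chartMap_mem_range {t : F} (ht : t ∈ I) (ht0 : t ≠ 0) (y : PrimeSpectrum (chart I s)) :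
    chartMap hs hs0 y ∈ Set.range (chartMap ht ht0) ↔
      (⟨t / s, div_mem_chart s ht⟩ : chart I s) ∉ y.asIdeal := by
  rw [mem_range_chartMap]
  have h2 := Proj.awayι_preimage_basicOpen (sectionGrading I)
    (sectionMonomial_mem 1 s (by rwa [pow_one])) one_pos
    (sectionMonomial_mem 1 t (by rwa [pow_one])) one_pos
  let y' : Spec (.of (chart I s)) := y
  let z := Spec.map (CommRingCat.ofHom (awayToChart hs hs0)) y'
  change Proj.awayι (sectionGrading I) (degOne s hs) (sectionMonomial_mem 1 s _) one_pos z ∈ _ ↔ _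
  refine (SetLike.ext_iff.mp h2 z).trans (not_congr ?_)
  change awayToChart hs hs0 _ ∈ y.asIdeal ↔ _
  congr! 1
  apply Subtype.ext
  rw [coe_awayToChart, awayToField_mk, map_pow, sectionEval_monomial, sectionEval_monomial,
    pow_one, pow_one]

/-- The generic point of `Proj (⨁ Iⁿ)`, as a morphism from the spectrum of the field `F`. -/
def genericMap : Spec (.of F) ⟶ blowup I :=
  Spec.map (CommRingCat.ofHom (chart I s).val.toRingHom) ≫ chartMap hs hs0

/-- The morphism from the spectrum of the function field does not depend on the chart: for two
sections `s` and `t` it agrees with the one through the intersection of their charts, which is the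
chart of the section `s t` of degree two. -/
lemma genericMap_eq {t : F} (ht : t ∈ I) (ht0 : t ≠ 0) :
    genericMap hs hs0 = genericMap ht ht0 := by
  have key : ∀ {s t : F} (hs : s ∈ I) (hs0 : s ≠ 0) (ht : t ∈ I) {x : sectionRing I}
      (hx : x = degOne s hs * degOne t ht) (hx2 : x ∈ sectionGrading I 2)
      (h : sectionEval I x ≠ 0),
      genericMap hs hs0 = Spec.map (CommRingCat.ofHom (awayToField _ h)) ≫
        Proj.awayι (sectionGrading I) x hx2 two_pos := by
    intro s t hs hs0 ht x hx hx2 h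
    have h1 := Proj.SpecMap_awayMap_awayι (𝒜 := sectionGrading I)
      (sectionMonomial_mem 1 s (by rwa [pow_one])) one_pos
      (sectionMonomial_mem 1 t (by rwa [pow_one])) hx
    rw [← h1, ← Category.assoc, ← Spec.map_comp, genericMap]
    delta chartMap
    rw [← Category.assoc, ← Spec.map_comp]
    congr 2
    refine CommRingCat.hom_ext (RingHom.ext fun b ↦ ?_)
    exact (congr($(awayToField_comp_awayMap (sectionEval_degOne_ne_zero hs hs0) h
      (sectionMonomial_mem 1 s _) (sectionMonomial_mem 1 t _) hx) b)).symm
  have h : sectionEval I (degOne s hs * degOne t ht) ≠ 0 := by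
    rw [map_mul, sectionEval_monomial, sectionEval_monomial]; exact mul_ne_zero hs0 ht0
  have h2 : degOne s hs * degOne t ht ∈ sectionGrading I 2 :=
    SetLike.mul_mem_graded (sectionMonomial_mem 1 s _) (sectionMonomial_mem 1 t _)
  rw [key hs hs0 ht rfl h2 h, key ht ht0 hs (mul_comm _ _) h2 h]

end Blowup

/-! ### Centres of valuation rings -/

section Centre

variable {R F : Type u} [CommRing R] [Field F] [Algebra R F]

/-- The inclusion of a subalgebra of `F` in a valuation ring of `F`. -/
def toValuationSubring (A : Subalgebra R F) (V : ValuationSubring F) (h : ∀ a ∈ A, a ∈ V) :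
    A →+* V :=
  A.val.toRingHom.codRestrict V.toSubring fun a ↦ h a a.2

/-- The centre on `Spec A` of a valuation ring containing `A`. -/
def centre (A : Subalgebra R F) (V : ValuationSubring F) (h : ∀ a ∈ A, a ∈ V) :
    PrimeSpectrum A :=
  PrimeSpectrum.comap (toValuationSubring A V h) (closedPoint V)

lemma mem_centre {A : Subalgebra R F} {V : ValuationSubring F} {h : ∀ a ∈ A, a ∈ V} {a : A} :
    a ∈ (centre A V h).asIdeal ↔ (a : F) ∈ V.nonunits :=
  (ValuationSubring.coe_mem_nonunits_iff (a := toValuationSubring A V h a)).symm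

variable {I : Submodule R F} {s : F} (hs : s ∈ I) (hs0 : s ≠ 0)

lemma chartMap_centre_eq {V : ValuationSubring F} (h : ∀ a ∈ chart I s, a ∈ V)
    {t : F} (ht : t ∈ I) (ht0 : t ≠ 0) (h' : ∀ a ∈ chart I t, a ∈ V) :
    chartMap hs hs0 (centre _ V h) = chartMap ht ht0 (centre _ V h') := by
  let g : Spec (.of F) ⟶ Spec (.of V) := Spec.map (CommRingCat.ofHom V.subtype)
  have : IsDominant g := ⟨(PrimeSpectrum.denseRange_comap_iff_ker_le_nilRadical V.subtype).mpr
    (by rw [(RingHom.injective_iff_ker_eq_bot _).mp V.subtype_injective]; exact bot_le)⟩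
  have key : Spec.map (CommRingCat.ofHom (toValuationSubring _ V h)) ≫ chartMap hs hs0 =
      Spec.map (CommRingCat.ofHom (toValuationSubring _ V h')) ≫ chartMap ht ht0 := by
    have : (blowup I).IsSeparated := inferInstance
    refine ext_of_isDominant g ?_
    have h1 := genericMap_eq hs hs0 ht ht0
    rw [← Category.assoc, ← Category.assoc, ← Spec.map_comp, ← Spec.map_comp]
    exact h1
  let c : Spec (.of V) := closedPoint V
  exact congr($key c)

include hs hs0 in
/-- A valuation ring which contains a chart and has its centre on a second chart contains that
chart. -/
lemma mem_of_chartMap_centre_mem_range {V : ValuationSubring F} (h : ∀ a ∈ chart I s, a ∈ V)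
    {t : F} (ht : t ∈ I) (ht0 : t ≠ 0)
    (hr : chartMap hs hs0 (centre _ V h) ∈ Set.range (chartMap ht ht0)) :
    ∀ a ∈ chart I t, a ∈ V := by
  rw [chartMap_mem_range, mem_centre] at hr
  have h1 : s / t ∈ V := by
    rw [ValuationSubring.mem_nonunits_iff, not_lt] at hr
    rw [← ValuationSubring.valuation_le_one_iff, ← inv_div, map_inv₀]
    exact inv_le_one_of_one_le₀ hr
  intro a ha
  induction ha using Algebra.adjoin_induction with
  | mem x hx =>
    obtain ⟨a, ha, rfl⟩ := hx
    have : a / t = a / s * (s / t) := by field_simp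
    change a / t ∈ V
    rw [this]
    exact V.mul_mem _ _ (h _ (div_mem_chart s ha)) h1
  | algebraMap r => exact h _ (Subalgebra.algebraMap_mem _ r)
  | add x y _ _ hx hy => exact V.add_mem _ _ hx hy
  | mul x y _ _ hx hy => exact V.mul_mem _ _ hx hy

/-- Every prime of a subring of `F` is the centre of a valuation ring. -/
lemma exists_centre_eq (A : Subalgebra R F) (y : PrimeSpectrum A) :
    ∃ (V : ValuationSubring F) (h : ∀ a ∈ A, a ∈ V), centre A V h = y := by
  have : (show Ideal A.toSubring from y.asIdeal).IsPrime := y.isPrime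
  obtain ⟨V, hV⟩ := LocalSubring.exists_le_valuationSubring
    (LocalSubring.ofPrime A.toSubring y.asIdeal)
  obtain ⟨h1, h2⟩ := hV
  have h : ∀ a ∈ A, a ∈ V := fun a ha ↦ h1 (LocalSubring.le_ofPrime A.toSubring y.asIdeal ha)
  refine ⟨V, h, PrimeSpectrum.ext (Ideal.ext fun a ↦ ?_)⟩
  rw [← IsLocalization.AtPrime.to_map_mem_maximal_iff
    (LocalSubring.ofPrime A.toSubring y.asIdeal).toSubring (show Ideal A.toSubring from y.asIdeal) a]
  rw [← not_iff_not]
  change ¬ (toValuationSubring A V h a ∈ maximalIdeal V) ↔ _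
  rw [IsLocalRing.notMem_maximalIdeal, IsLocalRing.notMem_maximalIdeal]
  exact ⟨fun h ↦ h2.map_nonunit _ h, fun h ↦ h.map (Subring.inclusion h1)⟩

/-- The ring `⨁ Iⁿ` is generated in degree one, so that the charts of the sections of `I` cover.
-/
lemma adjoin_range_degOne :
    Algebra.adjoin (sectionGrading I 0) (Set.range fun s : I ↦ degOne s.1 s.2) = ⊤ := by
  have key (n : ℕ) : ∀ a (ha : a ∈ I ^ n), sectionMonomial n a ha ∈
      Algebra.adjoin (sectionGrading I 0) (Set.range fun s : I ↦ degOne s.1 s.2) := by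
    induction n with
    | zero =>
      intro a ha
      exact Subalgebra.algebraMap_mem _
        (⟨sectionMonomial 0 a ha, sectionMonomial_mem 0 a ha⟩ : sectionGrading I 0)
    | succ n hn =>
      intro a ha
      have ha' := ha
      rw [pow_succ'] at ha'
      induction ha' using Submodule.mul_induction_on' with
      | mem_mul_mem b hb c hc =>
        have : sectionMonomial (n + 1) (b * c) ha = degOne b hb * sectionMonomial n c hc :=
          Subtype.ext ((congrArg (monomial · (b * c)) (add_comm n 1)).trans
            (monomial_mul_monomial 1 n b c).symm)
        rw [this]
        exact Subalgebra.mul_mem _ (Algebra.subset_adjoin ⟨⟨b, hb⟩, rfl⟩) (hn c hc)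
      | add b hb c hc h1 h2 =>
        rw [← pow_succ'] at hb hc
        have : sectionMonomial (n + 1) (b + c) ha =
            sectionMonomial (n + 1) b hb + sectionMonomial (n + 1) c hc :=
          Subtype.ext (map_add (monomial (n + 1)) b c)
        rw [this]
        exact Subalgebra.add_mem _ (h1 hb) (h2 hc)
  rw [eq_top_iff]
  intro f _
  classical
  rw [← DirectSum.sum_support_decompose (sectionGrading I) f]
  refine Subalgebra.sum_mem _ fun i _ ↦ ?_
  rw [eq_sectionMonomial (DirectSum.decompose (sectionGrading I) f i).2]
  exact key _ _ _

lemma iUnion_range_chartMap (x : blowup I) :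
    ∃ (s : F) (hs : s ∈ I) (hs0 : s ≠ 0), x ∈ Set.range (chartMap hs hs0) := by
  have h := Proj.iSup_basicOpen_eq_top' (sectionGrading I) (fun s : I ↦ degOne s.1 s.2)
    (fun s ↦ ⟨1, sectionMonomial_mem 1 s.1 _⟩) adjoin_range_degOne
  have hx : x ∈ ⨆ s : I, Proj.basicOpen (sectionGrading I) (degOne s.1 s.2) := by
    rw [h]; trivial
  obtain ⟨s, hs⟩ := TopologicalSpace.Opens.mem_iSup.mp hx
  have hs0 : s.1 ≠ 0 := by
    intro h0
    have : degOne s.1 s.2 = 0 := Subtype.ext (by simp [sectionMonomial, h0])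
    rw [this, Proj.basicOpen_zero] at hs
    exact hs
  exact ⟨s.1, s.2, hs0, (mem_range_chartMap s.2 hs0 x).mpr hs⟩

/-- The valuative criterion for a family of charts to cover. -/
lemma exists_mem_range_chartMap {S : Set F} (hS : ∀ s ∈ S, s ∈ I) (hS0 : ∀ s ∈ S, s ≠ 0)
    (h : ∀ V : ValuationSubring F, (∀ r, algebraMap R F r ∈ V) →
      ∃ s ∈ S, ∀ a ∈ chart I s, a ∈ V) (x : blowup I) :
    ∃ (s : F) (hs : s ∈ S), x ∈ Set.range (chartMap (hS s hs) (hS0 s hs)) := by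
  obtain ⟨t, ht, ht0, y, rfl⟩ := iUnion_range_chartMap x
  obtain ⟨V, hV, rfl⟩ := exists_centre_eq (chart I t) y
  obtain ⟨s, hs, hsV⟩ := h V fun r ↦ hV _ (Subalgebra.algebraMap_mem _ r)
  exact ⟨s, hs, centre _ V hsV, chartMap_centre_eq _ _ _ _ _ _⟩

end Centre

/-! ### Integrality and the function field -/

section FunctionField

variable {R F : Type u} [CommRing R] [Field F] [Algebra R F]
variable {I : Submodule R F} {s : F} (hs : s ∈ I) (hs0 : s ≠ 0)

include hs hs0 in
/-- The generic point of any chart is the generic point of the whole scheme. -/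
lemma chartMap_bot_specializes (x : blowup I) :
    chartMap hs hs0 (⊥ : PrimeSpectrum (chart I s)) ⤳ x := by
  obtain ⟨t, ht, ht0, y, rfl⟩ := iUnion_range_chartMap x
  let z : Spec (.of F) := (⊥ : PrimeSpectrum F)
  have h1 : ∀ {t} (ht : t ∈ I) (ht0 : t ≠ 0), genericMap ht ht0 z =
      chartMap ht ht0 (⊥ : PrimeSpectrum (chart I t)) := by
    intro t ht ht0
    change chartMap ht ht0 (PrimeSpectrum.comap (chart I t).val.toRingHom ⊥) = _
    congr 1
    exact PrimeSpectrum.ext (Ideal.ext fun a ↦ ZeroMemClass.coe_eq_zero)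
  rw [← h1, genericMap_eq hs hs0 ht ht0, h1]
  refine Specializes.map ?_ (chartMap ht ht0).continuous
  exact (PrimeSpectrum.le_iff_specializes _ _).mp bot_le

include hs hs0 in
lemma isIntegral_blowup : IsIntegral (blowup I) := by
  have h1 : IrreducibleSpace (blowup I) := by
    refine (irreducibleSpace_def _).mpr ?_
    have : closure {chartMap hs hs0 (⊥ : PrimeSpectrum (chart I s))} = Set.univ :=
      Set.eq_univ_of_forall fun x ↦ (chartMap_bot_specializes hs hs0 x).mem_closure
    rw [Set.top_eq_univ, ← this]
    exact isIrreducible_singleton.closure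
  have (x : blowup I) : _root_.IsReduced ((blowup I).presheaf.stalk x) := by
    obtain ⟨t, ht, ht0, y, rfl⟩ := iUnion_range_chartMap x
    let _ := (chartStalk (chartMap ht ht0) y).toAlgebra
    have := isLocalization_chartStalk (chartMap ht ht0) y
    have := PrimeSpectrum.isPrime y
    have := IsLocalization.isDomain_of_le_nonZeroDivisors ((blowup I).presheaf.stalk (chartMap ht ht0 y))
      (PrimeSpectrum.asIdeal y).primeCompl_le_nonZeroDivisors
    infer_instance
  have := isReduced_of_isReduced_stalk (blowup I)
  exact isIntegral_of_irreducibleSpace_of_isReduced _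

include hs hs0 in
/-- If `F` is the field of fractions of one chart, it is the function field of the scheme. -/
lemma exists_functionField_blowup [IsIntegral (blowup I)] [IsFractionRing (chart I s) F] :
    ∃ e : (blowup I).functionField ≃+* F,
      e.toRingHom.comp (toStalk (blowupToBase I) (genericPoint (blowup I))) = algebraMap R F := by
  have h1 : genericPoint (blowup I) = chartMap hs hs0 (⊥ : PrimeSpectrum (chart I s)) :=
    ((genericPoint_specializes _).antisymm (chartMap_bot_specializes hs hs0 _)).eq
  have key : ∀ x : blowup I, x = chartMap hs hs0 (⊥ : PrimeSpectrum (chart I s)) →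
      ∃ e : (blowup I).presheaf.stalk x ≃+* F,
        e.toRingHom.comp (toStalk (blowupToBase I) x) = algebraMap R F := by
    rintro x rfl
    let y : PrimeSpectrum (chart I s) := ⊥
    let _ := (chartStalk (chartMap hs hs0) y).toAlgebra
    have h2 := isLocalization_chartStalk (chartMap hs hs0) y
    have h3 : y.asIdeal.primeCompl = nonZeroDivisors (chart I s) := by
      ext a
      exact mem_nonZeroDivisors_iff_ne_zero.symm
    rw [IsLocalization.AtPrime, h3] at h2
    let e := IsLocalization.algEquiv (nonZeroDivisors (chart I s))
      ((blowup I).presheaf.stalk (chartMap hs hs0 y)) F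
    refine ⟨e.toRingEquiv, RingHom.ext fun r ↦ ?_⟩
    refine (congrArg e (toStalk_eq_chartStalk (chartMap hs hs0) (blowupToBase I)
      (chartMap_blowupToBase hs hs0) y r)).trans ?_
    exact e.commutes (algebraMap R (chart I s) r)
  exact key _ h1

end FunctionField

/-! ### Lines on a regular surface, in terms of coordinate rings -/

section Line

variable {R A : Type u} [CommRing R] [IsLocalRing R] [CommRing A] [Algebra R A]

/-- The prime `P` of `A` defines an affine line over the residue field of `R`, the curve is a
Cartier divisor, and a generator of the maximal ideal of `R` vanishes on it to order `m`. -/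
structure IsLine (P : Ideal A) (m : ℕ) : Prop where
  exists_hom : ∃ φ : A →+* (ResidueField R)[X], Function.Surjective φ ∧ RingHom.ker φ = P ∧
    (∀ r, φ (algebraMap R A r) = C (residue R r)) ∧
    ∃ ϖ ∈ P, ∃ v : A, IsUnit (φ v) ∧ (∀ a ∈ P, ∃ N : ℕ, ϖ ∣ v ^ N * a) ∧
    ∃ π : R, maximalIdeal R = Ideal.span {π} ∧ ∃ w ∉ P, ∃ w' ∉ P,
      w' * algebraMap R A π = w * ϖ ^ m

variable {P : Ideal A} {m : ℕ}

lemma IsLine.isPrime (h : IsLine (R := R) P m) : P.IsPrime := by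
  obtain ⟨φ, -, rfl, -⟩ := h.exists_hom
  exact RingHom.ker_isPrime φ

/-- A line is not a point. -/
lemma IsLine.not_isMaximal (h : IsLine (R := R) P m) : ¬ P.IsMaximal := by
  obtain ⟨φ, hφ, rfl, -⟩ := h.exists_hom
  intro hm
  have e := RingHom.quotientKerEquivOfSurjective hφ
  have : IsField (ResidueField R)[X] :=
    e.symm.toMulEquiv.isField ((Ideal.Quotient.maximal_ideal_iff_isField_quotient _).mp hm)
  exact Polynomial.not_isField _ this

/-- If `M` contains the line `P`, then `P` is principal in the localisation at `M`. -/
lemma map_eq_span_of_dvd {M : Ideal A} [M.IsPrime] {S : Type u} [CommRing S] [Algebra A S]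
    [IsLocalization.AtPrime S M] {ϖ v : A} (hϖ : ϖ ∈ P) (hv : v ∉ M) (h : ∀ a ∈ P, ∃ N : ℕ, ϖ ∣ v ^ N * a) :
    P.map (algebraMap A S) = Ideal.span {algebraMap A S ϖ} := by
  refine le_antisymm (Ideal.map_le_iff_le_comap.mpr fun a ha ↦ ?_) ?_
  · obtain ⟨N, b, hb⟩ := h a ha
    have hu : IsUnit (algebraMap A S (v ^ N)) := by
      rw [map_pow]
      exact (IsLocalization.map_units S (⟨v, hv⟩ : M.primeCompl)).pow N
    rw [Ideal.mem_comap, Ideal.mem_span_singleton, ← hu.dvd_mul_left, ← map_mul, hb, map_mul]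
    exact dvd_mul_right _ _
  · rw [Ideal.span_singleton_le_iff_mem]
    exact Ideal.mem_map_of_mem _ hϖ

lemma notMem_of_isUnit {P M : Ideal A} (hM : M ≠ ⊤) (hPM : P ≤ M) {B : Type u} [CommRing B]
    {φ : A →+* B} (hφ : Function.Surjective φ) (hk : RingHom.ker φ = P) {v : A}
    (hv : IsUnit (φ v)) : v ∉ M := by
  intro hvM
  apply hM
  obtain ⟨b, hb⟩ := hv.exists_right_inv
  obtain ⟨c, rfl⟩ := hφ b
  have : 1 - v * c ∈ M := hPM (by rw [← hk, RingHom.mem_ker, map_sub, map_mul, hb, map_one, sub_self])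
  rw [Ideal.eq_top_iff_one]
  simpa using M.add_mem this (M.mul_mem_right c hvM)

lemma exists_eq_sup_span {k : Type u} [Field k] {φ : A →+* k[X]} (hφ : Function.Surjective φ)
    (hk : RingHom.ker φ = P) {J : Ideal A} (hPJ : P ≤ J) : ∃ g, J = P ⊔ Ideal.span {g} := by
  obtain ⟨f, hf⟩ := IsPrincipalIdealRing.principal (J.map φ)
  obtain ⟨g, rfl⟩ := hφ f
  refine ⟨g, ?_⟩
  have h4 : (J.map φ).comap φ = J := by
    rw [Ideal.comap_map_of_surjective φ hφ, sup_eq_left]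
    exact (hk.le : Ideal.comap φ ⊥ ≤ P).trans hPJ
  have h5 : (Ideal.span {φ g}).comap φ = P ⊔ Ideal.span {g} := by
    rw [← Set.image_singleton, ← Ideal.map_span, Ideal.comap_map_of_surjective φ hφ, sup_comm]
    congr 1
  rw [← h4, ← h5, hf]

/-- A surface is regular along a line. -/
lemma IsLine.isRegularLocalRing [IsDomain A] [IsNoetherianRing A] (h : IsLine (R := R) P m)
    (hP : P ≠ ⊥) {M : Ideal A} [M.IsPrime] (hPM : P ≤ M) (S : Type u) [CommRing S] [Algebra A S]
    [IsLocalization.AtPrime S M] : IsRegularLocalRing S := by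
  have := IsLocalization.AtPrime.isLocalRing S M
  have := IsLocalization.isNoetherianRing M.primeCompl S inferInstance
  have hPp := h.isPrime
  obtain ⟨φ, hφ, hk, -, ϖ, hϖ, v, hv, hd, -⟩ := h.exists_hom
  have hvM := notMem_of_isUnit (Ideal.IsPrime.ne_top ‹_›) hPM hφ hk hv
  have h1 : P.map (algebraMap A S) = Ideal.span {algebraMap A S ϖ} := map_eq_span_of_dvd hϖ hvM hd
  have hb : 1 ≤ P.height := by
    have := Ideal.height_add_one_le_of_lt_of_isPrime (I := ⊥) (J := P) (bot_lt_iff_ne_bot.mpr hP)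
    exact le_trans (by simp) this
  apply IsRegularLocalRing.of_spanFinrank_maximalIdeal_le
  rw [IsLocalization.AtPrime.ringKrullDim_eq_height M S, ← IsLocalization.AtPrime.map_eq_maximalIdeal M S]
  -- At the generic point of the line `ϖ` generates the maximal ideal; at a closed point `ϖ` and a
  -- function `g` which is a parameter on the line do. The height is at least one and two
  -- respectively.
  by_cases hPM' : P = M
  · subst hPM'
    rw [h1]
    have h2 := Submodule.spanFinrank_span_le_ncard_of_finite (R := S)
      (Set.finite_singleton (algebraMap A S ϖ))
    rw [Set.ncard_singleton] at h2
    exact_mod_cast (Nat.cast_le (α := ℕ∞).mpr h2).trans hb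
  · have hM2 := Ideal.height_add_one_le_of_lt_of_isPrime (lt_of_le_of_ne hPM hPM')
    have hM2' : 2 ≤ M.height := le_trans (by rw [← one_add_one_eq_two]; gcongr) hM2
    obtain ⟨g, hM⟩ := exists_eq_sup_span hφ hk hPM
    have h3 : M.map (algebraMap A S) = Ideal.span {algebraMap A S ϖ, algebraMap A S g} := by
      rw [Ideal.span_insert, ← h1]
      conv_lhs => rw [hM]
      rw [Ideal.map_sup, Ideal.map_span, Set.image_singleton]
    rw [h3]
    have h2 := Submodule.spanFinrank_span_le_ncard_of_finite (R := S)
      (Set.toFinite {algebraMap A S ϖ, algebraMap A S g})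
    replace h2 := h2.trans (Set.ncard_insert_le _ _)
    rw [Set.ncard_singleton] at h2
    exact_mod_cast (Nat.cast_le (α := ℕ∞).mpr h2).trans hM2'

/-- The local rings of a line are regular. -/
lemma IsLine.isRegularLocalRing_quotient (h : IsLine (R := R) P m) {M : Ideal A} [M.IsPrime]
    (hPM : P ≤ M) (S : Type u) [CommRing S] [Algebra A S] [IsLocalization.AtPrime S M] :
    IsRegularLocalRing (S ⧸ P.map (algebraMap A S)) := by
  have hPp := h.isPrime
  obtain ⟨φ, hφ, hk, -⟩ := h.exists_hom
  have := IsLocalization.AtPrime.isLocalRing S M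
  have : (P.map (algebraMap A S)).IsPrime :=
    IsLocalization.isPrime_of_isPrime_disjoint M.primeCompl S P hPp
      (Set.disjoint_left.mpr fun a ha ha' ↦ ha (hPM ha'))
  have : IsLocalRing (S ⧸ P.map (algebraMap A S)) :=
    .of_surjective' (Ideal.Quotient.mk _) Ideal.Quotient.mk_surjective
  -- The local ring of the line is a localisation of `k[t]`, so its ideals are principal.
  have : IsPrincipalIdealRing (S ⧸ P.map (algebraMap A S)) := by
    refine ⟨fun I ↦ ?_⟩
    have hI : P ≤ (I.comap (Ideal.Quotient.mk (P.map (algebraMap A S)))).under A := by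
      intro a ha
      change Ideal.Quotient.mk _ (algebraMap A S a) ∈ I
      rw [Ideal.Quotient.eq_zero_iff_mem.mpr (Ideal.mem_map_of_mem _ ha)]
      exact I.zero_mem
    obtain ⟨g, hg⟩ := exists_eq_sup_span hφ hk hI
    refine ⟨Ideal.Quotient.mk _ (algebraMap A S g), ?_⟩
    rw [← Ideal.map_comap_of_surjective _ (Ideal.Quotient.mk_surjective (I := P.map (algebraMap A S))) I,
      ← IsLocalization.map_under M.primeCompl S (I.comap _), hg, Ideal.map_sup, Ideal.map_sup,
      Ideal.map_quotient_self, bot_sup_eq, Ideal.map_span, Ideal.map_span, Set.image_singleton,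
      Set.image_singleton]
  infer_instance

/-- The function field of a line is a field of rational functions. -/
lemma IsLine.exists_residueField_equiv (h : IsLine (R := R) P m) [P.IsPrime] (S : Type u)
    [CommRing S] [Algebra A S] [IsLocalization.AtPrime S P] [IsLocalRing S] :
    ∃ e : ResidueField S ≃+* RatFunc (ResidueField R), ∀ r : R,
      e (residue S (algebraMap A S (algebraMap R A r))) =
        algebraMap (ResidueField R) (RatFunc (ResidueField R)) (residue R r) := by
  obtain ⟨φ, hφ, hk, hC, -⟩ := h.exists_hom
  -- The parametrisation extends to the local ring, since it maps functions that do not vanish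
  -- identically on the line to nonzero polynomials.
  let f : A →+* RatFunc (ResidueField R) :=
    (algebraMap (ResidueField R)[X] (RatFunc (ResidueField R))).comp φ
  have hf : ∀ a ∉ P, f a ≠ 0 := fun a ha h0 ↦ ha (by
    rw [← hk, RingHom.mem_ker]
    exact (FaithfulSMul.algebraMap_eq_zero_iff (ResidueField R)[X] (RatFunc (ResidueField R))).mp h0)
  let g : S →+* RatFunc (ResidueField R) :=
    IsLocalization.lift (M := P.primeCompl) (g := f) fun a ↦ (hf a.1 a.2).isUnit
  have hg : ∀ a, g (algebraMap A S a) = f a := IsLocalization.lift_eq _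
  have hgs : Function.Surjective g := by
    intro z
    obtain ⟨p, q, hq, rfl⟩ := IsFractionRing.div_surjective (A := (ResidueField R)[X]) z
    obtain ⟨a, rfl⟩ := hφ p
    obtain ⟨b, rfl⟩ := hφ q
    have hb : b ∉ P := fun hb ↦ nonZeroDivisors.ne_zero hq (by rwa [← hk] at hb)
    refine ⟨IsLocalization.mk' S a (⟨b, hb⟩ : P.primeCompl), ?_⟩
    refine (eq_div_iff (hf b hb)).mpr ?_
    change _ * f b = f a
    rw [← hg b, ← map_mul, IsLocalization.mk'_spec, hg]
  have hker : RingHom.ker g = maximalIdeal S :=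
    IsLocalRing.eq_maximalIdeal (RingHom.ker_isMaximal_of_surjective g hgs)
  refine ⟨(Ideal.quotEquivOfEq hker.symm).trans (RingHom.quotientKerEquivOfSurjective hgs),
    fun r ↦ ?_⟩
  change g (algebraMap A S (algebraMap R A r)) = _
  rw [hg]
  change algebraMap _ _ (φ _) = _
  rw [hC]
  rfl

/-- The multiplicity of a line in the special fibre. -/
lemma IsLine.map_maximalIdeal (h : IsLine (R := R) P m) [P.IsPrime] (S : Type u)
    [CommRing S] [Algebra A S] [IsLocalization.AtPrime S P] [IsLocalRing S] :
    (maximalIdeal R).map ((algebraMap A S).comp (algebraMap R A)) = maximalIdeal S ^ m := by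
  obtain ⟨φ, hφ, hk, -, ϖ, hϖ, v, hv, hd, π, hπ, w, hw, w', hw', e⟩ := h.exists_hom
  have hvM := notMem_of_isUnit (Ideal.IsPrime.ne_top ‹_›) le_rfl hφ hk hv
  rw [← IsLocalization.AtPrime.map_eq_maximalIdeal P S, map_eq_span_of_dvd hϖ hvM hd,
    Ideal.span_singleton_pow, hπ, Ideal.map_span, Set.image_singleton]
  have hu : IsUnit (algebraMap A S w) := IsLocalization.map_units S (⟨w, hw⟩ : P.primeCompl)
  have hu' : IsUnit (algebraMap A S w') := IsLocalization.map_units S (⟨w', hw'⟩ : P.primeCompl)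
  have e' := congrArg (algebraMap A S) e
  rw [map_mul, map_mul, map_pow] at e'
  rw [RingHom.comp_apply, ← Ideal.span_singleton_mul_left_unit hu', e',
    Ideal.span_singleton_mul_left_unit hu]

/-- The length of a scheme supported at one point of a line. -/
lemma length_quotient_map_eq {k : Type u} [Field k] {ψ : A →+* k[X]} (hψ : Function.Surjective ψ)
    {M : Ideal A} [M.IsPrime] (hM : M = (Ideal.span {X}).comap ψ) {J : Ideal A} {n : ℕ}
    (hJ : J = (Ideal.span {X ^ n}).comap ψ)
    (S : Type u) [CommRing S] [Algebra A S] [IsLocalization.AtPrime S M] :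
    Module.length S (S ⧸ J.map (algebraMap A S)) = n := by
  let B := k[X] ⧸ Ideal.span {(X : k[X]) ^ n}
  let f : A →+* B := (Ideal.Quotient.mk _).comp ψ
  have hf : ∀ a ∉ M, IsUnit (f a) := by
    intro a ha
    have h1 : ¬ X ∣ ψ a := by rwa [hM, Ideal.mem_comap, Ideal.mem_span_singleton] at ha
    obtain ⟨b, c, hbc⟩ := ((irreducible_X.coprime_iff_not_dvd.mpr h1).pow_left (m := n))
    refine .of_mul_eq_one (Ideal.Quotient.mk _ c) ?_
    have h2 := congrArg (Ideal.Quotient.mk (Ideal.span {(X : k[X]) ^ n})) hbc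
    rw [map_add, map_mul, map_mul, Ideal.Quotient.eq_zero_iff_mem.mpr
      (Ideal.mem_span_singleton_self _), mul_zero, zero_add, map_one, mul_comm] at h2
    exact h2
  have hker : ∀ a, f a = 0 ↔ a ∈ J := fun a ↦ by
    rw [hJ]; exact Ideal.Quotient.eq_zero_iff_mem
  let g : S →+* B := IsLocalization.lift (M := M.primeCompl) (g := f) fun a ↦ hf a.1 a.2
  have hg : ∀ a, g (algebraMap A S a) = f a := IsLocalization.lift_eq _
  have hgs : Function.Surjective g := by
    intro z
    obtain ⟨p, rfl⟩ := Ideal.Quotient.mk_surjective z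
    obtain ⟨a, rfl⟩ := hψ p
    exact ⟨algebraMap A S a, hg a⟩
  -- The local ring modulo `J` is `k[X] / (Xⁿ)`.
  have hgk : RingHom.ker g = J.map (algebraMap A S) := by
    ext z
    obtain ⟨a, b, rfl⟩ := IsLocalization.exists_mk'_eq M.primeCompl z
    rw [RingHom.mem_ker, IsLocalization.mk'_mem_map_algebraMap_iff,
      IsLocalization.lift_mk', Units.mul_left_eq_zero, hker]
    refine ⟨fun h ↦ ⟨1, one_mem _, by simpa using h⟩, ?_⟩
    rintro ⟨c, hc, h⟩
    rw [← hker, map_mul] at h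
    exact (hker a).mp ((hf c hc).mul_right_eq_zero.mp h)
  let _ := g.toAlgebra
  let e : (S ⧸ J.map (algebraMap A S)) ≃ₗ[S] B :=
    { (Ideal.quotEquivOfEq hgk.symm).trans (RingHom.quotientKerEquivOfSurjective hgs) with
      map_smul' := fun r z ↦ by
        obtain ⟨z, rfl⟩ := Ideal.Quotient.mk_surjective z
        exact map_mul g r z }
  rw [e.length_eq, Module.length_eq_of_surjective (R := B) (S := S) hgs,
    ← Module.length_eq_of_surjective (R := B) (S := k[X]) Ideal.Quotient.mk_surjective]
  have h3 := Ring.ord_pow (x := (X : k[X])) (mem_nonZeroDivisors_of_ne_zero X_ne_zero) n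
  rw [Ring.ord_of_irreducible irreducible_X] at h3
  exact h3.trans (nsmul_one n)

end Line

/-! ### Local rings of a line on a scheme -/

section LineStalk

variable {R A : Type u} [CommRing R] [IsLocalRing R] [CommRing A] [Algebra R A] {P : Ideal A}
  {m : ℕ} {X : Scheme.{u}} (ι : Spec (.of A) ⟶ X) [IsOpenImmersion ι] (y : Spec (.of A))

lemma IsLine.isRegularLocalRing_stalk_quotient (h : IsLine (R := R) P m)
    (hy : P ≤ PrimeSpectrum.asIdeal y) :
    IsRegularLocalRing (X.presheaf.stalk (ι y) ⧸ P.map (chartStalk ι y)) := by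
  let _ := (chartStalk ι y).toAlgebra
  have := isLocalization_chartStalk ι y
  have := PrimeSpectrum.isPrime y
  exact h.isRegularLocalRing_quotient hy (X.presheaf.stalk (ι y))

lemma IsLine.exists_residueField_stalk_equiv (h : IsLine (R := R) (PrimeSpectrum.asIdeal y) m) :
    ∃ e : ResidueField (X.presheaf.stalk (ι y)) ≃+* RatFunc (ResidueField R), ∀ r : R,
      e (residue _ (chartStalk ι y (algebraMap R A r))) =
        algebraMap (ResidueField R) (RatFunc (ResidueField R)) (residue R r) := by
  let _ := (chartStalk ι y).toAlgebra
  have := isLocalization_chartStalk ι y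
  have := PrimeSpectrum.isPrime y
  exact h.exists_residueField_equiv (X.presheaf.stalk (ι y))

lemma IsLine.map_maximalIdeal_stalk (h : IsLine (R := R) (PrimeSpectrum.asIdeal y) m) :
    (maximalIdeal R).map ((chartStalk ι y).comp (algebraMap R A)) =
      maximalIdeal (X.presheaf.stalk (ι y)) ^ m := by
  let _ := (chartStalk ι y).toAlgebra
  have := isLocalization_chartStalk ι y
  have := PrimeSpectrum.isPrime y
  exact h.map_maximalIdeal (X.presheaf.stalk (ι y))

lemma length_stalk_quotient_map_eq {k : Type u} [Field k] {ψ : A →+* k[X]}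
    (hψ : Function.Surjective ψ)
    (hM : PrimeSpectrum.asIdeal y = (Ideal.span {Polynomial.X}).comap ψ) {J : Ideal A} {n : ℕ}
    (hJ : J = (Ideal.span {Polynomial.X ^ n}).comap ψ) :
    Module.length (X.presheaf.stalk (ι y))
      (X.presheaf.stalk (ι y) ⧸ J.map (chartStalk ι y)) = n := by
  let _ := (chartStalk ι y).toAlgebra
  have := isLocalization_chartStalk ι y
  have := PrimeSpectrum.isPrime y
  exact length_quotient_map_eq hψ hM hJ (X.presheaf.stalk (ι y))

end LineStalk

/-! ### Regular models covered by charts -/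

section Model

variable {K : Type u} [Field K] {O : ValuationSubring K} {W : WeierstrassCurve K}

variable {F : Type u} [Field F] [Algebra O F] {I : Submodule O F}

/-- Sections `s c` of `I` whose charts cover `Proj (⨁ Iⁿ)` and are regular. -/
structure IsRegularAtlas (I : Submodule O F) {σ : Type} (s : σ → F) : Prop where
  fg : I.FG
  mem : ∀ c, s c ∈ I
  ne_zero : ∀ c, s c ≠ 0
  cover : ∀ V : ValuationSubring F, (∀ r : O, algebraMap O F r ∈ V) →
    ∃ c, ∀ a ∈ chart I (s c), a ∈ V
  isFractionRing : ∃ c, IsFractionRing (chart I (s c)) F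
  regular : ∀ c (M : Ideal (chart I (s c))) [M.IsPrime],
    IsRegularLocalRing (Localization.AtPrime M)

variable {σ : Type} {s : σ → F}

lemma IsRegularAtlas.exists_mem_range (h : IsRegularAtlas I s) (x : blowup I) :
    ∃ c, x ∈ Set.range (chartMap (h.mem c) (h.ne_zero c)) := by
  obtain ⟨t, ⟨c, rfl⟩, hx⟩ := exists_mem_range_chartMap (S := Set.range s)
    (by rintro _ ⟨c, rfl⟩; exact h.mem c) (by rintro _ ⟨c, rfl⟩; exact h.ne_zero c)
    (fun V hV ↦ by obtain ⟨c, hc⟩ := h.cover V hV; exact ⟨_, ⟨c, rfl⟩, hc⟩) x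
  exact ⟨c, hx⟩

lemma IsRegularAtlas.isRegularLocalRing_stalk (h : IsRegularAtlas I s) (x : blowup I) :
    IsRegularLocalRing ((blowup I).presheaf.stalk x) := by
  obtain ⟨c, y, rfl⟩ := h.exists_mem_range x
  let _ := (chartStalk (chartMap (h.mem c) (h.ne_zero c)) y).toAlgebra
  have := isLocalization_chartStalk (chartMap (h.mem c) (h.ne_zero c)) y
  have hy := PrimeSpectrum.isPrime y
  have := h.regular c (PrimeSpectrum.asIdeal y)
  exact .of_ringEquiv (IsLocalization.algEquiv (PrimeSpectrum.asIdeal y).primeCompl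
    (Localization.AtPrime (PrimeSpectrum.asIdeal y)) _).toRingEquiv

lemma IsRegularAtlas.isIntegral (h : IsRegularAtlas I s) : IsIntegral (blowup I) :=
  isIntegral_blowup (h.mem h.isFractionRing.choose) (h.ne_zero _)

lemma IsRegularAtlas.exists_functionField (h : IsRegularAtlas I s) :
    haveI := h.isIntegral
    ∃ e : (blowup I).functionField ≃+* F,
      e.toRingHom.comp (toStalk (blowupToBase I) (genericPoint (blowup I))) = algebraMap O F := by
  have := h.isIntegral
  obtain ⟨c, hc⟩ := h.isFractionRing
  exact exists_functionField_blowup (h.mem c) (h.ne_zero c)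

/-- The regular model with underlying scheme `Proj (⨁ Iⁿ)`. -/
def IsRegularAtlas.model [IsDiscreteValuationRing O] {I : Submodule O W.toAffine.FunctionField}
    {s : σ → W.toAffine.FunctionField}
    (h : IsRegularAtlas I s) : RegularModel O W where
  X := blowup I
  π := blowupToBase I
  isIntegral := h.isIntegral
  isProper := isProper_blowupToBase ((algebraMap K _).injective.comp Subtype.val_injective) h.fg
  regular := h.isRegularLocalRing_stalk
  functionFieldEquiv := h.exists_functionField.choose
  functionFieldEquiv_comp := h.exists_functionField.choose_spec

end Model

/-! ### Configurations of lines on an atlas -/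

section Configuration

variable {K : Type u} [Field K] {O : ValuationSubring K}
variable {F : Type u} [Field F] [Algebra O F] {I : Submodule O F} {σ : Type} {s : σ → F}

/-- Valuation rings `V i` whose centres on the charts are the components of the special fibre, and
form the configuration `T`. -/
structure IsFibreAtlas (I : Submodule O F) (s : σ → F) (T : FibreConfiguration)
    (V : Fin T.n → ValuationSubring F) : Prop where
  dominates : ∀ i, ∀ r ∈ maximalIdeal O, algebraMap O F r ∈ (V i).nonunits
  visible : ∀ i, ∃ c, ∀ a ∈ chart I (s c), a ∈ V i
  line : ∀ c i (h : ∀ a ∈ chart I (s c), a ∈ V i), IsLine (R := O) (centre _ _ h).asIdeal (T.mult i)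
  /-- Every point of the special fibre lies on a component. -/
  exists_le : ∀ c (Q : Ideal (chart I (s c))) [Q.IsPrime], (maximalIdeal O).map (algebraMap O _) ≤ Q →
    ∃ i, ∃ h : ∀ a ∈ chart I (s c), a ∈ V i, (centre _ _ h).asIdeal ≤ Q
  disjoint : ∀ i j, i ≠ j → T.inter i j = 0 → ∀ c (hi : ∀ a ∈ chart I (s c), a ∈ V i)
    (hj : ∀ a ∈ chart I (s c), a ∈ V j), (centre _ _ hi).asIdeal ⊔ (centre _ _ hj).asIdeal = ⊤
  /-- The intersection is known in the chart `c₀`, and it has no points outside of this chart,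
  because the section of `c₀` does not vanish at the points of intersection in other charts. -/
  meet : ∀ i j, i ≠ j → T.inter i j ≠ 0 → ∃ c₀, ∃ (hi : ∀ a ∈ chart I (s c₀), a ∈ V i)
    (hj : ∀ a ∈ chart I (s c₀), a ∈ V j),
    (∃ ψ : chart I (s c₀) →+* (ResidueField O)[X], Function.Surjective ψ ∧
      (centre _ _ hi).asIdeal ⊔ (centre _ _ hj).asIdeal =
        (Ideal.span {X ^ T.inter i j}).comap ψ) ∧
    ∀ c (hi' : ∀ a ∈ chart I (s c), a ∈ V i) (hj' : ∀ a ∈ chart I (s c), a ∈ V j) (b : chart I (s c)),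
      (b : F) = s c₀ / s c →
      (centre _ _ hi').asIdeal ⊔ (centre _ _ hj').asIdeal ⊔ Ideal.span {b} = ⊤

variable {T : FibreConfiguration} {V : Fin T.n → ValuationSubring F}

lemma IsFibreAtlas.map_le (h : IsFibreAtlas I s T V) {c : σ} {i : Fin T.n}
    (hi : ∀ a ∈ chart I (s c), a ∈ V i) :
    (maximalIdeal O).map (algebraMap O _) ≤ (centre _ _ hi).asIdeal :=
  Ideal.map_le_iff_le_comap.mpr fun r hr ↦ mem_centre.mpr (h.dominates i r hr)

lemma IsFibreAtlas.centre_ne_bot [IsDiscreteValuationRing O] (h : IsFibreAtlas I s T V)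
    (hO : Function.Injective (algebraMap O F)) {c : σ}
    {i : Fin T.n} (hi : ∀ a ∈ chart I (s c), a ∈ V i) : (centre _ _ hi).asIdeal ≠ ⊥ := by
  intro h0
  obtain ⟨π, hπ⟩ := IsDiscreteValuationRing.exists_irreducible O
  have h1 := h.map_le hi (Ideal.mem_map_of_mem _
    ((IsLocalRing.mem_maximalIdeal π).mpr hπ.not_isUnit))
  rw [h0, Ideal.mem_bot] at h1
  exact hπ.ne_zero (hO (by rw [map_zero]; exact congrArg Subtype.val h1))

lemma isNoetherianRing_chart [IsDiscreteValuationRing O] (hI : I.FG) (t : F) :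
    IsNoetherianRing (chart I t) := by
  have : (chart I t).FG := by
    obtain ⟨S, hS⟩ := hI
    classical
    refine ⟨S.image (LinearMap.mulRight O t⁻¹), ?_⟩
    rw [chart, ← hS, Finset.coe_image, ← Algebra.adjoin_span, ← Submodule.map_span]
    congr 1
    ext a
    simp [div_eq_mul_inv]
  have : Algebra.FiniteType O (chart I t) := (chart I t).fg_iff_finiteType.mp this
  exact Algebra.FiniteType.isNoetherianRing O _

/-- The total space is regular at the points of the special fibre. -/
lemma IsFibreAtlas.isRegularLocalRing [IsDiscreteValuationRing O] (h : IsFibreAtlas I s T V)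
    (hO : Function.Injective (algebraMap O F)) (hI : I.FG) (c : σ) (M : Ideal (chart I (s c)))
    [M.IsPrime] (hM : (maximalIdeal O).map (algebraMap O _) ≤ M) :
    IsRegularLocalRing (Localization.AtPrime M) := by
  have := isNoetherianRing_chart hI (s c)
  obtain ⟨i, hi, hiM⟩ := h.exists_le c M hM
  exact (h.line c i hi).isRegularLocalRing (h.centre_ne_bot hO hi) hiM _

/-- The generic point of the `i`-th component. -/
def IsFibreAtlas.point (h : IsFibreAtlas I s T V) (ha : IsRegularAtlas I s) (i : Fin T.n) :
    blowup I :=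
  chartMap (ha.mem _) (ha.ne_zero _) (centre _ _ (h.visible i).choose_spec)

variable (h : IsFibreAtlas I s T V) (ha : IsRegularAtlas I s)

lemma IsFibreAtlas.point_eq {c : σ} {i : Fin T.n} (hi : ∀ a ∈ chart I (s c), a ∈ V i) :
    h.point ha i = chartMap (ha.mem c) (ha.ne_zero c) (centre _ _ hi) :=
  chartMap_centre_eq _ _ _ _ _ _

/-- Near a point of the `i`-th component, that component is visible. -/
lemma IsFibreAtlas.mem_of_specializes {c : σ} {i : Fin T.n} {y : PrimeSpectrum (chart I (s c))}
    (hy : h.point ha i ⤳ chartMap (ha.mem c) (ha.ne_zero c) y) :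
    ∃ hi : ∀ a ∈ chart I (s c), a ∈ V i, (centre _ _ hi).asIdeal ≤ y.asIdeal := by
  have hr : h.point ha i ∈ Set.range (chartMap (ha.mem c) (ha.ne_zero c)) :=
    hy.mem_open (chartMap (ha.mem c) (ha.ne_zero c)).isOpenEmbedding.isOpen_range ⟨y, rfl⟩
  have hi := mem_of_chartMap_centre_mem_range _ _ _ _ _ hr
  refine ⟨hi, ?_⟩
  rw [h.point_eq ha hi] at hy
  exact (PrimeSpectrum.le_iff_specializes _ _).mpr
    ((chartMap (ha.mem c) (ha.ne_zero c)).isOpenEmbedding.isInducing.specializes_iff.mp hy)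

lemma IsFibreAtlas.specializes {c : σ} {i : Fin T.n} (hi : ∀ a ∈ chart I (s c), a ∈ V i)
    {y : PrimeSpectrum (chart I (s c))} (hy : (centre _ _ hi).asIdeal ≤ y.asIdeal) :
    h.point ha i ⤳ chartMap (ha.mem c) (ha.ne_zero c) y := by
  rw [h.point_eq ha hi]
  exact Specializes.map ((PrimeSpectrum.le_iff_specializes _ _).mp hy)
    (chartMap (ha.mem c) (ha.ne_zero c)).continuous

include h in
lemma IsFibreAtlas.inter_ne_zero {i j : Fin T.n} (hij : i ≠ j) {x : blowup I}
    (hi : h.point ha i ⤳ x) (hj : h.point ha j ⤳ x) : T.inter i j ≠ 0 := by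
  intro h0
  obtain ⟨c, y, rfl⟩ := ha.exists_mem_range x
  obtain ⟨hi', hi⟩ := h.mem_of_specializes ha hi
  obtain ⟨hj', hj⟩ := h.mem_of_specializes ha hj
  apply (PrimeSpectrum.isPrime y).ne_top
  rw [eq_top_iff, ← h.disjoint i j hij h0 c hi' hj']
  exact sup_le hi hj

/-- The point of intersection, in a chart where the sum of the two prime ideals is known. -/
def meetPoint {A k : Type u} [CommRing A] [Field k] (ψ : A →+* k[X]) : PrimeSpectrum A :=
  PrimeSpectrum.comap ψ ⟨Ideal.span {X}, (Ideal.span_singleton_prime X_ne_zero).mpr prime_X⟩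

lemma eq_meetPoint {A k : Type u} [CommRing A] [Field k] {ψ : A →+* k[X]}
    (hψ : Function.Surjective ψ) {n : ℕ} {y : PrimeSpectrum A}
    (hy : (Ideal.span {X ^ n}).comap ψ ≤ y.asIdeal) : y = meetPoint ψ := by
  have hm : (meetPoint ψ).asIdeal.IsMaximal := by
    have : (Ideal.span {(X : k[X])}).IsMaximal :=
      PrincipalIdealRing.isMaximal_of_irreducible irreducible_X
    exact Ideal.comap_isMaximal_of_surjective ψ hψ
  refine PrimeSpectrum.ext (hm.eq_of_le y.isPrime.ne_top fun a ha ↦ ?_).symm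
  obtain ⟨b, hb⟩ := Ideal.mem_span_singleton.mp (show ψ a ∈ Ideal.span {X} from ha)
  refine y.isPrime.mem_of_pow_mem n (hy ?_)
  rw [Ideal.mem_comap, map_pow, hb, mul_pow, Ideal.mem_span_singleton]
  exact dvd_mul_right _ _

include h in
/-- A point where two components meet lies in the chart chosen for that pair. -/
lemma IsFibreAtlas.eq_chartMap_meetPoint {i j : Fin T.n} {c : σ}
    {hi : ∀ a ∈ chart I (s c), a ∈ V i} {hj : ∀ a ∈ chart I (s c), a ∈ V j}
    {ψ : chart I (s c) →+* (ResidueField O)[X]} (hψ : Function.Surjective ψ)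
    (hJ : (centre _ _ hi).asIdeal ⊔ (centre _ _ hj).asIdeal =
        (Ideal.span {X ^ T.inter i j}).comap ψ)
    (hc : ∀ c' (hi' : ∀ a ∈ chart I (s c'), a ∈ V i) (hj' : ∀ a ∈ chart I (s c'), a ∈ V j)
      (b : chart I (s c')), (b : F) = s c / s c' →
      (centre _ _ hi').asIdeal ⊔ (centre _ _ hj').asIdeal ⊔ Ideal.span {b} = ⊤)
    {x : blowup I} (hxi : h.point ha i ⤳ x) (hxj : h.point ha j ⤳ x) :
    x = chartMap (ha.mem c) (ha.ne_zero c) (meetPoint ψ) := by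
  have hr : x ∈ Set.range (chartMap (ha.mem c) (ha.ne_zero c)) := by
    obtain ⟨c', y, rfl⟩ := ha.exists_mem_range x
    obtain ⟨hi', hi⟩ := h.mem_of_specializes ha hxi
    obtain ⟨hj', hj⟩ := h.mem_of_specializes ha hxj
    refine (chartMap_mem_range _ _ _ _ _).mpr fun hb ↦ ?_
    apply (PrimeSpectrum.isPrime y).ne_top
    rw [eq_top_iff, ← hc c' hi' hj' ⟨_, div_mem_chart _ (ha.mem c)⟩ rfl]
    exact sup_le (sup_le hi hj) ((Ideal.span_singleton_le_iff_mem _).mpr hb)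
  obtain ⟨y, rfl⟩ := hr
  obtain ⟨hi', hi⟩ := h.mem_of_specializes ha hxi
  obtain ⟨hj', hj⟩ := h.mem_of_specializes ha hxj
  congr 1
  exact eq_meetPoint hψ (hJ ▸ sup_le hi hj)

include h in
/-- No component contains another one: the intersection of two distinct ones is at most a closed
point. -/
lemma IsFibreAtlas.not_specializes {i j : Fin T.n} (hij : i ≠ j) :
    ¬ h.point ha i ⤳ h.point ha j := by
  intro hs
  obtain ⟨c, hi, hj, ⟨ψ, hψ, hJ⟩, hc⟩ := h.meet i j hij
    (h.inter_ne_zero ha hij hs (specializes_refl _))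
  have h1 := h.eq_chartMap_meetPoint ha hψ hJ hc hs (specializes_refl _)
  rw [h.point_eq ha hj] at h1
  have h2 := (chartMap (ha.mem c) (ha.ne_zero c)).isOpenEmbedding.injective h1
  apply (h.line c j hj).not_isMaximal
  rw [h2]
  have : (Ideal.span {(X : (ResidueField O)[X])}).IsMaximal :=
    PrincipalIdealRing.isMaximal_of_irreducible irreducible_X
  exact Ideal.comap_isMaximal_of_surjective ψ hψ

lemma blowupToBase_chartMap_eq_iff {t : F} (ht : t ∈ I) (ht0 : t ≠ 0)
    (y : PrimeSpectrum (chart I t)) :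
    blowupToBase I (chartMap ht ht0 y) = closedPoint O ↔
      (maximalIdeal O).map (algebraMap O _) ≤ y.asIdeal := by
  have h1 : blowupToBase I (chartMap ht ht0 y) =
      PrimeSpectrum.comap (algebraMap O (chart I t)) y := by
    let y' : Spec (.of (chart I t)) := y
    exact congr($(chartMap_blowupToBase ht ht0) y')
  rw [h1, Ideal.map_le_iff_le_comap]
  constructor
  · intro h2
    exact congr(PrimeSpectrum.asIdeal $h2).ge
  · intro h2
    exact PrimeSpectrum.ext ((maximalIdeal.isMaximal O).eq_of_le
      (PrimeSpectrum.comap (algebraMap O (chart I t)) y).isPrime.ne_top h2).symm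

lemma IsFibreAtlas.blowupToBase_point (i : Fin T.n) :
    blowupToBase I (h.point ha i) = closedPoint O :=
  (blowupToBase_chartMap_eq_iff _ _ _).mpr (h.map_le _)

lemma IsFibreAtlas.exists_specializes {x : blowup I} (hx : blowupToBase I x = closedPoint O) :
    ∃ i, h.point ha i ⤳ x := by
  obtain ⟨c, y, rfl⟩ := ha.exists_mem_range x
  have := PrimeSpectrum.isPrime y
  obtain ⟨i, hi, hy⟩ := h.exists_le c (PrimeSpectrum.asIdeal y)
    ((blowupToBase_chartMap_eq_iff _ _ _).mp hx)
  exact ⟨i, h.specializes ha hi hy⟩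

include h in
lemma IsFibreAtlas.map_maximalIdeal (i : Fin T.n) :
    (maximalIdeal O).map (toStalk (blowupToBase I) (h.point ha i)) =
      maximalIdeal ((blowup I).presheaf.stalk (h.point ha i)) ^ T.mult i := by
  obtain ⟨c, hi⟩ := h.visible i
  rw [h.point_eq ha hi]
  refine Eq.trans ?_ ((h.line c i hi).map_maximalIdeal_stalk
    (chartMap (ha.mem c) (ha.ne_zero c)) _)
  congr 1
  exact RingHom.ext (toStalk_eq_chartStalk _ _ (chartMap_blowupToBase _ _) _)

include h in
lemma IsFibreAtlas.isRegularLocalRing_quotient (i : Fin T.n) (x : blowup I)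
    (hx : h.point ha i ⤳ x) :
    IsRegularLocalRing ((blowup I).presheaf.stalk x ⧸ curveIdeal hx) := by
  obtain ⟨c, y, rfl⟩ := ha.exists_mem_range x
  obtain ⟨hi, hy⟩ := h.mem_of_specializes ha hx
  have key : ∀ (z : blowup I) (hz : z ⤳ chartMap (ha.mem c) (ha.ne_zero c) y),
      z = chartMap (ha.mem c) (ha.ne_zero c) (centre _ _ hi) →
      IsRegularLocalRing ((blowup I).presheaf.stalk (chartMap (ha.mem c) (ha.ne_zero c) y) ⧸
        curveIdeal hz) := by
    rintro z hz rfl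
    have e : curveIdeal hz = (centre _ _ hi).asIdeal.map (chartStalk _ y) :=
      curveIdeal_eq_map _ hz
    rw [e]
    exact (h.line c i hi).isRegularLocalRing_stalk_quotient _ y hy
  exact key _ hx (h.point_eq ha hi)

include h in
lemma IsFibreAtlas.exists_residueField_equiv (i : Fin T.n) :
    ∃ e : ResidueField ((blowup I).presheaf.stalk (h.point ha i)) ≃+* RatFunc (ResidueField O),
      (e.toRingHom.comp (residue ((blowup I).presheaf.stalk (h.point ha i)))).comp
        (toStalk (blowupToBase I) (h.point ha i)) =
      (algebraMap (ResidueField O) (RatFunc (ResidueField O))).comp (residue O) := by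
  obtain ⟨c, hi⟩ := h.visible i
  rw [h.point_eq ha hi]
  obtain ⟨e, he⟩ := (h.line c i hi).exists_residueField_stalk_equiv
    (chartMap (ha.mem c) (ha.ne_zero c)) (centre _ _ hi)
  refine ⟨e, RingHom.ext fun r ↦ ?_⟩
  refine Eq.trans ?_ (he r)
  exact congrArg (fun z ↦ e (residue _ z))
    (toStalk_eq_chartStalk _ _ (chartMap_blowupToBase _ _) _ r)

include h in
/-- Two components which intersect do so in one point, with the prescribed multiplicity. -/
lemma IsFibreAtlas.exists_localIntersection_eq {i j : Fin T.n} (hij : i ≠ j)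
    (h0 : T.inter i j ≠ 0) :
    ∃ (x : blowup I) (hi : h.point ha i ⤳ x) (hj : h.point ha j ⤳ x),
      (∀ y, h.point ha i ⤳ y → h.point ha j ⤳ y → y = x) ∧
      localIntersection hi hj = T.inter i j := by
  obtain ⟨c, hi, hj, ⟨ψ, hψ, hJ⟩, hc⟩ := h.meet i j hij h0
  have hle : (centre _ _ hi).asIdeal ⊔ (centre _ _ hj).asIdeal ≤ (meetPoint ψ).asIdeal := by
    rw [hJ]
    refine Ideal.comap_mono ?_
    rw [Ideal.span_singleton_le_span_singleton]
    exact dvd_pow_self _ h0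
  refine ⟨chartMap (ha.mem c) (ha.ne_zero c) (meetPoint ψ),
    h.specializes ha hi (le_sup_left.trans hle), h.specializes ha hj (le_sup_right.trans hle),
    fun y hyi hyj ↦ h.eq_chartMap_meetPoint ha hψ hJ hc hyi hyj, ?_⟩
  have key : ∀ (z z' : blowup I)
      (hz : z ⤳ chartMap (ha.mem c) (ha.ne_zero c) (meetPoint ψ))
      (hz' : z' ⤳ chartMap (ha.mem c) (ha.ne_zero c) (meetPoint ψ)),
      z = chartMap (ha.mem c) (ha.ne_zero c) (centre _ _ hi) →
      z' = chartMap (ha.mem c) (ha.ne_zero c) (centre _ _ hj) →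
      localIntersection hz hz' = T.inter i j := by
    rintro z z' hz hz' rfl rfl
    have e : curveIdeal hz = (centre _ _ hi).asIdeal.map (chartStalk _ (meetPoint ψ)) :=
      curveIdeal_eq_map _ hz
    have e' : curveIdeal hz' = (centre _ _ hj).asIdeal.map (chartStalk _ (meetPoint ψ)) :=
      curveIdeal_eq_map _ hz'
    rw [localIntersection, e, e', ← Ideal.map_sup]
    exact length_stalk_quotient_map_eq _ (meetPoint ψ) hψ rfl hJ
  exact key _ _ _ _ (h.point_eq ha hi) (h.point_eq ha hj)

include h in
/-- The components are precisely the maximal points of the special fibre. -/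
lemma IsFibreAtlas.range_point : Set.range (h.point ha) =
    {g | blowupToBase I g = closedPoint O ∧
      ∀ y, blowupToBase I y = closedPoint O → y ⤳ g → y = g} := by
  ext x
  constructor
  · rintro ⟨i, rfl⟩
    refine ⟨h.blowupToBase_point ha i, fun y hy hyi ↦ ?_⟩
    obtain ⟨j, hj⟩ := h.exists_specializes ha hy
    obtain rfl : j = i := by
      by_contra hji
      exact h.not_specializes ha hji (hj.trans hyi)
    exact (hyi.antisymm hj).eq
  · rintro ⟨hx, hx'⟩
    obtain ⟨i, hi⟩ := h.exists_specializes ha hx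
    exact ⟨i, hx' _ (h.blowupToBase_point ha i) hi⟩

end Configuration

section SpecialFibre

variable {K : Type u} [Field K] {O : ValuationSubring K} [IsDiscreteValuationRing O]
  {W : WeierstrassCurve K} {I : Submodule O W.toAffine.FunctionField}
  {σ : Type} {s : σ → W.toAffine.FunctionField} {T : FibreConfiguration}
  {V : Fin T.n → ValuationSubring W.toAffine.FunctionField}

/-- The special fibre of the regular model has the configuration of the atlas. -/
theorem IsFibreAtlas.hasSpecialFibre (h : IsFibreAtlas I s T V) (ha : IsRegularAtlas I s) :
    ha.model.HasSpecialFibre T := by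
  refine ⟨h.point ha, fun i j hij ↦ ?_, h.range_point ha, h.map_maximalIdeal ha,
    fun i ↦ ⟨h.isRegularLocalRing_quotient ha i, h.exists_residueField_equiv ha i⟩,
    fun i j hij h0 x hx ↦ h.inter_ne_zero ha hij hx.1 hx.2 h0,
    fun i j hij h0 ↦ h.exists_localIntersection_eq ha hij h0⟩
  by_contra hne
  exact h.not_specializes ha hne (specializes_of_eq hij)

end SpecialFibre

/-! ### Regularity of the affine curve `y² = x³ - a x` over a field -/

section Weierstrass

variable {K B : Type*} [Field K] [CommRing B] [Algebra K B] {x y : B} {a : K}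

/-- The norm of `P + Q y` to `K[x]` does not vanish. -/
lemma norm_ne_zero (a : K) {P Q : K[X]} (h : P ≠ 0 ∨ Q ≠ 0) :
    P ^ 2 - Q ^ 2 * (X ^ 3 - C a * X) ≠ 0 := by
  intro h0
  have hf : (X ^ 3 - C a * X : K[X]).natDegree = 3 := by compute_degree!
  have hf0 : (X ^ 3 - C a * X : K[X]) ≠ 0 := fun h ↦ by simp [h] at hf
  rw [sub_eq_zero] at h0
  by_cases hQ : Q = 0
  · subst hQ
    simp_all
  have h1 := congrArg natDegree h0
  rw [natDegree_pow, natDegree_mul (pow_ne_zero 2 hQ) hf0, natDegree_pow, hf] at h1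
  omega

lemma isCoprime_derivative (ha : a ≠ 0) (h2 : (2 : K) ≠ 0) :
    IsCoprime (X ^ 3 - C a * X) (3 * X ^ 2 - C a : K[X]) := by
  have h3 : (2 : K[X]) * C (2⁻¹) = 1 := by
    rw [← map_ofNat (C : K →+* K[X]) 2, ← C_mul, mul_inv_cancel₀ h2, C_1]
  have h4 : C a * C a⁻¹ = 1 := by rw [← C_mul, mul_inv_cancel₀ ha, C_1]
  refine ⟨-9 * C 2⁻¹ * C a⁻¹ ^ 2 * X, 3 * C 2⁻¹ * C a⁻¹ ^ 2 * X ^ 2 - C a⁻¹, ?_⟩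
  linear_combination (6 * C 2⁻¹ * C a⁻¹ * X ^ 2 + 1) * h4 + 3 * C a⁻¹ * X ^ 2 * h3

variable [IsDomain B] [IsLocalRing B]

omit [IsDomain B] in
/-- The ring has a single prime element up to units: every element of the form `P + Q y` is, up to
a unit, a power of one element `ϖ`. -/
lemma exists_associated_pow (ha : a ≠ 0) (h2 : (2 : K) ≠ 0)
    (hxy : y ^ 2 = x ^ 3 - algebraMap K B a * x) (hx : Transcendental K x) :
    ∃ ϖ : B, ϖ ≠ 0 ∧ ∀ P Q : K[X], P ≠ 0 ∨ Q ≠ 0 →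
      ∃ j : ℕ, Associated (aeval x P + aeval x Q * y) (ϖ ^ j) := by
  have hf : aeval x (X ^ 3 - C a * X : K[X]) = y ^ 2 := by simp [hxy]
  have hN (P Q : K[X]) : (aeval x P + aeval x Q * y) * (aeval x P - aeval x Q * y) =
      aeval x (P ^ 2 - Q ^ 2 * (X ^ 3 - C a * X)) := by
    rw [map_sub, map_mul, hf, map_pow, map_pow]; ring
  have hx0 {D : K[X]} (hD : D ≠ 0) : aeval x D ≠ 0 := fun h ↦
    hD (transcendental_iff.mp hx D h)
  have hK {c : K} (hc : c ≠ 0) : IsUnit (algebraMap K B c) := hc.isUnit.map _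
  -- The polynomial `q` generates the prime of `K[x]` below the maximal ideal.
  obtain ⟨q, hq⟩ := IsPrincipalIdealRing.principal
    ((maximalIdeal B).comap (aeval x : K[X] →ₐ[K] B))
  have hq' (D : K[X]) : aeval x D ∈ maximalIdeal B ↔ q ∣ D := by
    rw [← Ideal.mem_span_singleton]
    exact SetLike.ext_iff.mp hq D
  have hqu (D : K[X]) (hD : ¬ q ∣ D) : IsUnit (aeval x D) := by
    rwa [← hq', notMem_maximalIdeal] at hD
  -- If `q = 0`, then all nonzero norms are units, and with them all nonzero elements.
  by_cases hq0 : q = 0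
  · refine ⟨1, one_ne_zero, fun P Q h ↦ ⟨0, ?_⟩⟩
    rw [pow_zero, associated_one_iff_isUnit]
    have h3 := hqu _ (by rw [hq0, zero_dvd_iff]; exact norm_ne_zero a h)
    rw [← hN] at h3
    exact isUnit_of_mul_isUnit_left h3
  have hqp : Prime q := by
    rw [← Ideal.span_singleton_prime hq0]
    have := Ideal.comap_isPrime (aeval x : K[X] →ₐ[K] B) (maximalIdeal B)
    rwa [hq] at this
  have hpow (D : K[X]) (hD : D ≠ 0) : ∃ j : ℕ, Associated (aeval x D) (aeval x q ^ j) := by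
    obtain ⟨D', e, hD'⟩ := (FiniteMultiplicity.of_prime_left hqp hD).exists_eq_pow_mul_and_not_dvd
    refine ⟨multiplicity q D, ?_⟩
    conv_lhs => rw [e]
    rw [map_mul, map_pow]
    exact associated_mul_unit_left _ _ (hqu _ hD')
  -- If `q` divides `x³ - a x`, then `y` is a parameter at the point and `q` is associated to
  -- `y²`, as the cubic is separable. The orders of `P` and of `Q y` have different parity, so the
  -- smaller one is the order of the sum.
  by_cases hqf : q ∣ X ^ 3 - C a * X
  · obtain ⟨g, hg⟩ := hqf
    have hgq : ¬ q ∣ g := by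
      rintro ⟨g', rfl⟩
      have h3 : q ∣ 3 * X ^ 2 - C a := by
        have : derivative (X ^ 3 - C a * X) = 3 * X ^ 2 - C a := by
          rw [derivative_sub, derivative_X_pow, derivative_C_mul, derivative_X, mul_one]
          norm_num
          exact map_ofNat C 3
        rw [← this, hg]
        refine ⟨2 * derivative q * g' + q * derivative g', ?_⟩
        simp only [derivative_mul]
        ring
      exact hqp.not_isUnit ((isCoprime_derivative ha h2).isUnit_of_dvd' (hg ▸ dvd_mul_right _ _) h3)
    rw [hg, map_mul] at hf
    have hqy : Associated (aeval x q) (y ^ 2) := by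
      rw [← hf]
      exact (associated_mul_unit_left _ _ (hqu _ hgq)).symm
    have hym : y ∈ maximalIdeal B := by
      refine Ideal.IsPrime.mem_of_pow_mem inferInstance 2 ?_
      rw [← hf]
      exact Ideal.mul_mem_right _ _ ((hq' q).mpr dvd_rfl)
    have hy0 : y ≠ 0 := by
      rintro rfl
      rw [zero_pow two_ne_zero] at hqy
      exact hx0 hq0 ((associated_zero_iff_eq_zero _).mp hqy)
    refine ⟨y, hy0, fun P Q h ↦ ?_⟩
    have hsum : ∀ {i l : ℕ} {z w : B}, Associated z (y ^ i) → Associated w (y ^ l) → i < l →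
        Associated (z + w) (y ^ i) := by
      intro i l z w hz hw hil
      obtain ⟨e, rfl⟩ := hz.symm
      obtain ⟨e', rfl⟩ := hw.symm
      obtain ⟨m, rfl⟩ := Nat.exists_eq_add_of_lt hil
      have : y ^ i * e + y ^ (i + m + 1) * e' = y ^ i * (e + y * (y ^ m * e')) := by ring
      rw [this]
      refine associated_mul_unit_left _ _ ?_
      rw [← notMem_maximalIdeal]
      intro h
      exact (notMem_maximalIdeal.mpr e.isUnit)
        ((Ideal.add_mem_iff_left _ (Ideal.mul_mem_right _ _ hym)).mp h)
    by_cases hP : P = 0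
    · obtain ⟨l, hl⟩ := hpow Q (h.resolve_left (· hP))
      refine ⟨2 * l + 1, ?_⟩
      rw [hP, map_zero, zero_add, pow_succ, pow_mul]
      exact (hl.trans (hqy.pow_pow)).mul_right y
    obtain ⟨i, hi⟩ := hpow P hP
    replace hi : Associated (aeval x P) (y ^ (2 * i)) := by
      rw [pow_mul]; exact hi.trans hqy.pow_pow
    by_cases hQ : Q = 0
    · exact ⟨2 * i, by rwa [hQ, map_zero, zero_mul, add_zero]⟩
    obtain ⟨l, hl⟩ := hpow Q hQ
    replace hl : Associated (aeval x Q * y) (y ^ (2 * l + 1)) := by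
      rw [pow_succ, pow_mul]
      exact (hl.trans (hqy.pow_pow)).mul_right y
    rcases lt_or_gt_of_ne (show 2 * i ≠ 2 * l + 1 by omega) with h | h
    · exact ⟨_, hsum hi hl h⟩
    · exact ⟨_, by rw [add_comm]; exact hsum hl hi h⟩
  -- Otherwise `y` is a unit and `q` is a parameter. If `P` and `Q` are coprime, then `P + Q y`
  -- and `P - Q y` are not both in the maximal ideal, so one of them is a unit and the order of
  -- the other is the order of the norm.
  · have hyu : IsUnit y := by
      have := hqu _ hqf
      rw [hf] at this
      exact (isUnit_pow_iff two_ne_zero).mp this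
    refine ⟨aeval x q, hx0 hq0, fun P Q h ↦ ?_⟩
    classical
    obtain ⟨P', Q', hc, hg⟩ : ∃ P' Q', IsCoprime P' Q' ∧ ∃ g ≠ 0, P = g * P' ∧ Q = g * Q' := by
      have hg : gcd P Q ≠ 0 := by
        rw [Ne, gcd_eq_zero_iff]; tauto
      obtain ⟨P', hP'⟩ := gcd_dvd_left P Q
      obtain ⟨Q', hQ'⟩ := gcd_dvd_right P Q
      refine ⟨P', Q', ?_, gcd P Q, hg, hP', hQ'⟩
      rw [← gcd_isUnit_iff]
      have : gcd P Q * gcd P' Q' ∣ gcd P Q * 1 := by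
        rw [mul_one]
        refine dvd_gcd ?_ ?_
        · nth_rw 2 [hP']
          exact mul_dvd_mul_left _ (gcd_dvd_left _ _)
        · nth_rw 2 [hQ']
          exact mul_dvd_mul_left _ (gcd_dvd_right _ _)
      exact isUnit_of_dvd_one ((mul_dvd_mul_iff_left hg).mp this)
    obtain ⟨g, hg0, rfl, rfl⟩ := hg
    obtain ⟨j, hj⟩ := hpow g hg0
    have hPQ' : P' ≠ 0 ∨ Q' ≠ 0 := by
      rcases h with h | h
      exacts [.inl (right_ne_zero_of_mul h), .inr (right_ne_zero_of_mul h)]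
    have key : ∃ j : ℕ, Associated (aeval x P' + aeval x Q' * y) (aeval x q ^ j) := by
      by_cases hu : IsUnit (aeval x P' + aeval x Q' * y)
      · exact ⟨0, by rwa [pow_zero, associated_one_iff_isUnit]⟩
      have hu' : IsUnit (aeval x P' - aeval x Q' * y) := by
        by_contra hu'
        rw [← mem_nonunits_iff, ← mem_maximalIdeal] at hu hu'
        have h3 : algebraMap K B 2 * aeval x P' ∈ maximalIdeal B := by
          convert Ideal.add_mem _ hu hu' using 1
          rw [map_ofNat]; ring
        have h4 : algebraMap K B 2 * y * aeval x Q' ∈ maximalIdeal B := by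
          convert Ideal.sub_mem _ hu hu' using 1
          rw [map_ofNat]; ring
        rw [Ideal.unit_mul_mem_iff_mem _ (hK h2), hq'] at h3
        rw [Ideal.unit_mul_mem_iff_mem _ ((hK h2).mul hyu), hq'] at h4
        exact hqp.not_isUnit (hc.isUnit_of_dvd' h3 h4)
      obtain ⟨j, hj⟩ := hpow _ (norm_ne_zero a hPQ')
      refine ⟨j, ?_⟩
      rw [← hN] at hj
      exact (associated_mul_unit_left _ _ hu').symm.trans hj
    obtain ⟨j', hj'⟩ := key
    refine ⟨j + j', ?_⟩
    have := hj.mul_mul hj'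
    rw [← pow_add] at this
    rwa [show aeval x (g * P') + aeval x (g * Q') * y =
      aeval x g * (aeval x P' + aeval x Q' * y) by rw [map_mul, map_mul]; ring]

/-- The local rings of the curve `y² = x³ - a x` over a field `K` in which `2 a ≠ 0` are regular. -/
lemma isRegularLocalRing_of_weierstrass [IsNoetherianRing B] (ha : a ≠ 0) (h2 : (2 : K) ≠ 0)
    (hxy : y ^ 2 = x ^ 3 - algebraMap K B a * x) (hx : Transcendental K x)
    (hspan : ∀ b : B, ∃ P Q D : K[X], D ≠ 0 ∧ b * aeval x D = aeval x P + aeval x Q * y) :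
    IsRegularLocalRing B := by
  obtain ⟨ϖ, hϖ, h⟩ := exists_associated_pow ha h2 hxy hx
  have key (b : B) (hb : b ≠ 0) : ∃ i j : ℕ, Associated (b * ϖ ^ i) (ϖ ^ j) := by
    obtain ⟨P, Q, D, hD, e⟩ := hspan b
    have hD' : aeval x D ≠ 0 := fun h ↦ hD (transcendental_iff.mp hx D h)
    obtain ⟨i, hi⟩ := h D 0 (.inl hD)
    rw [map_zero, zero_mul, add_zero] at hi
    obtain ⟨j, hj⟩ := h P Q (by
      by_contra! h0
      rw [h0.1, h0.2] at e
      simp_all)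
    exact ⟨i, j, (hi.symm.mul_left b).trans (e ▸ hj)⟩
  -- Any two elements divide one another in some order, so `B` is a valuation ring; being
  -- noetherian, it is a principal ideal domain.
  have : ValuationRing B := by
    rw [ValuationRing.iff_dvd_total]
    refine ⟨fun b b' ↦ ?_⟩
    by_cases hb : b = 0
    · exact .inr (hb ▸ dvd_zero _)
    by_cases hb' : b' = 0
    · exact .inl (hb' ▸ dvd_zero _)
    obtain ⟨i, j, hij⟩ := key b hb
    obtain ⟨i', j', hij'⟩ := key b' hb'
    have e1 : Associated (ϖ ^ (i + i') * b) (ϖ ^ (j + i')) := by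
      have := hij.mul_right (ϖ ^ i')
      rw [← pow_add] at this
      rwa [show ϖ ^ (i + i') * b = b * ϖ ^ i * ϖ ^ i' by ring]
    have e2 : Associated (ϖ ^ (i + i') * b') (ϖ ^ (j' + i)) := by
      have := hij'.mul_right (ϖ ^ i)
      rw [← pow_add] at this
      rwa [show ϖ ^ (i + i') * b' = b' * ϖ ^ i' * ϖ ^ i by ring]
    have hne := pow_ne_zero (i + i') hϖ
    rcases le_total (j + i') (j' + i) with h | h
    · exact .inl ((mul_dvd_mul_iff_left hne).mp (e1.dvd.trans ((pow_dvd_pow _ h).trans e2.symm.dvd)))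
    · exact .inr ((mul_dvd_mul_iff_left hne).mp (e2.dvd.trans ((pow_dvd_pow _ h).trans e1.symm.dvd)))
  have : IsPrincipalIdealRing B := ((IsBezout.TFAE (R := B)).out 0 1 rfl rfl).mp inferInstance
  infer_instance

end Weierstrass

/-! ### Valuation rings with transcendental residues -/

section ResTranscendental

variable {K F : Type u} [Field K] {O : ValuationSubring K} [Field F] [Algebra O F]
variable {V : ValuationSubring F} {t θ : F}

variable (O) in
/-- The valuation ring `V` dominates `O`, and the residue of `t ∈ V` is transcendental over the
residue field of `O`. -/
structure IsResTranscendental (V : ValuationSubring F) (t : F) : Prop where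
  algebraMap_mem : ∀ r : O, algebraMap O F r ∈ V
  mem : t ∈ V
  aeval_mem : ∀ G : O[X], aeval t G ∈ V.nonunits ↔ G.map (residue O) = 0

namespace IsResTranscendental

lemma algebraMap_mem_nonunits (h : IsResTranscendental O V t) {r : O} :
    algebraMap O F r ∈ V.nonunits ↔ r ∈ maximalIdeal O := by
  rw [← aeval_C t, h.aeval_mem, map_C, C_eq_zero, residue_eq_zero_iff]

lemma valuation_algebraMap (h : IsResTranscendental O V t) {r : O} (hr : IsUnit r) :
    V.valuation (algebraMap O F r) = 1 := by
  refine le_antisymm ((V.valuation_le_one_iff _).mpr (h.algebraMap_mem r)) ?_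
  rw [← not_lt, ← ValuationSubring.mem_nonunits_iff, h.algebraMap_mem_nonunits, mem_maximalIdeal,
    mem_nonunits_iff, not_not]
  exact hr

lemma valuation_algebraMap_lt_one (h : IsResTranscendental O V t) {r : O} (hr : Irreducible r) :
    V.valuation (algebraMap O F r) < 1 := by
  rw [← ValuationSubring.mem_nonunits_iff, h.algebraMap_mem_nonunits, mem_maximalIdeal]
  exact hr.not_isUnit

lemma valuation_eq_one (h : IsResTranscendental O V t) : V.valuation t = 1 := by
  refine le_antisymm ((V.valuation_le_one_iff _).mpr h.mem) ?_
  have := h.aeval_mem X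
  rw [aeval_X, Polynomial.map_X] at this
  rw [← not_lt, ← ValuationSubring.mem_nonunits_iff, this]
  exact X_ne_zero

end IsResTranscendental

lemma aeval_mem_nonunits (hm : ∀ r ∈ maximalIdeal O, algebraMap O F r ∈ V.nonunits) (ht : t ∈ V)
    {G : O[X]} (hG : G.map (residue O) = 0) : aeval t G ∈ V.nonunits := by
  rw [aeval_eq_sum_range, ValuationSubring.mem_nonunits_iff]
  refine Valuation.map_sum_lt _ one_ne_zero fun i _ ↦ ?_
  have h1 : G.coeff i ∈ maximalIdeal O := by
    rw [← residue_eq_zero_iff, ← coeff_map, hG, coeff_zero]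
  rw [Algebra.smul_def, map_mul, map_pow]
  exact mul_lt_one_of_lt_of_le (V.mem_nonunits_iff.mp (hm _ h1))
    (pow_le_one₀ zero_le ((V.valuation_le_one_iff _).mpr ht))

/-- If the residue of `θ` is a rational function of the residue of `t`, and the former is
transcendental, then so is the latter. -/
lemma IsResTranscendental.of_relation (h : IsResTranscendental O V θ) (ht : t ∈ V) {G H : O[X]}
    (hH : aeval t H ∉ V.nonunits) (hGH : θ * aeval t H - aeval t G ∈ V.nonunits) :
    IsResTranscendental O V t := by
  refine ⟨h.algebraMap_mem, ht, fun Q ↦ ⟨fun hQ ↦ ?_, aeval_mem_nonunits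
    (fun r hr ↦ h.algebraMap_mem_nonunits.mpr hr) ht⟩⟩
  -- If the residue of `t` were algebraic over the residue field of `O`, so would be that of `θ`,
  -- which is a quotient of polynomials in it.
  by_contra hQ0
  let ρ : O →+* V := (algebraMap O F).codRestrict V.toSubring h.algebraMap_mem
  have : IsLocalHom ρ := ⟨fun r hr ↦ by
    by_contra hr'
    have h1 := h.algebraMap_mem_nonunits.mpr ((mem_maximalIdeal r).mpr hr')
    exact (ValuationSubring.coe_mem_nonunits_iff (a := ρ r)).mp h1 hr⟩
  let _ : Algebra (ResidueField O) (ResidueField V) := (ResidueField.map ρ).toAlgebra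
  have hρ (z : V) (Q : O[X]) : ((Q.eval₂ ρ z : V) : F) = aeval (z : F) Q :=
    hom_eval₂ Q ρ V.subtype z
  have ev (z : V) (Q : O[X]) :
      residue V (Q.eval₂ ρ z) = aeval (residue V z) (Q.map (residue O)) := by
    rw [hom_eval₂, aeval_def, eval₂_map]
    rfl
  have h0 (z : V) : residue V z = 0 ↔ (z : F) ∈ V.nonunits := by
    rw [residue_eq_zero_iff, ValuationSubring.coe_mem_nonunits_iff]
  let t' : V := ⟨t, ht⟩
  let θ' : V := ⟨θ, h.mem⟩
  have hta : IsAlgebraic (ResidueField O) (residue V t') :=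
    ⟨Q.map (residue O), hQ0, by rw [← ev, h0, hρ]; exact hQ⟩
  have hta' (Q : (ResidueField O)[X]) : IsAlgebraic (ResidueField O) (aeval (residue V t') Q) := by
    induction Q using Polynomial.induction_on' with
    | add p q hp hq => rw [map_add]; exact hp.add hq
    | monomial n a =>
      rw [aeval_monomial]
      exact (isAlgebraic_algebraMap a).mul (hta.pow n)
  have e1 : residue V θ' * aeval (residue V t') (H.map (residue O)) =
      aeval (residue V t') (G.map (residue O)) := by
    rw [← ev, ← ev, ← map_mul, ← sub_eq_zero, ← map_sub, h0]
    push_cast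
    rw [hρ, hρ]
    exact hGH
  have e2 : aeval (residue V t') (H.map (residue O)) ≠ 0 := by
    rw [← ev, Ne, h0, hρ]
    exact hH
  have hθa : IsAlgebraic (ResidueField O) (residue V θ') := by
    rw [← eq_div_iff e2] at e1
    rw [e1, div_eq_mul_inv]
    exact (hta' _).mul (hta' _).inv
  obtain ⟨q, hq0, hq⟩ := hθa
  obtain ⟨q, rfl⟩ := Polynomial.map_surjective _ residue_surjective q
  rw [← ev, h0, hρ] at hq
  exact hq0 ((h.aeval_mem q).mp hq)

/-- The Gauss extension of the valuation of `O` to `O[θ]`, extended further to `F`. -/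
lemma exists_isResTranscendental (hθ : Transcendental O θ) :
    ∃ V : ValuationSubring F, IsResTranscendental O V θ := by
  let e : O[X] ≃ₐ[O] Algebra.adjoin O {θ} := algEquivOfTranscendental O θ hθ
  have he (G : O[X]) : (e G : F) = aeval θ G := by
    have := Subalgebra.aeval_coe _ (⟨θ, Algebra.self_mem_adjoin_singleton O θ⟩ : Algebra.adjoin O {θ}) G
    rw [this]
    rfl
  -- The prime which is the kernel of the reduction `O[θ] → k[θ]`.
  let p : PrimeSpectrum (Algebra.adjoin O {θ}) :=
    ⟨RingHom.ker ((mapRingHom (residue O)).comp (e.symm : Algebra.adjoin O {θ} →+* O[X])),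
      RingHom.ker_isPrime _⟩
  obtain ⟨V, hV, hp⟩ := exists_centre_eq _ p
  refine ⟨V, fun r ↦ hV _ (Subalgebra.algebraMap_mem _ r), hV _ (Algebra.self_mem_adjoin_singleton _ _),
    fun G ↦ ?_⟩
  rw [← he, ← mem_centre (h := hV), hp]
  change (e.symm (e G)).map (residue O) = 0 ↔ _
  rw [e.symm_apply_apply]

end ResTranscendental

/-! ### Lines as centres of valuation rings -/

section LineChart

variable {K F : Type u} [Field K] {O : ValuationSubring K} [Field F] [Algebra O F]
variable {A : Subalgebra O F} {V : ValuationSubring F} {t ϖ v : F} {m : ℕ}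

/-- The centre of `V` on `Spec A` is a line with coordinate `t`, the closure of which is cut out
by `ϖ` where `v` is invertible; the multiplicity in the special fibre is `m`. -/
structure IsLineChart (A : Subalgebra O F) (V : ValuationSubring F) (t ϖ v : F) (m : ℕ) : Prop where
  le : ∀ a ∈ A, a ∈ V
  trans : IsResTranscendental O V t
  coord_mem : t ∈ A
  mem : ϖ ∈ A
  mem_nonunits : ϖ ∈ V.nonunits
  unit_mem : v ∈ A
  /-- The function `v` is a nonzero constant on the line. -/
  exists_unit : ∃ c : O, IsUnit c ∧ v - algebraMap O F c ∈ V.nonunits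
  /-- Where `v` is invertible, every function is a polynomial in `t` modulo `ϖ`. -/
  approx : ∀ a ∈ A, ∃ (N : ℕ) (G : O[X]), ∃ b ∈ A, v ^ N * (a - aeval t G) = ϖ * b
  /-- Where `v` is invertible, `π` is the product of `ϖ ^ m` and of a function which does not
  vanish identically on the line. -/
  order : m ≠ 0 ∧ ∃ π : O, Irreducible π ∧ ∃ N : ℕ, ∃ w ∈ A, w ∉ V.nonunits ∧
    v ^ N * algebraMap O F π = w * ϖ ^ m

/-- It is enough to approximate generators by polynomials in the coordinate. -/
lemma approx_of_adjoin {S : Set F} (hA : A = Algebra.adjoin O S) (ht : t ∈ A) (hv : v ∈ A)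
    (hS : ∀ g ∈ S, ∃ (N : ℕ) (G : O[X]), ∃ b ∈ A, v ^ N * (g - aeval t G) = ϖ * b) :
    ∀ a ∈ A, ∃ (N : ℕ) (G : O[X]), ∃ b ∈ A, v ^ N * (a - aeval t G) = ϖ * b := by
  have hG (G : O[X]) : aeval t G ∈ A := by
    have := Subalgebra.aeval_coe A ⟨t, ht⟩ G
    exact this ▸ Subtype.prop _
  intro a ha
  have ha' := ha
  rw [hA] at ha'
  have hSA : Algebra.adjoin O S ≤ A := hA.ge
  induction ha' using Algebra.adjoin_induction with
  | mem x hx => exact hS x hx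
  | algebraMap r => exact ⟨0, C r, 0, A.zero_mem, by simp⟩
  | add x y hx hy ihx ihy =>
    obtain ⟨N, G, b, hb, e⟩ := ihx (hSA hx)
    obtain ⟨N', G', b', hb', e'⟩ := ihy (hSA hy)
    refine ⟨N + N', G + G', v ^ N' * b + v ^ N * b',
      A.add_mem (A.mul_mem (A.pow_mem hv _) hb) (A.mul_mem (A.pow_mem hv _) hb'), ?_⟩
    rw [map_add]
    linear_combination v ^ N' * e + v ^ N * e'
  | mul x y hx hy ihx ihy =>
    obtain ⟨N, G, b, hb, e⟩ := ihx (hSA hx)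
    obtain ⟨N', G', b', hb', e'⟩ := ihy (hSA hy)
    refine ⟨N + N', G * G', v ^ N' * y * b + v ^ N * aeval t G * b',
      A.add_mem (A.mul_mem (A.mul_mem (A.pow_mem hv _) (hSA hy)) hb)
        (A.mul_mem (A.mul_mem (A.pow_mem hv _) (hG G)) hb'), ?_⟩
    rw [map_mul]
    linear_combination v ^ N' * y * e + v ^ N * aeval t G * e'

namespace IsLineChart

lemma valuation_unit (h : IsLineChart A V t ϖ v m) : V.valuation v = 1 := by
  obtain ⟨c, hc, hvc⟩ := h.exists_unit
  rw [ValuationSubring.mem_nonunits_iff, ← h.trans.valuation_algebraMap hc] at hvc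
  have := V.valuation.map_add_eq_of_lt_right hvc
  rwa [sub_add_cancel, h.trans.valuation_algebraMap hc] at this

/-- The parametrisation of the line. -/
lemma exists_hom (h : IsLineChart A V t ϖ v m) (h' : ∀ a ∈ A, a ∈ V) :
    ∃ φ : A →+* (ResidueField O)[X], Function.Surjective φ ∧
    RingHom.ker φ = (centre A V h').asIdeal ∧
    ∀ G : O[X], φ (aeval ⟨t, h.coord_mem⟩ G) = G.map (residue O) := by
  let P := (centre A V h').asIdeal
  have hP : P.IsPrime := (centre A V h').isPrime
  have hv : ⟨v, h.unit_mem⟩ ∉ P := by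
    rw [mem_centre, ValuationSubring.mem_nonunits_iff, h.valuation_unit]
    exact lt_irrefl _
  -- The map `O[t] → A / P` is surjective, and its kernel consists of the polynomials with
  -- reduction zero.
  let ψ : O[X] →+* A ⧸ P := (Ideal.Quotient.mk P).comp
    (aeval (⟨t, h.coord_mem⟩ : A) : O[X] →ₐ[O] A).toRingHom
  have hψ : Function.Surjective ψ := by
    intro z
    obtain ⟨a, rfl⟩ := Ideal.Quotient.mk_surjective z
    obtain ⟨N, G, b, hb, e⟩ := h.approx a a.2
    refine ⟨G, ?_⟩
    refine (Ideal.Quotient.eq.mpr ?_).symm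
    have h2 : ⟨v, h.unit_mem⟩ ^ N * (a - aeval (⟨t, h.coord_mem⟩ : A) G) ∈ P := by
      have : (⟨v, h.unit_mem⟩ ^ N * (a - aeval (⟨t, h.coord_mem⟩ : A) G) : A) =
          ⟨ϖ, h.mem⟩ * ⟨b, hb⟩ := by
        apply Subtype.ext
        push_cast
        exact e
      rw [this]
      exact P.mul_mem_right _ (mem_centre.mpr h.mem_nonunits)
    exact (hP.mem_or_mem h2).resolve_left fun h3 ↦ hv (hP.mem_of_pow_mem _ h3)
  have hψ0 (G : O[X]) : ψ G = 0 ↔ G.map (residue O) = 0 := by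
    rw [← h.trans.aeval_mem]
    refine Ideal.Quotient.eq_zero_iff_mem.trans (mem_centre.trans ?_)
    exact iff_of_eq (congrArg (· ∈ V.nonunits) (Subalgebra.aeval_coe A ⟨t, h.coord_mem⟩ G).symm)
  let ρ : A ⧸ P →+* (ResidueField O)[X] := RingHom.liftOfSurjective ψ hψ
    ⟨mapRingHom (residue O), fun G hG ↦ (hψ0 G).mp hG⟩
  have hρ (G : O[X]) : ρ (ψ G) = G.map (residue O) :=
    RingHom.liftOfRightInverse_comp_apply _ _ _ _ _
  refine ⟨ρ.comp (Ideal.Quotient.mk P), fun z ↦ ?_, ?_, hρ⟩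
  · obtain ⟨G, rfl⟩ := Polynomial.map_surjective _ residue_surjective z
    exact ⟨_, hρ G⟩
  · ext a
    obtain ⟨G, hG⟩ := hψ (Ideal.Quotient.mk P a)
    rw [RingHom.mem_ker, RingHom.comp_apply, ← hG, hρ, ← hψ0, hG, Ideal.Quotient.eq_zero_iff_mem]

variable [IsDiscreteValuationRing O]

/-- Away from `v`, the line is cut out by `ϖ`. -/
lemma exists_eq_mul (h : IsLineChart A V t ϖ v m) {a : F} (ha : a ∈ A) (haV : a ∈ V.nonunits) :
    ∃ N : ℕ, ∃ b ∈ A, v ^ N * a = ϖ * b := by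
  obtain ⟨N, G, b, hb, e⟩ := h.approx a ha
  obtain ⟨hm, π, hπ, N', w, hw, -, e'⟩ := h.order
  have h1 : aeval t G ∈ V.nonunits := by
    have h2 : v ^ N * aeval t G = v ^ N * a - ϖ * b := by linear_combination -e
    have h3 := congrArg V.valuation h2
    rw [map_mul, map_pow, h.valuation_unit, one_pow, one_mul] at h3
    rw [ValuationSubring.mem_nonunits_iff, h3]
    refine V.valuation.map_sub_lt ?_ ?_
    · rw [map_mul, map_pow, h.valuation_unit, one_pow, one_mul]
      exact V.mem_nonunits_iff.mp haV
    · rw [map_mul]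
      exact mul_lt_one_of_lt_of_le (V.mem_nonunits_iff.mp h.mem_nonunits)
        ((V.valuation_le_one_iff _).mpr (h.le b hb))
  rw [h.trans.aeval_mem] at h1
  -- The polynomial `G` which approximates `a` has reduction zero, so it is divisible by `π`,
  -- which up to a power of `v` is a multiple of `ϖ`.
  obtain ⟨G', rfl⟩ : C π ∣ G := by
    rw [C_dvd_iff_dvd_coeff]
    intro i
    rw [← Ideal.mem_span_singleton, ← hπ.maximalIdeal_eq, ← residue_eq_zero_iff, ← coeff_map, h1,
      coeff_zero]
  have hG' : aeval t G' ∈ A := by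
    have := Subalgebra.aeval_coe A ⟨t, h.coord_mem⟩ G'
    exact this ▸ Subtype.prop _
  obtain ⟨m, rfl⟩ := Nat.exists_eq_add_one_of_ne_zero hm
  refine ⟨N + N', v ^ N' * b + v ^ N * (w * ϖ ^ m * aeval t G'), ?_, ?_⟩
  · exact A.add_mem (A.mul_mem (A.pow_mem h.unit_mem _) hb) (A.mul_mem (A.pow_mem h.unit_mem _)
      (A.mul_mem (A.mul_mem hw (A.pow_mem h.mem _)) hG'))
  · rw [map_mul, aeval_C] at e
    linear_combination v ^ N' * e + v ^ N * aeval t G' * e'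

lemma isLine (h : IsLineChart A V t ϖ v m) (h' : ∀ a ∈ A, a ∈ V) :
    IsLine (R := O) (centre A V h').asIdeal m := by
  obtain ⟨φ, hφ, hk, hG⟩ := h.exists_hom h'
  have hC (r : O) : φ (algebraMap O A r) = C (residue O r) := by
    have := hG (C r)
    rwa [aeval_C, map_C] at this
  obtain ⟨hm, π, hπ, N, w, hw, hwV, e⟩ := h.order
  refine ⟨φ, hφ, hk, hC, ⟨ϖ, h.mem⟩, mem_centre.mpr h.mem_nonunits, ⟨v, h.unit_mem⟩, ?_,
    fun a ha ↦ ?_, π, hπ.maximalIdeal_eq, ⟨w, hw⟩, mt mem_centre.mp hwV, ⟨v, h.unit_mem⟩ ^ N, ?_,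
    Subtype.ext e⟩
  · obtain ⟨c, hc, hvc⟩ := h.exists_unit
    have : (⟨v, h.unit_mem⟩ - algebraMap O A c : A) ∈ RingHom.ker φ := hk ▸ mem_centre.mpr hvc
    rw [RingHom.mem_ker, map_sub, sub_eq_zero, hC] at this
    rw [this]
    exact (hc.map _).map _
  · obtain ⟨N, b, hb, e⟩ := h.exists_eq_mul a.2 (mem_centre.mp ha)
    exact ⟨N, ⟨b, hb⟩, Subtype.ext e⟩
  · rw [mem_centre, ValuationSubring.mem_nonunits_iff]
    push_cast
    rw [map_pow, h.valuation_unit, one_pow]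
    exact lt_irrefl _

/-- A prime contains the line if it contains `ϖ` and not `v`. -/
lemma mem_nonunits_of_mem (h : IsLineChart A V t ϖ v m) {W : ValuationSubring F}
    (hW : ∀ a ∈ A, a ∈ W) (hϖ : W.valuation ϖ < 1) (hv : W.valuation v = 1) {a : F} (ha : a ∈ A)
    (haV : a ∈ V.nonunits) : a ∈ W.nonunits := by
  obtain ⟨N, b, hb, e⟩ := h.exists_eq_mul ha haV
  have h3 := congrArg W.valuation e
  rw [map_mul, map_pow, hv, one_pow, one_mul, map_mul] at h3
  rw [ValuationSubring.mem_nonunits_iff, h3]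
  exact mul_lt_one_of_lt_of_le hϖ ((W.valuation_le_one_iff _).mpr (hW b hb))

/-- The intersection of two lines, one of which is given by the equation `ϖ' = 0`, where `ϖ'` is
`t ^ n` on the other line. -/
lemma exists_sup_eq (h : IsLineChart A V t ϖ v m) {V' : ValuationSubring F} {t' ϖ' : F} {m' : ℕ}
    (h' : IsLineChart A V' t' ϖ' 1 m') {n : ℕ} {ε : O} (hε : IsUnit ε)
    (he : ϖ' - algebraMap O F ε * t ^ n ∈ V.nonunits) (hV : ∀ a ∈ A, a ∈ V)
    (hV' : ∀ a ∈ A, a ∈ V') :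
    ∃ ψ : A →+* (ResidueField O)[X], Function.Surjective ψ ∧
      (centre A V hV).asIdeal ⊔ (centre A V' hV').asIdeal = (Ideal.span {X ^ n}).comap ψ := by
  obtain ⟨φ, hφ, hk, hG⟩ := h.exists_hom hV
  have e1 : φ ⟨ϖ', h'.mem⟩ = C (residue O ε) * X ^ n := by
    have h1 : (⟨ϖ', h'.mem⟩ - aeval (⟨t, h.coord_mem⟩ : A) (C ε * X ^ n : O[X])) ∈
        RingHom.ker φ := by
      rw [hk, mem_centre]
      simpa using he
    rw [RingHom.mem_ker, map_sub, sub_eq_zero, hG] at h1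
    simpa using h1
  -- The parametrisation of the first line maps the ideal of the second one to the ideal generated
  -- by the image of `ϖ'`.
  refine ⟨φ, hφ, le_antisymm (sup_le (fun a ha ↦ ?_) fun a ha ↦ ?_) fun a ha ↦ ?_⟩
  · rw [← hk, RingHom.mem_ker] at ha
    rw [Ideal.mem_comap, ha]
    exact Ideal.zero_mem _
  · obtain ⟨N, b, hb, e⟩ := h'.exists_eq_mul a.2 (mem_centre.mp ha)
    rw [one_pow, one_mul] at e
    have : a = ⟨ϖ', h'.mem⟩ * ⟨b, hb⟩ := Subtype.ext e
    rw [Ideal.mem_comap, Ideal.mem_span_singleton, this, map_mul, e1]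
    exact ⟨C (residue O ε) * φ ⟨b, hb⟩, by ring⟩
  · rw [Ideal.mem_comap, Ideal.mem_span_singleton] at ha
    obtain ⟨q, hq⟩ := ha
    have hu : IsUnit (residue O ε) := hε.map _
    obtain ⟨b, hb⟩ := hφ (C (residue O ε)⁻¹ * q)
    have h2 : a - ⟨ϖ', h'.mem⟩ * b ∈ RingHom.ker φ := by
      rw [RingHom.mem_ker, map_sub, map_mul, e1, hb, hq]
      have : C (residue O ε) * C (residue O ε)⁻¹ = 1 := by
        rw [← C_mul, mul_inv_cancel₀ hu.ne_zero, C_1]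
      linear_combination -X ^ n * q * this
    rw [hk] at h2
    rw [← sub_add_cancel a (⟨ϖ', h'.mem⟩ * b)]
    exact Ideal.add_mem _ (Ideal.mem_sup_left h2) (Ideal.mem_sup_right
      (Ideal.mul_mem_right _ _ (mem_centre.mpr h'.mem_nonunits)))

end IsLineChart

/-- Two centres are disjoint if functions which vanish on one of them each add up to a unit. -/
lemma centre_sup_centre_eq_top {V' : ValuationSubring F} (hV : ∀ a ∈ A, a ∈ V)
    (hV' : ∀ a ∈ A, a ∈ V') {a b : F} (ha : a ∈ A) (hb : b ∈ A) (haV : a ∈ V.nonunits)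
    (hbV : b ∈ V'.nonunits) {c : O} (hc : IsUnit c) (hab : a + b = algebraMap O F c) :
    (centre A V hV).asIdeal ⊔ (centre A V' hV').asIdeal = ⊤ := by
  refine Ideal.eq_top_of_isUnit_mem _ ?_ (hc.map (algebraMap O A))
  have : algebraMap O A c = ⟨a, ha⟩ + ⟨b, hb⟩ := Subtype.ext hab.symm
  rw [this]
  exact Ideal.add_mem _ (Ideal.mem_sup_left (mem_centre.mpr haV))
    (Ideal.mem_sup_right (mem_centre.mpr hbV))

end LineChart

/-! ### The function field of `y² = x³ - a x` -/

section Coordinates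

variable {K F : Type u} [Field K] [Field F] [Algebra K F] {a : K} {x y : F}

/-- The field `F` is the function field of the curve `y² = x³ - a x` over `K`. -/
structure IsFunctionField (a : K) (x y : F) : Prop where
  ne_zero : a ≠ 0
  two_ne_zero : (2 : K) ≠ 0
  transcendental : Transcendental K x
  equation : y ^ 2 = x ^ 3 - algebraMap K F a * x
  generate : ∀ L : Subfield F, (∀ c, algebraMap K F c ∈ L) → x ∈ L → y ∈ L → L = ⊤

namespace IsFunctionField

lemma x_ne_zero (h : IsFunctionField a x y) : x ≠ 0 := fun h0 ↦ h.transcendental (h0 ▸ isAlgebraic_zero)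

lemma aeval_ne_zero (h : IsFunctionField a x y) {D : K[X]} (hD : D ≠ 0) : aeval x D ≠ 0 :=
  fun h0 ↦ hD (transcendental_iff.mp h.transcendental D h0)

lemma aeval_cubic (h : IsFunctionField a x y) : aeval x (X ^ 3 - C a * X : K[X]) = y ^ 2 := by
  simp [h.equation]

lemma y_ne_zero (h : IsFunctionField a x y) : y ≠ 0 := by
  intro h0
  have h1 := h.aeval_cubic
  have h2 := norm_ne_zero a (P := 0) (Q := 1) (.inr one_ne_zero)
  refine h.aeval_ne_zero h2 ?_
  rw [h0] at h1
  rw [map_sub, map_mul, h1]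
  simp

lemma aeval_norm (h : IsFunctionField a x y) (P Q : K[X]) :
    (aeval x P + aeval x Q * y) * (aeval x P - aeval x Q * y) =
      aeval x (P ^ 2 - Q ^ 2 * (X ^ 3 - C a * X)) := by
  rw [map_sub, map_mul, h.aeval_cubic, map_pow, map_pow]; ring

/-- Every element of the function field is of the form `(P + Q y) / D` with polynomials `P`, `Q`,
`D` in `x`. -/
lemma exists_mul_aeval_eq (h : IsFunctionField a x y) (z : F) :
    ∃ P Q D : K[X], D ≠ 0 ∧ z * aeval x D = aeval x P + aeval x Q * y := by
  let L : Subfield F :=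
    { carrier := {z | ∃ P Q D : K[X], D ≠ 0 ∧ z * aeval x D = aeval x P + aeval x Q * y}
      mul_mem' := by
        rintro z z' ⟨P, Q, D, hD, e⟩ ⟨P', Q', D', hD', e'⟩
        refine ⟨P * P' + Q * Q' * (X ^ 3 - C a * X), P * Q' + Q * P', D * D', mul_ne_zero hD hD', ?_⟩
        rw [map_mul, map_add, map_mul, map_mul, map_mul, h.aeval_cubic, map_add, map_mul, map_mul]
        linear_combination (z' * aeval x D') * e + (aeval x P + aeval x Q * y) * e'
      one_mem' := ⟨1, 0, 1, one_ne_zero, by simp⟩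
      add_mem' := by
        rintro z z' ⟨P, Q, D, hD, e⟩ ⟨P', Q', D', hD', e'⟩
        refine ⟨P * D' + P' * D, Q * D' + Q' * D, D * D', mul_ne_zero hD hD', ?_⟩
        simp only [map_mul, map_add]
        linear_combination aeval x D' * e + aeval x D * e'
      zero_mem' := ⟨0, 0, 1, one_ne_zero, by simp⟩
      neg_mem' := by
        rintro z ⟨P, Q, D, hD, e⟩
        refine ⟨-P, -Q, D, hD, ?_⟩
        simp only [map_neg]
        linear_combination -e
      inv_mem' := by
        rintro z ⟨P, Q, D, hD, e⟩
        by_cases hz : z = 0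
        · exact ⟨0, 0, 1, one_ne_zero, by simp [hz]⟩
        have hPQ : P ≠ 0 ∨ Q ≠ 0 := by
          by_contra! h0
          rw [h0.1, h0.2, map_zero, zero_mul, add_zero] at e
          exact mul_ne_zero hz (h.aeval_ne_zero hD) e
        refine ⟨D * P, -D * Q, _, norm_ne_zero a hPQ, ?_⟩
        rw [← h.aeval_norm, ← e, map_mul, map_mul, map_neg]
        field_simp
        ring }
  have hL : L = ⊤ := h.generate L (fun c ↦ ⟨C c, 0, 1, one_ne_zero, by simp⟩)
    ⟨X, 0, 1, one_ne_zero, by simp⟩ ⟨0, 1, 1, one_ne_zero, by simp⟩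
  exact hL.ge (Subfield.mem_top z)

/-- Translation by the point `(0, 0)`. -/
lemma translate (h : IsFunctionField a x y) :
    IsFunctionField a (-algebraMap K F a / x) (algebraMap K F a * y / x ^ 2) := by
  have hx := h.x_ne_zero
  have ha : algebraMap K F a ≠ 0 := (_root_.map_ne_zero _).mpr h.ne_zero
  have hx' (L : Subfield F) (hL : ∀ c, algebraMap K F c ∈ L) (h1 : -algebraMap K F a / x ∈ L) :
      x ∈ L := by
    have : x = -algebraMap K F a / (-algebraMap K F a / x) := by field_simp
    rw [this]
    exact L.div_mem (L.neg_mem (hL a)) h1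
  refine ⟨h.ne_zero, h.two_ne_zero, fun h1 ↦ h.transcendental ?_, ?_, fun L hL h1 h2 ↦ ?_⟩
  · exact mem_algebraicClosure_iff.mp <| hx' (algebraicClosure K F).toSubfield
      (fun c ↦ mem_algebraicClosure_iff.mpr (isAlgebraic_algebraMap c))
      (mem_algebraicClosure_iff.mpr h1)
  · field_simp
    linear_combination h.equation
  · have hxL := hx' L hL h1
    refine h.generate L hL hxL ?_
    have : y = (algebraMap K F a * y / x ^ 2) * x ^ 2 / algebraMap K F a := by field_simp
    rw [this]
    exact L.div_mem (L.mul_mem h2 (L.pow_mem hxL 2)) (hL a)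

/-- An element over which `x` is algebraic is transcendental. -/
lemma transcendental_of_mem (h : IsFunctionField a x y) {z : F}
    (hz : ∀ L : Subfield F, (∀ c, algebraMap K F c ∈ L) → z ∈ L → x ∈ L) : Transcendental K z :=
  fun h1 ↦ h.transcendental
    (mem_algebraicClosure_iff.mp <| hz (algebraicClosure K F).toSubfield
      (fun c ↦ mem_algebraicClosure_iff.mpr (isAlgebraic_algebraMap c))
      (mem_algebraicClosure_iff.mpr h1))

end IsFunctionField

/-- The roots of monic polynomials over the algebraic closure of `K` in `F` belong to it. -/
lemma mem_algebraicClosure_of_aeval_eq_zero {z : F} {p : (algebraicClosure K F)[X]} (hp : p ≠ 0)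
    (hz : aeval z p = 0) : IsAlgebraic K z :=
  IsAlgebraic.restrictScalars K (⟨p, hp, hz⟩ : IsAlgebraic (algebraicClosure K F) z)

/-- The function `x` is algebraic over `y`, being a root of `X³ - a X - y²`. -/
lemma IsFunctionField.transcendental_y (h : IsFunctionField a x y) : Transcendental K y := by
  intro hy
  let y' : algebraicClosure K F := ⟨y, mem_algebraicClosure_iff.mpr hy⟩
  let p : (algebraicClosure K F)[X] := X ^ 3 - C (algebraMap K _ a) * X - C (y' ^ 2)
  have hp : p.natDegree = 3 := by simp only [p]; compute_degree!
  refine h.transcendental (mem_algebraicClosure_of_aeval_eq_zero (p := p)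
    (by rintro h0; rw [h0] at hp; simp at hp) ?_)
  simp only [p, map_sub, map_mul, map_pow, aeval_X, aeval_C]
  change x ^ 3 - algebraMap K F a * x - y ^ 2 = 0
  linear_combination -h.equation

/-- The function `x` is algebraic over `s = y / x`, being a root of `X² - s² X - a`. -/
lemma IsFunctionField.transcendental_slope (h : IsFunctionField a x y) : Transcendental K (y / x) := by
  intro hy
  have hx := h.x_ne_zero
  let y' : algebraicClosure K F := ⟨y / x, mem_algebraicClosure_iff.mpr hy⟩
  let p : (algebraicClosure K F)[X] := X ^ 2 - C (y' ^ 2) * X - C (algebraMap K _ a)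
  have hp : p.natDegree = 2 := by simp only [p]; compute_degree!
  refine h.transcendental (mem_algebraicClosure_of_aeval_eq_zero (p := p)
    (by rintro h0; rw [h0] at hp; simp at hp) ?_)
  simp only [p, map_sub, map_mul, map_pow, aeval_X, aeval_C]
  change x ^ 2 - (y / x) ^ 2 * x - algebraMap K F a = 0
  field_simp
  linear_combination -h.equation

variable {O : ValuationSubring K} [Algebra O F] [IsScalarTower O K F]

/-- A subring of the function field is regular at its points over the generic point of `O`,
if it contains the coordinates. -/
lemma IsFunctionField.isRegularLocalRing [IsDiscreteValuationRing O] (h : IsFunctionField a x y)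
    {A : Subalgebra O F} [IsNoetherianRing A] {π : O} (hπ : Irreducible π)
    (hx : x ∈ A) (hy : y ∈ A) (M : Ideal A) [M.IsPrime] (hM : algebraMap O A π ∉ M) (B : Type u) [CommRing B] [Algebra A B]
    [IsLocalization.AtPrime B M] : IsRegularLocalRing B := by
  have := IsLocalization.AtPrime.isLocalRing B M
  have := IsLocalization.isNoetherianRing M.primeCompl B inferInstance
  have := IsLocalization.isDomain_of_le_nonZeroDivisors B M.primeCompl_le_nonZeroDivisors
  have hu (m : M.primeCompl) : IsUnit (A.val.toRingHom m) :=
    (show (m : A).1 ≠ 0 from fun h0 ↦ m.2 (by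
      rw [show (m : A) = 0 from Subtype.ext h0]; exact M.zero_mem)).isUnit
  let φ : B →+* F := IsLocalization.lift (M := M.primeCompl) (g := A.val.toRingHom) hu
  have hφ (b : A) : φ (algebraMap A B b) = b := IsLocalization.lift_eq hu b
  have hφi : Function.Injective φ := by
    rw [IsLocalization.lift_injective_iff]
    intro b c
    rw [(IsLocalization.injective B M.primeCompl_le_nonZeroDivisors).eq_iff]
    exact Subtype.val_injective.eq_iff.symm
  have hdiv {z : F} {d : A} (hd : d ∉ M) (hz : (d : F) * z ∈ A) : ∃ b : B, φ b = z := by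
    have hd0 : (d : F) ≠ 0 := (hu ⟨d, hd⟩).ne_zero
    refine ⟨IsLocalization.mk' B (⟨_, hz⟩ : A) (⟨d, hd⟩ : M.primeCompl), ?_⟩
    exact (IsLocalization.lift_mk'_spec ..).mpr rfl
  have hπn (n : ℕ) : algebraMap O A π ^ n ∉ M := fun h1 ↦ hM (Ideal.IsPrime.mem_of_pow_mem ‹_› _ h1)
  obtain ⟨x', rfl⟩ : ∃ b, φ b = x := ⟨_, hφ ⟨x, hx⟩⟩
  obtain ⟨y', rfl⟩ : ∃ b, φ b = y := ⟨_, hφ ⟨y, hy⟩⟩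
  -- As `π` is invertible in `B`, the ring contains the field `K`.
  have hK (c : K) : ∃ b : B, φ b = algebraMap K F c := by
    obtain ⟨n, hn⟩ : ∃ n : ℕ, ∃ r : O, algebraMap O K r = algebraMap O K π ^ n * c := by
      rcases O.mem_or_inv_mem c with hc | hc
      · exact ⟨0, ⟨c, hc⟩, by rw [pow_zero, one_mul]; rfl⟩
      by_cases hc0 : c = 0
      · exact ⟨0, 0, by simp [hc0]⟩
      obtain ⟨n, e, he⟩ := IsDiscreteValuationRing.associated_pow_irreducible
        (x := (⟨c⁻¹, hc⟩ : O)) (fun h0 ↦ inv_ne_zero hc0 (congrArg Subtype.val h0)) hπ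
      refine ⟨n, e, ?_⟩
      rw [← map_pow, ← he, map_mul]
      change _ = c⁻¹ * _ * c
      field_simp
    obtain ⟨r, hr⟩ := hn
    refine hdiv (hπn n) ?_
    have := congrArg (algebraMap K F) hr
    rw [map_mul, map_pow, ← IsScalarTower.algebraMap_apply, ← IsScalarTower.algebraMap_apply] at this
    exact this ▸ A.algebraMap_mem r
  have hrange (c : K) : algebraMap K F c ∈ φ.range := hK c
  let e : B ≃+* φ.range := RingEquiv.ofBijective φ.rangeRestrict
    ⟨fun b c hbc ↦ hφi (congrArg Subtype.val hbc), φ.rangeRestrict_surjective⟩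
  let ι : K →+* B := e.symm.toRingHom.comp ((algebraMap K F).codRestrict φ.range hrange)
  let _ : Algebra K B := ι.toAlgebra
  have hι (c : K) : φ (algebraMap K B c) = algebraMap K F c :=
    congrArg Subtype.val (e.apply_symm_apply ⟨_, hrange c⟩)
  let φ' : B →ₐ[K] F := { φ with commutes' := hι }
  have hφ' (P : K[X]) (b : B) : φ (aeval b P) = aeval (φ b) P := (aeval_algHom_apply φ' b P).symm
  refine isRegularLocalRing_of_weierstrass (a := a) (x := x') (y := y') h.ne_zero h.two_ne_zero
    (hφi ?_) ?_ fun b ↦ ?_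
  · rw [map_pow, h.equation, map_sub, map_mul, map_pow, hι]
  · rw [transcendental_iff]
    intro P hP
    by_contra hP0
    exact h.aeval_ne_zero hP0 (by rw [← hφ', hP, map_zero])
  · obtain ⟨P, Q, D, hD, e⟩ := h.exists_mul_aeval_eq (φ b)
    refine ⟨P, Q, D, hD, hφi ?_⟩
    rw [map_mul, map_add, map_mul, hφ', hφ', hφ', e]

/-- The function field is the field of fractions of a subring which contains the coordinates. -/
lemma IsFunctionField.isFractionRing [IsDiscreteValuationRing O] (h : IsFunctionField a x y)
    {A : Subalgebra O F} (hx : x ∈ A) (hy : y ∈ A) : IsFractionRing A F := by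
  refine IsFractionRing.of_field A F fun z ↦ ?_
  let L := Subfield.closure (A : Set F)
  have hA {z : F} (hz : z ∈ A) : z ∈ L := Subfield.subset_closure hz
  have hO (r : O) : algebraMap O F r ∈ L := hA (A.algebraMap_mem r)
  have hL : L = ⊤ := h.generate L (fun c ↦ ?_) (hA hx) (hA hy)
  · have hz : z ∈ Subfield.closure (A : Set F) := hL.ge (Subfield.mem_top z)
    rw [Subfield.mem_closure_iff] at hz
    obtain ⟨b, hb, c, hc, rfl⟩ := hz
    have hcl : Subring.closure (A : Set F) ≤ A.toSubring := Subring.closure_le.mpr le_rfl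
    exact ⟨⟨b, hcl hb⟩, ⟨c, hcl hc⟩, rfl⟩
  · obtain ⟨r, s, hs, rfl⟩ := IsFractionRing.div_surjective (A := O) c
    rw [map_div₀, ← IsScalarTower.algebraMap_apply, ← IsScalarTower.algebraMap_apply]
    exact L.div_mem (hO r) (hO s)

end Coordinates

/-! ### Products of pencils -/

section Pencils

variable {R F : Type u} [CommRing R] [Field F] [Algebra R F] {ι : Type} [Fintype ι]
variable {f : ι → F}

variable (R) in
/-- The module of sections attached to the rational functions `f i`: it defines the closure of the
graph of the rational map to a product of projective lines with components `f i`. -/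
def pencilModule (f : ι → F) : Submodule R F := ∏ i, Submodule.span R {1, f i}

/-- The section which does not vanish where those `f i` with `ε i` and the inverses of the
others are regular. -/
def pencilSection (f : ι → F) (ε : ι → Bool) : F := ∏ i, if ε i then 1 else f i

/-- The one of `f i` and its inverse which is regular on the chart given by `ε`. -/
def pencilSide (f : ι → F) (ε : ι → Bool) (i : ι) : F := if ε i then f i else (f i)⁻¹

lemma fg_pencilModule : (pencilModule R f).FG := by
  classical
  rw [pencilModule]
  refine Finset.prod_induction _ Submodule.FG (fun _ _ ↦ Submodule.FG.mul)
    ?_ fun i _ ↦ Submodule.fg_span (Set.toFinite _)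
  rw [Submodule.one_eq_span]
  exact Submodule.fg_span_singleton 1

omit [Fintype ι] in
lemma prod_mem_prod_submodule (s : Finset ι) {M : ι → Submodule R F} {a : ι → F}
    (h : ∀ i ∈ s, a i ∈ M i) : ∏ i ∈ s, a i ∈ ∏ i ∈ s, M i := by
  classical
  induction s using Finset.induction_on with
  | empty => exact Submodule.one_le.mp le_rfl
  | insert i s hi hs =>
    rw [Finset.prod_insert hi, Finset.prod_insert hi]
    exact Submodule.mul_mem_mul (h i (Finset.mem_insert_self i s))
      (hs fun j hj ↦ h j (Finset.mem_insert_of_mem hj))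

lemma pencilSection_mem (ε : ι → Bool) : pencilSection f ε ∈ pencilModule R f := by
  refine prod_mem_prod_submodule _ fun i _ ↦ ?_
  split_ifs <;> exact Submodule.subset_span (by simp)

lemma pencilSection_ne_zero (hf : ∀ i, f i ≠ 0) (ε : ι → Bool) : pencilSection f ε ≠ 0 := by
  refine Finset.prod_ne_zero_iff.mpr fun i _ ↦ ?_
  split_ifs
  exacts [one_ne_zero, hf i]

/-- A chart of a product of pencils is generated by one side of each pencil. -/
lemma chart_pencilModule (hf : ∀ i, f i ≠ 0) (ε : ι → Bool) :
    chart (pencilModule R f) (pencilSection f ε) =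
      Algebra.adjoin R (Set.range (pencilSide f ε)) := by
  classical
  set B := Algebra.adjoin R (Set.range (pencilSide f ε)) with hB
  have hside (i : ι) : pencilSide f ε i ∈ B := Algebra.subset_adjoin ⟨i, rfl⟩
  refine le_antisymm (Algebra.adjoin_le ?_) (Algebra.adjoin_le ?_)
  -- A product of elements `r + r' f i` divided by the section is a polynomial in the sides.
  · have key (s : Finset ι) : ∀ a ∈ ∏ i ∈ s, Submodule.span R {1, f i},
        a / (∏ i ∈ s, if ε i then 1 else f i) ∈ B := by
      induction s using Finset.induction_on with
      | empty =>
        intro a ha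
        obtain ⟨r, rfl⟩ := Submodule.mem_one.mp ha
        rw [Finset.prod_empty, div_one]
        exact B.algebraMap_mem r
      | insert i s hi hs =>
        intro a ha
        rw [Finset.prod_insert hi] at ha ⊢
        induction ha using Submodule.mul_induction_on' with
        | mem_mul_mem b hb c hc =>
          rw [mul_div_mul_comm]
          refine B.mul_mem ?_ (hs c hc)
          obtain ⟨r, r', rfl⟩ := Submodule.mem_span_pair.mp hb
          have h1 := hside i
          have hfi := hf i
          rw [pencilSide] at h1
          rw [Algebra.smul_def, Algebra.smul_def, mul_one]
          split_ifs at h1 ⊢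
          · rw [div_one]
            exact B.add_mem (B.algebraMap_mem r) (B.mul_mem (B.algebraMap_mem r') h1)
          · rw [add_div, mul_div_cancel_right₀ _ hfi, div_eq_mul_inv]
            exact B.add_mem (B.mul_mem (B.algebraMap_mem r) h1) (B.algebraMap_mem r')
        | add b hb c hc h1 h2 =>
          rw [add_div]
          exact B.add_mem h1 h2
    rintro _ ⟨a, ha, rfl⟩
    exact key _ a ha
  -- The side number `i` is the quotient of two sections which differ only in the factor number
  -- `i`.
  · rintro _ ⟨i, rfl⟩
    have h1 : ∏ j, (if j = i then (if ε i then f i else 1) else (if ε j then 1 else f j)) ∈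
        pencilModule R f := by
      refine prod_mem_prod_submodule _ fun j _ ↦ ?_
      split_ifs with h <;> (try subst h) <;> exact Submodule.subset_span (by simp)
    have h2 := div_mem_chart (pencilSection f ε) h1
    have h3 : (∏ j, if j = i then (if ε i then f i else 1) else (if ε j then 1 else f j)) /
        pencilSection f ε = pencilSide f ε i := by
      rw [pencilSection, ← Finset.prod_div_distrib, Finset.prod_eq_single i, pencilSide, if_pos rfl]
      · split_ifs
        exacts [div_one _, one_div _]
      · intro j _ hj
        rw [if_neg hj, div_self]
        split_ifs
        exacts [one_ne_zero, hf j]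
      · simp
    rwa [h3] at h2

lemma forall_mem_chart_iff (hf : ∀ i, f i ≠ 0) (ε : ι → Bool) (V : ValuationSubring F)
    (hV : ∀ r : R, algebraMap R F r ∈ V) :
    (∀ a ∈ chart (pencilModule R f) (pencilSection f ε), a ∈ V) ↔ ∀ i, pencilSide f ε i ∈ V := by
  rw [chart_pencilModule hf]
  refine ⟨fun h i ↦ h _ (Algebra.subset_adjoin ⟨i, rfl⟩), fun h a ha ↦ ?_⟩
  induction ha using Algebra.adjoin_induction with
  | mem x hx => obtain ⟨i, rfl⟩ := hx; exact h i
  | algebraMap r => exact hV r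
  | add x y _ _ hx hy => exact V.add_mem _ _ hx hy
  | mul x y _ _ hx hy => exact V.mul_mem _ _ hx hy

/-- The side of a pencil which is given by `b` is regular along a divisor on which the valuation
of the function compares with `1` as given by `o`. -/
def IsCompatible (b : Bool) (o : Ordering) : Prop := if b then o ≠ .gt else o ≠ .lt

instance (b : Bool) (o : Ordering) : Decidable (IsCompatible b o) := by
  unfold IsCompatible; infer_instance

omit [Fintype ι] in
lemma pencilSide_mem_iff (ε : ι → Bool) (V : ValuationSubring F) {i : ι} (hf : f i ≠ 0) :
    pencilSide f ε i ∈ V ↔ IsCompatible (ε i) (cmp (V.valuation (f i)) 1) := by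
  rw [pencilSide, IsCompatible]
  split_ifs
  · rw [← V.valuation_le_one_iff, Ne, cmp_eq_gt_iff, not_lt]
  · rw [← V.valuation_le_one_iff, Ne, cmp_eq_lt_iff, not_lt, map_inv₀,
      inv_le_one₀ (zero_lt_iff.mpr ((_root_.map_ne_zero _).mpr hf))]

end Pencils

/-! ### Monomials -/

section Monomials

/-- The comparison of a monomial with one, if powers of the variables are powers of `ρ`. -/
lemma cmp_monomial {Γ : Type*} [LinearOrderedCommGroupWithZero Γ] {ρ X Y : Γ} (hρ0 : ρ ≠ 0)
    (hρ : ρ < 1) {N : ℕ} (hN : N ≠ 0) {α β : ℤ} (hX : X ^ N = ρ ^ α) (hY : Y ^ N = ρ ^ β)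
    (i j k : ℤ) : cmp (ρ ^ i * X ^ j * Y ^ k) 1 = cmp 0 (N * i + α * j + β * k) := by
  have hz (Z : Γ) (l : ℤ) : (Z ^ l) ^ N = (Z ^ N) ^ l := by
    rw [← zpow_natCast, ← zpow_mul, mul_comm, zpow_mul, zpow_natCast]
  -- The `N`-th power of the monomial is a power of `ρ`, and taking `N`-th powers preserves the
  -- order.
  have h1 : (ρ ^ i * X ^ j * Y ^ k) ^ N = ρ ^ (N * i + α * j + β * k) := by
    rw [mul_pow, mul_pow, hz, hz, hz, hX, hY, ← zpow_natCast, ← zpow_mul, ← zpow_mul, ← zpow_mul,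
      zpow_add₀ hρ0, zpow_add₀ hρ0]
  have hρ' := zero_lt_iff.mpr hρ0
  rcases lt_trichotomy 0 (N * i + α * j + β * k) with h | h | h
  · rw [(cmp_eq_lt_iff _ _).mpr h, cmp_eq_lt_iff, ← pow_lt_one_iff hN, h1]
    exact (zpow_lt_one_iff_right_of_lt_one₀ hρ' hρ).mpr h
  · rw [← h, zpow_zero] at h1
    rw [(cmp_eq_eq_iff _ _).mpr h, cmp_eq_eq_iff]
    exact le_antisymm (not_lt.mp (mt (one_lt_pow_iff hN).mpr h1.le.not_gt))
      (not_lt.mp (mt (pow_lt_one_iff hN).mpr h1.ge.not_gt))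
  · rw [(cmp_eq_gt_iff _ _).mpr h, cmp_eq_gt_iff, ← one_lt_pow_iff hN, h1]
    exact (one_lt_zpow_iff_right_of_lt_one₀ hρ' hρ).mpr h

variable {F : Type u} [Field F] {p x y : F}

/-- The monomial with exponents `e` in `p`, `x`, `y`. -/
def monom (p x y : F) (e : ℤ × ℤ × ℤ) : F := p ^ e.1 * x ^ e.2.1 * y ^ e.2.2

section

variable (hp : p ≠ 0) (hx : x ≠ 0) (hy : y ≠ 0)
include hp hx hy

lemma monom_ne_zero (e : ℤ × ℤ × ℤ) : monom p x y e ≠ 0 :=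
  mul_ne_zero (mul_ne_zero (zpow_ne_zero _ hp) (zpow_ne_zero _ hx)) (zpow_ne_zero _ hy)

lemma monom_add (e e' : ℤ × ℤ × ℤ) : monom p x y (e + e') = monom p x y e * monom p x y e' := by
  simp only [monom, Prod.fst_add, Prod.snd_add, zpow_add₀ hp, zpow_add₀ hx, zpow_add₀ hy]
  ring

omit hp hx hy in
lemma monom_zero : monom p x y 0 = 1 := by simp [monom]

omit hp hx hy in
lemma monom_smul (n : ℤ) (e : ℤ × ℤ × ℤ) : monom p x y (n • e) = monom p x y e ^ n := by
  simp only [monom, Prod.smul_fst, Prod.smul_snd, smul_eq_mul, mul_zpow, ← zpow_mul, mul_comm n]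

omit hp hx hy in
lemma monom_neg (e : ℤ × ℤ × ℤ) : monom p x y (-e) = (monom p x y e)⁻¹ := by
  have := monom_smul (p := p) (x := x) (y := y) (-1) e
  rwa [neg_one_smul, zpow_neg_one] at this

end

end Monomials

/-! ### Valuation rings and monomials -/

section Orders

variable {F : Type u} [Field F] {p x y : F} {V : ValuationSubring F}

lemma valuation_monom_eq_one {e₁ e₂ e₃ : ℤ × ℤ × ℤ} (hp : p ≠ 0) (hx : x ≠ 0) (hy : y ≠ 0)
    (h₁ : V.valuation (monom p x y e₁) = 1) (h₂ : V.valuation (monom p x y e₂) = 1) (a b : ℤ)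
    (he : e₃ = a • e₁ + b • e₂) : V.valuation (monom p x y e₃) = 1 := by
  rw [he, monom_add hp hx hy, monom_smul, monom_smul, map_mul, map_zpow₀, map_zpow₀, h₁, h₂, one_zpow,
    one_zpow, one_mul]

/-- In the valuation of `V`, the `N`-th powers of `x` and `y` agree with the `α`-th and the
`β`-th power of `p`, which is not a unit. -/
structure HasOrders (V : ValuationSubring F) (p x y : F) (N : ℕ) (α β : ℤ) : Prop where
  ne_zero : N ≠ 0
  p_ne_zero : p ≠ 0
  x_ne_zero : x ≠ 0
  y_ne_zero : y ≠ 0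
  lt_one : V.valuation p < 1
  x_eq_one : V.valuation (monom p x y (-α, N, 0)) = 1
  y_eq_one : V.valuation (monom p x y (-β, 0, N)) = 1

variable {N : ℕ} {α β : ℤ}

/-- The monomial with exponents `(i, j, k)` vanishes to order `i + (α j + β k) / N`, in multiples
of the order of `p`. -/
lemma HasOrders.cmp (h : HasOrders V p x y N α β) (e : ℤ × ℤ × ℤ) :
    cmp (V.valuation (monom p x y e)) 1 = cmp 0 (N * e.1 + α * e.2.1 + β * e.2.2) := by
  have hp := (_root_.map_ne_zero V.valuation).mpr h.p_ne_zero
  have hx := h.x_eq_one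
  have hy := h.y_eq_one
  simp only [monom, map_mul, map_zpow₀, zpow_zero, mul_one, zpow_neg, zpow_natCast, map_inv₀,
    map_pow] at hx hy
  rw [monom, map_mul, map_mul, map_zpow₀, map_zpow₀, map_zpow₀]
  refine cmp_monomial hp h.lt_one h.ne_zero ?_ ?_ _ _ _
  · exact ((inv_mul_eq_one₀ (zpow_ne_zero _ hp)).mp hx).symm
  · exact ((inv_mul_eq_one₀ (zpow_ne_zero _ hp)).mp hy).symm

lemma HasOrders.eq_one (h : HasOrders V p x y N α β) (e : ℤ × ℤ × ℤ)
    (he : N * e.1 + α * e.2.1 + β * e.2.2 = 0) : V.valuation (monom p x y e) = 1 := by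
  rw [← cmp_eq_eq_iff, h.cmp, he, cmp_self_eq_eq]

lemma HasOrders.mem_nonunits (h : HasOrders V p x y N α β) (e : ℤ × ℤ × ℤ)
    (he : 0 < N * e.1 + α * e.2.1 + β * e.2.2) : monom p x y e ∈ V.nonunits := by
  rw [ValuationSubring.mem_nonunits_iff, ← cmp_eq_lt_iff, h.cmp, cmp_eq_lt_iff]
  exact he

lemma HasOrders.notMem_nonunits (h : HasOrders V p x y N α β) (e : ℤ × ℤ × ℤ)
    (he : N * e.1 + α * e.2.1 + β * e.2.2 = 0) : monom p x y e ∉ V.nonunits := by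
  rw [ValuationSubring.mem_nonunits_iff, h.eq_one e he]
  exact lt_irrefl _

lemma HasOrders.mem (h : HasOrders V p x y N α β) (e : ℤ × ℤ × ℤ)
    (he : 0 ≤ N * e.1 + α * e.2.1 + β * e.2.2) : monom p x y e ∈ V := by
  rcases he.eq_or_lt with he | he
  · rw [← V.valuation_le_one_iff, h.eq_one e he.symm]
  · exact V.nonunits_subset (h.mem_nonunits e he)

end Orders

/-! ### The curve `y² = x³ - πᵏ u x` over a discrete valuation ring -/

section Equation

variable {K F : Type u} [Field K] [Field F] [Algebra K F] {O : ValuationSubring K} [Algebra O F]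
variable [IsScalarTower O K F]

/-- The field `F` is the function field of the curve `y² = x³ - πᵏ u x`, where `π` is a
uniformizer of `O` and `u` is a unit, and `2` is a unit. -/
structure IsCurve (k : ℕ) (π u : O) (x y : F) : Prop where
  irreducible : Irreducible π
  isUnit : IsUnit u
  isUnit_two : IsUnit (2 : O)
  isFunctionField : IsFunctionField (π ^ k * u : K) x y

variable {k : ℕ} {π u : O} {x y : F}

/-- The monomial with exponents `e` in `π`, `x`, `y`. -/
abbrev mon (π : O) (x y : F) (e : ℤ × ℤ × ℤ) : F := monom (algebraMap O F π) x y e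

/-- The first coordinate of the translate of `(x, y)` by the point `(0, 0)`. -/
def translateX (k : ℕ) (π u : O) (x : F) : F := -(algebraMap O F π ^ k * algebraMap O F u) / x

/-- The second coordinate of the translate of `(x, y)` by the point `(0, 0)`. -/
def translateY (k : ℕ) (π u : O) (x y : F) : F :=
  algebraMap O F π ^ k * algebraMap O F u * y / x ^ 2

omit [Algebra K F] [IsScalarTower O K F] in
lemma algebraMap_unit_ne_zero {r : O} (hr : IsUnit r) : algebraMap O F r ≠ 0 :=
  (hr.map (algebraMap O F)).ne_zero

omit [Algebra K F] [IsScalarTower O K F] in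
lemma mon_smul (n : ℤ) (e : ℤ × ℤ × ℤ) : mon π x y (n • e) = mon π x y e ^ n := monom_smul n e

omit [Algebra K F] [IsScalarTower O K F] in
lemma mon_pi : mon π x y (1, 0, 0) = algebraMap O F π := by simp [mon, monom]

namespace IsCurve

section
variable (h : IsCurve k π u x y)
include h

lemma p_ne_zero : algebraMap O F π ≠ 0 := by
  rw [IsScalarTower.algebraMap_apply O K F]
  exact (_root_.map_ne_zero _).mpr fun h0 ↦ h.irreducible.ne_zero (Subtype.ext h0)

omit [IsScalarTower O K F] in
lemma u_ne_zero : algebraMap O F u ≠ 0 := algebraMap_unit_ne_zero h.isUnit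
omit [IsScalarTower O K F] [Algebra O F] in
lemma x_ne_zero : x ≠ 0 := h.isFunctionField.x_ne_zero
omit [IsScalarTower O K F] [Algebra O F] in
lemma y_ne_zero : y ≠ 0 := h.isFunctionField.y_ne_zero

omit h in
lemma algebraMap_eq :
    algebraMap K F (π ^ k * u : K) = algebraMap O F π ^ k * algebraMap O F u := by
  rw [map_mul, map_pow, IsScalarTower.algebraMap_apply O K F, IsScalarTower.algebraMap_apply O K F]
  rfl

lemma equation : y ^ 2 = x ^ 3 - algebraMap O F π ^ k * algebraMap O F u * x := by
  rw [← algebraMap_eq, h.isFunctionField.equation]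

/-- Translation by the point `(0, 0)`. -/
lemma translate : IsCurve k π u (translateX k π u x)
    (translateY k π u x y) := by
  rw [translateX, translateY, ← algebraMap_eq]
  exact ⟨h.irreducible, h.isUnit, h.isUnit_two, h.isFunctionField.translate⟩

lemma monom_add (e e' : ℤ × ℤ × ℤ) : mon π x y (e + e') =
    mon π x y e * mon π x y e' :=
  EllipticFibre.monom_add h.p_ne_zero h.x_ne_zero h.y_ne_zero e e'

/-- The function `δ = y² / x³` is `1 - πᵏ u / x²`. -/
lemma delta_add : mon π x y (0, -3, 2) +
    algebraMap O F u * mon π x y (k, -2, 0) = 1 := by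
  have hx := h.x_ne_zero
  simp only [mon, monom, zpow_neg, zpow_natCast, zpow_ofNat]
  field_simp
  linear_combination h.equation

lemma delta_mem {A : Subalgebra O F} (hA : mon π x y (k, -2, 0) ∈ A) :
    mon π x y (0, -3, 2) ∈ A := by
  rw [eq_sub_of_add_eq h.delta_add]
  exact A.sub_mem A.one_mem (A.mul_mem (A.algebraMap_mem u) hA)

end

end IsCurve

/-- The effect of the translation on exponents of monomials. -/
def translateExp (k : ℕ) (e : ℤ × ℤ × ℤ) : ℤ × ℤ × ℤ :=
  (e.1 + k * e.2.1 + k * e.2.2, -e.2.1 - 2 * e.2.2, e.2.2)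

/-- Up to units of `O`, the translation maps monomials to monomials. -/
lemma IsCurve.monom_translate (h : IsCurve k π u x y) (e : ℤ × ℤ × ℤ) : ∃ c : O, IsUnit c ∧
    mon π (translateX k π u x)
      (translateY k π u x y) e =
    algebraMap O F c * mon π x y (translateExp k e) := by
  have hx := h.x_ne_zero
  have hp := h.p_ne_zero
  obtain ⟨u', hu'⟩ := h.isUnit
  refine ⟨((-u') ^ e.2.1 * u' ^ e.2.2 : Oˣ), Units.isUnit _, ?_⟩
  have h1 (v : Oˣ) (n : ℤ) : algebraMap O F (v ^ n : Oˣ) = algebraMap O F v ^ n := by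
    exact (congrArg Units.val (map_zpow (Units.map (algebraMap O F : O →* F)) v n)).trans
      (Units.val_zpow_eq_zpow_val _ _)
  rw [Units.val_mul, map_mul, h1, h1, mon, mon, monom, monom, translateExp, Units.val_neg, map_neg, hu',
    translateX, translateY]
  have e1 : -(algebraMap O F π ^ k * algebraMap O F u) / x =
    algebraMap O F π ^ (k : ℤ) * -algebraMap O F u * x ^ (-1 : ℤ) := by
    rw [zpow_natCast, zpow_neg_one]; ring
  have e2 : algebraMap O F π ^ k * algebraMap O F u * y / x ^ 2 =
    algebraMap O F π ^ (k : ℤ) * algebraMap O F u * y * x ^ (-2 : ℤ) := by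
    rw [zpow_natCast, zpow_neg, zpow_ofNat]; ring
  rw [e1, e2]
  simp only [mul_zpow, ← zpow_mul]
  rw [zpow_add₀ hp, zpow_add₀ hp, sub_eq_add_neg, zpow_add₀ hx]
  simp only [neg_mul, one_mul]
  ring

/-- Orders with respect to the translated coordinates determine those with respect to the original
ones. -/
lemma HasOrders.translate (h : IsCurve k π u x y) {V : ValuationSubring F}
    (hV : ∀ r : O, IsUnit r → V.valuation (algebraMap O F r) = 1) {N : ℕ} {α β : ℤ}
    (h' : HasOrders V (algebraMap O F π) (translateX k π u x)
      (translateY k π u x y) N α β) :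
    HasOrders V (algebraMap O F π) x y N (k * N - α) (k * N + β - 2 * α) := by
  have key (e : ℤ × ℤ × ℤ) : V.valuation (mon π x y (translateExp k e)) =
      V.valuation (mon π (translateX k π u x)
      (translateY k π u x y) e) := by
    obtain ⟨c, hc, e1⟩ := h.monom_translate e
    rw [e1, map_mul, hV c hc, one_mul]
  refine ⟨h'.ne_zero, h.p_ne_zero, h.x_ne_zero, h.y_ne_zero, h'.lt_one, ?_, ?_⟩
  · rw [show ((-(k * N - α), N, 0) : ℤ × ℤ × ℤ) = translateExp k (α, -N, 0) by
      simp [translateExp]; ring, key]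
    exact h'.eq_one _ (by ring)
  · rw [show ((-(k * N + β - 2 * α), 0, N) : ℤ × ℤ × ℤ) = translateExp k (2 * α - β, -2 * N, N) by
      simp [translateExp]; ring, key]
    exact h'.eq_one _ (by ring)

end Equation

/-! ### Rings generated by monomials -/

section MonomialRing

variable {K F : Type u} [Field K] [Field F] [Algebra K F] {O : ValuationSubring K} [Algebra O F]
variable [IsScalarTower O K F] {k : ℕ} {π u : O} {x y : F} {V : ValuationSubring F}

/-- The ring generated over `O` by the monomials with exponents in `L`. -/
def monAlg (π : O) (x y : F) (L : List (ℤ × ℤ × ℤ)) : Subalgebra O F :=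
  Algebra.adjoin O (mon π x y '' {e | e ∈ L})

omit [Algebra K F] [IsScalarTower O K F]

lemma mon_mem_monAlg {L : List (ℤ × ℤ × ℤ)} {e : ℤ × ℤ × ℤ} (he : e ∈ L) :
    mon π x y e ∈ monAlg π x y L :=
  Algebra.subset_adjoin ⟨e, he, rfl⟩

lemma monAlg_le {L : List (ℤ × ℤ × ℤ)} {A : Subalgebra O F} (h : ∀ e ∈ L, mon π x y e ∈ A) :
    monAlg π x y L ≤ A := by
  refine Algebra.adjoin_le ?_
  rintro _ ⟨e, he, rfl⟩
  exact h e he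

lemma forall_mem_monAlg {L : List (ℤ × ℤ × ℤ)} (hV : ∀ r : O, algebraMap O F r ∈ V)
    (h : ∀ e ∈ L, mon π x y e ∈ V) : ∀ a ∈ monAlg π x y L, a ∈ V := by
  intro a ha
  induction ha using Algebra.adjoin_induction with
  | mem x hx => obtain ⟨e, he, rfl⟩ := hx; exact h e he
  | algebraMap r => exact hV r
  | add x y _ _ hx hy => exact V.add_mem _ _ hx hy
  | mul x y _ _ hx hy => exact V.mul_mem _ _ hx hy

lemma monAlg_congr {L L' : List (ℤ × ℤ × ℤ)} (h : L ⊆ L') (h' : L' ⊆ L) :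
    monAlg π x y L = monAlg π x y L' :=
  le_antisymm (monAlg_le fun _ he ↦ mon_mem_monAlg (h he))
    (monAlg_le fun _ he ↦ mon_mem_monAlg (h' he))

variable [Algebra K F] [IsScalarTower O K F]

namespace IsCurve

variable (h : IsCurve k π u x y)
include h

/-- A ring which contains three monomials contains the products of their powers with powers of
`π`. -/
lemma mon_mem {A : Subalgebra O F} {e₁ e₂ e₃ e : ℤ × ℤ × ℤ} (h₁ : mon π x y e₁ ∈ A)
    (h₂ : mon π x y e₂ ∈ A) (h₃ : mon π x y e₃ ∈ A) (n a b c : ℕ)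
    (he : e = ((n : ℤ), (0 : ℤ), (0 : ℤ)) + (a : ℤ) • e₁ + (b : ℤ) • e₂ + (c : ℤ) • e₃) :
    mon π x y e ∈ A := by
  have h0 : mon π x y ((n : ℤ), (0 : ℤ), (0 : ℤ)) ∈ A := by
    simp only [mon, monom, zpow_natCast, zpow_zero, mul_one]
    exact A.pow_mem (A.algebraMap_mem π) n
  rw [he, h.monom_add, h.monom_add, h.monom_add, mon_smul, mon_smul, mon_smul, zpow_natCast, zpow_natCast, zpow_natCast]
  exact A.mul_mem (A.mul_mem (A.mul_mem h0 (A.pow_mem h₁ a)) (A.pow_mem h₂ b)) (A.pow_mem h₃ c)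

lemma monAlg_translate (L : List (ℤ × ℤ × ℤ)) :
    monAlg π (translateX k π u x) (translateY k π u x y) L =
      monAlg π x y (L.map (translateExp k)) := by
  refine le_antisymm (monAlg_le fun e he ↦ ?_) (monAlg_le fun e he ↦ ?_)
  · obtain ⟨c, hc, e1⟩ := h.monom_translate e
    rw [e1]
    exact Subalgebra.mul_mem _ (Subalgebra.algebraMap_mem _ c)
      (mon_mem_monAlg (List.mem_map.mpr ⟨e, he, rfl⟩))
  · obtain ⟨e, he', rfl⟩ := List.mem_map.mp he
    obtain ⟨c, hc, e1⟩ := h.monom_translate e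
    obtain ⟨d, hd⟩ := hc.exists_left_inv
    have : mon π x y (translateExp k e) = algebraMap O F d *
        mon π (translateX k π u x) (translateY k π u x y) e := by
      rw [e1, ← mul_assoc, ← map_mul, hd, map_one, one_mul]
    rw [this]
    exact Subalgebra.mul_mem _ (Subalgebra.algebraMap_mem _ d) (mon_mem_monAlg he')

omit h [Algebra K F] [IsScalarTower O K F] in
/-- The coordinate of a line is a polynomial in the coordinate. -/
lemma approx_self {A : Subalgebra O F} (t ϖ : F) :
    ∃ G : O[X], ∃ b ∈ A, t = aeval t G + ϖ * b :=
  ⟨X, 0, A.zero_mem, by simp⟩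

/-- A multiple of `ϖ` is congruent to the zero polynomial modulo `ϖ`. -/
lemma approx_mul {A : Subalgebra O F} {t : F} {e ϖ b : ℤ × ℤ × ℤ} (hb : mon π x y b ∈ A)
    (he : e = ϖ + b) : ∃ G : O[X], ∃ b ∈ A, mon π x y e = aeval t G + mon π x y ϖ * b :=
  ⟨0, _, hb, by rw [map_zero, zero_add, he, h.monom_add]⟩

/-- A criterion for the centre of `V` on a ring of monomials to be a line with coordinate `t` and
equation `ϖ`: the generators are polynomials in `t` modulo `ϖ`, and `π = w ϖᵐ`, where `w` is a
monomial of order zero along the line. The conditions on exponents are decidable. -/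
lemma isLineChart {L : List (ℤ × ℤ × ℤ)} {t ϖ w : ℤ × ℤ × ℤ} {m N : ℕ} {α β : ℤ}
    (ord : HasOrders V (algebraMap O F π) x y N α β)
    (trans : IsResTranscendental O V (mon π x y t))
    (hL : ∀ e ∈ L, 0 ≤ N * e.1 + α * e.2.1 + β * e.2.2)
    (ht : mon π x y t ∈ monAlg π x y L) (hϖ : mon π x y ϖ ∈ monAlg π x y L)
    (hϖ' : mon π x y ϖ ∈ V.nonunits)
    (approx : ∀ e ∈ L, ∃ G : O[X], ∃ b ∈ monAlg π x y L,
      mon π x y e = aeval (mon π x y t) G + mon π x y ϖ * b)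
    (hm : m ≠ 0) (hw : mon π x y w ∈ monAlg π x y L)
    (hw' : N * w.1 + α * w.2.1 + β * w.2.2 = 0) (hπ : (1, 0, 0) = w + (m : ℤ) • ϖ) :
    IsLineChart (monAlg π x y L) V (mon π x y t) (mon π x y ϖ) 1 m where
  le := forall_mem_monAlg trans.algebraMap_mem fun e he ↦ ord.mem e (hL e he)
  trans := trans
  coord_mem := ht
  mem := hϖ
  mem_nonunits := hϖ'
  unit_mem := Subalgebra.one_mem _
  exists_unit := ⟨1, isUnit_one, by simp⟩
  approx := by
    refine approx_of_adjoin rfl ht (Subalgebra.one_mem _) ?_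
    rintro _ ⟨e, he, rfl⟩
    obtain ⟨G, b, hb, e1⟩ := approx e he
    exact ⟨0, G, b, hb, by rw [e1]; ring⟩
  order := ⟨hm, π, h.irreducible, 0, _, hw, ord.notMem_nonunits w hw', by
    have := mon_pi (π := π) (x := x) (y := y)
    rw [hπ, h.monom_add, mon_smul, zpow_natCast] at this
    rw [pow_zero, one_mul, this]⟩

end IsCurve

end MonomialRing

/-! ### Orders of vanishing along the components -/

section Components

variable {K F : Type u} [Field K] [Field F] [Algebra K F] {O : ValuationSubring K} [Algebra O F]
variable [IsScalarTower O K F] {k : ℕ} {π u : O} {x y : F} {V : ValuationSubring F}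

namespace IsCurve

/-- The orders of `x` and `y` along a divisor are known if two independent monomials are units
there: powers of `x` and `y` are products of powers of these two and of `π`. -/
lemma hasOrders (h : IsCurve k π u x y) (hV : V.valuation (algebraMap O F π) < 1)
    {e₁ e₂ : ℤ × ℤ × ℤ} (h₁ : V.valuation (mon π x y e₁) = 1) (h₂ : V.valuation (mon π x y e₂) = 1)
    {N : ℕ} (hN : N ≠ 0) {α β : ℤ} (a b c d : ℤ) (hx : (-α, (N : ℤ), (0 : ℤ)) = a • e₁ + b • e₂)
    (hy : (-β, (0 : ℤ), (N : ℤ)) = c • e₁ + d • e₂) : HasOrders V (algebraMap O F π) x y N α β :=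
  ⟨hN, h.p_ne_zero, h.x_ne_zero, h.y_ne_zero, hV,
    valuation_monom_eq_one h.p_ne_zero h.x_ne_zero h.y_ne_zero h₁ h₂ a b hx,
    valuation_monom_eq_one h.p_ne_zero h.x_ne_zero h.y_ne_zero h₁ h₂ c d hy⟩

/-- Where `τ = πᵏ / x²` vanishes, `δ = y² / x³ = 1 - u τ` is a unit. -/
lemma valuation_delta {θ : F} (h : IsCurve k π u x y) (hV : IsResTranscendental O V θ)
    (hτ : V.valuation (mon π x y (k, -2, 0)) < 1) : V.valuation (mon π x y (0, -3, 2)) = 1 := by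
  rw [eq_sub_of_add_eq h.delta_add]
  refine Valuation.map_one_sub_of_lt _ ?_
  rwa [map_mul, hV.valuation_algebraMap h.isUnit, one_mul]

omit [Algebra K F] [IsScalarTower O K F] in
/-- The value of a polynomial in an element with transcendental residue. -/
lemma _root_.EllipticFibre.IsResTranscendental.valuation_one_sub {θ : F}
    (hV : IsResTranscendental O V θ) (u : O) {n : ℕ} (hn : n ≠ 0) :
    V.valuation (1 - algebraMap O F u * θ ^ n) = 1 := by
  refine le_antisymm ((V.valuation_le_one_iff _).mpr (V.sub_mem V.one_mem
    (V.mul_mem _ _ (hV.algebraMap_mem u) (V.pow_mem hV.mem n)))) ?_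
  have h1 := hV.aeval_mem (1 - C u * X ^ n)
  rw [map_sub, map_one, map_mul, aeval_C, map_pow, aeval_X] at h1
  rw [← not_lt, ← ValuationSubring.mem_nonunits_iff, h1]
  intro h2
  have h3 := congrArg (Polynomial.eval 0) h2
  simp [hn] at h3

omit [IsScalarTower O K F] in
lemma valuation_pi {θ : F} (h : IsCurve k π u x y) (hV : IsResTranscendental O V θ) :
    V.valuation (algebraMap O F π) < 1 :=
  hV.valuation_algebraMap_lt_one h.irreducible

/-- Orders along the closure of the special fibre of the Weierstrass equation. -/
lemma hasOrders_coord (h : IsCurve k π u x y) (hk : k ≠ 0) (hV : IsResTranscendental O V x) :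
    HasOrders V (algebraMap O F π) x y 2 0 0 := by
  have hx : V.valuation (mon π x y (0, 1, 0)) = 1 := by
    simpa [mon, monom] using hV.valuation_eq_one
  refine h.hasOrders (h.valuation_pi hV) hx (h.valuation_delta hV ?_) two_ne_zero 2 0 3 1
    (by simp) (by simp)
  simp only [mon, monom, zpow_neg, zpow_natCast, zpow_ofNat, pow_zero, mul_one, map_mul, map_pow,
    map_inv₀, hV.valuation_eq_one, one_pow, inv_one]
  exact pow_lt_one₀ zero_le (h.valuation_pi hV) hk

variable (h : IsCurve 3 π u x y)
include h

/-- Orders along the component of multiplicity `2` next to the closure of the special fibre of the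
Weierstrass equation, with coordinate `x / π`. -/
lemma hasOrders_one_of_three (hV : IsResTranscendental O V (mon π x y (-1, 1, 0))) :
    HasOrders V (algebraMap O F π) x y 2 2 3 := by
  refine h.hasOrders (h.valuation_pi hV) hV.valuation_eq_one (h.valuation_delta hV ?_)
    two_ne_zero 2 0 3 1 (by simp) (by simp)
  have : mon π x y ((3 : ℕ), -2, 0) = algebraMap O F π * mon π x y (-1, 1, 0) ^ (-2 : ℤ) := by
    rw [← mon_pi (π := π) (x := x) (y := y), ← mon_smul, ← h.monom_add]
    rfl
  rw [this, map_mul, map_zpow₀, hV.valuation_eq_one, one_zpow, mul_one]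
  exact h.valuation_pi hV

/-- Orders along the component of multiplicity `3` with coordinate `g = y / π²`. -/
lemma hasOrders_two_of_three (hV : IsResTranscendental O V (mon π x y (-2, 0, 1))) :
    HasOrders V (algebraMap O F π) x y 3 4 6 := by
  have hp := h.p_ne_zero
  have hx := h.x_ne_zero
  set b := mon π x y (-1, 1, 0) with hb
  set g := mon π x y (-2, 0, 1) with hg
  have e1 : mon π x y (-4, 3, 0) = g ^ 2 + algebraMap O F u * b := by
    simp only [hb, hg, mon, monom, zpow_neg, zpow_ofNat]
    field_simp
    linear_combination -h.equation
  have e2 : b ^ 3 = algebraMap O F π * (g ^ 2 + algebraMap O F u * b) := by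
    rw [← e1, ← mon_pi (π := π) (x := x) (y := y), ← h.monom_add, ← zpow_natCast, hb, ← mon_smul]
    rfl
  have hπ := h.valuation_pi hV
  have hub : V.valuation (algebraMap O F u * b) = V.valuation b := by
    rw [map_mul, hV.valuation_algebraMap h.isUnit, one_mul]
  have hg1 : V.valuation (g ^ 2) = 1 := by rw [map_pow, hV.valuation_eq_one, one_pow]
  -- The relation `b³ = π (g² + u b)` for `b = x / π` is impossible if `b` is not in the maximal
  -- ideal. So `b` vanishes, and `b³ / π` is a unit.
  have hb1 : V.valuation b < 1 := by
    by_contra! h1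
    have h2 : V.valuation (g ^ 2 + algebraMap O F u * b) ≤ V.valuation b :=
      (V.valuation.map_add _ _).trans (max_le (hg1.trans_le h1) hub.le)
    have h3 : V.valuation (b ^ 3) < V.valuation b := by
      rw [e2, map_mul]
      exact (mul_le_mul_of_nonneg_left h2 zero_le).trans_lt
        (mul_lt_of_lt_one_left (zero_lt_one.trans_le h1) hπ)
    rw [map_pow] at h3
    exact h3.not_ge (le_self_pow₀ h1 three_ne_zero)
  refine h.hasOrders hπ hV.valuation_eq_one (e₂ := (-4, 3, 0)) ?_ three_ne_zero 0 1 3 0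
    (by simp) (by simp)
  rw [e1, Valuation.map_add_eq_of_lt_left _ (by rw [hub, hg1]; exact hb1), hg1]

/-- Orders along the component of multiplicity `4` with coordinate `τ = π³ / x²`, on which `δ = 1
- u τ` does not vanish identically. -/
lemma hasOrders_three_of_three (hV : IsResTranscendental O V (mon π x y (3, -2, 0))) :
    HasOrders V (algebraMap O F π) x y 4 6 9 := by
  refine h.hasOrders (h.valuation_pi hV) hV.valuation_eq_one (e₂ := (0, -3, 2)) ?_
    four_ne_zero (-2) 0 (-3) 2 (by simp) (by simp)
  have := hV.valuation_one_sub u one_ne_zero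
  rw [pow_one] at this
  rw [eq_sub_of_add_eq h.delta_add]
  exact this

/-- Orders along the component outside the long chain, with coordinate `s = y / (π x)`. -/
lemma hasOrders_seven_of_three (hV : IsResTranscendental O V (mon π x y (-1, -1, 1))) :
    HasOrders V (algebraMap O F π) x y 2 3 5 := by
  have hp := h.p_ne_zero
  have hx := h.x_ne_zero
  set b := mon π x y (-1, 1, 0) with hb
  set s := mon π x y (-1, -1, 1) with hs
  have e1 : mon π x y (-3, 2, 0) = algebraMap O F u + b * s ^ 2 := by
    simp only [hb, hs, mon, monom, zpow_neg, zpow_ofNat]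
    field_simp
    linear_combination -h.equation
  have e2 : b ^ 2 = algebraMap O F π * (algebraMap O F u + b * s ^ 2) := by
    rw [← e1, ← mon_pi (π := π) (x := x) (y := y), ← h.monom_add, ← zpow_natCast, hb, ← mon_smul]
    rfl
  have hπ := h.valuation_pi hV
  have hu := hV.valuation_algebraMap h.isUnit
  have hbs : V.valuation (b * s ^ 2) = V.valuation b := by
    rw [map_mul, map_pow, hV.valuation_eq_one, one_pow, mul_one]
  -- The relation `b² = π (u + b s²)` for `b = x / π` is impossible if `b` is not in the maximal
  -- ideal. So `b` vanishes, and `b² / π` is a unit.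
  have hb1 : V.valuation b < 1 := by
    by_contra! h1
    have h2 : V.valuation (algebraMap O F u + b * s ^ 2) ≤ V.valuation b :=
      (V.valuation.map_add _ _).trans (max_le (hu.trans_le h1) hbs.le)
    have h3 : V.valuation (b ^ 2) < V.valuation b := by
      rw [e2, map_mul]
      exact (mul_le_mul_of_nonneg_left h2 zero_le).trans_lt
        (mul_lt_of_lt_one_left (zero_lt_one.trans_le h1) hπ)
    rw [map_pow] at h3
    exact h3.not_ge (le_self_pow₀ h1 two_ne_zero)
  refine h.hasOrders hπ hV.valuation_eq_one (e₂ := (-3, 2, 0)) ?_ two_ne_zero 0 1 2 1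
    (by simp) (by simp)
  rw [e1, Valuation.map_add_eq_of_lt_left _ (by rw [hbs, hu]; exact hb1), hu]

end IsCurve

end Components

/-! ### The charts of a fibre of type `III*` -/

lemma forall_mem_pair {α : Type*} {p : α → Prop} {a b : α} (ha : p a) (hb : p b) :
    ∀ e ∈ [a, b], p e := by simp [ha, hb]

lemma forall_mem_triple {α : Type*} {p : α → Prop} {a b c : α} (ha : p a) (hb : p b) (hc : p c) :
    ∀ e ∈ [a, b, c], p e := by simp [ha, hb, hc]

section Charts

variable {K F : Type u} [Field K] [Field F] [Algebra K F] {O : ValuationSubring K} [Algebra O F]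
variable [IsScalarTower O K F] {k : ℕ} {π u : O} {x y : F} {V W : ValuationSubring F}

omit [Algebra K F] [IsScalarTower O K F] in
lemma IsResTranscendental.inv {t : F} (h : IsResTranscendental O V t) :
    IsResTranscendental O V t⁻¹ := by
  have ht := h.valuation_eq_one
  refine h.of_relation (G := 1) (H := X) ?_ ?_ ?_
  · rw [← V.valuation_le_one_iff, map_inv₀, ht, inv_one]
  · rw [aeval_X, ValuationSubring.mem_nonunits_iff, map_inv₀, ht, inv_one]
    exact lt_irrefl _
  · have ht0 : t ≠ 0 := by rintro rfl; simp at ht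
    rw [aeval_X, map_one, mul_inv_cancel₀ ht0, sub_self, ValuationSubring.mem_nonunits_iff, map_zero]
    exact zero_lt_one

namespace IsCurve

section
variable (h : IsCurve k π u x y)
include h

/-- If `π` is a product of powers of three monomials which are integral in `W`, then one of them
is in the maximal ideal, as `π` is. Applied to the equations of the components, this says that a
point of the special fibre lies on one of them. -/
lemma exists_valuation_lt_one (hπ : W.valuation (algebraMap O F π) < 1) {e₁ e₂ e₃ : ℤ × ℤ × ℤ}
    (h₁ : mon π x y e₁ ∈ W) (h₂ : mon π x y e₂ ∈ W) (h₃ : mon π x y e₃ ∈ W) (a b c : ℤ)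
    (he : (1, 0, 0) = a • e₁ + b • e₂ + c • e₃) :
    W.valuation (mon π x y e₁) < 1 ∨ W.valuation (mon π x y e₂) < 1 ∨
      W.valuation (mon π x y e₃) < 1 := by
  rw [← W.valuation_le_one_iff] at h₁ h₂ h₃
  by_contra! h0
  refine hπ.ne ?_
  rw [← mon_pi (π := π) (x := x) (y := y), he, h.monom_add, h.monom_add, mon_smul, mon_smul, mon_smul,
    map_mul, map_mul, map_zpow₀, map_zpow₀, map_zpow₀, h₁.antisymm h0.1, h₂.antisymm h0.2.1,
    h₃.antisymm h0.2.2]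
  simp

omit h [Algebra K F] [IsScalarTower O K F] in
lemma valuation_eq_one_of_mem {e : ℤ × ℤ × ℤ} (he : mon π x y e ∈ W) (he' : mon π x y (-e) ∈ W)
    (h0 : mon π x y e ≠ 0) : W.valuation (mon π x y e) = 1 := by
  rw [← W.valuation_le_one_iff] at he he'
  rw [mon, monom_neg, map_inv₀, inv_le_one₀ (zero_lt_iff.mpr ((_root_.map_ne_zero _).mpr h0))] at he'
  exact he.antisymm he'

lemma mon_ne_zero (e : ℤ × ℤ × ℤ) : mon π x y e ≠ 0 :=
  monom_ne_zero h.p_ne_zero h.x_ne_zero h.y_ne_zero e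

/-- The function `δ⁻¹ = x³ / y²` is `1 + πᵏ u x / y²`. -/
lemma inv_delta_eq : mon π x y (0, 3, -2) = 1 + algebraMap O F u * mon π x y (k, 1, -2) := by
  have hx := h.x_ne_zero
  have hy := h.y_ne_zero
  simp only [mon, monom, zpow_neg, zpow_natCast, zpow_ofNat]
  field_simp
  linear_combination -h.equation

lemma inv_delta_mem {A : Subalgebra O F} (hA : mon π x y (k, 1, -2) ∈ A) :
    mon π x y (0, 3, -2) ∈ A := by
  rw [h.inv_delta_eq]
  exact A.add_mem A.one_mem (A.mul_mem (A.algebraMap_mem u) hA)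

omit h [Algebra K F] [IsScalarTower O K F] in
/-- If `θ tⁿ` is a polynomial in the monomial `t` up to a multiple of a monomial which vanishes,
then the residue of `t` is transcendental with that of `θ`. -/
lemma isResTranscendental_of_sub {t e : ℤ × ℤ × ℤ} {N : ℕ} {α β : ℤ} {θ c : F}
    (hV : IsResTranscendental O V θ)
    (ord : HasOrders V (algebraMap O F π) x y N α β) (ht : N * t.1 + α * t.2.1 + β * t.2.2 = 0)
    (he : 0 < N * e.1 + α * e.2.1 + β * e.2.2) (hc : c ∈ V) {G : O[X]} (n : ℕ)
    (hG : θ * mon π x y t ^ n - aeval (mon π x y t) G = c * mon π x y e) :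
    IsResTranscendental O V (mon π x y t) := by
  refine hV.of_relation (G := G) (H := X ^ n) (ord.mem t ht.ge) ?_ ?_
  · rw [map_pow, aeval_X, ValuationSubring.mem_nonunits_iff, map_pow, ord.eq_one t ht, one_pow]
    exact lt_irrefl _
  · rw [map_pow, aeval_X, hG, ValuationSubring.mem_nonunits_iff, map_mul]
    exact (mul_le_of_le_one_left zero_le ((V.valuation_le_one_iff _).mpr hc)).trans_lt
      (V.mem_nonunits_iff.mp (ord.mem_nonunits e he))

end

section Infinity

/-- Exponents of generators of the chart around the point at infinity. -/
abbrev infinityChart : List (ℤ × ℤ × ℤ) := [(0, 1, -1), (0, -1, 0)]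

variable (h : IsCurve (k + 1) π u x y)
include h

/-- Modulo `π` the equation is `y² = x³`, a cuspidal cubic, which near infinity is a line with
coordinate `x / y`, where `1 / x` is the square of the coordinate. -/
lemma isLineChart_infinity (hV : IsResTranscendental O V x) :
    IsLineChart (monAlg π x y infinityChart) V (mon π x y (0, 1, -1))
      (mon π x y (1, 0, 0)) 1 1 := by
  have ord := h.hasOrders_coord (Nat.succ_ne_zero k) hV
  have hx := h.x_ne_zero
  have hy := h.y_ne_zero
  have trans : IsResTranscendental O V (mon π x y (0, 1, -1)) := by
    refine isResTranscendental_of_sub hV ord (e := (k + 1, 1, -2)) (by simp) (by simp)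
      (hV.algebraMap_mem u) (G := 1) 2 ?_
    have := h.inv_delta_eq
    rw [map_one, sub_eq_iff_eq_add, add_comm]
    push_cast at this
    rw [← this]
    simp only [mon, monom, zpow_neg, zpow_ofNat]
    field_simp
  have hz : mon π x y (0, 1, -1) ∈ monAlg π x y infinityChart := mon_mem_monAlg (by simp)
  have hq : mon π x y (0, -1, 0) ∈ monAlg π x y infinityChart := mon_mem_monAlg (by simp)
  have hπ : mon π x y (1, 0, 0) ∈ monAlg π x y infinityChart := by
    rw [mon_pi]; exact Subalgebra.algebraMap_mem _ π
  refine h.isLineChart ord trans (by simp) hz hπ (ord.mem_nonunits _ (by simp))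
    (forall_mem_pair (approx_self _ _) ⟨X ^ 2, -(algebraMap O F u * mon π x y (k, 0, -2)), ?_, ?_⟩)
    one_ne_zero (w := 0) ?_ (by simp) (by simp)
  · exact Subalgebra.neg_mem _ (Subalgebra.mul_mem _ (Subalgebra.algebraMap_mem _ u)
      (h.mon_mem hz hq hq k 2 2 0 (by simp)))
  · have := h.equation
    simp only [mon, monom, zpow_neg, zpow_ofNat, zpow_natCast, map_pow, aeval_X]
    field_simp
    rw [this]
    ring
  · rw [mon, monom_zero]; exact Subalgebra.one_mem _

lemma isResTranscendental_slope (hV : IsResTranscendental O V x) :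
    IsResTranscendental O V (mon π x y (0, -1, 1)) := by
  have := (h.isLineChart_infinity hV).trans.inv
  rwa [mon, ← monom_neg] at this

end Infinity

section ThreeStar

/-- Exponents of generators of the chart around the intersection of the components of
multiplicities `1` and `2` at the ends of the long chain of a fibre of type `III*`. -/
abbrev chartA : List (ℤ × ℤ × ℤ) := [(0, -1, 1), (1, -1, 0), (1, 1, -1)]

/-- Exponents of generators of the chart around the intersection of the components of
multiplicities `2` and `3` of a fibre of type `III*`. -/
abbrev chartB : List (ℤ × ℤ × ℤ) := [(-1, 1, 0), (2, 0, -1), (3, -2, 0)]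

/-- Exponents of generators of the chart around the intersections of the components of
multiplicities `3` and `4`, and of the latter with the component outside the long chain. -/
abbrev chartC : List (ℤ × ℤ × ℤ) := [(3, -2, 0), (-2, 3, -1)]

/-- Exponents of generators of a chart which meets only the component outside the long chain of
a fibre of type `III*`. -/
abbrev chartD : List (ℤ × ℤ × ℤ) := [(-1, 1, 0), (-1, -1, 1), (3, -2, 0)]

variable (h : IsCurve 3 π u x y)
include h

lemma delta_mem_chartA : mon π x y (0, 3, -2) ∈ monAlg π x y chartA ∧
    mon π x y (0, -3, 2) ∈ monAlg π x y chartA := by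
  have hr : mon π x y (0, -1, 1) ∈ monAlg π x y chartA := mon_mem_monAlg (by decide)
  have hp : mon π x y (1, -1, 0) ∈ monAlg π x y chartA := mon_mem_monAlg (by decide)
  have hκ : mon π x y (1, 1, -1) ∈ monAlg π x y chartA := mon_mem_monAlg (by decide)
  have hh := h.inv_delta_mem (h.mon_mem hr hp hκ 0 0 1 2 (by decide))
  exact ⟨hh, h.delta_mem (h.mon_mem hr hp hh 0 2 3 1 (by decide))⟩

lemma isLineChart_chartA_zero (hV : IsResTranscendental O V x) :
    IsLineChart (monAlg π x y chartA) V (mon π x y (0, -1, 1)) (mon π x y (1, -1, 0)) 1 1 := by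
  have ord := h.hasOrders_coord (by decide) hV
  have hr : mon π x y (0, -1, 1) ∈ monAlg π x y chartA := mon_mem_monAlg (by decide)
  have hp : mon π x y (1, -1, 0) ∈ monAlg π x y chartA := mon_mem_monAlg (by decide)
  have hh := h.delta_mem_chartA.1
  exact h.isLineChart ord (h.isResTranscendental_slope hV) (by decide) hr hp
    (ord.mem_nonunits _ (by decide)) (forall_mem_triple (approx_self _ _)
      (h.approx_mul (b := 0) (h.mon_mem hr hp hp 0 0 0 0 (by decide)) (by decide))
      (h.approx_mul (b := (0, 2, -1)) (h.mon_mem hr hh hp 0 1 1 0 (by decide)) (by decide)))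
    one_ne_zero (w := (0, 1, 0)) (h.mon_mem hr hh hp 0 2 1 0 (by decide)) (by decide) (by decide)

lemma isLineChart_chartA_one (hV : IsResTranscendental O V (mon π x y (-1, 1, 0))) :
    IsLineChart (monAlg π x y chartA) V (mon π x y (1, -1, 0)) (mon π x y (0, -1, 1)) 1 2 := by
  have ord := h.hasOrders_one_of_three hV
  have hr : mon π x y (0, -1, 1) ∈ monAlg π x y chartA := mon_mem_monAlg (by decide)
  have hp : mon π x y (1, -1, 0) ∈ monAlg π x y chartA := mon_mem_monAlg (by decide)
  have hh := h.delta_mem_chartA.1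
  have trans := hV.inv
  rw [mon, ← monom_neg] at trans
  exact h.isLineChart ord trans (by decide) hp hr
    (ord.mem_nonunits _ (by decide)) (forall_mem_triple
      (h.approx_mul (b := 0) (h.mon_mem hr hp hp 0 0 0 0 (by decide)) (by decide))
      (approx_self _ _)
      (h.approx_mul (b := (1, 2, -2)) (h.mon_mem hp hh hr 0 1 1 0 (by decide)) (by decide)))
    two_ne_zero (w := (1, 2, -2)) (h.mon_mem hp hh hr 0 1 1 0 (by decide)) (by decide) (by decide)

lemma exists_lt_one_chartA (hW : ∀ a ∈ monAlg π x y chartA, a ∈ W)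
    (hπ : W.valuation (algebraMap O F π) < 1) :
    W.valuation (mon π x y (1, -1, 0)) < 1 ∨ W.valuation (mon π x y (0, -1, 1)) < 1 := by
  obtain ⟨hh, hδ⟩ := h.delta_mem_chartA
  have h1 := valuation_eq_one_of_mem (hW _ hδ) (hW _ hh) (h.mon_ne_zero _)
  rcases h.exists_valuation_lt_one hπ (hW _ (mon_mem_monAlg (e := (1, -1, 0)) (by decide)))
    (hW _ (mon_mem_monAlg (e := (0, -1, 1)) (by decide))) (hW _ hδ) 1 2 (-1) (by decide) with h | h | h
  exacts [.inl h, .inr h, absurd h1 h.ne]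

lemma delta_mem_chartB : mon π x y (0, 3, -2) ∈ monAlg π x y chartB ∧
    mon π x y (0, -3, 2) ∈ monAlg π x y chartB := by
  have hb : mon π x y (-1, 1, 0) ∈ monAlg π x y chartB := mon_mem_monAlg (by decide)
  have hf : mon π x y (2, 0, -1) ∈ monAlg π x y chartB := mon_mem_monAlg (by decide)
  exact ⟨h.inv_delta_mem (h.mon_mem hb hf hf 0 1 2 0 (by decide)),
    h.delta_mem (mon_mem_monAlg (by decide))⟩

lemma isLineChart_chartB_one (hV : IsResTranscendental O V (mon π x y (-1, 1, 0))) :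
    IsLineChart (monAlg π x y chartB) V (mon π x y (-1, 1, 0)) (mon π x y (2, 0, -1)) 1 2 := by
  have ord := h.hasOrders_one_of_three hV
  have hb : mon π x y (-1, 1, 0) ∈ monAlg π x y chartB := mon_mem_monAlg (by decide)
  have hf : mon π x y (2, 0, -1) ∈ monAlg π x y chartB := mon_mem_monAlg (by decide)
  have hδ := h.delta_mem_chartB.2
  exact h.isLineChart ord hV (by decide) hb hf
    (ord.mem_nonunits _ (by decide)) (forall_mem_triple (approx_self _ _)
      (h.approx_mul (b := 0) (h.mon_mem hb hb hb 0 0 0 0 (by decide)) (by decide))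
      (h.approx_mul (b := (1, -2, 1)) (h.mon_mem hf hb hδ 0 1 1 1 (by decide)) (by decide)))
    two_ne_zero (w := (-3, 0, 2)) (h.mon_mem hb hδ hf 0 3 1 0 (by decide)) (by decide) (by decide)

lemma isLineChart_chartB_two (hV : IsResTranscendental O V (mon π x y (-2, 0, 1))) :
    IsLineChart (monAlg π x y chartB) V (mon π x y (2, 0, -1)) (mon π x y (-1, 1, 0)) 1 3 := by
  have ord := h.hasOrders_two_of_three hV
  have hb : mon π x y (-1, 1, 0) ∈ monAlg π x y chartB := mon_mem_monAlg (by decide)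
  have hf : mon π x y (2, 0, -1) ∈ monAlg π x y chartB := mon_mem_monAlg (by decide)
  have hδ := h.delta_mem_chartB.2
  have trans := hV.inv
  rw [mon, ← monom_neg] at trans
  exact h.isLineChart ord trans (by decide) hf hb
    (ord.mem_nonunits _ (by decide)) (forall_mem_triple
      (h.approx_mul (b := 0) (h.mon_mem hb hb hb 0 0 0 0 (by decide)) (by decide))
      (approx_self _ _)
      (h.approx_mul (b := (4, -3, 0)) (h.mon_mem hf hδ hb 0 2 1 0 (by decide)) (by decide)))
    three_ne_zero (w := (4, -3, 0)) (h.mon_mem hf hδ hb 0 2 1 0 (by decide)) (by decide) (by decide)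

lemma exists_lt_one_chartB (hW : ∀ a ∈ monAlg π x y chartB, a ∈ W)
    (hπ : W.valuation (algebraMap O F π) < 1) :
    W.valuation (mon π x y (2, 0, -1)) < 1 ∨ W.valuation (mon π x y (-1, 1, 0)) < 1 := by
  obtain ⟨hh, hδ⟩ := h.delta_mem_chartB
  have h1 := valuation_eq_one_of_mem (hW _ hδ) (hW _ hh) (h.mon_ne_zero _)
  rcases h.exists_valuation_lt_one hπ (hW _ (mon_mem_monAlg (e := (2, 0, -1)) (by decide)))
    (hW _ (mon_mem_monAlg (e := (-1, 1, 0)) (by decide))) (hW _ hδ) 2 3 1 (by decide) with h | h | h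
  exacts [.inl h, .inr h, absurd h1 h.ne]

lemma delta_mem_chartC : mon π x y (0, -3, 2) ∈ monAlg π x y chartC :=
  h.delta_mem (mon_mem_monAlg (by decide))

lemma isLineChart_chartC_two (hV : IsResTranscendental O V (mon π x y (-2, 0, 1))) :
    IsLineChart (monAlg π x y chartC) V (mon π x y (-2, 3, -1)) (mon π x y (3, -2, 0)) 1 3 := by
  have ord := h.hasOrders_two_of_three hV
  have hτ : mon π x y (3, -2, 0) ∈ monAlg π x y chartC := mon_mem_monAlg (by decide)
  have hω : mon π x y (-2, 3, -1) ∈ monAlg π x y chartC := mon_mem_monAlg (by decide)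
  have hδ := h.delta_mem_chartC
  refine h.isLineChart ord ?_ (by decide) hω hτ
    (ord.mem_nonunits _ (by decide)) (forall_mem_pair
      (h.approx_mul (b := 0) (h.mon_mem hτ hτ hτ 0 0 0 0 (by decide)) (by decide))
      (approx_self _ _))
    three_ne_zero (w := (-8, 6, 0)) (h.mon_mem hω hδ hτ 0 4 2 0 (by decide)) (by decide) (by decide)
  -- The function `ω` is `g + u κ`, where `κ` vanishes along the component.
  refine isResTranscendental_of_sub hV ord (e := (1, 1, -1)) (by decide) (by decide)
    (c := -algebraMap O F u) (V.neg_mem _ (hV.algebraMap_mem u)) (G := X) 0 ?_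
  have := h.equation
  have hx := h.x_ne_zero
  have hy := h.y_ne_zero
  have hp := h.p_ne_zero
  simp only [mon, monom, zpow_neg, zpow_ofNat, aeval_X]
  field_simp
  linear_combination this

lemma isLineChart_chartC_three (hV : IsResTranscendental O V (mon π x y (3, -2, 0))) :
    IsLineChart (monAlg π x y chartC) V (mon π x y (3, -2, 0)) (mon π x y (-2, 3, -1)) 1 4 := by
  have ord := h.hasOrders_three_of_three hV
  have hτ : mon π x y (3, -2, 0) ∈ monAlg π x y chartC := mon_mem_monAlg (by decide)
  have hω : mon π x y (-2, 3, -1) ∈ monAlg π x y chartC := mon_mem_monAlg (by decide)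
  have hδ := h.delta_mem_chartC
  exact h.isLineChart ord hV (by decide) hτ hω
    (ord.mem_nonunits _ (by decide)) (forall_mem_pair (approx_self _ _)
      (h.approx_mul (b := 0) (h.mon_mem hτ hτ hτ 0 0 0 0 (by decide)) (by decide)))
    four_ne_zero (w := (9, -12, 4)) (h.mon_mem hτ hδ hτ 0 3 2 0 (by decide)) (by decide) (by decide)

lemma isLineChart_chartC_seven (hV : IsResTranscendental O V (mon π x y (-1, -1, 1))) :
    IsLineChart (monAlg π x y chartC) V (mon π x y (-2, 3, -1)) (mon π x y (0, -3, 2)) 1 2 := by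
  have ord := h.hasOrders_seven_of_three hV
  have hτ : mon π x y (3, -2, 0) ∈ monAlg π x y chartC := mon_mem_monAlg (by decide)
  have hω : mon π x y (-2, 3, -1) ∈ monAlg π x y chartC := mon_mem_monAlg (by decide)
  have hδ := h.delta_mem_chartC
  obtain ⟨u', hu'⟩ := h.isUnit.exists_right_inv
  have huu' : algebraMap O F u * algebraMap O F u' = 1 := by rw [← map_mul, hu', map_one]
  have hx := h.x_ne_zero
  have hy := h.y_ne_zero
  have hp := h.p_ne_zero
  -- On this component `δ = 1 - u τ` vanishes, so that `τ` is the constant `u⁻¹`.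
  refine h.isLineChart ord ?_ (by decide) hω hδ
    (ord.mem_nonunits _ (by decide)) (forall_mem_pair
      ⟨C u', -algebraMap O F u', Subalgebra.neg_mem _ (Subalgebra.algebraMap_mem _ u'), ?_⟩
      (approx_self _ _))
    two_ne_zero (w := (1, 6, -4)) (h.mon_mem hτ hω hτ 0 3 4 0 (by decide)) (by decide) (by decide)
  -- As `ω s = x² / π³ = u + b s²` and `b` vanishes, `ω` is `u / s` on the component.
  · refine isResTranscendental_of_sub hV ord (e := (-3, -1, 2)) (by decide) (by decide)
      (c := 1) V.one_mem (G := C u) 1 ?_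
    have := h.equation
    simp only [mon, monom, zpow_neg, zpow_ofNat, aeval_C]
    field_simp
    linear_combination -this
  · have := h.delta_add
    rw [aeval_C]
    push_cast at this
    linear_combination -mon π x y (3, -2, 0) * huu' + algebraMap O F u' * this

lemma exists_lt_one_chartC (hW : ∀ a ∈ monAlg π x y chartC, a ∈ W)
    (hπ : W.valuation (algebraMap O F π) < 1) :
    W.valuation (mon π x y (3, -2, 0)) < 1 ∨ W.valuation (mon π x y (-2, 3, -1)) < 1 ∨
      W.valuation (mon π x y (0, -3, 2)) < 1 :=
  h.exists_valuation_lt_one hπ (hW _ (mon_mem_monAlg (by decide)))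
    (hW _ (mon_mem_monAlg (by decide))) (hW _ h.delta_mem_chartC) 3 4 2 (by decide)

/-- The function `τ⁻¹ = x² / π³` is `u + b s²`, where `b = x / π` and `s = y / (π x)`. -/
lemma inv_tau_eq : mon π x y (-3, 2, 0) = algebraMap O F u + mon π x y (-3, -1, 2) := by
  have := h.equation
  have hx := h.x_ne_zero
  have hp := h.p_ne_zero
  simp only [mon, monom, zpow_neg, zpow_ofNat]
  field_simp
  linear_combination -this

lemma inv_mem_chartD : mon π x y (-3, 2, 0) ∈ monAlg π x y chartD := by
  have hb : mon π x y (-1, 1, 0) ∈ monAlg π x y chartD := mon_mem_monAlg (by decide)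
  have hs : mon π x y (-1, -1, 1) ∈ monAlg π x y chartD := mon_mem_monAlg (by decide)
  rw [h.inv_tau_eq]
  exact Subalgebra.add_mem _ (Subalgebra.algebraMap_mem _ u)
    (h.mon_mem hb hs hs 0 1 2 0 (by decide))

lemma isLineChart_chartD_seven (hV : IsResTranscendental O V (mon π x y (-1, -1, 1))) :
    IsLineChart (monAlg π x y chartD) V (mon π x y (-1, -1, 1)) (mon π x y (-1, 1, 0)) 1 2 := by
  have ord := h.hasOrders_seven_of_three hV
  have hb : mon π x y (-1, 1, 0) ∈ monAlg π x y chartD := mon_mem_monAlg (by decide)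
  have hs : mon π x y (-1, -1, 1) ∈ monAlg π x y chartD := mon_mem_monAlg (by decide)
  have hτ : mon π x y (3, -2, 0) ∈ monAlg π x y chartD := mon_mem_monAlg (by decide)
  obtain ⟨u', hu'⟩ := h.isUnit.exists_right_inv
  have huu' : algebraMap O F u * algebraMap O F u' = 1 := by rw [← map_mul, hu', map_one]
  -- The function `τ` is the constant `u⁻¹` on the component, as `δ = 1 - u τ` is a multiple of
  -- `b`.
  refine h.isLineChart ord hV (by decide) hs hb
    (ord.mem_nonunits _ (by decide)) (forall_mem_triple
      (h.approx_mul (b := 0) (h.mon_mem hb hb hb 0 0 0 0 (by decide)) (by decide))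
      (approx_self _ _)
      ⟨C u', -algebraMap O F u' * mon π x y (1, -4, 2), Subalgebra.mul_mem _
        (Subalgebra.neg_mem _ (Subalgebra.algebraMap_mem _ u'))
        (h.mon_mem hs hτ hb 0 2 1 0 (by decide)), ?_⟩)
    two_ne_zero (w := (3, -2, 0)) hτ (by decide) (by decide)
  have := h.delta_add
  have e1 := h.monom_add (-1, 1, 0) (1, -4, 2)
  rw [show ((-1, 1, 0) + (1, -4, 2) : ℤ × ℤ × ℤ) = (0, -3, 2) by decide] at e1
  rw [aeval_C]
  push_cast at this
  linear_combination -mon π x y (3, -2, 0) * huu' + algebraMap O F u' * this - algebraMap O F u' * e1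

lemma lt_one_chartD (hW : ∀ a ∈ monAlg π x y chartD, a ∈ W)
    (hπ : W.valuation (algebraMap O F π) < 1) : W.valuation (mon π x y (-1, 1, 0)) < 1 := by
  have hτ : mon π x y (3, -2, 0) ∈ W := hW _ (mon_mem_monAlg (by decide))
  have h1 := valuation_eq_one_of_mem hτ (hW _ h.inv_mem_chartD) (h.mon_ne_zero _)
  rcases h.exists_valuation_lt_one hπ (hW _ (mon_mem_monAlg (e := (-1, 1, 0)) (by decide)))
    hτ hτ 2 1 0 (by decide) with h | h | h
  exacts [h, absurd h1 h.ne, absurd h1 h.ne]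

end ThreeStar

end IsCurve

end Charts

/-! ### The charts of a fibre of type `III` -/

section Charts

variable {K F : Type u} [Field K] [Field F] [Algebra K F] {O : ValuationSubring K} [Algebra O F]
variable [IsScalarTower O K F] {k : ℕ} {π u : O} {x y : F} {V W : ValuationSubring F}

omit [Algebra K F] [IsScalarTower O K F] in
lemma IsResTranscendental.of_mul {t : F} {c : O} (hc : IsUnit c)
    (h : IsResTranscendental O V (algebraMap O F c * t)) : IsResTranscendental O V t := by
  have h1 := h.valuation_eq_one
  rw [map_mul, h.valuation_algebraMap hc, one_mul] at h1
  refine h.of_relation (G := C c * X) (H := 1) ((V.valuation_le_one_iff _).mp h1.le) ?_ ?_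
  · rw [map_one, ValuationSubring.mem_nonunits_iff, map_one]
    exact lt_irrefl _
  · rw [map_one, map_mul, aeval_C, aeval_X, mul_one, sub_self, ValuationSubring.mem_nonunits_iff,
      map_zero]
    exact zero_lt_one

namespace IsCurve

/-- As monomials are permuted up to units by the translation, a monomial in the translated
coordinates has a transcendental residue together with the corresponding one in `x` and `y`. -/
lemma isResTranscendental_translate (h : IsCurve k π u x y) {e : ℤ × ℤ × ℤ} :
    IsResTranscendental O V (mon π (translateX k π u x) (translateY k π u x y) e) ↔
      IsResTranscendental O V (mon π x y (translateExp k e)) := by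
  obtain ⟨c, hc, e1⟩ := h.monom_translate e
  obtain ⟨d, hd⟩ := hc.exists_left_inv
  rw [e1]
  refine ⟨fun h ↦ h.of_mul hc, fun h ↦ .of_mul (.of_mul_eq_one c hd) ?_⟩
  rwa [← mul_assoc, ← map_mul, hd, map_one, one_mul]

section One

/-- Exponents of generators of the chart around the point where the components of a fibre of type
`III` meet. -/
abbrev tangencyChart : List (ℤ × ℤ × ℤ) := [(0, -1, 1), (1, -1, 0)]

variable (h : IsCurve 1 π u x y)
include h

/-- For `r = y / x` and `p = π / x` the equation reads `x = r² + u p`. -/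
lemma x_eq_add : mon π x y (0, 1, 0) =
    mon π x y (0, -1, 1) ^ 2 + algebraMap O F u * mon π x y (1, -1, 0) := by
  have := h.equation
  have hx := h.x_ne_zero
  simp only [mon, monom, zpow_neg, zpow_ofNat]
  field_simp
  linear_combination -this

lemma x_mem_tangencyChart : mon π x y (0, 1, 0) ∈ monAlg π x y tangencyChart := by
  rw [h.x_eq_add]
  exact Subalgebra.add_mem _ (Subalgebra.pow_mem _ (mon_mem_monAlg (by decide)) 2)
    (Subalgebra.mul_mem _ (Subalgebra.algebraMap_mem _ u) (mon_mem_monAlg (by decide)))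

lemma isLineChart_tangencyChart_zero (hV : IsResTranscendental O V x) :
    IsLineChart (monAlg π x y tangencyChart) V (mon π x y (0, -1, 1)) (mon π x y (1, -1, 0)) 1 1 := by
  have ord := h.hasOrders_coord one_ne_zero hV
  have hr : mon π x y (0, -1, 1) ∈ monAlg π x y tangencyChart := mon_mem_monAlg (by decide)
  have hp : mon π x y (1, -1, 0) ∈ monAlg π x y tangencyChart := mon_mem_monAlg (by decide)
  exact h.isLineChart ord (h.isResTranscendental_slope hV) (by decide) hr hp
    (ord.mem_nonunits _ (by decide)) (forall_mem_pair (approx_self _ _)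
      (h.approx_mul (b := 0) (h.mon_mem hr hp hp 0 0 0 0 (by decide)) (by decide)))
    one_ne_zero (w := (0, 1, 0)) h.x_mem_tangencyChart (by decide) (by decide)

lemma isLineChart_tangencyChart_one (hV : IsResTranscendental O V (translateX 1 π u x)) :
    IsLineChart (monAlg π x y tangencyChart) V (mon π x y (0, -1, 1)) (mon π x y (0, 1, 0)) 1 1 := by
  have ord : HasOrders V (algebraMap O F π) x y 2 2 2 := HasOrders.translate h
    (fun r hr ↦ hV.valuation_algebraMap hr) (h.translate.hasOrders_coord one_ne_zero hV)
  have trans := h.isResTranscendental_translate.mp (h.translate.isResTranscendental_slope hV)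
  rw [show translateExp 1 (0, -1, 1) = (0, -1, 1) by decide] at trans
  have hr : mon π x y (0, -1, 1) ∈ monAlg π x y tangencyChart := mon_mem_monAlg (by decide)
  have hp : mon π x y (1, -1, 0) ∈ monAlg π x y tangencyChart := mon_mem_monAlg (by decide)
  obtain ⟨u', hu'⟩ := h.isUnit.exists_right_inv
  have huu' : algebraMap O F u * algebraMap O F u' = 1 := by rw [← map_mul, hu', map_one]
  -- As `x = r² + u p`, the function `p = π / x` is `-u⁻¹ r²` where `x` vanishes.
  refine h.isLineChart ord trans (by decide) hr h.x_mem_tangencyChart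
    (ord.mem_nonunits _ (by decide)) (forall_mem_pair (approx_self _ _)
      ⟨-C u' * X ^ 2, algebraMap O F u', Subalgebra.algebraMap_mem _ u', ?_⟩)
    one_ne_zero (w := (1, -1, 0)) hp (by decide) (by decide)
  have := h.x_eq_add
  rw [map_mul, map_neg, aeval_C, map_pow, aeval_X]
  linear_combination -mon π x y (1, -1, 0) * huu' - algebraMap O F u' * this

lemma exists_lt_one_tangencyChart (hW : ∀ a ∈ monAlg π x y tangencyChart, a ∈ W)
    (hπ : W.valuation (algebraMap O F π) < 1) :
    W.valuation (mon π x y (1, -1, 0)) < 1 ∨ W.valuation (mon π x y (0, 1, 0)) < 1 := by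
  have hx := hW _ h.x_mem_tangencyChart
  rcases h.exists_valuation_lt_one hπ (hW _ (mon_mem_monAlg (e := (1, -1, 0)) (by decide))) hx hx
    1 1 0 (by decide) with h | h | h
  exacts [.inl h, .inr h, .inr h]

end One

/-! ### The charts of a fibre of type `I₀*` -/

section Two

/-- Exponents of generators of the chart around the intersections of the double component of a
fibre of type `I₀*` with three of the simple components. -/
abbrev doubleChart : List (ℤ × ℤ × ℤ) := [(1, -1, 0), (0, 2, -1)]

/-- Exponents of generators of a chart which meets two simple components of a fibre of type `I₀*`. -/
abbrev simpleChart : List (ℤ × ℤ × ℤ) := [(-1, -1, 1), (1, -1, 0)]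

variable (h : IsCurve 2 π u x y)
include h

lemma delta_mem_doubleChart : mon π x y (0, -3, 2) ∈ monAlg π x y doubleChart := by
  have hp : mon π x y (1, -1, 0) ∈ monAlg π x y doubleChart := mon_mem_monAlg (by decide)
  exact h.delta_mem (h.mon_mem hp hp hp 0 2 0 0 (by decide))

lemma isLineChart_doubleChart_zero (hV : IsResTranscendental O V x) :
    IsLineChart (monAlg π x y doubleChart) V (mon π x y (0, 2, -1)) (mon π x y (1, -1, 0)) 1 1 := by
  have ord := h.hasOrders_coord two_ne_zero hV
  have hp : mon π x y (1, -1, 0) ∈ monAlg π x y doubleChart := mon_mem_monAlg (by decide)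
  have hω : mon π x y (0, 2, -1) ∈ monAlg π x y doubleChart := mon_mem_monAlg (by decide)
  refine h.isLineChart ord ?_ (by decide) hω hp
    (ord.mem_nonunits _ (by decide)) (forall_mem_pair
      (h.approx_mul (b := 0) (h.mon_mem hp hp hp 0 0 0 0 (by decide)) (by decide))
      (approx_self _ _))
    one_ne_zero (w := (0, 1, 0)) (h.mon_mem hω h.delta_mem_doubleChart hp 0 2 1 0 (by decide))
    (by decide) (by decide)
  -- The square of `ω = x² / y` is `x / δ`, and `δ` is one on the component.
  refine isResTranscendental_of_sub hV ord (e := (2, 2, -2)) (by decide) (by decide)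
    (c := -algebraMap O F u) (V.neg_mem _ (hV.algebraMap_mem u)) (G := X ^ 2) 0 ?_
  have := h.equation
  have hy := h.y_ne_zero
  simp only [mon, monom, zpow_neg, zpow_ofNat, map_pow, aeval_X]
  field_simp
  linear_combination x * this

/-- Orders along the double component of a fibre of type `I₀*`, with coordinate `p = π / x`, on
which `δ = 1 - u p²` does not vanish identically. -/
lemma hasOrders_one_of_two (hV : IsResTranscendental O V (mon π x y (1, -1, 0))) :
    HasOrders V (algebraMap O F π) x y 2 2 3 := by
  refine h.hasOrders (h.valuation_pi hV) hV.valuation_eq_one (e₂ := (0, -3, 2)) ?_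
    two_ne_zero (-2) 0 (-3) 1 (by decide) (by decide)
  have := hV.valuation_one_sub u two_ne_zero
  rw [eq_sub_of_add_eq h.delta_add]
  rwa [← zpow_natCast, ← mon_smul] at this

lemma isLineChart_doubleChart_one (hV : IsResTranscendental O V (mon π x y (1, -1, 0))) :
    IsLineChart (monAlg π x y doubleChart) V (mon π x y (1, -1, 0)) (mon π x y (0, 2, -1)) 1 2 := by
  have ord := h.hasOrders_one_of_two hV
  have hp : mon π x y (1, -1, 0) ∈ monAlg π x y doubleChart := mon_mem_monAlg (by decide)
  have hω : mon π x y (0, 2, -1) ∈ monAlg π x y doubleChart := mon_mem_monAlg (by decide)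
  exact h.isLineChart ord hV (by decide) hp hω
    (ord.mem_nonunits _ (by decide)) (forall_mem_pair (approx_self _ _)
      (h.approx_mul (b := 0) (h.mon_mem hp hp hp 0 0 0 0 (by decide)) (by decide)))
    two_ne_zero (w := (1, -4, 2)) (h.mon_mem hp h.delta_mem_doubleChart hp 0 1 1 0 (by decide))
    (by decide) (by decide)

end Two

/-- The function `(1 - c π / x) / π`, which is a coordinate on the special fibre of the blowup of
the point `x = c π` of the `x`-line. -/
def branchCoord (π c : O) (x : F) : F :=
  (1 - algebraMap O F c * (algebraMap O F π / x)) / algebraMap O F π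

section Branch

variable {c d : O} (h : IsCurve 2 π u x y) (hc : IsUnit c) (hu : u = c ^ 2 + π * d)
variable (hV : IsResTranscendental O V (branchCoord π c x))
include h hc hu hV

omit hc hu hV in
lemma one_sub_eq : 1 - algebraMap O F c * mon π x y (1, -1, 0) =
    algebraMap O F π * branchCoord π c x := by
  have hp := h.p_ne_zero
  have hx := h.x_ne_zero
  simp only [branchCoord, mon, monom, zpow_neg, zpow_ofNat]
  field_simp

omit hc hu in
lemma one_sub_lt : V.valuation (1 - algebraMap O F c * mon π x y (1, -1, 0)) < 1 := by
  rw [h.one_sub_eq, map_mul, hV.valuation_eq_one, mul_one]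
  exact h.valuation_pi hV

omit hu in
lemma valuation_p_of_branch : V.valuation (mon π x y (1, -1, 0)) = 1 := by
  have h1 := Valuation.map_one_sub_of_lt _ (h.one_sub_lt hV)
  rwa [sub_sub_cancel, map_mul, hV.valuation_algebraMap hc, one_mul] at h1

/-- Along the component given by the root `p = 1 / c` of `1 - u p²` modulo `π`, the function `s =
y / (π x)` is a coordinate. -/
lemma isResTranscendental_of_branch : IsResTranscendental O V (mon π x y (-1, -1, 1)) := by
  have hp := h.p_ne_zero
  have hx := h.x_ne_zero
  have hp1 := h.valuation_p_of_branch hc hV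
  set p := mon π x y (1, -1, 0) with hpdef
  set s := mon π x y (-1, -1, 1) with hsdef
  set θ := branchCoord π c x with hθ
  have hO := hV.algebraMap_mem
  have hpV : p ∈ V := (V.valuation_le_one_iff _).mp hp1.le
  have hu' : algebraMap O F u = algebraMap O F c ^ 2 + algebraMap O F π * algebraMap O F d := by
    rw [hu, map_add, map_mul, map_pow]
  have e0 : 1 - algebraMap O F c * p = algebraMap O F π * θ := h.one_sub_eq
  -- Dividing the equation by `π x²`, and writing `u = c² + π d` and `1 - c p = π θ`.
  have e1 : s ^ 2 * p = θ * (1 + algebraMap O F c * p) - algebraMap O F d * p ^ 2 := by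
    have e2 : algebraMap O F π * (s ^ 2 * p) = 1 - algebraMap O F u * p ^ 2 := by
      have := h.equation
      simp only [hpdef, hsdef, mon, monom, zpow_neg, zpow_ofNat]
      field_simp
      linear_combination this
    apply mul_left_cancel₀ hp
    rw [e2]
    linear_combination (1 + algebraMap O F c * p) * e0 - p ^ 2 * hu'
  have hs : s ∈ V := by
    have e2 := congrArg V.valuation e1
    rw [map_mul, hp1, mul_one, map_pow] at e2
    rw [← V.valuation_le_one_iff, ← pow_le_one_iff two_ne_zero, e2, V.valuation_le_one_iff]
    exact V.sub_mem (V.mul_mem _ _ hV.mem (V.add_mem _ _ V.one_mem (V.mul_mem _ _ (hO c) hpV)))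
      (V.mul_mem _ _ (hO d) (V.pow_mem hpV 2))
  obtain ⟨c', hc'⟩ := hc.exists_right_inv
  have hcc' : algebraMap O F c * algebraMap O F c' = 1 := by rw [← map_mul, hc', map_one]
  -- As `c p` is one on the component, the residue of `θ` is a polynomial in that of `s` by the
  -- relation `2 c θ = s² + d / c`. Here it matters that `2` is a unit.
  refine hV.of_relation (G := X ^ 2 + C (d * c')) (H := C (2 * c)) hs ?_ ?_
  · rw [aeval_C, hV.algebraMap_mem_nonunits, mem_maximalIdeal, mem_nonunits_iff, not_not]
    exact h.isUnit_two.mul hc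
  · have e3 : θ * aeval s (C (2 * c)) - aeval s (X ^ 2 + C (d * c') : O[X]) =
        algebraMap O F π * (-θ * s ^ 2 + algebraMap O F c * θ ^ 2 +
          algebraMap O F d * algebraMap O F c' * (-2 * θ + algebraMap O F π * θ ^ 2)) := by
      have e4 : algebraMap O F c * p = 1 - algebraMap O F π * θ := by linear_combination -e0
      have e5 : p = algebraMap O F c' * (1 - algebraMap O F π * θ) := by
        linear_combination algebraMap O F c' * e4 - p * hcc'
      rw [map_add, map_pow, aeval_X, aeval_C, aeval_C, map_mul, map_mul, map_ofNat]
      linear_combination -algebraMap O F c * e1 + (s ^ 2 - algebraMap O F c * θ +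
        algebraMap O F d * p) * e4 + algebraMap O F d * (1 - algebraMap O F π * θ) * e5
    rw [e3, ValuationSubring.mem_nonunits_iff, map_mul]
    refine mul_lt_one_of_lt_of_le (h.valuation_pi hV) ((V.valuation_le_one_iff _).mpr ?_)
    have hπV := hO π
    have hθV := hV.mem
    have h2 : (2 : F) ∈ V := map_ofNat (algebraMap O F) 2 ▸ hO 2
    exact V.add_mem _ _ (V.add_mem _ _ (V.mul_mem _ _ (V.neg_mem _ hθV) (V.pow_mem hs 2))
      (V.mul_mem _ _ (hO c) (V.pow_mem hθV 2))) (V.mul_mem _ _ (V.mul_mem _ _ (hO d) (hO c'))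
      (V.add_mem _ _ (V.mul_mem _ _ (V.neg_mem _ h2) hθV) (V.mul_mem _ _ hπV (V.pow_mem hθV 2))))

/-- Orders along a simple component which meets the double component at a root of `1 - u p²`. -/
lemma hasOrders_of_branch : HasOrders V (algebraMap O F π) x y 1 1 2 :=
  h.hasOrders (h.valuation_pi hV) (h.valuation_p_of_branch hc hV)
    (h.isResTranscendental_of_branch hc hu hV).valuation_eq_one one_ne_zero (-1) 0 (-1) 1
    (by decide) (by decide)

/-- The function `δ = 1 - u p²` vanishes on two components, given by `c p = 1` and `c p = -1`
modulo `π`. Where `1 + c p` is invertible, it cuts out the first of them. -/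
lemma isLineChart_doubleChart_branch :
    IsLineChart (monAlg π x y doubleChart) V (mon π x y (0, 2, -1)) (mon π x y (0, -3, 2))
      (1 + algebraMap O F c * mon π x y (1, -1, 0)) 1 := by
  have ord := h.hasOrders_of_branch hc hu hV
  have hp : mon π x y (1, -1, 0) ∈ monAlg π x y doubleChart := mon_mem_monAlg (by decide)
  have hω : mon π x y (0, 2, -1) ∈ monAlg π x y doubleChart := mon_mem_monAlg (by decide)
  have hδ := h.delta_mem_doubleChart
  have hv := Subalgebra.add_mem _ (Subalgebra.one_mem _)
    (Subalgebra.mul_mem _ (Subalgebra.algebraMap_mem _ c) hp)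
  obtain ⟨c', hc'⟩ := hc.exists_right_inv
  have hcc' : algebraMap O F c * algebraMap O F c' = 1 := by rw [← map_mul, hc', map_one]
  have hu' : algebraMap O F u = algebraMap O F c ^ 2 + algebraMap O F π * algebraMap O F d := by
    rw [hu, map_add, map_mul, map_pow]
  have hxy := h.equation
  have hp0 := h.p_ne_zero
  have hx0 := h.x_ne_zero
  have hy0 := h.y_ne_zero
  exact
  { le := forall_mem_monAlg hV.algebraMap_mem fun e he ↦ ord.mem e
      ((show ∀ e ∈ doubleChart, 0 ≤ ((1 : ℕ) : ℤ) * e.1 + 1 * e.2.1 + 2 * e.2.2 by decide) e he)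
    -- The function `ω = x² / y` is `c / s` on the component, as `x / π` is the constant `c`
    -- there.
    trans := isResTranscendental_of_sub (h.isResTranscendental_of_branch hc hu hV) ord
      (e := (0, 1, 0)) (c := branchCoord π c x) (G := C c) (by decide) (by decide) hV.mem 1 (by
        simp only [mon, monom, zpow_neg, zpow_ofNat, aeval_C, branchCoord]
        field_simp)
    coord_mem := hω
    mem := hδ
    mem_nonunits := ord.mem_nonunits _ (by decide)
    unit_mem := hv
    exists_unit := ⟨2, h.isUnit_two, by
      have := h.one_sub_lt hV
      rw [map_ofNat, ValuationSubring.mem_nonunits_iff, ← Valuation.map_neg]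
      convert this using 2
      ring⟩
    approx := by
      refine approx_of_adjoin rfl hω hv ?_
      rintro _ ⟨e, he, rfl⟩
      revert e
      refine forall_mem_pair ⟨1, C c', -(algebraMap O F c' * (1 + algebraMap O F d * mon π x y (3, 1, -2))),
        Subalgebra.neg_mem _ (Subalgebra.mul_mem _ (Subalgebra.algebraMap_mem _ c')
          (Subalgebra.add_mem _ (Subalgebra.one_mem _) (Subalgebra.mul_mem _
          (Subalgebra.algebraMap_mem _ d) (h.mon_mem hp hω hp 0 3 2 0 (by decide))))), ?_⟩
        ⟨0, X, 0, Subalgebra.zero_mem _, by simp⟩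
      have e1 : (1 : F) - algebraMap O F c ^ 2 * mon π x y (1, -1, 0) ^ 2 =
          mon π x y (0, -3, 2) * (1 + algebraMap O F d * mon π x y (3, 1, -2)) := by
        rw [hu'] at hxy
        simp only [mon, monom, zpow_neg, zpow_ofNat]
        field_simp
        linear_combination -hxy
      rw [aeval_C, pow_one]
      linear_combination -algebraMap O F c' * e1 - (mon π x y (1, -1, 0) + algebraMap O F c *
        mon π x y (1, -1, 0) ^ 2) * hcc'
    order := ⟨one_ne_zero, π, h.irreducible, 0, _, h.mon_mem (e := (1, 3, -2)) hp hω hp 0 1 2 0 (by decide),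
      ord.notMem_nonunits _ (by decide), by
        rw [pow_zero, one_mul, pow_one, ← h.monom_add, ← mon_pi (x := x) (y := y)]
        rfl⟩ }

/-- The special fibre of the chart is the union of two lines, given by `c p = 1` and `c p = -1`
modulo `π`; the function `1 + c p` separates them. -/
lemma isLineChart_simpleChart :
    IsLineChart (monAlg π x y simpleChart) V (mon π x y (-1, -1, 1)) (mon π x y (1, 0, 0))
      (1 + algebraMap O F c * mon π x y (1, -1, 0)) 1 := by
  have ord := h.hasOrders_of_branch hc hu hV
  have hp : mon π x y (1, -1, 0) ∈ monAlg π x y simpleChart := mon_mem_monAlg (by decide)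
  have hs : mon π x y (-1, -1, 1) ∈ monAlg π x y simpleChart := mon_mem_monAlg (by decide)
  have hv := Subalgebra.add_mem _ (Subalgebra.one_mem _)
    (Subalgebra.mul_mem _ (Subalgebra.algebraMap_mem _ c) hp)
  obtain ⟨c', hc'⟩ := hc.exists_right_inv
  have hcc' : algebraMap O F c * algebraMap O F c' = 1 := by rw [← map_mul, hc', map_one]
  have hu' : algebraMap O F u = algebraMap O F c ^ 2 + algebraMap O F π * algebraMap O F d := by
    rw [hu, map_add, map_mul, map_pow]
  have hxy := h.equation
  have hp0 := h.p_ne_zero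
  have hx0 := h.x_ne_zero
  have hy0 := h.y_ne_zero
  exact
  { le := forall_mem_monAlg hV.algebraMap_mem fun e he ↦ ord.mem e
      ((show ∀ e ∈ simpleChart, 0 ≤ ((1 : ℕ) : ℤ) * e.1 + 1 * e.2.1 + 2 * e.2.2 by decide) e he)
    trans := h.isResTranscendental_of_branch hc hu hV
    coord_mem := hs
    mem := by rw [mon_pi]; exact Subalgebra.algebraMap_mem _ π
    mem_nonunits := ord.mem_nonunits _ (by decide)
    unit_mem := hv
    exists_unit := ⟨2, h.isUnit_two, by
      have := h.one_sub_lt hV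
      rw [map_ofNat, ValuationSubring.mem_nonunits_iff, ← Valuation.map_neg]
      convert this using 2
      ring⟩
    approx := by
      refine approx_of_adjoin rfl hs hv ?_
      rintro _ ⟨e, he, rfl⟩
      revert e
      refine forall_mem_pair ⟨0, X, 0, Subalgebra.zero_mem _, by simp⟩
        ⟨1, C c', -(algebraMap O F c' * (mon π x y (-1, -3, 2) + algebraMap O F d * mon π x y (2, -2, 0))),
        Subalgebra.neg_mem _ (Subalgebra.mul_mem _ (Subalgebra.algebraMap_mem _ c')
          (Subalgebra.add_mem _ (h.mon_mem hp hs hp 0 1 2 0 (by decide)) (Subalgebra.mul_mem _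
          (Subalgebra.algebraMap_mem _ d) (h.mon_mem hp hp hp 0 2 0 0 (by decide))))), ?_⟩
      have e1 : (1 : F) - algebraMap O F c ^ 2 * mon π x y (1, -1, 0) ^ 2 =
          mon π x y (1, 0, 0) * (mon π x y (-1, -3, 2) + algebraMap O F d * mon π x y (2, -2, 0)) := by
        rw [hu'] at hxy
        simp only [mon, monom, zpow_neg, zpow_ofNat]
        field_simp
        linear_combination -hxy
      rw [aeval_C, pow_one]
      linear_combination -algebraMap O F c' * e1 - (mon π x y (1, -1, 0) + algebraMap O F c *
        mon π x y (1, -1, 0) ^ 2) * hcc'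
    order := ⟨one_ne_zero, π, h.irreducible, 0, 1, Subalgebra.one_mem _, by
      rw [ValuationSubring.mem_nonunits_iff, map_one]
      exact lt_irrefl _, by
        rw [pow_zero, one_mul, pow_one, one_mul, mon_pi]⟩ }

end Branch

end IsCurve

end Charts

/-! ### Models defined by monomials -/

section PencilAtlas

variable {K F : Type u} [Field K] [Field F] [Algebra K F] {O : ValuationSubring K} [Algebra O F]
variable {π : O} {x y : F} {n m : ℕ}

/-- The exponents of the sides of the pencils with exponents `E` on the chart given by `ε`. -/
def sideExps (E : Fin n → ℤ × ℤ × ℤ) (ε : Fin n → Bool) : List (ℤ × ℤ × ℤ) :=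
  List.ofFn fun j ↦ if ε j then E j else -E j

omit [Algebra K F] in
/-- The charts of a product of pencils given by monomials are generated by monomials. -/
lemma chart_eq_monAlg (E : Fin n → ℤ × ℤ × ℤ) (hE : ∀ e, mon π x y e ≠ 0) (ε : Fin n → Bool) :
    chart (pencilModule O fun j ↦ mon π x y (E j)) (pencilSection (fun j ↦ mon π x y (E j)) ε) =
      monAlg π x y (sideExps E ε) := by
  rw [chart_pencilModule fun j ↦ hE (E j), monAlg]
  congr 1
  ext z
  simp only [Set.mem_range, Set.mem_image, Set.mem_ofPred_eq, sideExps, List.mem_ofFn]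
  constructor
  · rintro ⟨j, rfl⟩
    refine ⟨_, ⟨j, rfl⟩, ?_⟩
    rw [pencilSide]
    split_ifs
    exacts [rfl, monom_neg _]
  · rintro ⟨_, ⟨j, rfl⟩, rfl⟩
    refine ⟨j, ?_⟩
    rw [pencilSide]
    split_ifs
    exacts [rfl, (monom_neg _).symm]

/-- The divisor along which the monomials with exponents `(-α, N, 0)` and `(-β, 0, N)` are units
meets the chart given by `ε`. -/
def IsVisible (E : Fin n → ℤ × ℤ × ℤ) (ε : Fin n → Bool) (N : ℕ) (α β : ℤ) : Prop :=
  ∀ j, IsCompatible (ε j) (cmp 0 (N * (E j).1 + α * (E j).2.1 + β * (E j).2.2))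

instance (E : Fin n → ℤ × ℤ × ℤ) (ε : Fin n → Bool) (N : ℕ) (α β : ℤ) :
    Decidable (IsVisible E ε N α β) := by
  unfold IsVisible; infer_instance

omit [Algebra K F] in
/-- Whether a component meets a chart is decided by its orders. -/
lemma forall_mem_chart_iff_isVisible {V : ValuationSubring F} {N : ℕ} {α β : ℤ}
    (ord : HasOrders V (algebraMap O F π) x y N α β) (hV : ∀ r : O, algebraMap O F r ∈ V)
    (E : Fin n → ℤ × ℤ × ℤ) (ε : Fin n → Bool) :
    (∀ a ∈ chart (pencilModule O fun j ↦ mon π x y (E j))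
      (pencilSection (fun j ↦ mon π x y (E j)) ε), a ∈ V) ↔ IsVisible E ε N α β := by
  have h0 (e : ℤ × ℤ × ℤ) : mon π x y e ≠ 0 :=
    monom_ne_zero ord.p_ne_zero ord.x_ne_zero ord.y_ne_zero e
  rw [forall_mem_chart_iff (fun j ↦ h0 _) _ _ hV]
  refine forall_congr' fun j ↦ ?_
  rw [pencilSide_mem_iff (f := fun j ↦ mon π x y (E j)) ε V (h0 (E j)), ord.cmp]

/-- On `Spec A`, the centres of `V` and `V'` are lines which intersect in one point with
multiplicity `n`. -/
def MeetsAt (A : Subalgebra O F) (V V' : ValuationSubring F) (n : ℕ) : Prop :=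
  ∃ t ϖ v t' ϖ' : F, ∃ (m m' : ℕ) (ε : O), IsLineChart A V t ϖ v m ∧ IsLineChart A V' t' ϖ' 1 m' ∧
    IsUnit ε ∧ ϖ' - algebraMap O F ε * t ^ n ∈ V.nonunits

/-- The closure of the graph of the rational map to a product of projective lines, the components
of which are the monomials with exponents `E j`, is a regular model with special fibre `T`. The
index `c` runs over affine charts given by signs `ε c`, and the component `i` of the special fibre
is the centre of `V i`. -/
structure IsPencilAtlas (π : O) (x y : F) (E : Fin n → ℤ × ℤ × ℤ) (ε : Fin m → Fin n → Bool)
    (T : FibreConfiguration) (V : Fin T.n → ValuationSubring F) (N : Fin T.n → ℕ)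
    (α β : Fin T.n → ℤ) : Prop where
  irreducible : Irreducible π
  ne_zero : ∀ e, mon π x y e ≠ 0
  ord : ∀ i, HasOrders (V i) (algebraMap O F π) x y (N i) (α i) (β i)
  trans : ∀ i, ∃ t, IsResTranscendental O (V i) t
  visible : ∀ i, ∃ c, IsVisible E (ε c) (N i) (α i) (β i)
  line : ∀ c i, IsVisible E (ε c) (N i) (α i) (β i) → ∃ t ϖ v,
    IsLineChart (monAlg π x y (sideExps E (ε c))) (V i) t ϖ v (T.mult i)
  /-- A point of the special fibre lies on the component `i` if the equation `ϖ` vanishes and the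
  auxiliary function `v` does not. -/
  exists_le : ∀ c (W : ValuationSubring F), (∀ a ∈ monAlg π x y (sideExps E (ε c)), a ∈ W) →
    W.valuation (algebraMap O F π) < 1 → ∃ i t ϖ v m,
      IsLineChart (monAlg π x y (sideExps E (ε c))) (V i) t ϖ v m ∧
      W.valuation ϖ < 1 ∧ W.valuation v = 1
  /-- Components which are not meant to intersect are separated on each chart where both are
  visible. -/
  disjoint : ∀ i j, i < j → T.inter i j = 0 → ∀ c, IsVisible E (ε c) (N i) (α i) (β i) →
    IsVisible E (ε c) (N j) (α j) (β j) → ∃ a ∈ monAlg π x y (sideExps E (ε c)),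
    ∃ b ∈ monAlg π x y (sideExps E (ε c)), a ∈ (V i).nonunits ∧ b ∈ (V j).nonunits ∧
    ∃ d : O, IsUnit d ∧ a + b = algebraMap O F d
  /-- The intersection is computed in the chart `c₀`. On every other chart where both components
  are visible, the quotient of the two sections is a nonzero constant on the component `j`. -/
  meet : ∀ i j, i < j → T.inter i j ≠ 0 → ∃ c₀,
    (MeetsAt (monAlg π x y (sideExps E (ε c₀))) (V i) (V j) (T.inter i j) ∨
      MeetsAt (monAlg π x y (sideExps E (ε c₀))) (V j) (V i) (T.inter i j)) ∧
    ∀ c, IsVisible E (ε c) (N i) (α i) (β i) → IsVisible E (ε c) (N j) (α j) (β j) → c ≠ c₀ →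
      ∃ d : O, IsUnit d ∧ pencilSection (fun j ↦ mon π x y (E j)) (ε c₀) /
        pencilSection (fun j ↦ mon π x y (E j)) (ε c) - algebraMap O F d ∈ (V j).nonunits
  /-- The valuative criterion for the charts to cover. -/
  cover : ∀ W : ValuationSubring F, (∀ r : O, algebraMap O F r ∈ W) →
    ∃ c, ∀ a ∈ monAlg π x y (sideExps E (ε c)), a ∈ W
  /-- Each chart contains the coordinates of the curve or of an isomorphic one, so it is regular
  away from the special fibre. -/
  generic : ∀ c, ∃ (a' : K) (x' y' : F), IsFunctionField a' x' y' ∧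
    x' ∈ monAlg π x y (sideExps E (ε c)) ∧ y' ∈ monAlg π x y (sideExps E (ε c))

variable [IsDiscreteValuationRing O]
variable {E : Fin n → ℤ × ℤ × ℤ} {ε : Fin m → Fin n → Bool} {T : FibreConfiguration}
variable {V : Fin T.n → ValuationSubring F} {N : Fin T.n → ℕ} {α β : Fin T.n → ℤ}

omit [Algebra K F] in
lemma MeetsAt.exists_hom {A : Subalgebra O F} {V V' : ValuationSubring F}
    {n : ℕ} (h : MeetsAt A V V' n) (hV : ∀ a ∈ A, a ∈ V) (hV' : ∀ a ∈ A, a ∈ V') :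
    ∃ ψ : A →+* (ResidueField O)[X], Function.Surjective ψ ∧
      (centre A V hV).asIdeal ⊔ (centre A V' hV').asIdeal = (Ideal.span {X ^ n}).comap ψ := by
  obtain ⟨t, ϖ, v, t', ϖ', m, m', ε, h1, h2, hε, he⟩ := h
  exact h1.exists_sup_eq h2 hε he hV hV'

omit [Algebra K F] [IsDiscreteValuationRing O] in
/-- If the second line is cut out by the coordinate of the first, the intersection is transversal. -/
lemma IsLineChart.meetsAt_one {A : Subalgebra O F} {V V' : ValuationSubring F} {t ϖ v t' : F}
    {m m' : ℕ} (l : IsLineChart A V t ϖ v m) (l' : IsLineChart A V' t' t 1 m') :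
    MeetsAt A V V' 1 :=
  ⟨_, _, _, _, _, _, _, 1, l, l', isUnit_one, by
    rw [map_one, one_mul, pow_one, sub_self, ValuationSubring.mem_nonunits_iff, map_zero]
    exact zero_lt_one⟩

/-- The conditions on monomials imply those on prime ideals of the charts. -/
lemma IsPencilAtlas.isFibreAtlas (h : IsPencilAtlas (K := K) π x y E ε T V N α β) :
    IsFibreAtlas (pencilModule O fun j ↦ mon π x y (E j))
      (fun c ↦ pencilSection (fun j ↦ mon π x y (E j)) (ε c)) T V := by
  have hA (c : Fin m) := chart_eq_monAlg E h.ne_zero (ε c)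
  have hO (i : Fin T.n) (r : O) : algebraMap O F r ∈ V i := by
    obtain ⟨t, ht⟩ := h.trans i
    exact ht.algebraMap_mem r
  have hvis (c : Fin m) (i : Fin T.n) := forall_mem_chart_iff_isVisible (h.ord i) (hO i) E (ε c)
  refine ⟨fun i r hr ↦ ?_, fun i ↦ ?_, fun c i hi ↦ ?_, fun c Q hQ hle ↦ ?_, ?_, ?_⟩
  · obtain ⟨t, ht⟩ := h.trans i
    exact ht.algebraMap_mem_nonunits.mpr hr
  · obtain ⟨c, hc⟩ := h.visible i
    exact ⟨c, (hvis c i).mpr hc⟩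
  · obtain ⟨t, ϖ, v, hl⟩ := h.line c i ((hvis c i).mp hi)
    rw [← hA c] at hl
    exact hl.isLine hi
  · obtain ⟨W, hW, hWQ⟩ := exists_centre_eq _ (⟨Q, hQ⟩ : PrimeSpectrum _)
    have hπ : W.valuation (algebraMap O F π) < 1 := by
      have h1 := hle (Ideal.mem_map_of_mem _ ((mem_maximalIdeal π).mpr h.irreducible.not_isUnit))
      rw [← show (centre _ W hW).asIdeal = Q from congrArg _ hWQ, mem_centre] at h1
      exact W.mem_nonunits_iff.mp h1
    obtain ⟨i, t, ϖ, v, m, hl, hϖ, hv⟩ := h.exists_le c W (by rw [← hA c]; exact hW) hπ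
    rw [← hA c] at hl
    refine ⟨i, hl.le, fun a ha ↦ ?_⟩
    rw [← show (centre _ W hW).asIdeal = Q from congrArg _ hWQ, mem_centre]
    exact hl.mem_nonunits_of_mem hW hϖ hv a.2 (mem_centre.mp ha)
  · have key (i j : Fin T.n) (hij : i < j) (h0 : T.inter i j = 0) (c : Fin m)
        (hi : ∀ a ∈ chart (pencilModule O fun j ↦ mon π x y (E j))
          (pencilSection (fun j ↦ mon π x y (E j)) (ε c)), a ∈ V i)
        (hj : ∀ a ∈ chart (pencilModule O fun j ↦ mon π x y (E j))
          (pencilSection (fun j ↦ mon π x y (E j)) (ε c)), a ∈ V j) :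
        (centre _ _ hi).asIdeal ⊔ (centre _ _ hj).asIdeal = ⊤ := by
      obtain ⟨a, ha, b, hb, haV, hbV, d, hd, e⟩ :=
        h.disjoint i j hij h0 c ((hvis c i).mp hi) ((hvis c j).mp hj)
      rw [← hA c] at ha hb
      exact centre_sup_centre_eq_top hi hj ha hb haV hbV hd e
    intro i j hij h0 c hi hj
    rcases lt_or_gt_of_ne hij with hij | hij
    · exact key i j hij h0 c hi hj
    · rw [sup_comm]
      exact key j i hij (by rw [T.symm, h0]) c hj hi
  · have key (i j : Fin T.n) (hij : i < j) (h0 : T.inter i j ≠ 0) : ∃ c₀,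
        ∃ (hi : ∀ a ∈ chart (pencilModule O fun j ↦ mon π x y (E j))
          (pencilSection (fun j ↦ mon π x y (E j)) (ε c₀)), a ∈ V i)
        (hj : ∀ a ∈ chart (pencilModule O fun j ↦ mon π x y (E j))
          (pencilSection (fun j ↦ mon π x y (E j)) (ε c₀)), a ∈ V j),
        (∃ ψ : chart (pencilModule O fun j ↦ mon π x y (E j))
          (pencilSection (fun j ↦ mon π x y (E j)) (ε c₀)) →+* (ResidueField O)[X],
          Function.Surjective ψ ∧ (centre _ _ hi).asIdeal ⊔ (centre _ _ hj).asIdeal =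
            (Ideal.span {X ^ T.inter i j}).comap ψ) ∧
        ∀ c (hi' : ∀ a ∈ chart (pencilModule O fun j ↦ mon π x y (E j))
          (pencilSection (fun j ↦ mon π x y (E j)) (ε c)), a ∈ V i)
          (hj' : ∀ a ∈ chart (pencilModule O fun j ↦ mon π x y (E j))
          (pencilSection (fun j ↦ mon π x y (E j)) (ε c)), a ∈ V j)
          (b : chart (pencilModule O fun j ↦ mon π x y (E j))
            (pencilSection (fun j ↦ mon π x y (E j)) (ε c))),
          (b : F) = pencilSection (fun j ↦ mon π x y (E j)) (ε c₀) /
            pencilSection (fun j ↦ mon π x y (E j)) (ε c) →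
          (centre _ _ hi').asIdeal ⊔ (centre _ _ hj').asIdeal ⊔ Ideal.span {b} = ⊤ := by
      obtain ⟨c₀, hm, hc⟩ := h.meet i j hij h0
      rw [← hA c₀] at hm
      have hij' : (∀ a ∈ chart (pencilModule O fun j ↦ mon π x y (E j))
          (pencilSection (fun j ↦ mon π x y (E j)) (ε c₀)), a ∈ V i) ∧
          ∀ a ∈ chart (pencilModule O fun j ↦ mon π x y (E j))
          (pencilSection (fun j ↦ mon π x y (E j)) (ε c₀)), a ∈ V j := by
        rcases hm with ⟨_, _, _, _, _, _, _, _, h1, h2, -⟩ | ⟨_, _, _, _, _, _, _, _, h1, h2, -⟩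
        exacts [⟨h1.le, h2.le⟩, ⟨h2.le, h1.le⟩]
      refine ⟨c₀, hij'.1, hij'.2, ?_, fun c hi hj b hb ↦ ?_⟩
      · rcases hm with hm | hm
        · exact hm.exists_hom _ _
        · rw [sup_comm]
          exact hm.exists_hom _ _
      · by_cases hcc : c = c₀
        · subst hcc
          rw [div_self (pencilSection_ne_zero (fun j ↦ h.ne_zero _) _)] at hb
          rw [show b = 1 from Subtype.ext hb, Ideal.span_singleton_one, sup_top_eq]
        · obtain ⟨d, hd, hdV⟩ := hc c ((hvis c i).mp hi) ((hvis c j).mp hj) hcc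
          refine Ideal.eq_top_of_isUnit_mem _ ?_ (hd.map (algebraMap O _))
          have : algebraMap O _ d = b - (b - algebraMap O _ d) := by ring
          rw [this]
          refine Ideal.sub_mem _ (Ideal.mem_sup_right (Ideal.mem_span_singleton_self b))
            (Ideal.mem_sup_left (Ideal.mem_sup_right ?_))
          rw [mem_centre]
          rw [← hb] at hdV
          exact hdV
    intro i j hij h0
    rcases lt_or_gt_of_ne hij with hij | hij
    · exact key i j hij h0
    · obtain ⟨c₀, hj, hi, ⟨ψ, h1, h2⟩, h3⟩ := key j i hij (by rwa [T.symm])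
      refine ⟨c₀, hi, hj, ⟨ψ, h1, by rw [sup_comm, h2, T.symm]⟩, fun c hi' hj' b hb ↦ ?_⟩
      rw [sup_comm (centre _ _ hi').asIdeal]
      exact h3 c hj' hi' b hb

/-- The model is regular: points of the special fibre lie on a component, and the other points are
points of the elliptic curve over `K`. -/
lemma IsPencilAtlas.isRegularAtlas [IsScalarTower O K F]
    (h : IsPencilAtlas (K := K) π x y E ε T V N α β) :
    IsRegularAtlas (pencilModule O fun j ↦ mon π x y (E j))
      (fun c ↦ pencilSection (fun j ↦ mon π x y (E j)) (ε c)) := by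
  have hA (c : Fin m) := chart_eq_monAlg E h.ne_zero (ε c)
  refine ⟨fg_pencilModule, fun c ↦ pencilSection_mem _, fun c ↦ pencilSection_ne_zero
    (fun j ↦ h.ne_zero _) _, fun W hW ↦ ?_, ?_, fun c M hM ↦ ?_⟩
  · obtain ⟨c, hc⟩ := h.cover W hW
    exact ⟨c, by rw [hA c]; exact hc⟩
  · obtain ⟨c, -⟩ := h.cover ⊤ fun _ ↦ trivial
    obtain ⟨a', x', y', hF, hx, hy⟩ := h.generic c
    rw [← hA c] at hx hy
    exact ⟨c, hF.isFractionRing hx hy⟩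
  · have := isNoetherianRing_chart (fg_pencilModule (R := O) (f := fun j ↦ mon π x y (E j)))
      (pencilSection (fun j ↦ mon π x y (E j)) (ε c))
    by_cases hπ : algebraMap O _ π ∈ M
    · refine h.isFibreAtlas.isRegularLocalRing ?_ fg_pencilModule c M ?_
      · rw [IsScalarTower.algebraMap_eq O K F]
        exact (algebraMap K F).injective.comp Subtype.val_injective
      · rw [h.irreducible.maximalIdeal_eq, Ideal.map_span, Set.image_singleton,
          Ideal.span_singleton_le_iff_mem]
        exact hπ
    · obtain ⟨a', x', y', hF, hx, hy⟩ := h.generic c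
      rw [← hA c] at hx hy
      exact hF.isRegularLocalRing h.irreducible hx hy M hπ _

/-- A regular model described by monomials has the special fibre which it is meant to have. -/
theorem IsPencilAtlas.hasFibre {K : Type u} [Field K] {O : ValuationSubring K}
    [IsDiscreteValuationRing O] {W : WeierstrassCurve K} {π : O} {x y : W.toAffine.FunctionField}
    {E : Fin n → ℤ × ℤ × ℤ} {ε : Fin m → Fin n → Bool} {T : FibreConfiguration}
    {V : Fin T.n → ValuationSubring W.toAffine.FunctionField} {N : Fin T.n → ℕ}
    {α β : Fin T.n → ℤ} (h : IsPencilAtlas (K := K) π x y E ε T V N α β) : HasFibre O W T :=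
  ⟨h.isRegularAtlas.model, h.isFibreAtlas.hasSpecialFibre h.isRegularAtlas⟩

end PencilAtlas

/-! ### A fibre of type `III` -/

section Instances

variable {K F : Type u} [Field K] [Field F] [Algebra K F] {O : ValuationSubring K} [Algebra O F]
variable [IsScalarTower O K F] {k : ℕ} {π u : O} {x y : F} {V W : ValuationSubring F}

omit [Algebra K F] [IsScalarTower O K F] in
lemma mon_mem_or (π : O) (x y : F) (W : ValuationSubring F) (e : ℤ × ℤ × ℤ) :
    mon π x y e ∈ W ∨ mon π x y (-e) ∈ W := by
  rw [mon, mon, monom_neg]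
  exact W.mem_or_inv_mem _

omit [Algebra K F] [IsScalarTower O K F] in
lemma mon_mul_neg (e : ℤ × ℤ × ℤ) (h0 : mon π x y e ≠ 0) : mon π x y e * mon π x y (-e) = 1 := by
  rw [mon, mon, monom_neg, mul_inv_cancel₀ h0]

lemma _root_.ValuationSubring.mul_mem_nonunits {V : ValuationSubring F} {a b : F} (ha : a ∈ V)
    (hb : b ∈ V.nonunits) : a * b ∈ V.nonunits := by
  rw [ValuationSubring.mem_nonunits_iff, map_mul] at *
  exact (mul_le_of_le_one_left zero_le ((V.valuation_le_one_iff _).mpr ha)).trans_lt hb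

namespace IsCurve

/-- A ring which contains the coordinates of the translated curve, up to units. -/
lemma exists_isFunctionField_translate (h : IsCurve k π u x y) {A : Subalgebra O F}
    (hA : mon π x y (k, -1, 0) ∈ A) (hA' : mon π x y (k, -2, 1) ∈ A) :
    ∃ (a : K) (x' y' : F), IsFunctionField a x' y' ∧ x' ∈ A ∧ y' ∈ A := by
  have hx := h.x_ne_zero
  refine ⟨_, _, _, h.translate.isFunctionField, ?_, ?_⟩
  · have : translateX k π u x = -algebraMap O F u * mon π x y (k, -1, 0) := by
      simp only [translateX, mon, monom, zpow_neg, zpow_ofNat, zpow_natCast]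
      field_simp
    rw [this]
    exact A.mul_mem (A.neg_mem (A.algebraMap_mem u)) hA
  · have : translateY k π u x y = algebraMap O F u * mon π x y (k, -2, 1) := by
      simp only [translateY, mon, monom, zpow_neg, zpow_ofNat, zpow_natCast]
      field_simp
    rw [this]
    exact A.mul_mem (A.algebraMap_mem u) hA'

lemma exists_isFunctionField_infinityChart (h : IsCurve k π u x y) : ∃ (a : K) (x' y' : F),
    IsFunctionField a x' y' ∧ x' ∈ monAlg π x y infinityChart ∧
      y' ∈ monAlg π x y infinityChart := by
  have hz : mon π x y (0, 1, -1) ∈ monAlg π x y infinityChart := mon_mem_monAlg (by decide)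
  have hq : mon π x y (0, -1, 0) ∈ monAlg π x y infinityChart := mon_mem_monAlg (by decide)
  have hδ := h.delta_mem (h.mon_mem (e := (k, -2, 0)) hq hq hq k 2 0 0 (by simp))
  exact h.exists_isFunctionField_translate (h.mon_mem hq hq hq k 1 0 0 (by simp))
    (h.mon_mem hz hδ hq k 1 1 0 (by simp))

omit [Algebra K F] [IsScalarTower O K F] in
lemma mon_x : mon π x y (0, 1, 0) = x := by simp [mon, monom]

omit [Algebra K F] [IsScalarTower O K F] in
lemma mon_y : mon π x y (0, 0, 1) = y := by simp [mon, monom]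

omit [IsScalarTower O K F] in
lemma exists_isFunctionField (h : IsCurve k π u x y) {A : Subalgebra O F}
    (hx : mon π x y (0, 1, 0) ∈ A) (hy : mon π x y (0, 0, 1) ∈ A) : ∃ (a : K) (x' y' : F),
    IsFunctionField a x' y' ∧ x' ∈ A ∧ y' ∈ A :=
  ⟨_, x, y, h.isFunctionField, by rwa [mon_x] at hx, by rwa [mon_y] at hy⟩

section One

variable (h : IsCurve 1 π u x y)

/-- The pencils `y / x`, `x` and `π / x`. -/
abbrev _root_.EllipticFibre.exponentsIII : Fin 3 → ℤ × ℤ × ℤ := ![(0, -1, 1), (0, 1, 0), (1, -1, 0)]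

/-- The charts around the point at infinity, around the intersection of the components, and around
the closure of the rational point `(0, 0)`. -/
abbrev _root_.EllipticFibre.signsIII : Fin 3 → Fin 3 → Bool :=
  ![![false, false, true], ![true, true, true], ![false, true, false]]

include h

lemma monAlg_sideExps_signsIII_zero :
    monAlg π x y (sideExps exponentsIII (signsIII 0)) = monAlg π x y infinityChart := by
  have hq : mon π x y (0, -1, 0) ∈ monAlg π x y infinityChart := mon_mem_monAlg (by decide)
  refine le_antisymm (monAlg_le (forall_mem_triple (p := fun e ↦ mon π x y e ∈ _) (mon_mem_monAlg (by decide)) hq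
    (h.mon_mem hq hq hq 1 1 0 0 (by decide)))) (monAlg_le (forall_mem_pair
    (mon_mem_monAlg (by decide)) (mon_mem_monAlg (by decide))))

lemma monAlg_sideExps_signsIII_one :
    monAlg π x y (sideExps exponentsIII (signsIII 1)) = monAlg π x y tangencyChart := by
  refine le_antisymm (monAlg_le (forall_mem_triple (mon_mem_monAlg (by decide))
    h.x_mem_tangencyChart (mon_mem_monAlg (by decide)))) (monAlg_le (forall_mem_pair
    (mon_mem_monAlg (by decide)) (mon_mem_monAlg (by decide))))

lemma monAlg_sideExps_signsIII_two :
    monAlg π x y (sideExps exponentsIII (signsIII 2)) =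
      monAlg π (translateX 1 π u x) (translateY 1 π u x y) infinityChart := by
  rw [← h.translate.monAlg_sideExps_signsIII_zero, h.monAlg_translate]
  exact monAlg_congr (by decide) (by decide)

/-- The charts cover. If `y / x` is integral, so is `π / x`; this gives the chart around the
tangency point. Otherwise `x / y` is integral, and the point is in the chart at infinity if `1 /
x` is integral, and in its translate if not. -/
lemma exists_le_signsIII (hW : ∀ r : O, algebraMap O F r ∈ W) :
    ∃ c, ∀ a ∈ monAlg π x y (sideExps exponentsIII (signsIII c)), a ∈ W := by
  have hx := h.x_eq_add
  obtain ⟨u', hu'⟩ := h.isUnit.exists_right_inv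
  have huu' : algebraMap O F u * algebraMap O F u' = 1 := by rw [← map_mul, hu', map_one]
  have hp : mon π x y (1, -1, 0) = algebraMap O F π * mon π x y (0, -1, 0) := by
    rw [← mon_pi (x := x) (y := y), ← h.monom_add]; rfl
  -- If `x` is integral, then so is `u p = x - r²`; if `1 / x` is, then so is `p = π / x`.
  have key (hr : mon π x y (0, -1, 1) ∈ W) : mon π x y (1, -1, 0) ∈ W := by
    rcases mon_mem_or π x y W (0, 1, 0) with hx' | hx'
    · have : mon π x y (1, -1, 0) = algebraMap O F u' *
          (mon π x y (0, 1, 0) - mon π x y (0, -1, 1) ^ 2) := by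
        linear_combination -algebraMap O F u' * hx - mon π x y (1, -1, 0) * huu'
      rw [this]
      exact W.mul_mem _ _ (hW _) (W.sub_mem hx' (W.pow_mem hr 2))
    · rw [hp]
      exact W.mul_mem _ _ (hW π) hx'
  by_cases hr : mon π x y (0, -1, 1) ∈ W
  · refine ⟨1, ?_⟩
    rw [h.monAlg_sideExps_signsIII_one]
    exact forall_mem_monAlg hW (forall_mem_pair hr (key hr))
  have hz := (mon_mem_or π x y W (0, -1, 1)).resolve_left hr
  by_cases hq : mon π x y (0, -1, 0) ∈ W
  · refine ⟨0, ?_⟩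
    rw [h.monAlg_sideExps_signsIII_zero]
    exact forall_mem_monAlg hW (forall_mem_pair hz hq)
  have hx' := (mon_mem_or π x y W (0, -1, 0)).resolve_left hq
  rcases mon_mem_or π x y W (1, -1, 0) with hp' | hp'
  · refine absurd ?_ hr
    -- The square of `y / x` is integral.
    have h2 : mon π x y (0, -1, 1) = (mon π x y (0, 1, 0) - algebraMap O F u * mon π x y (1, -1, 0)) *
        mon π x y (-(0, -1, 1)) := by
      have := mon_mul_neg (0, -1, 1) (h.mon_ne_zero (0, -1, 1))
      rw [hx]
      linear_combination -mon π x y (0, -1, 1) * this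
    rw [h2]
    exact W.mul_mem _ _ (W.sub_mem hx' (W.mul_mem _ _ (hW u) hp')) hz
  · exact ⟨2, forall_mem_monAlg hW (forall_mem_triple (p := fun e ↦ mon π x y e ∈ W) hz hx' hp')⟩

/-- The component `0` is the closure of the special fibre of the Weierstrass equation and `1` is
its translate. Both meet the chart `1`, where they are cut out by `p = π / x` and by `x`. The
orders of `(π, x, y)` are `(2, 0, 0)` and `(2, 2, 2)`. -/
theorem isPencilAtlas_signsIII {V₀ V₁ : ValuationSubring F} (h₀ : IsResTranscendental O V₀ x)
    (h₁ : IsResTranscendental O V₁ (translateX 1 π u x)) :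
    IsPencilAtlas (K := K) π x y exponentsIII signsIII typeIII ![V₀, V₁] ![2, 2] ![0, 2] ![0, 2] := by
  -- The components `i` which are visible on the charts `c`; below, `lci` describes the component
  -- `i` on the chart `c`.
  have tab : ∀ (c : Fin 3) (i : Fin 2), IsVisible exponentsIII (signsIII c) ((![2, 2] : Fin 2 → ℕ) i)
      ((![0, 2] : Fin 2 → ℤ) i) ((![0, 2] : Fin 2 → ℤ) i) → c = 0 ∧ i = 0 ∨ c = 1 ∧ i = 0 ∨
        c = 1 ∧ i = 1 ∨ c = 2 ∧ i = 1 := by decide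
  have l00 := h.isLineChart_infinity (k := 0) h₀
  have l10 := h.isLineChart_tangencyChart_zero h₀
  have l11 := h.isLineChart_tangencyChart_one h₁
  have l21 := h.translate.isLineChart_infinity (k := 0) h₁
  rw [← h.monAlg_sideExps_signsIII_zero] at l00
  rw [← h.monAlg_sideExps_signsIII_one] at l10 l11
  rw [← h.monAlg_sideExps_signsIII_two] at l21
  have hπ : mon π x y (1, 0, 0) = algebraMap O F π := mon_pi
  have hπ' : mon π (translateX 1 π u x) (translateY 1 π u x y) (1, 0, 0) = algebraMap O F π := mon_pi
  exact
  { irreducible := h.irreducible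
    ne_zero := h.mon_ne_zero
    ord := Fin.forall_fin_two.mpr ⟨h.hasOrders_coord one_ne_zero h₀, HasOrders.translate h
      (fun r hr ↦ h₁.valuation_algebraMap hr) (h.translate.hasOrders_coord one_ne_zero h₁)⟩
    trans := Fin.forall_fin_two.mpr ⟨⟨_, h₀⟩, ⟨_, h₁⟩⟩
    visible := by decide
    line := fun c i hci ↦ by
      rcases tab c i hci with ⟨rfl, rfl⟩ | ⟨rfl, rfl⟩ | ⟨rfl, rfl⟩ | ⟨rfl, rfl⟩
      exacts [⟨_, _, _, l00⟩, ⟨_, _, _, l10⟩, ⟨_, _, _, l11⟩, ⟨_, _, _, l21⟩]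
    exists_le := fun c W hW hWπ ↦ by
      have h1 := map_one W.valuation
      revert hW
      fin_cases c <;> intro hW
      · exact ⟨(0 : Fin 2), _, _, _, _, l00, hπ.symm ▸ hWπ, h1⟩
      · have hW' := hW
        change ∀ a ∈ monAlg π x y (sideExps exponentsIII (signsIII 1)), a ∈ W at hW'
        rw [h.monAlg_sideExps_signsIII_one] at hW'
        rcases h.exists_lt_one_tangencyChart hW' hWπ with hlt | hlt
        exacts [⟨(0 : Fin 2), _, _, _, _, l10, hlt, h1⟩, ⟨(1 : Fin 2), _, _, _, _, l11, hlt, h1⟩]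
      · exact ⟨(1 : Fin 2), _, _, _, _, l21, hπ'.symm ▸ hWπ, h1⟩
    disjoint := fun i j hij h0 ↦ by
      obtain ⟨rfl, rfl⟩ := (by decide : ∀ i j : Fin 2, i < j → i = 0 ∧ j = 1) i j hij
      cases h0
    meet := fun i j hij _ ↦ by
      obtain ⟨rfl, rfl⟩ := (by decide : ∀ i j : Fin 2, i < j → i = 0 ∧ j = 1) i j hij
      refine ⟨1, .inl ⟨_, _, _, _, _, _, _, 1, l10, l11, isUnit_one, ?_⟩, fun c h0 h1 hc ↦ ?_⟩
      -- On the component `0`, where `p` vanishes, the equation `x = r² + u p` of the other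
      -- component is the square of the coordinate: they are tangent.
      · change _ - _ * _ ^ 2 ∈ _
        rw [map_one, one_mul, h.x_eq_add, add_sub_cancel_left]
        exact ValuationSubring.mul_mem_nonunits (h₀.algebraMap_mem u) l10.mem_nonunits
      · exact absurd ((by decide : ∀ c, IsVisible exponentsIII (signsIII c) 2 0 0 →
          IsVisible exponentsIII (signsIII c) 2 2 2 → c = 1) c h0 h1) hc
    cover := fun W hW ↦ h.exists_le_signsIII hW
    generic := fun c ↦ by
      fin_cases c
      · exact h.monAlg_sideExps_signsIII_zero ▸ h.exists_isFunctionField_infinityChart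
      · have hx := h.x_mem_tangencyChart
        exact h.monAlg_sideExps_signsIII_one ▸ h.exists_isFunctionField hx (h.mon_mem
          (e₁ := (0, -1, 1)) (mon_mem_monAlg (by decide)) hx hx 0 1 1 0 (by decide))
      · exact h.monAlg_sideExps_signsIII_two ▸ h.translate.exists_isFunctionField_infinityChart }

end One

end IsCurve

end Instances

/-! ### A fibre of type `I₀*` -/

/-- The sections of two charts which differ in the sign of one pencil. -/
lemma pencilSection_div {F : Type u} [Field F] {ι : Type} [Fintype ι] {f : ι → F}
    (hf : ∀ i, f i ≠ 0) {ε ε' : ι → Bool} (j : ι) (h : ∀ i, i ≠ j → ε i = ε' i) (hj : ε j = true)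
    (hj' : ε' j = false) : pencilSection f ε / pencilSection f ε' = (f j)⁻¹ := by
  classical
  have h1 : pencilSection f ε' = f j * pencilSection f ε := by
    rw [pencilSection, pencilSection, ← Finset.mul_prod_erase _ _ (Finset.mem_univ j),
      ← Finset.mul_prod_erase Finset.univ (fun i ↦ if ε i then 1 else f i) (Finset.mem_univ j)]
    simp only [hj, hj', if_true, Bool.false_eq_true, if_false, one_mul]
    congr 1
    exact Finset.prod_congr rfl fun i hi ↦ by rw [h i (Finset.ne_of_mem_erase hi)]
  rw [h1, div_mul_cancel_right₀ (pencilSection_ne_zero hf ε)]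

section Instances

variable {K F : Type u} [Field K] [Field F] [Algebra K F] {O : ValuationSubring K} [Algebra O F]
variable [IsScalarTower O K F] {k : ℕ} {π u : O} {x y : F} {V W : ValuationSubring F}

namespace IsCurve

lemma mon_translate_mem_iff (h : IsCurve k π u x y) (hW : ∀ r : O, algebraMap O F r ∈ W)
    (e : ℤ × ℤ × ℤ) : mon π (translateX k π u x) (translateY k π u x y) e ∈ W ↔
      mon π x y (translateExp k e) ∈ W := by
  obtain ⟨c, hc, e1⟩ := h.monom_translate e
  obtain ⟨d, hd⟩ := hc.exists_left_inv
  rw [e1]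
  refine ⟨fun h1 ↦ ?_, fun h1 ↦ W.mul_mem _ _ (hW c) h1⟩
  have := W.mul_mem _ _ (hW d) h1
  rwa [← mul_assoc, ← map_mul, hd, map_one, one_mul] at this

section Two

variable (h : IsCurve 2 π u x y)

/-- The pencils `y / x`, `π / x` and `y / (π x)`. -/
abbrev _root_.EllipticFibre.exponentsI0star : Fin 3 → ℤ × ℤ × ℤ :=
  ![(0, -1, 1), (1, -1, 0), (-1, -1, 1)]

/-- The chart around the point at infinity, the chart around the intersections of the double
component with three of the simple components, a chart which is preserved by the translation and
meets only two simple components, and the translates of the first two charts. -/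
abbrev _root_.EllipticFibre.signsI0star : Fin 5 → Fin 3 → Bool :=
  ![![false, true, false], ![true, true, false], ![true, true, true], ![true, false, false],
    ![false, false, false]]

include h

lemma monAlg_sideExps_signsI0star_zero :
    monAlg π x y (sideExps exponentsI0star (signsI0star 0)) = monAlg π x y infinityChart := by
  have hz : mon π x y (0, 1, -1) ∈ monAlg π x y infinityChart := mon_mem_monAlg (by decide)
  have hq : mon π x y (0, -1, 0) ∈ monAlg π x y infinityChart := mon_mem_monAlg (by decide)
  have hz' : mon π x y (0, 1, -1) ∈ monAlg π x y (sideExps exponentsI0star (signsI0star 0)) :=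
    mon_mem_monAlg (by decide)
  have hp : mon π x y (1, -1, 0) ∈ monAlg π x y (sideExps exponentsI0star (signsI0star 0)) :=
    mon_mem_monAlg (by decide)
  have hδ := h.delta_mem (h.mon_mem hp hp hp 0 2 0 0 (by decide))
  exact le_antisymm (monAlg_le (forall_mem_triple (p := fun e ↦ mon π x y e ∈ _) hz
    (h.mon_mem hq hq hq 1 1 0 0 (by decide)) (h.mon_mem hz hq hq 1 1 0 0 (by decide))))
    (monAlg_le (forall_mem_pair hz' (h.mon_mem hz' hδ hp 0 2 1 0 (by decide))))

/-- The function `x² / y` in terms of the pencils. -/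
lemma omega_eq_of_two : mon π x y (0, 2, -1) = mon π x y (0, -1, 1) +
    algebraMap O F u * (mon π x y (1, 1, -1) * mon π x y (1, -1, 0)) := by
  have hx := h.x_ne_zero
  have hy := h.y_ne_zero
  have := h.equation
  simp only [mon, monom, zpow_neg, zpow_ofNat]
  field_simp
  linear_combination -this

lemma monAlg_sideExps_signsI0star_one :
    monAlg π x y (sideExps exponentsI0star (signsI0star 1)) = monAlg π x y doubleChart := by
  have hp : mon π x y (1, -1, 0) ∈ monAlg π x y doubleChart := mon_mem_monAlg (by decide)
  have hω : mon π x y (0, 2, -1) ∈ monAlg π x y doubleChart := mon_mem_monAlg (by decide)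
  have hδ := h.delta_mem_doubleChart
  have hp' : mon π x y (1, -1, 0) ∈ monAlg π x y (sideExps exponentsI0star (signsI0star 1)) :=
    mon_mem_monAlg (by decide)
  refine le_antisymm (monAlg_le (forall_mem_triple (p := fun e ↦ mon π x y e ∈ _)
    (h.mon_mem hω hδ hp 0 1 1 0 (by decide)) hp (h.mon_mem hω hp hp 0 1 1 0 (by decide))))
    (monAlg_le (forall_mem_pair hp' ?_))
  rw [h.omega_eq_of_two]
  exact Subalgebra.add_mem _ (mon_mem_monAlg (by decide)) (Subalgebra.mul_mem _
    (Subalgebra.algebraMap_mem _ u) (Subalgebra.mul_mem _ (mon_mem_monAlg (by decide)) hp'))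

lemma monAlg_sideExps_signsI0star_two :
    monAlg π x y (sideExps exponentsI0star (signsI0star 2)) = monAlg π x y simpleChart := by
  have hs : mon π x y (-1, -1, 1) ∈ monAlg π x y simpleChart := mon_mem_monAlg (by decide)
  exact le_antisymm (monAlg_le (forall_mem_triple (p := fun e ↦ mon π x y e ∈ _)
    (h.mon_mem hs hs hs 1 1 0 0 (by decide)) (mon_mem_monAlg (by decide)) hs))
    (monAlg_le (forall_mem_pair (mon_mem_monAlg (by decide)) (mon_mem_monAlg (by decide))))

lemma monAlg_sideExps_signsI0star_three :
    monAlg π x y (sideExps exponentsI0star (signsI0star 3)) =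
      monAlg π (translateX 2 π u x) (translateY 2 π u x y) doubleChart := by
  rw [← h.translate.monAlg_sideExps_signsI0star_one, h.monAlg_translate]
  exact monAlg_congr (by decide) (by decide)

lemma monAlg_sideExps_signsI0star_four :
    monAlg π x y (sideExps exponentsI0star (signsI0star 4)) =
      monAlg π (translateX 2 π u x) (translateY 2 π u x y) infinityChart := by
  rw [← h.translate.monAlg_sideExps_signsI0star_zero, h.monAlg_translate]
  exact monAlg_congr (by decide) (by decide)

/-- The function `x / π` in terms of `π / x` and `y / (π x)`. -/
lemma inv_p_eq : mon π x y (-1, 1, 0) = algebraMap O F π * mon π x y (-1, -1, 1) ^ 2 +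
    algebraMap O F u * mon π x y (1, -1, 0) := by
  have hx := h.x_ne_zero
  have hp := h.p_ne_zero
  have := h.equation
  simp only [mon, monom, zpow_neg, zpow_ofNat]
  field_simp
  linear_combination -this

/-- The charts at infinity and around the double component are distinguished by whether `y / x` or
its inverse is integral. -/
lemma forall_mem_infinityChart_or_doubleChart (hW : ∀ r : O, algebraMap O F r ∈ W)
    (hp : mon π x y (1, -1, 0) ∈ W) (hκ : mon π x y (1, 1, -1) ∈ W) :
    (∀ a ∈ monAlg π x y infinityChart, a ∈ W) ∨ ∀ a ∈ monAlg π x y doubleChart, a ∈ W := by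
  rcases mon_mem_or π x y W (0, -1, 1) with hr | hz
  · refine .inr (forall_mem_monAlg hW (forall_mem_pair hp ?_))
    rw [h.omega_eq_of_two]
    exact W.add_mem _ _ hr (W.mul_mem _ _ (hW u) (W.mul_mem _ _ hκ hp))
  · refine .inl ?_
    rw [← h.monAlg_sideExps_signsI0star_zero]
    exact forall_mem_monAlg hW (forall_mem_triple (p := fun e ↦ mon π x y e ∈ W) hz hp hκ)

/-- The charts cover. Where `s = y / (π x)` is integral, so is `π / x`. Otherwise one of `π / x`
and its inverse is integral, and these cases are exchanged by the translation. -/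
lemma exists_le_signsI0star (hW : ∀ r : O, algebraMap O F r ∈ W) :
    ∃ c, ∀ a ∈ monAlg π x y (sideExps exponentsI0star (signsI0star c)), a ∈ W := by
  obtain ⟨u', hu'⟩ := h.isUnit.exists_right_inv
  have huu' : algebraMap O F u * algebraMap O F u' = 1 := by rw [← map_mul, hu', map_one]
  rcases mon_mem_or π x y W (-1, -1, 1) with hs | hκ
  · have hp : mon π x y (1, -1, 0) ∈ W := by
      rcases mon_mem_or π x y W (1, -1, 0) with hp | hp
      · exact hp
      · have : mon π x y (1, -1, 0) = algebraMap O F u' * (mon π x y (-1, 1, 0) -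
            algebraMap O F π * mon π x y (-1, -1, 1) ^ 2) := by
          linear_combination -algebraMap O F u' * h.inv_p_eq - mon π x y (1, -1, 0) * huu'
        rw [this]
        exact W.mul_mem _ _ (hW u') (W.sub_mem hp (W.mul_mem _ _ (hW π) (W.pow_mem hs 2)))
    refine ⟨2, ?_⟩
    rw [h.monAlg_sideExps_signsI0star_two]
    exact forall_mem_monAlg hW (forall_mem_pair hs hp)
  rcases mon_mem_or π x y W (1, -1, 0) with hp | hp
  · rcases h.forall_mem_infinityChart_or_doubleChart hW hp hκ with h1 | h1
    exacts [⟨0, h.monAlg_sideExps_signsI0star_zero ▸ h1⟩,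
      ⟨1, h.monAlg_sideExps_signsI0star_one ▸ h1⟩]
  · rcases h.translate.forall_mem_infinityChart_or_doubleChart hW
      ((h.mon_translate_mem_iff hW _).mpr hp) ((h.mon_translate_mem_iff hW _).mpr hκ) with h1 | h1
    exacts [⟨4, h.monAlg_sideExps_signsI0star_four ▸ h1⟩,
      ⟨3, h.monAlg_sideExps_signsI0star_three ▸ h1⟩]

lemma exists_lt_one_doubleChart (hW : ∀ a ∈ monAlg π x y doubleChart, a ∈ W)
    (hπ : W.valuation (algebraMap O F π) < 1) : W.valuation (mon π x y (1, -1, 0)) < 1 ∨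
      W.valuation (mon π x y (0, 2, -1)) < 1 ∨ W.valuation (mon π x y (0, -3, 2)) < 1 :=
  h.exists_valuation_lt_one hπ (hW _ (mon_mem_monAlg (by decide)))
    (hW _ (mon_mem_monAlg (by decide))) (hW _ h.delta_mem_doubleChart) 1 2 1 (by decide)

lemma exists_isFunctionField_doubleChart : ∃ (a : K) (x' y' : F), IsFunctionField a x' y' ∧
    x' ∈ monAlg π x y doubleChart ∧ y' ∈ monAlg π x y doubleChart := by
  have hω : mon π x y (0, 2, -1) ∈ monAlg π x y doubleChart := mon_mem_monAlg (by decide)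
  have hδ := h.delta_mem_doubleChart
  exact h.exists_isFunctionField (h.mon_mem hω hδ hδ 0 2 1 0 (by decide))
    (h.mon_mem hω hδ hδ 0 3 2 0 (by decide))

lemma exists_isFunctionField_simpleChart : ∃ (a : K) (x' y' : F), IsFunctionField a x' y' ∧
    x' ∈ monAlg π x y simpleChart ∧ y' ∈ monAlg π x y simpleChart := by
  have hs : mon π x y (-1, -1, 1) ∈ monAlg π x y simpleChart := mon_mem_monAlg (by decide)
  have hp : mon π x y (1, -1, 0) ∈ monAlg π x y simpleChart := mon_mem_monAlg (by decide)
  have hb : mon π x y (-1, 1, 0) ∈ monAlg π x y simpleChart := by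
    rw [h.inv_p_eq]
    exact Subalgebra.add_mem _ (Subalgebra.mul_mem _ (Subalgebra.algebraMap_mem _ π)
      (Subalgebra.pow_mem _ hs 2)) (Subalgebra.mul_mem _ (Subalgebra.algebraMap_mem _ u) hp)
  exact h.exists_isFunctionField (h.mon_mem hb hb hb 1 1 0 0 (by decide))
    (h.mon_mem hs hb hb 2 1 1 0 (by decide))

section Branch

variable {c d : O} (hc : IsUnit c) (hu : u = c ^ 2 + π * d)
  (hV : IsResTranscendental O V (branchCoord π c x))
include hc hu hV

/-- In the translated coordinates, the component which belongs to `c` is given by `-c`. -/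
lemma isResTranscendental_branch_translate :
    IsResTranscendental O V (branchCoord π (-c) (translateX 2 π u x)) := by
  have hp := h.p_ne_zero
  have hx := h.x_ne_zero
  have hu0 := h.u_ne_zero
  have hp1 := h.valuation_p_of_branch hc hV
  have hO := hV.algebraMap_mem
  have hu' : algebraMap O F u = algebraMap O F c ^ 2 + algebraMap O F π * algebraMap O F d := by
    rw [hu, map_add, map_mul, map_pow]
  have e0 : 1 - algebraMap O F c * mon π x y (1, -1, 0) =
    algebraMap O F π * branchCoord π c x := h.one_sub_eq
  have e1 : branchCoord π (-c) (translateX 2 π u x) *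
      (algebraMap O F u * mon π x y (1, -1, 0)) =
      algebraMap O F d * mon π x y (1, -1, 0) - algebraMap O F c * branchCoord π c x := by
    apply mul_left_cancel₀ hp
    rw [mul_sub, mul_left_comm _ (algebraMap O F c), ← e0]
    have : algebraMap O F π * (branchCoord π (-c) (translateX 2 π u x) *
      (algebraMap O F u * mon π x y (1, -1, 0))) =
        algebraMap O F u * mon π x y (1, -1, 0) - algebraMap O F c := by
      simp only [branchCoord, translateX, mon, monom, zpow_neg, zpow_ofNat, map_neg]
      field_simp
    rw [this, hu']
    ring
  set p := mon π x y (1, -1, 0) with hpdef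
  set θ := branchCoord π c x with hθ
  set θ' := branchCoord π (-c) (translateX 2 π u x) with hθ'
  have hpV : p ∈ V := (V.valuation_le_one_iff _).mp hp1.le
  have hθV' : θ' ∈ V := by
    have e2 := congrArg V.valuation e1
    rw [map_mul, map_mul, hp1, hV.valuation_algebraMap h.isUnit, mul_one, mul_one] at e2
    rw [← V.valuation_le_one_iff, e2, V.valuation_le_one_iff]
    exact V.sub_mem (V.mul_mem _ _ (hO d) hpV) (V.mul_mem _ _ (hO c) hV.mem)
  obtain ⟨c', hc'⟩ := hc.exists_right_inv
  have hcc' : algebraMap O F c * algebraMap O F c' = 1 := by rw [← map_mul, hc', map_one]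
  -- On the component `c p = 1` and `u = c²`, so that the residues of `θ` and `θ'` satisfy `c θ =
  -- d / c - c θ'`.
  refine hV.of_relation (G := C (d * c') - C c * X) (H := C c) hθV' ?_ ?_
  · rw [aeval_C, hV.algebraMap_mem_nonunits, mem_maximalIdeal, mem_nonunits_iff, not_not]
    exact hc
  · have e3 : θ * aeval θ' (C c) - aeval θ' (C (d * c') - C c * X : O[X]) =
        (-(algebraMap O F d * algebraMap O F c' * θ) +
          θ' * (algebraMap O F c * θ - algebraMap O F d * p)) * algebraMap O F π := by
      rw [map_sub, map_mul (aeval θ') (C c), aeval_X, aeval_C, aeval_C, map_mul]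
      linear_combination e1 + (θ' * algebraMap O F c - algebraMap O F d * algebraMap O F c') * e0 -
        algebraMap O F d * p * hcc' - θ' * p * hu'
    rw [e3]
    refine ValuationSubring.mul_mem_nonunits (V.add_mem _ _ (V.neg_mem _ (V.mul_mem _ _
      (V.mul_mem _ _ (hO d) (hO c')) hV.mem)) (V.mul_mem _ _ hθV'
      (V.sub_mem (V.mul_mem _ _ (hO c) hV.mem) (V.mul_mem _ _ (hO d) hpV)))) (h.valuation_pi hV)

omit hu in
/-- The function `x / π` is the constant `c` on the component. -/
lemma inv_p_sub_mem : mon π x y (-1, 1, 0) - algebraMap O F c ∈ V.nonunits := by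
  have hp1 := h.valuation_p_of_branch hc hV
  have e1 := mon_mul_neg (1, -1, 0) (h.mon_ne_zero (1, -1, 0))
  have : mon π x y (-1, 1, 0) - algebraMap O F c =
      mon π x y (-(1, -1, 0)) * (1 - algebraMap O F c * mon π x y (1, -1, 0)) := by
    rw [show mon π x y (-1, 1, 0) = mon π x y (-(1, -1, 0)) from rfl]
    linear_combination algebraMap O F c * e1
  rw [this]
  refine ValuationSubring.mul_mem_nonunits ?_ (h.one_sub_lt hV)
  rw [← V.valuation_le_one_iff, mon, monom_neg, map_inv₀, hp1, inv_one]

omit hc hu in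
/-- The components of `I₀*` which meet the chart around `p = 0` are disjoint. -/
lemma exists_add_eq_of_branch {A : Subalgebra O F} (hA : mon π x y (1, -1, 0) ∈ A)
    {V₁ : ValuationSubring F} (h₁ : IsResTranscendental O V₁ x) : ∃ a ∈ A, ∃ b ∈ A,
    a ∈ V₁.nonunits ∧ b ∈ V.nonunits ∧ ∃ e : O, IsUnit e ∧ a + b = algebraMap O F e := by
  have hcp := A.mul_mem (A.algebraMap_mem c) hA
  exact ⟨_, hcp, _, A.sub_mem A.one_mem hcp, ValuationSubring.mul_mem_nonunits
    (h₁.algebraMap_mem c) ((h.hasOrders_coord two_ne_zero h₁).mem_nonunits _ (by decide)),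
    h.one_sub_lt hV, 1, isUnit_one, by rw [map_one]; ring⟩

omit hc hu in
/-- The components given by `c` and `-c` are disjoint, as `1 - c p` and `1 + c p` add up to `2`.
-/
lemma exists_add_eq_of_branch_neg {A : Subalgebra O F} (hA : mon π x y (1, -1, 0) ∈ A)
    {V' : ValuationSubring F} (hV' : IsResTranscendental O V' (branchCoord π (-c) x)) :
    ∃ a ∈ A, ∃ b ∈ A, a ∈ V.nonunits ∧ b ∈ V'.nonunits ∧
      ∃ e : O, IsUnit e ∧ a + b = algebraMap O F e :=
  ⟨_, A.sub_mem A.one_mem (A.mul_mem (A.algebraMap_mem c) hA), _,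
    A.sub_mem A.one_mem (A.mul_mem (A.algebraMap_mem (-c)) hA), h.one_sub_lt hV, h.one_sub_lt hV',
    2, h.isUnit_two, by rw [map_neg, map_ofNat]; ring⟩

omit hc hu hV [IsScalarTower O K F] in
/-- As `1 + c p` and `1 - c p` add up to the unit `2`, one of them is a unit. -/
lemma valuation_one_add_or (hW : ∀ r : O, algebraMap O F r ∈ W)
    (hp : mon π x y (1, -1, 0) ∈ W) (c : O) :
    W.valuation (1 + algebraMap O F c * mon π x y (1, -1, 0)) = 1 ∨
      W.valuation (1 + algebraMap O F (-c) * mon π x y (1, -1, 0)) = 1 := by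
  have h1 (c : O) : W.valuation (1 + algebraMap O F c * mon π x y (1, -1, 0)) ≤ 1 :=
    (W.valuation_le_one_iff _).mpr (W.add_mem _ _ W.one_mem (W.mul_mem _ _ (hW c) hp))
  obtain ⟨e, he⟩ := h.isUnit_two.exists_right_inv
  by_contra! h2
  have h3 := W.valuation.map_add_lt ((h1 c).lt_of_ne h2.1) ((h1 (-c)).lt_of_ne h2.2)
  have h4 := ValuationSubring.mul_mem_nonunits (hW e) (W.mem_nonunits_iff.mpr h3)
  have h5 : algebraMap O F e * (1 + algebraMap O F c * mon π x y (1, -1, 0) +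
      (1 + algebraMap O F (-c) * mon π x y (1, -1, 0))) = 1 := by
    have := congrArg (algebraMap O F) he
    rw [map_mul, map_ofNat, map_one] at this
    rw [map_neg]
    linear_combination this
  rw [h5, ValuationSubring.mem_nonunits_iff, map_one] at h4
  exact lt_irrefl _ h4

end Branch

/-- The component `0` is the double one, with coordinate `p = π / x`. It meets the others where
`p` is zero, infinite, `1 / c` and `-1 / c` respectively: the component `1` is the closure of the
special fibre of the Weierstrass equation, `2` is its translate, and `3` and `4` lie over the
roots of `1 - u p²`. The orders of `(π, x, y)` along them are `(2, 2, 3)`, `(2, 0, 0)`, `(2, 4,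
4)`, `(1, 1, 2)` and `(1, 1, 2)`. -/
theorem isPencilAtlas_signsI0star {c d : O} (hc : IsUnit c) (hu : u = c ^ 2 + π * d)
    {V : Fin 5 → ValuationSubring F} (h₀ : IsResTranscendental O (V 0) (mon π x y (1, -1, 0)))
    (h₁ : IsResTranscendental O (V 1) x) (h₂ : IsResTranscendental O (V 2) (translateX 2 π u x))
    (h₃ : IsResTranscendental O (V 3) (branchCoord π c x))
    (h₄ : IsResTranscendental O (V 4) (branchCoord π (-c) x)) :
    IsPencilAtlas (K := K) π x y exponentsI0star signsI0star typeI0star V ![2, 2, 2, 1, 1]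
      ![2, 0, 4, 1, 1] ![3, 0, 4, 2, 2] := by
  -- The components `i` which are visible on the charts `c`; below, `lci` describes the component
  -- `i` on the chart `c`, and `Ac` identifies the ring of the chart.
  have tab : ∀ (c : Fin 5) (i : Fin 5), IsVisible exponentsI0star (signsI0star c)
      ((![2, 2, 2, 1, 1] : Fin 5 → ℕ) i) ((![2, 0, 4, 1, 1] : Fin 5 → ℤ) i)
      ((![3, 0, 4, 2, 2] : Fin 5 → ℤ) i) → c = 0 ∧ i = 1 ∨ (c = 1 ∧ i = 0 ∨ c = 1 ∧ i = 1 ∨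
        c = 1 ∧ i = 3 ∨ c = 1 ∧ i = 4) ∨ (c = 2 ∧ i = 3 ∨ c = 2 ∧ i = 4) ∨ (c = 3 ∧ i = 0 ∨
        c = 3 ∧ i = 2 ∨ c = 3 ∧ i = 3 ∨ c = 3 ∧ i = 4) ∨ c = 4 ∧ i = 2 := by decide
  have hu₄ : u = (-c) ^ 2 + π * d := by rw [neg_sq, hu]
  -- The coordinates of the components `0`, `3` and `4` in terms of the translated curve.
  have h₀' := h₀.inv
  rw [mon, ← monom_neg] at h₀'
  replace h₀' := h.isResTranscendental_translate (e := (1, -1, 0)).mpr h₀'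
  have h₃' := h.isResTranscendental_branch_translate hc hu h₃
  have h₄' := h.isResTranscendental_branch_translate hc.neg hu₄ h₄
  have l01 := h.isLineChart_infinity (k := 1) h₁
  have l10 := h.isLineChart_doubleChart_one h₀
  have l11 := h.isLineChart_doubleChart_zero h₁
  have l13 := h.isLineChart_doubleChart_branch hc hu h₃
  have l14 := h.isLineChart_doubleChart_branch hc.neg hu₄ h₄
  have l23 := h.isLineChart_simpleChart hc hu h₃
  have l24 := h.isLineChart_simpleChart hc.neg hu₄ h₄
  have l30 := h.translate.isLineChart_doubleChart_one h₀'
  have l32 := h.translate.isLineChart_doubleChart_zero h₂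
  have l33 := h.translate.isLineChart_doubleChart_branch hc.neg hu₄ h₃'
  have l34 := h.translate.isLineChart_doubleChart_branch hc.neg.neg (by rw [neg_neg, hu]) h₄'
  have l42 := h.translate.isLineChart_infinity (k := 1) h₂
  have hπ : mon π x y (1, 0, 0) = algebraMap O F π := mon_pi
  have hπ' : mon π (translateX 2 π u x) (translateY 2 π u x y) (1, 0, 0) = algebraMap O F π := mon_pi
  have e1 (W : ValuationSubring F) : W.valuation 1 = 1 := map_one W.valuation
  have A0 := h.monAlg_sideExps_signsI0star_zero
  have A1 := h.monAlg_sideExps_signsI0star_one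
  have A2 := h.monAlg_sideExps_signsI0star_two
  have A3 := h.monAlg_sideExps_signsI0star_three
  have A4 := h.monAlg_sideExps_signsI0star_four
  exact
  { irreducible := h.irreducible
    ne_zero := h.mon_ne_zero
    ord := fun i ↦ by
      change Fin 5 at i
      fin_cases i
      exacts [h.hasOrders_one_of_two h₀, h.hasOrders_coord two_ne_zero h₁, HasOrders.translate h
        (fun r hr ↦ h₂.valuation_algebraMap hr) (h.translate.hasOrders_coord two_ne_zero h₂),
        h.hasOrders_of_branch hc hu h₃, h.hasOrders_of_branch hc.neg hu₄ h₄]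
    trans := fun i ↦ by
      change Fin 5 at i
      fin_cases i
      exacts [⟨_, h₀⟩, ⟨_, h₁⟩, ⟨_, h₂⟩, ⟨_, h₃⟩, ⟨_, h₄⟩]
    visible := by decide
    line := fun c i hci ↦ by
      rcases tab c i hci with ⟨rfl, rfl⟩ | (⟨rfl, rfl⟩ | ⟨rfl, rfl⟩ | ⟨rfl, rfl⟩ | ⟨rfl, rfl⟩) |
        (⟨rfl, rfl⟩ | ⟨rfl, rfl⟩) | (⟨rfl, rfl⟩ | ⟨rfl, rfl⟩ | ⟨rfl, rfl⟩ | ⟨rfl, rfl⟩) | ⟨rfl, rfl⟩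
      exacts [⟨_, _, _, A0 ▸ l01⟩, ⟨_, _, _, A1 ▸ l10⟩, ⟨_, _, _, A1 ▸ l11⟩, ⟨_, _, _, A1 ▸ l13⟩,
        ⟨_, _, _, A1 ▸ l14⟩, ⟨_, _, _, A2 ▸ l23⟩, ⟨_, _, _, A2 ▸ l24⟩, ⟨_, _, _, A3 ▸ l30⟩,
        ⟨_, _, _, A3 ▸ l32⟩, ⟨_, _, _, A3 ▸ l33⟩, ⟨_, _, _, A3 ▸ l34⟩, ⟨_, _, _, A4 ▸ l42⟩]
    exists_le := fun j W hW hWπ ↦ by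
      have hO (r : O) : algebraMap O F r ∈ W := hW _ (Subalgebra.algebraMap_mem _ r)
      revert hW
      fin_cases j
      · exact fun _ ↦ ⟨(1 : Fin 5), _, _, _, _, A0 ▸ l01, hπ.symm ▸ hWπ, e1 W⟩
      · change (∀ a ∈ monAlg π x y (sideExps exponentsI0star (signsI0star 1)), a ∈ W) → ∃ i t ϖ v m,
          IsLineChart (monAlg π x y (sideExps exponentsI0star (signsI0star 1))) _ _ _ _ _ ∧ _
        rw [A1]
        intro hW
        rcases h.exists_lt_one_doubleChart hW hWπ with hlt | hlt | hlt
        · exact ⟨(1 : Fin 5), _, _, _, _, l11, hlt, e1 W⟩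
        · exact ⟨(0 : Fin 5), _, _, _, _, l10, hlt, e1 W⟩
        · rcases h.valuation_one_add_or hO (hW _ (mon_mem_monAlg (by decide))) c with hv | hv
          exacts [⟨(3 : Fin 5), _, _, _, _, l13, hlt, hv⟩, ⟨(4 : Fin 5), _, _, _, _, l14, hlt, hv⟩]
      · change (∀ a ∈ monAlg π x y (sideExps exponentsI0star (signsI0star 2)), a ∈ W) → ∃ i t ϖ v m,
          IsLineChart (monAlg π x y (sideExps exponentsI0star (signsI0star 2))) _ _ _ _ _ ∧ _
        rw [A2]
        intro hW
        rcases h.valuation_one_add_or hO (hW _ (mon_mem_monAlg (by decide))) c with hv | hv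
        exacts [⟨(3 : Fin 5), _, _, _, _, l23, hπ.symm ▸ hWπ, hv⟩,
          ⟨(4 : Fin 5), _, _, _, _, l24, hπ.symm ▸ hWπ, hv⟩]
      · change (∀ a ∈ monAlg π x y (sideExps exponentsI0star (signsI0star 3)), a ∈ W) → ∃ i t ϖ v m,
          IsLineChart (monAlg π x y (sideExps exponentsI0star (signsI0star 3))) _ _ _ _ _ ∧ _
        rw [A3]
        intro hW
        rcases h.translate.exists_lt_one_doubleChart hW hWπ with hlt | hlt | hlt
        · exact ⟨(2 : Fin 5), _, _, _, _, l32, hlt, e1 W⟩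
        · exact ⟨(0 : Fin 5), _, _, _, _, l30, hlt, e1 W⟩
        · rcases h.translate.valuation_one_add_or hO (hW _ (mon_mem_monAlg (by decide))) (-c)
            with hv | hv
          exacts [⟨(3 : Fin 5), _, _, _, _, l33, hlt, hv⟩, ⟨(4 : Fin 5), _, _, _, _, l34, hlt, hv⟩]
      · exact fun _ ↦ ⟨(2 : Fin 5), _, _, _, _, A4 ▸ l42, hπ'.symm ▸ hWπ, e1 W⟩
    disjoint := fun i j hij h0 c' hi hj ↦ by
      -- The pairs of simple components which are visible on a common chart.
      have key := (by decide : ∀ c i j : Fin 5, i < j → i.val ≠ 0 →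
        IsVisible exponentsI0star (signsI0star c)
          ((![2, 2, 2, 1, 1] : Fin 5 → ℕ) i) ((![2, 0, 4, 1, 1] : Fin 5 → ℤ) i)
          ((![3, 0, 4, 2, 2] : Fin 5 → ℤ) i) →
        IsVisible exponentsI0star (signsI0star c)
          ((![2, 2, 2, 1, 1] : Fin 5 → ℕ) j) ((![2, 0, 4, 1, 1] : Fin 5 → ℤ) j)
          ((![3, 0, 4, 2, 2] : Fin 5 → ℤ) j) → (c, i, j) ∈ [((1 : Fin 5), (1 : Fin 5), (3 : Fin 5)),
        (1, 1, 4), (3, 2, 3), (3, 2, 4), (1, 3, 4), (2, 3, 4), (3, 3, 4)]) c' i j hij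
        ((by decide : ∀ i j : Fin typeI0star.n, i < j → typeI0star.inter i j = 0 → i.val ≠ 0) i j
          hij h0) hi hj
      simp only [List.mem_cons, Prod.mk.injEq, List.not_mem_nil, or_false] at key
      rcases key with ⟨rfl, rfl, rfl⟩ | ⟨rfl, rfl, rfl⟩ | ⟨rfl, rfl, rfl⟩ | ⟨rfl, rfl, rfl⟩ |
        ⟨rfl, rfl, rfl⟩ | ⟨rfl, rfl, rfl⟩ | ⟨rfl, rfl, rfl⟩
      · exact h.exists_add_eq_of_branch h₃ (mon_mem_monAlg (by decide)) h₁
      · exact h.exists_add_eq_of_branch h₄ (mon_mem_monAlg (by decide)) h₁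
      · rw [A3]
        exact h.translate.exists_add_eq_of_branch h₃' (mon_mem_monAlg (by decide)) h₂
      · rw [A3]
        exact h.translate.exists_add_eq_of_branch h₄' (mon_mem_monAlg (by decide)) h₂
      · exact h.exists_add_eq_of_branch_neg h₃ (mon_mem_monAlg (by decide)) h₄
      · exact h.exists_add_eq_of_branch_neg h₃ (mon_mem_monAlg (by decide)) h₄
      · rw [A3]
        exact h.translate.exists_add_eq_of_branch_neg h₃' (mon_mem_monAlg (by decide)) h₄'
    meet := fun i j hij h0 ↦ by
      -- The components `0`, `3` and `4` are also visible on the chart `3`. The quotient of the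
      -- sections of the charts `1` and `3` is `x / π`, which is a nonzero constant on the
      -- components `3` and `4`.
      have hdiv : pencilSection (fun j ↦ mon π x y (exponentsI0star j)) (signsI0star 1) /
          pencilSection (fun j ↦ mon π x y (exponentsI0star j)) (signsI0star 3) =
          mon π x y (-1, 1, 0) :=
        (pencilSection_div (fun _ ↦ h.mon_ne_zero _) 1 (by decide) (by decide) (by decide)).trans
          (monom_neg _).symm
      rcases (by decide : ∀ i j : Fin 5, i < j → i.val = 0 → i = 0 ∧ j = 1 ∨
        i = 0 ∧ j = 2 ∨ i = 0 ∧ j = 3 ∨ i = 0 ∧ j = 4) i j hij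
        ((by decide : ∀ i j : Fin typeI0star.n, i < j → typeI0star.inter i j ≠ 0 → i.val = 0) i j hij h0)
        with
        ⟨rfl, rfl⟩ | ⟨rfl, rfl⟩ | ⟨rfl, rfl⟩ | ⟨rfl, rfl⟩
      · refine ⟨1, .inl (A1 ▸ l10.meetsAt_one l11), fun c h0 h1 hc ↦ ?_⟩
        exact absurd ((by decide : ∀ c, IsVisible exponentsI0star (signsI0star c) 2 2 3 →
          IsVisible exponentsI0star (signsI0star c) 2 0 0 → c = 1) c h0 h1) hc
      · refine ⟨3, .inl (A3 ▸ l30.meetsAt_one l32), fun c h0 h1 hc ↦ ?_⟩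
        exact absurd ((by decide : ∀ c, IsVisible exponentsI0star (signsI0star c) 2 2 3 →
          IsVisible exponentsI0star (signsI0star c) 2 4 4 → c = 3) c h0 h1) hc
      · refine ⟨1, .inr (A1 ▸ l13.meetsAt_one l10), fun c' h0 h1 hc' ↦ ?_⟩
        obtain rfl := (by decide : ∀ c, IsVisible exponentsI0star (signsI0star c) 2 2 3 →
          IsVisible exponentsI0star (signsI0star c) 1 1 2 → c ≠ 1 → c = 3) c' h0 h1 hc'
        rw [hdiv]
        exact ⟨c, hc, h.inv_p_sub_mem hc h₃⟩
      · refine ⟨1, .inr (A1 ▸ l14.meetsAt_one l10), fun c' h0 h1 hc' ↦ ?_⟩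
        obtain rfl := (by decide : ∀ c, IsVisible exponentsI0star (signsI0star c) 2 2 3 →
          IsVisible exponentsI0star (signsI0star c) 1 1 2 → c ≠ 1 → c = 3) c' h0 h1 hc'
        rw [hdiv]
        exact ⟨-c, hc.neg, h.inv_p_sub_mem hc.neg h₄⟩
    cover := fun W hW ↦ h.exists_le_signsI0star hW
    generic := fun c ↦ by
      fin_cases c
      exacts [A0 ▸ h.exists_isFunctionField_infinityChart,
        A1 ▸ h.exists_isFunctionField_doubleChart, A2 ▸ h.exists_isFunctionField_simpleChart,
        A3 ▸ h.translate.exists_isFunctionField_doubleChart,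
        A4 ▸ h.translate.exists_isFunctionField_infinityChart] }

end Two

end IsCurve

end Instances

/-! ### A fibre of type `III*` -/

lemma forall_mem_seven {α : Type*} {p : α → Prop} {a b c d e f g : α} (ha : p a) (hb : p b)
    (hc : p c) (hd : p d) (he : p e) (hf : p f) (hg : p g) : ∀ x ∈ [a, b, c, d, e, f, g], p x := by
  simp [ha, hb, hc, hd, he, hf, hg]

section Instances

variable {K F : Type u} [Field K] [Field F] [Algebra K F] {O : ValuationSubring K} [Algebra O F]
variable [IsScalarTower O K F] {k : ℕ} {π u : O} {x y : F} {V W : ValuationSubring F}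

namespace IsCurve

variable (h : IsCurve 3 π u x y)

/-- The pencils `y / x`, `x / π`, `y / π²`, `π³ / x²`, `π y / x²`, `π² / x` and `y / (π x)`. -/
abbrev _root_.EllipticFibre.exponentsIIIstar : Fin 7 → ℤ × ℤ × ℤ :=
  ![(0, -1, 1), (-1, 1, 0), (-2, 0, 1), (3, -2, 0), (1, -2, 1), (2, -1, 0), (-1, -1, 1)]

/-- The charts along the long chain of components; the chart number `4` meets only the component
outside this chain, and the translation exchanges the charts number `i` and `8 - i`. -/
abbrev _root_.EllipticFibre.signsIIIstar : Fin 9 → Fin 7 → Bool :=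
  ![![false, false, false, true, true, true, false], ![true, false, false, true, true, true, false],
    ![true, true, false, true, true, true, false], ![true, true, true, true, true, true, false],
    ![true, true, true, true, true, true, true], ![true, true, true, false, true, true, false],
    ![true, true, true, false, false, true, false], ![true, true, true, false, false, false, false],
    ![false, true, true, false, false, false, false]]

include h

lemma monAlg_sideExps_signsIIIstar_zero :
    monAlg π x y (sideExps exponentsIIIstar (signsIIIstar 0)) = monAlg π x y infinityChart := by
  have hz : mon π x y (0, 1, -1) ∈ monAlg π x y infinityChart := mon_mem_monAlg (by decide)
  have hq : mon π x y (0, -1, 0) ∈ monAlg π x y infinityChart := mon_mem_monAlg (by decide)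
  have hδ := h.delta_mem (h.mon_mem hq hq hq 3 2 0 0 (by decide))
  have hz' : mon π x y (0, 1, -1) ∈ monAlg π x y (sideExps exponentsIIIstar (signsIIIstar 0)) :=
    mon_mem_monAlg (by decide)
  have hδ' : mon π x y (0, -3, 2) ∈ monAlg π x y (sideExps exponentsIIIstar (signsIIIstar 0)) :=
    h.delta_mem (mon_mem_monAlg (by decide))
  exact le_antisymm (monAlg_le (forall_mem_seven (p := fun e ↦ mon π x y e ∈ _) hz
    (h.mon_mem hq hq hq 1 1 0 0 (by decide)) (h.mon_mem hz hq hq 2 1 1 0 (by decide))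
    (h.mon_mem hq hq hq 3 2 0 0 (by decide)) (h.mon_mem hz hδ hq 1 1 1 0 (by decide))
    (h.mon_mem hq hq hq 2 1 0 0 (by decide)) (h.mon_mem hz hq hq 1 1 0 0 (by decide))))
    (monAlg_le (forall_mem_pair hz' (h.mon_mem hz' hδ' hz' 0 2 1 0 (by decide))))

lemma monAlg_sideExps_signsIIIstar_one :
    monAlg π x y (sideExps exponentsIIIstar (signsIIIstar 1)) = monAlg π x y chartA := by
  have hr : mon π x y (0, -1, 1) ∈ monAlg π x y chartA := mon_mem_monAlg (by decide)
  have hp : mon π x y (1, -1, 0) ∈ monAlg π x y chartA := mon_mem_monAlg (by decide)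
  have hκ : mon π x y (1, 1, -1) ∈ monAlg π x y chartA := mon_mem_monAlg (by decide)
  exact le_antisymm (monAlg_le (forall_mem_seven (p := fun e ↦ mon π x y e ∈ _) hr hp
    (h.mon_mem hp hκ hp 0 1 1 0 (by decide))
    (h.mon_mem hp hr h.delta_mem_chartA.1 0 3 2 1 (by decide))
    (h.mon_mem hp hr hp 0 1 1 0 (by decide)) (h.mon_mem hp hp hp 1 1 0 0 (by decide)) hκ))
    (monAlg_le (forall_mem_triple (mon_mem_monAlg (by decide)) (mon_mem_monAlg (by decide))
      (mon_mem_monAlg (by decide))))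

lemma monAlg_sideExps_signsIIIstar_two :
    monAlg π x y (sideExps exponentsIIIstar (signsIIIstar 2)) = monAlg π x y chartB := by
  have hb : mon π x y (-1, 1, 0) ∈ monAlg π x y chartB := mon_mem_monAlg (by decide)
  have hf : mon π x y (2, 0, -1) ∈ monAlg π x y chartB := mon_mem_monAlg (by decide)
  have hτ : mon π x y (3, -2, 0) ∈ monAlg π x y chartB := mon_mem_monAlg (by decide)
  have hδ := h.delta_mem_chartB.2
  exact le_antisymm (monAlg_le (forall_mem_seven (p := fun e ↦ mon π x y e ∈ _)
    (h.mon_mem hb hf hδ 0 2 1 1 (by decide)) hb hf hτ (h.mon_mem hb hf hδ 0 1 1 1 (by decide))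
    (h.mon_mem hτ hb hb 0 1 1 0 (by decide)) (h.mon_mem hb hf hb 0 1 1 0 (by decide))))
    (monAlg_le (forall_mem_triple (mon_mem_monAlg (by decide)) (mon_mem_monAlg (by decide))
      (mon_mem_monAlg (by decide))))

/-- The function `x³ / (π² y)` in terms of the pencils. -/
lemma omega_eq_of_three : mon π x y (-2, 3, -1) = mon π x y (-2, 0, 1) +
    algebraMap O F u * mon π x y (1, 1, -1) := by
  have hx := h.x_ne_zero
  have hy := h.y_ne_zero
  have hp := h.p_ne_zero
  have := h.equation
  simp only [mon, monom, zpow_neg, zpow_ofNat]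
  field_simp
  linear_combination -this

lemma monAlg_sideExps_signsIIIstar_three :
    monAlg π x y (sideExps exponentsIIIstar (signsIIIstar 3)) = monAlg π x y chartC := by
  have hτ : mon π x y (3, -2, 0) ∈ monAlg π x y chartC := mon_mem_monAlg (by decide)
  have hω : mon π x y (-2, 3, -1) ∈ monAlg π x y chartC := mon_mem_monAlg (by decide)
  have hδ := h.delta_mem_chartC
  refine le_antisymm (monAlg_le (forall_mem_seven (p := fun e ↦ mon π x y e ∈ _)
    (h.mon_mem hτ hω hδ 0 2 3 2 (by decide)) (h.mon_mem hτ hω hδ 0 1 2 1 (by decide))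
    (h.mon_mem hω hδ hδ 0 1 1 0 (by decide)) hτ (h.mon_mem hτ hω hδ 0 1 1 1 (by decide))
    (h.mon_mem hτ hω hδ 0 2 2 1 (by decide)) (h.mon_mem hτ hω hδ 0 1 1 0 (by decide))))
    (monAlg_le (forall_mem_pair (mon_mem_monAlg (by decide)) ?_))
  rw [h.omega_eq_of_three]
  exact Subalgebra.add_mem _ (mon_mem_monAlg (by decide)) (Subalgebra.mul_mem _
    (Subalgebra.algebraMap_mem _ u) (mon_mem_monAlg (by decide)))

lemma monAlg_sideExps_signsIIIstar_four :
    monAlg π x y (sideExps exponentsIIIstar (signsIIIstar 4)) = monAlg π x y chartD := by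
  have hb : mon π x y (-1, 1, 0) ∈ monAlg π x y chartD := mon_mem_monAlg (by decide)
  have hs : mon π x y (-1, -1, 1) ∈ monAlg π x y chartD := mon_mem_monAlg (by decide)
  have hτ : mon π x y (3, -2, 0) ∈ monAlg π x y chartD := mon_mem_monAlg (by decide)
  exact le_antisymm (monAlg_le (forall_mem_seven (p := fun e ↦ mon π x y e ∈ _)
    (h.mon_mem hs hs hs 1 1 0 0 (by decide)) hb (h.mon_mem hs hb hb 0 1 1 0 (by decide)) hτ
    (h.mon_mem hτ hs hb 0 1 1 1 (by decide)) (h.mon_mem hτ hb hb 0 1 1 0 (by decide)) hs))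
    (monAlg_le (forall_mem_triple (mon_mem_monAlg (by decide)) (mon_mem_monAlg (by decide))
      (mon_mem_monAlg (by decide))))

lemma monAlg_sideExps_signsIIIstar_five :
    monAlg π x y (sideExps exponentsIIIstar (signsIIIstar 5)) =
      monAlg π (translateX 3 π u x) (translateY 3 π u x y) chartC := by
  rw [← h.translate.monAlg_sideExps_signsIIIstar_three, h.monAlg_translate]
  exact monAlg_congr (by decide) (by decide)

lemma monAlg_sideExps_signsIIIstar_six :
    monAlg π x y (sideExps exponentsIIIstar (signsIIIstar 6)) =
      monAlg π (translateX 3 π u x) (translateY 3 π u x y) chartB := by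
  rw [← h.translate.monAlg_sideExps_signsIIIstar_two, h.monAlg_translate]
  exact monAlg_congr (by decide) (by decide)

lemma monAlg_sideExps_signsIIIstar_seven :
    monAlg π x y (sideExps exponentsIIIstar (signsIIIstar 7)) =
      monAlg π (translateX 3 π u x) (translateY 3 π u x y) chartA := by
  rw [← h.translate.monAlg_sideExps_signsIIIstar_one, h.monAlg_translate]
  exact monAlg_congr (by decide) (by decide)

lemma monAlg_sideExps_signsIIIstar_eight :
    monAlg π x y (sideExps exponentsIIIstar (signsIIIstar 8)) =
      monAlg π (translateX 3 π u x) (translateY 3 π u x y) infinityChart := by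
  rw [← h.translate.monAlg_sideExps_signsIIIstar_zero, h.monAlg_translate]
  exact monAlg_congr (by decide) (by decide)

/-- In the half of the model where `τ = π³ / x²` and `π x / y` are integral, the chart is found by
testing along the chain whether `y / π²`, `x / π` and `y / x` are integral. -/
lemma forall_mem_chart_of_three (hW : ∀ r : O, algebraMap O F r ∈ W)
    (hτ : mon π x y (3, -2, 0) ∈ W) (hκ : mon π x y (1, 1, -1) ∈ W) :
    (∀ a ∈ monAlg π x y infinityChart, a ∈ W) ∨ (∀ a ∈ monAlg π x y chartA, a ∈ W) ∨
      (∀ a ∈ monAlg π x y chartB, a ∈ W) ∨ ∀ a ∈ monAlg π x y chartC, a ∈ W := by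
  rcases mon_mem_or π x y W (-2, 0, 1) with hg | hf
  · refine .inr (.inr (.inr (forall_mem_monAlg hW (forall_mem_pair hτ ?_))))
    rw [h.omega_eq_of_three]
    exact W.add_mem _ _ hg (W.mul_mem _ _ (hW u) hκ)
  rcases mon_mem_or π x y W (-1, 1, 0) with hb | hp
  · exact .inr (.inr (.inl (forall_mem_monAlg hW
      (forall_mem_triple (p := fun e ↦ mon π x y e ∈ W) hb hf hτ))))
  rcases mon_mem_or π x y W (0, -1, 1) with hr | hz
  · exact .inr (.inl (forall_mem_monAlg hW
      (forall_mem_triple (p := fun e ↦ mon π x y e ∈ W) hr hp hκ)))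
  refine .inl (forall_mem_monAlg hW (forall_mem_pair (p := fun e ↦ mon π x y e ∈ W) hz ?_))
  -- The function `1 / x` is `(x / y)² δ`, where `δ = 1 - u τ` is integral.
  have e1 : mon π x y (0, -1, 0) = mon π x y (-(0, -1, 1)) ^ 2 *
      (1 - algebraMap O F u * mon π x y (3, -2, 0)) := by
    have := h.delta_add
    push_cast at this
    rw [← this, add_sub_cancel_right, ← zpow_natCast, ← mon_smul, ← h.monom_add]
    rfl
  rw [e1]
  exact W.mul_mem _ _ (W.pow_mem hz 2) (W.sub_mem W.one_mem (W.mul_mem _ _ (hW u) hτ))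

/-- Where `s = y / (π x)` is integral, `b = x / π` is integral as well, because of the relation
`b² = π (u + b s²)`. -/
lemma mem_of_slope_mem (hW : ∀ r : O, algebraMap O F r ∈ W) (hs : mon π x y (-1, -1, 1) ∈ W) :
    mon π x y (-1, 1, 0) ∈ W ∧ mon π x y (-3, 2, 0) ∈ W := by
  have hsb : mon π x y (-3, -1, 2) = mon π x y (-1, 1, 0) * mon π x y (-1, -1, 1) ^ 2 := by
    rw [← zpow_natCast, ← mon_smul, ← h.monom_add]
    rfl
  have hb : mon π x y (-1, 1, 0) ∈ W := by
    rcases mon_mem_or π x y W (-1, 1, 0) with hb | hb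
    · exact hb
    · have e1 : mon π x y (-1, 1, 0) =
          algebraMap O F π * (mon π x y (-(-1, 1, 0)) * mon π x y (-3, 2, 0)) := by
        rw [← mon_pi (x := x) (y := y), ← h.monom_add, ← h.monom_add]
        rfl
      have e2 := mon_mul_neg (-1, 1, 0) (h.mon_ne_zero (-1, 1, 0))
      rw [h.inv_tau_eq, hsb] at e1
      have e3 : mon π x y (-1, 1, 0) = algebraMap O F π *
          (mon π x y (-(-1, 1, 0)) * algebraMap O F u + mon π x y (-1, -1, 1) ^ 2) := by
        linear_combination e1 + algebraMap O F π * mon π x y (-1, -1, 1) ^ 2 * e2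
      rw [e3]
      exact W.mul_mem _ _ (hW π) (W.add_mem _ _ (W.mul_mem _ _ hb (hW u)) (W.pow_mem hs 2))
  refine ⟨hb, ?_⟩
  rw [h.inv_tau_eq, hsb]
  exact W.add_mem _ _ (hW u) (W.mul_mem _ _ hb (W.pow_mem hs 2))

/-- The charts cover. Where `s = y / (π x)` is integral, all generators of the chart number `4`
are. Otherwise one of `τ = π³ / x²` and its inverse is integral, and these cases are exchanged by
the translation. -/
lemma exists_le_signsIIIstar (hW : ∀ r : O, algebraMap O F r ∈ W) :
    ∃ c, ∀ a ∈ monAlg π x y (sideExps exponentsIIIstar (signsIIIstar c)), a ∈ W := by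
  rcases mon_mem_or π x y W (-1, -1, 1) with hs | hκ
  · have hτ := (h.mon_translate_mem_iff hW _).mp
      (h.translate.mem_of_slope_mem hW ((h.mon_translate_mem_iff hW (-1, -1, 1)).mpr hs)).2
    refine ⟨4, ?_⟩
    rw [h.monAlg_sideExps_signsIIIstar_four]
    exact forall_mem_monAlg hW (forall_mem_triple (p := fun e ↦ mon π x y e ∈ W)
      (h.mem_of_slope_mem hW hs).1 hs hτ)
  rcases mon_mem_or π x y W (3, -2, 0) with hτ | hτ
  · rcases h.forall_mem_chart_of_three hW hτ hκ with h1 | h1 | h1 | h1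
    exacts [⟨0, h.monAlg_sideExps_signsIIIstar_zero ▸ h1⟩,
      ⟨1, h.monAlg_sideExps_signsIIIstar_one ▸ h1⟩, ⟨2, h.monAlg_sideExps_signsIIIstar_two ▸ h1⟩,
      ⟨3, h.monAlg_sideExps_signsIIIstar_three ▸ h1⟩]
  · rcases h.translate.forall_mem_chart_of_three hW ((h.mon_translate_mem_iff hW _).mpr hτ)
      ((h.mon_translate_mem_iff hW _).mpr hκ) with h1 | h1 | h1 | h1
    exacts [⟨8, h.monAlg_sideExps_signsIIIstar_eight ▸ h1⟩,
      ⟨7, h.monAlg_sideExps_signsIIIstar_seven ▸ h1⟩, ⟨6, h.monAlg_sideExps_signsIIIstar_six ▸ h1⟩,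
      ⟨5, h.monAlg_sideExps_signsIIIstar_five ▸ h1⟩]

lemma exists_isFunctionField_chartA : ∃ (a : K) (x' y' : F), IsFunctionField a x' y' ∧
    x' ∈ monAlg π x y chartA ∧ y' ∈ monAlg π x y chartA := by
  have hr : mon π x y (0, -1, 1) ∈ monAlg π x y chartA := mon_mem_monAlg (by decide)
  have hp : mon π x y (1, -1, 0) ∈ monAlg π x y chartA := mon_mem_monAlg (by decide)
  exact h.exists_isFunctionField_translate (h.mon_mem hp hp hp 2 1 0 0 (by decide))
    (h.mon_mem hp hr hr 2 1 1 0 (by decide))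

lemma exists_isFunctionField_chartB : ∃ (a : K) (x' y' : F), IsFunctionField a x' y' ∧
    x' ∈ monAlg π x y chartB ∧ y' ∈ monAlg π x y chartB := by
  have hb : mon π x y (-1, 1, 0) ∈ monAlg π x y chartB := mon_mem_monAlg (by decide)
  have hf : mon π x y (2, 0, -1) ∈ monAlg π x y chartB := mon_mem_monAlg (by decide)
  exact h.exists_isFunctionField (h.mon_mem hb hb hb 1 1 0 0 (by decide))
    (h.mon_mem hb hf h.delta_mem_chartB.2 1 3 1 1 (by decide))

lemma exists_isFunctionField_chartC : ∃ (a : K) (x' y' : F), IsFunctionField a x' y' ∧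
    x' ∈ monAlg π x y chartC ∧ y' ∈ monAlg π x y chartC := by
  have hτ : mon π x y (3, -2, 0) ∈ monAlg π x y chartC := mon_mem_monAlg (by decide)
  have hω : mon π x y (-2, 3, -1) ∈ monAlg π x y chartC := mon_mem_monAlg (by decide)
  have hδ := h.delta_mem_chartC
  exact h.exists_isFunctionField (h.mon_mem hτ hω hδ 1 1 2 1 (by decide))
    (h.mon_mem hω hδ hδ 2 1 1 0 (by decide))

lemma exists_isFunctionField_chartD : ∃ (a : K) (x' y' : F), IsFunctionField a x' y' ∧
    x' ∈ monAlg π x y chartD ∧ y' ∈ monAlg π x y chartD := by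
  have hb : mon π x y (-1, 1, 0) ∈ monAlg π x y chartD := mon_mem_monAlg (by decide)
  have hs : mon π x y (-1, -1, 1) ∈ monAlg π x y chartD := mon_mem_monAlg (by decide)
  exact h.exists_isFunctionField (h.mon_mem hb hb hb 1 1 0 0 (by decide))
    (h.mon_mem hs hb hb 2 1 1 0 (by decide))

/-- The component outside the long chain is disjoint from that of multiplicity `3`: the functions
`u τ` and `δ` vanish on one of them each, and add up to one. -/
lemma exists_add_eq_of_three {V₂ V₇ : ValuationSubring F} {A : Subalgebra O F}
    (hA : mon π x y (3, -2, 0) ∈ A) (h₂ : IsResTranscendental O V₂ (mon π x y (-2, 0, 1)))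
    (h₇ : IsResTranscendental O V₇ (mon π x y (-1, -1, 1))) : ∃ a ∈ A, ∃ b ∈ A,
    a ∈ V₂.nonunits ∧ b ∈ V₇.nonunits ∧ ∃ e : O, IsUnit e ∧ a + b = algebraMap O F e :=
  ⟨_, A.mul_mem (A.algebraMap_mem u) hA, _, h.delta_mem hA, ValuationSubring.mul_mem_nonunits
    (h₂.algebraMap_mem u) ((h.hasOrders_two_of_three h₂).mem_nonunits _ (by decide)),
    (h.hasOrders_seven_of_three h₇).mem_nonunits _ (by decide), 1, isUnit_one, by
      rw [map_one, add_comm]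
      exact h.delta_add⟩

set_option synthInstance.maxSize 1024 in
/-- The components `0`, …, `6` form the long chain, and `7` is the component outside of it. The
component `3` is the one of multiplicity `4`, with coordinate `τ = π³ / x²`, and the translation
exchanges `i` and `6 - i`. The lists are the orders of `π`, `x` and `y` along the components. -/
theorem isPencilAtlas_signsIIIstar {V : Fin 8 → ValuationSubring F}
    (h₀ : IsResTranscendental O (V 0) x) (h₁ : IsResTranscendental O (V 1) (mon π x y (-1, 1, 0)))
    (h₂ : IsResTranscendental O (V 2) (mon π x y (-2, 0, 1)))
    (h₃ : IsResTranscendental O (V 3) (mon π x y (3, -2, 0)))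
    (h₄ : IsResTranscendental O (V 4) (mon π (translateX 3 π u x) (translateY 3 π u x y) (-2, 0, 1)))
    (h₅ : IsResTranscendental O (V 5) (mon π (translateX 3 π u x) (translateY 3 π u x y) (-1, 1, 0)))
    (h₆ : IsResTranscendental O (V 6) (translateX 3 π u x))
    (h₇ : IsResTranscendental O (V 7) (mon π x y (-1, -1, 1))) :
    IsPencilAtlas (K := K) π x y exponentsIIIstar signsIIIstar typeIIIstar V
      ![2, 2, 3, 4, 3, 2, 2, 2] ![0, 2, 4, 6, 5, 4, 6, 3] ![0, 3, 6, 9, 7, 5, 6, 5] := by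
  -- The components `i` which are visible on the charts `c`; below, `lci` describes the component
  -- `i` on the chart `c`, and `Ac` identifies the ring of the chart.
  have tab : ∀ (c : Fin 9) (i : Fin 8), IsVisible exponentsIIIstar (signsIIIstar c)
      ((![2, 2, 3, 4, 3, 2, 2, 2] : Fin 8 → ℕ) i) ((![0, 2, 4, 6, 5, 4, 6, 3] : Fin 8 → ℤ) i)
      ((![0, 3, 6, 9, 7, 5, 6, 5] : Fin 8 → ℤ) i) → (c, i) ∈ [((0 : Fin 9), (0 : Fin 8)), (1, 0),
        (1, 1), (2, 1), (2, 2), (3, 2), (3, 3), (3, 7), (4, 7), (5, 4), (5, 3), (5, 7), (6, 5),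
        (6, 4), (7, 6), (7, 5), (8, 6)] := by decide
  simp only [List.mem_cons, Prod.mk.injEq, List.not_mem_nil, or_false] at tab
  -- The components `3` and `7` are preserved by the translation.
  have h₃' := h₃.inv
  rw [mon, ← monom_neg] at h₃'
  replace h₃' := h.isResTranscendental_translate (e := (3, -2, 0)).mpr h₃'
  have h₇' := h.isResTranscendental_translate (e := (-1, -1, 1)).mpr h₇
  have l00 := h.isLineChart_infinity (k := 2) h₀
  have l10 := h.isLineChart_chartA_zero h₀
  have l11 := h.isLineChart_chartA_one h₁
  have l21 := h.isLineChart_chartB_one h₁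
  have l22 := h.isLineChart_chartB_two h₂
  have l32 := h.isLineChart_chartC_two h₂
  have l33 := h.isLineChart_chartC_three h₃
  have l37 := h.isLineChart_chartC_seven h₇
  have l47 := h.isLineChart_chartD_seven h₇
  have l54 := h.translate.isLineChart_chartC_two h₄
  have l53 := h.translate.isLineChart_chartC_three h₃'
  have l57 := h.translate.isLineChart_chartC_seven h₇'
  have l65 := h.translate.isLineChart_chartB_one h₅
  have l64 := h.translate.isLineChart_chartB_two h₄
  have l76 := h.translate.isLineChart_chartA_zero h₆
  have l75 := h.translate.isLineChart_chartA_one h₅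
  have l86 := h.translate.isLineChart_infinity (k := 2) h₆
  have hπ : mon π x y (1, 0, 0) = algebraMap O F π := mon_pi
  have hπ' : mon π (translateX 3 π u x) (translateY 3 π u x y) (1, 0, 0) = algebraMap O F π := mon_pi
  have e1 (W : ValuationSubring F) : W.valuation 1 = 1 := map_one W.valuation
  have A0 := h.monAlg_sideExps_signsIIIstar_zero
  have A1 := h.monAlg_sideExps_signsIIIstar_one
  have A2 := h.monAlg_sideExps_signsIIIstar_two
  have A3 := h.monAlg_sideExps_signsIIIstar_three
  have A4 := h.monAlg_sideExps_signsIIIstar_four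
  have A5 := h.monAlg_sideExps_signsIIIstar_five
  have A6 := h.monAlg_sideExps_signsIIIstar_six
  have A7 := h.monAlg_sideExps_signsIIIstar_seven
  have A8 := h.monAlg_sideExps_signsIIIstar_eight
  exact
  { irreducible := h.irreducible
    ne_zero := h.mon_ne_zero
    ord := fun i ↦ by
      change Fin 8 at i
      fin_cases i
      exacts [h.hasOrders_coord three_ne_zero h₀, h.hasOrders_one_of_three h₁,
        h.hasOrders_two_of_three h₂, h.hasOrders_three_of_three h₃,
        HasOrders.translate h (fun r hr ↦ h₄.valuation_algebraMap hr)
          (h.translate.hasOrders_two_of_three h₄),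
        HasOrders.translate h (fun r hr ↦ h₅.valuation_algebraMap hr)
          (h.translate.hasOrders_one_of_three h₅),
        HasOrders.translate h (fun r hr ↦ h₆.valuation_algebraMap hr)
          (h.translate.hasOrders_coord three_ne_zero h₆), h.hasOrders_seven_of_three h₇]
    trans := fun i ↦ by
      change Fin 8 at i
      fin_cases i
      exacts [⟨_, h₀⟩, ⟨_, h₁⟩, ⟨_, h₂⟩, ⟨_, h₃⟩, ⟨_, h₄⟩, ⟨_, h₅⟩, ⟨_, h₆⟩, ⟨_, h₇⟩]
    visible := by decide
    line := fun c i hci ↦ by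
      rcases tab c i hci with ⟨rfl, rfl⟩ | ⟨rfl, rfl⟩ | ⟨rfl, rfl⟩ | ⟨rfl, rfl⟩ | ⟨rfl, rfl⟩ |
        ⟨rfl, rfl⟩ | ⟨rfl, rfl⟩ | ⟨rfl, rfl⟩ | ⟨rfl, rfl⟩ | ⟨rfl, rfl⟩ | ⟨rfl, rfl⟩ | ⟨rfl, rfl⟩ |
        ⟨rfl, rfl⟩ | ⟨rfl, rfl⟩ | ⟨rfl, rfl⟩ | ⟨rfl, rfl⟩ | ⟨rfl, rfl⟩
      exacts [⟨_, _, _, A0 ▸ l00⟩, ⟨_, _, _, A1 ▸ l10⟩, ⟨_, _, _, A1 ▸ l11⟩, ⟨_, _, _, A2 ▸ l21⟩,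
        ⟨_, _, _, A2 ▸ l22⟩, ⟨_, _, _, A3 ▸ l32⟩, ⟨_, _, _, A3 ▸ l33⟩, ⟨_, _, _, A3 ▸ l37⟩,
        ⟨_, _, _, A4 ▸ l47⟩, ⟨_, _, _, A5 ▸ l54⟩, ⟨_, _, _, A5 ▸ l53⟩, ⟨_, _, _, A5 ▸ l57⟩,
        ⟨_, _, _, A6 ▸ l65⟩, ⟨_, _, _, A6 ▸ l64⟩, ⟨_, _, _, A7 ▸ l76⟩, ⟨_, _, _, A7 ▸ l75⟩,
        ⟨_, _, _, A8 ▸ l86⟩]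
    exists_le := fun j W hW hWπ ↦ by
      revert hW
      fin_cases j
      · exact fun _ ↦ ⟨(0 : Fin 8), _, _, _, _, A0 ▸ l00, hπ.symm ▸ hWπ, e1 W⟩
      · intro hW
        rcases h.exists_lt_one_chartA (A1 ▸ hW) hWπ with hlt | hlt
        exacts [⟨(0 : Fin 8), _, _, _, _, A1 ▸ l10, hlt, e1 W⟩,
          ⟨(1 : Fin 8), _, _, _, _, A1 ▸ l11, hlt, e1 W⟩]
      · intro hW
        rcases h.exists_lt_one_chartB (A2 ▸ hW) hWπ with hlt | hlt
        exacts [⟨(1 : Fin 8), _, _, _, _, A2 ▸ l21, hlt, e1 W⟩,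
          ⟨(2 : Fin 8), _, _, _, _, A2 ▸ l22, hlt, e1 W⟩]
      · intro hW
        rcases h.exists_lt_one_chartC (A3 ▸ hW) hWπ with hlt | hlt | hlt
        exacts [⟨(2 : Fin 8), _, _, _, _, A3 ▸ l32, hlt, e1 W⟩,
          ⟨(3 : Fin 8), _, _, _, _, A3 ▸ l33, hlt, e1 W⟩,
          ⟨(7 : Fin 8), _, _, _, _, A3 ▸ l37, hlt, e1 W⟩]
      · intro hW
        exact ⟨(7 : Fin 8), _, _, _, _, A4 ▸ l47, h.lt_one_chartD (A4 ▸ hW) hWπ, e1 W⟩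
      · intro hW
        rcases h.translate.exists_lt_one_chartC (A5 ▸ hW) hWπ with hlt | hlt | hlt
        exacts [⟨(4 : Fin 8), _, _, _, _, A5 ▸ l54, hlt, e1 W⟩,
          ⟨(3 : Fin 8), _, _, _, _, A5 ▸ l53, hlt, e1 W⟩,
          ⟨(7 : Fin 8), _, _, _, _, A5 ▸ l57, hlt, e1 W⟩]
      · intro hW
        rcases h.translate.exists_lt_one_chartB (A6 ▸ hW) hWπ with hlt | hlt
        exacts [⟨(5 : Fin 8), _, _, _, _, A6 ▸ l65, hlt, e1 W⟩,
          ⟨(4 : Fin 8), _, _, _, _, A6 ▸ l64, hlt, e1 W⟩]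
      · intro hW
        rcases h.translate.exists_lt_one_chartA (A7 ▸ hW) hWπ with hlt | hlt
        exacts [⟨(6 : Fin 8), _, _, _, _, A7 ▸ l76, hlt, e1 W⟩,
          ⟨(5 : Fin 8), _, _, _, _, A7 ▸ l75, hlt, e1 W⟩]
      · exact fun _ ↦ ⟨(6 : Fin 8), _, _, _, _, A8 ▸ l86, hπ'.symm ▸ hWπ, e1 W⟩
    disjoint := fun i j hij h0 c' hi hj ↦ by
      -- The pairs of disjoint components which are visible on a common chart.
      have key := (by decide : ∀ (c : Fin 9) (i j : Fin 8), i < j →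
        (i.val, j.val) ∉ [(0, 1), (1, 2), (2, 3), (3, 4), (4, 5), (5, 6), (3, 7)] →
        IsVisible exponentsIIIstar (signsIIIstar c)
          ((![2, 2, 3, 4, 3, 2, 2, 2] : Fin 8 → ℕ) i) ((![0, 2, 4, 6, 5, 4, 6, 3] : Fin 8 → ℤ) i)
          ((![0, 3, 6, 9, 7, 5, 6, 5] : Fin 8 → ℤ) i) →
        IsVisible exponentsIIIstar (signsIIIstar c)
          ((![2, 2, 3, 4, 3, 2, 2, 2] : Fin 8 → ℕ) j) ((![0, 2, 4, 6, 5, 4, 6, 3] : Fin 8 → ℤ) j)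
          ((![0, 3, 6, 9, 7, 5, 6, 5] : Fin 8 → ℤ) j) →
        (c, i, j) ∈ [((3 : Fin 9), (2 : Fin 8), (7 : Fin 8)), (5, 4, 7)]) c' i j hij
        ((by decide : ∀ i j : Fin typeIIIstar.n, i < j → typeIIIstar.inter i j = 0 →
          (i.val, j.val) ∉ [(0, 1), (1, 2), (2, 3), (3, 4), (4, 5), (5, 6), (3, 7)]) i j hij h0) hi hj
      simp only [List.mem_cons, Prod.mk.injEq, List.not_mem_nil, or_false] at key
      rcases key with ⟨rfl, rfl, rfl⟩ | ⟨rfl, rfl, rfl⟩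
      · exact h.exists_add_eq_of_three (mon_mem_monAlg (by decide)) h₂ h₇
      · rw [A5]
        exact h.translate.exists_add_eq_of_three (mon_mem_monAlg (by decide)) h₄ h₇'
    meet := fun i j hij h0 ↦ by
      -- The components `3` and `7` are visible on the charts `3` and `5`. The section of the
      -- first one over that of the second is `x² / π³ = u + b s²`, which is the constant `u` on
      -- the component `7`.
      have hdiv : pencilSection (fun j ↦ mon π x y (exponentsIIIstar j)) (signsIIIstar 3) /
          pencilSection (fun j ↦ mon π x y (exponentsIIIstar j)) (signsIIIstar 5) =
          mon π x y (-3, 2, 0) :=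
        (pencilSection_div (fun _ ↦ h.mon_ne_zero _) 3 (by decide) (by decide) (by decide)).trans
          (monom_neg _).symm
      -- All other pairs of components which meet are visible on a single common chart.
      have only (c₀ : Fin 9) (N N' : ℕ) (α β α' β' : ℤ) (P : Fin 9 → Prop)
          (hc : ∀ c, IsVisible exponentsIIIstar (signsIIIstar c) N α β →
            IsVisible exponentsIIIstar (signsIIIstar c) N' α' β' → c = c₀) (c : Fin 9)
          (h1 : IsVisible exponentsIIIstar (signsIIIstar c) N α β)
          (h2 : IsVisible exponentsIIIstar (signsIIIstar c) N' α' β') (hne : c ≠ c₀) : P c :=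
        absurd (hc c h1 h2) hne
      have key := (by decide : ∀ i j : Fin 8,
        (i.val, j.val) ∈ [(0, 1), (1, 2), (2, 3), (3, 4), (4, 5), (5, 6), (3, 7)] →
        (i, j) ∈ [((0 : Fin 8), (1 : Fin 8)), (1, 2), (2, 3), (3, 4), (4, 5), (5, 6), (3, 7)]) i j
        ((by decide : ∀ i j : Fin typeIIIstar.n, i < j → typeIIIstar.inter i j ≠ 0 →
          (i.val, j.val) ∈ [(0, 1), (1, 2), (2, 3), (3, 4), (4, 5), (5, 6), (3, 7)]) i j hij h0)
      simp only [List.mem_cons, List.not_mem_nil, or_false] at key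
      rcases key with ⟨rfl, rfl⟩ | ⟨rfl, rfl⟩ | ⟨rfl, rfl⟩ | ⟨rfl, rfl⟩ | ⟨rfl, rfl⟩ | ⟨rfl, rfl⟩ |
        ⟨rfl, rfl⟩
      · exact ⟨1, .inl (A1 ▸ l10.meetsAt_one l11), only 1 2 2 0 0 2 3 _ (by decide)⟩
      · exact ⟨2, .inl (A2 ▸ l21.meetsAt_one l22), only 2 2 3 2 3 4 6 _ (by decide)⟩
      · exact ⟨3, .inl (A3 ▸ l32.meetsAt_one l33), only 3 3 4 4 6 6 9 _ (by decide)⟩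
      · exact ⟨5, .inr (A5 ▸ l54.meetsAt_one l53), only 5 4 3 6 9 5 7 _ (by decide)⟩
      · exact ⟨6, .inr (A6 ▸ l65.meetsAt_one l64), only 6 3 2 5 7 4 5 _ (by decide)⟩
      · exact ⟨7, .inr (A7 ▸ l76.meetsAt_one l75), only 7 2 2 4 5 6 6 _ (by decide)⟩
      · refine ⟨3, .inr (A3 ▸ l37.meetsAt_one l33), fun c h1 h2 hc ↦ ?_⟩
        obtain rfl := (by decide : ∀ c, IsVisible exponentsIIIstar (signsIIIstar c) 4 6 9 →
          IsVisible exponentsIIIstar (signsIIIstar c) 2 3 5 → c ≠ 3 → c = 5) c h1 h2 hc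
        rw [hdiv, h.inv_tau_eq]
        refine ⟨u, h.isUnit, ?_⟩
        rw [add_sub_cancel_left]
        exact (h.hasOrders_seven_of_three h₇).mem_nonunits _ (by decide)
    cover := fun W hW ↦ h.exists_le_signsIIIstar hW
    generic := fun c ↦ by
      fin_cases c
      exacts [A0 ▸ h.exists_isFunctionField_infinityChart, A1 ▸ h.exists_isFunctionField_chartA,
        A2 ▸ h.exists_isFunctionField_chartB, A3 ▸ h.exists_isFunctionField_chartC,
        A4 ▸ h.exists_isFunctionField_chartD, A5 ▸ h.translate.exists_isFunctionField_chartC,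
        A6 ▸ h.translate.exists_isFunctionField_chartB,
        A7 ▸ h.translate.exists_isFunctionField_chartA,
        A8 ▸ h.translate.exists_isFunctionField_infinityChart] }

end IsCurve

end Instances

/-! ### Regularity of hypersurfaces -/

section Hypersurface

variable {R : Type u} [CommRing R]

/-- A regular parameter cuts out a regular subscheme. -/
lemma isRegularLocalRing_quotient_span_singleton [IsRegularLocalRing R] {f : R}
    (hf : f ∈ maximalIdeal R) (hf2 : f ∉ maximalIdeal R ^ 2) :
    IsRegularLocalRing (R ⧸ Ideal.span {f}) := by
  classical
  have hne : Ideal.span {f} ≠ ⊤ := fun h ↦ (maximalIdeal.isMaximal R).ne_top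
    (top_le_iff.mp (h ▸ (Ideal.span_singleton_le_iff_mem _).mpr hf))
  have : Nontrivial (R ⧸ Ideal.span {f}) := Ideal.Quotient.nontrivial_iff.mpr hne
  have : IsLocalRing (R ⧸ Ideal.span {f}) :=
    .of_surjective' (Ideal.Quotient.mk _) Ideal.Quotient.mk_surjective
  -- The class of `f` is part of a basis of the cotangent space; lift such a basis.
  let v : CotangentSpace R := (maximalIdeal R).toCotangent ⟨f, hf⟩
  have hv : v ≠ 0 := fun h ↦ hf2 ((Ideal.toCotangent_eq_zero _ _).mp h)
  have hli : LinearIndepOn (ResidueField R) id {v} := LinearIndepOn.singleton hv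
  set T := hli.extend (Set.subset_univ {v}) with hT
  have hvT : v ∈ T := hli.subset_extend _ rfl
  have hTfin : T.Finite := Module.Finite.finite_basis (Module.Basis.extend hli)
  have hcard : T.ncard = Module.finrank (ResidueField R) (CotangentSpace R) := by
    rw [Module.finrank_eq_nat_card_basis (Module.Basis.extend hli), Nat.card_coe_set_eq]
  have hlift (t : CotangentSpace R) : ∃ a : maximalIdeal R,
      (maximalIdeal R).toCotangent a = t ∧ (t = v → (a : R) = f) := by
    by_cases ht : t = v
    · exact ⟨⟨f, hf⟩, ht.symm, fun _ ↦ rfl⟩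
    · obtain ⟨a, ha⟩ := (maximalIdeal R).toCotangent_surjective t
      exact ⟨a, ha, fun h ↦ absurd h ht⟩
  choose σ hσ hσv using hlift
  have hspan : Submodule.span R (σ '' T) = ⊤ := by
    rw [← CotangentSpace.span_image_eq_top_iff, Set.image_image]
    simp only [hσ, Set.image_id']
    rw [hT, ← Module.Basis.range_extend hli]
    exact (Module.Basis.extend hli).span_eq
  have hm : maximalIdeal R = Ideal.span ((fun t ↦ (σ t : R)) '' T) := by
    have := congrArg (Submodule.map (Submodule.subtype (maximalIdeal R))) hspan
    rw [Submodule.map_span, Set.image_image, Submodule.map_top, Submodule.range_subtype] at this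
    exact this.symm
  have hm' : maximalIdeal (R ⧸ Ideal.span {f}) =
      Ideal.span ((fun t ↦ Ideal.Quotient.mk (Ideal.span {f}) (σ t)) '' (T \ {v})) := by
    have hloc : IsLocalHom (Ideal.Quotient.mk (Ideal.span {f})) :=
      .of_surjective _ Ideal.Quotient.mk_surjective
    have h1 : maximalIdeal (R ⧸ Ideal.span {f}) = (maximalIdeal R).map (Ideal.Quotient.mk _) := by
      refine le_antisymm (fun a ha ↦ ?_) (Ideal.map_le_iff_le_comap.mpr fun a ha ↦ ?_)
      · obtain ⟨a, rfl⟩ := Ideal.Quotient.mk_surjective a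
        exact Ideal.mem_map_of_mem _ fun h ↦ ha (h.map _)
      · exact fun h ↦ ha ((isUnit_map_iff (Ideal.Quotient.mk (Ideal.span {f})) a).mp h)
    refine h1.trans ((congrArg (Ideal.map (Ideal.Quotient.mk (Ideal.span {f}))) hm).trans ?_)
    rw [Ideal.map_span, Set.image_image]
    refine le_antisymm (Ideal.span_le.mpr ?_)
      (Ideal.span_mono (Set.image_mono Set.sdiff_subset))
    rintro _ ⟨t, ht, rfl⟩
    by_cases htv : t = v
    · dsimp only
      rw [hσv t htv, Ideal.Quotient.eq_zero_iff_mem.mpr (Ideal.mem_span_singleton_self f)]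
      exact Ideal.zero_mem _
    · exact Ideal.subset_span ⟨t, ⟨ht, htv⟩, rfl⟩
  have hle : (maximalIdeal (R ⧸ Ideal.span {f})).spanFinrank + 1 ≤ T.ncard := by
    rw [hm', ← Set.ncard_sdiff_singleton_add_one hvT hTfin]
    exact Nat.succ_le_succ ((Submodule.spanFinrank_span_le_ncard_of_finite
      (hTfin.sdiff.image _)).trans (Set.ncard_image_le hTfin.sdiff))
  refine .of_spanFinrank_maximalIdeal_le _ ?_
  have h1 := (IsRegularLocalRing.iff_finrank_cotangentSpace (R := R)).mp inferInstance
  -- The dimension drops by at most one, and the number of generators by at least one.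
  have h2 := ringKrullDim_le_ringKrullDim_quotient_add_card {f}
    (by rw [Finset.coe_singleton, Set.singleton_subset_iff]
        exact (IsLocalRing.ringJacobson_eq_maximalIdeal R).ge hf)
  rw [← h1, ← hcard, Finset.coe_singleton, Finset.card_singleton] at h2
  have h3 : (((maximalIdeal (R ⧸ Ideal.span {f})).spanFinrank + 1 : ℕ) : WithBot ℕ∞) ≤
      ringKrullDim (R ⧸ Ideal.span {f}) + 1 := le_trans (by exact_mod_cast hle) h2
  generalize ringKrullDim (R ⧸ Ideal.span {f}) = d at h3 ⊢
  induction d using WithBot.recBotCoe with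
  | bot => simp at h3
  | coe d =>
    induction d using ENat.recTopCoe with
    | top => exact le_top
    | coe d => norm_cast at h3 ⊢; omega

/-- The Jacobian criterion: the hypersurface `f = 0` is regular at the points where a derivative of
`f` does not vanish. -/
lemma isRegularRing_quotient_span_singleton [IsRegularRing R] {f : R}
    (h : ∀ N : Ideal R, N.IsPrime → f ∈ N → ∃ D : Derivation ℤ R R, D f ∉ N) :
    IsRegularRing (R ⧸ Ideal.span {f}) := by
  refine ⟨fun p _ ↦ ?_⟩
  let N := p.comap (Ideal.Quotient.mk (Ideal.span {f}))
  have hfN : f ∈ N := by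
    rw [Ideal.mem_comap, Ideal.Quotient.eq_zero_iff_mem.mpr (Ideal.mem_span_singleton_self f)]
    exact p.zero_mem
  obtain ⟨D, hD⟩ := h N inferInstance hfN
  -- The derivation maps `N²` to `N`, so `f` is not in `N²`, even after localisation.
  have hN2 (a : R) (ha : a ∈ N ^ 2) : D a ∈ N := by
    rw [pow_two] at ha
    induction ha using Submodule.mul_induction_on' with
    | mem_mul_mem a ha b hb =>
      rw [Derivation.leibniz]
      exact N.add_mem (N.mul_mem_right _ ha) (N.mul_mem_right _ hb)
    | add a _ b _ ha hb =>
      rw [map_add]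
      exact N.add_mem ha hb
  have hmax := Localization.AtPrime.map_eq_maximalIdeal (I := N)
  have h1 : algebraMap R (Localization.AtPrime N) f ∈ maximalIdeal (Localization.AtPrime N) := by
    rw [← hmax]
    exact Ideal.mem_map_of_mem _ hfN
  have h2 : algebraMap R (Localization.AtPrime N) f ∉ maximalIdeal (Localization.AtPrime N) ^ 2 := by
    rw [← hmax, ← Ideal.map_pow, IsLocalization.algebraMap_mem_map_algebraMap_iff N.primeCompl]
    rintro ⟨s, hs, hsf⟩
    have h3 := hN2 _ hsf
    rw [Derivation.leibniz, smul_eq_mul, smul_eq_mul] at h3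
    have h4 := (N.add_mem_iff_left (N.mul_mem_right (D s) hfN)).mp h3
    exact (Ideal.IsPrime.mem_or_mem inferInstance h4).elim hs hD
  have h3 := isRegularLocalRing_quotient_span_singleton h1 h2
  have h4 : (Ideal.span {f}).map (algebraMap R (Localization.AtPrime N)) =
      Ideal.span {algebraMap R (Localization.AtPrime N) f} := by
    rw [Ideal.map_span, Set.image_singleton]
  rw [← h4] at h3
  -- The localisation of the quotient is the quotient of the localisation.
  have h5 : IsLocalization (Algebra.algebraMapSubmonoid (R ⧸ Ideal.span {f}) N.primeCompl)
    (Localization.AtPrime N ⧸ (Ideal.span {f}).map (algebraMap R (Localization.AtPrime N))) :=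
    inferInstance
  have h6 : Algebra.algebraMapSubmonoid (R ⧸ Ideal.span {f}) N.primeCompl = p.primeCompl := by
    ext a
    constructor
    · rintro ⟨b, hb, rfl⟩
      exact hb
    · obtain ⟨b, rfl⟩ := Ideal.Quotient.mk_surjective a
      exact fun hb ↦ ⟨b, hb, rfl⟩
  rw [h6] at h5
  exact .of_ringEquiv (IsLocalization.algEquiv p.primeCompl
    (Localization.AtPrime N ⧸ (Ideal.span {f}).map (algebraMap R (Localization.AtPrime N)))
    (Localization.AtPrime p)).toRingEquiv

end Hypersurface

/-! ### Affine Weierstrass equations with good reduction -/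

section Weierstrass

open MvPolynomial (pderiv)

variable {R A : Type u} [CommRing R] [CommRing A] [Algebra R A] {u w e : R}

/-- The polynomial `Y² - X³ + u X`. -/
def weierstrassPoly (u : R) : MvPolynomial (Fin 2) R :=
  .X 1 ^ 2 - .X 0 ^ 3 + .C u * .X 0

lemma aeval_weierstrassPoly (v : Fin 2 → A) : MvPolynomial.aeval v (weierstrassPoly u) =
    v 1 ^ 2 - v 0 ^ 3 + algebraMap R A u * v 0 := by
  simp [weierstrassPoly]

/-- As the discriminant is invertible, the polynomial and its derivatives have no common zeros. -/
lemma jacobian_identity (x y : A) (hu : u * w = 1) (he : 2 * e = 1) :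
    algebraMap R A (9 * e * w ^ 2) * x * (y ^ 2 - x ^ 3 + algebraMap R A u * x) +
      algebraMap R A w * (1 - algebraMap R A (3 * e * w) * x ^ 2) *
        (-3 * x ^ 2 + algebraMap R A u) -
      algebraMap R A (9 * e ^ 2 * w ^ 2) * x * y * (2 * y) = 1 := by
  have h1 : algebraMap R A u * algebraMap R A w = 1 := by rw [← map_mul, hu, map_one]
  have h2 : 2 * algebraMap R A e = 1 := by rw [← map_ofNat (algebraMap R A), ← map_mul, he, map_one]
  simp only [map_mul, map_pow, map_ofNat]
  linear_combination (1 + 6 * algebraMap R A e * algebraMap R A w * x ^ 2) * h1 +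
    (3 * algebraMap R A w * x ^ 2 - 9 * algebraMap R A e * algebraMap R A w ^ 2 * x * y ^ 2) * h2

lemma isRegularRing_weierstrass [IsRegularRing R] (hu : IsUnit u) (h2 : IsUnit (2 : R)) :
    IsRegularRing (MvPolynomial (Fin 2) R ⧸ Ideal.span {weierstrassPoly u}) := by
  obtain ⟨w, hw⟩ := hu.exists_right_inv
  obtain ⟨e, he⟩ := h2.exists_right_inv
  refine isRegularRing_quotient_span_singleton fun N hN hf ↦ ?_
  by_contra! h
  have h0 := h ((pderiv 0).restrictScalars ℤ)
  have h1 := h ((pderiv 1).restrictScalars ℤ)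
  have e0 : pderiv 0 (weierstrassPoly u) = -3 * .X 0 ^ 2 + .C u := by
    simp [weierstrassPoly, MvPolynomial.pderiv_X]
  have e1 : pderiv 1 (weierstrassPoly u) = 2 * .X 1 := by
    simp [weierstrassPoly, MvPolynomial.pderiv_X]
  rw [Derivation.restrictScalars_apply, e0] at h0
  rw [Derivation.restrictScalars_apply, e1] at h1
  refine hN.ne_top ((Ideal.eq_top_iff_one _).mpr ?_)
  rw [← jacobian_identity (.X 0 : MvPolynomial (Fin 2) R) (.X 1) hw he]
  exact N.sub_mem (N.add_mem (N.mul_mem_left _ hf) (N.mul_mem_left _ h0)) (N.mul_mem_left _ h1)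

/-- A solution of the Weierstrass equation can be lifted along a square-zero extension, by a step
of Newton's method. -/
lemma formallySmooth_weierstrass (hu : IsUnit u) (h2 : IsUnit (2 : R)) (v : Fin 2 → A)
    (hv : Function.Surjective (MvPolynomial.aeval v : MvPolynomial (Fin 2) R →ₐ[R] A))
    (hker : RingHom.ker (MvPolynomial.aeval v : MvPolynomial (Fin 2) R →ₐ[R] A) =
      Ideal.span {weierstrassPoly u}) : Algebra.FormallySmooth R A := by
  obtain ⟨w, hw⟩ := hu.exists_right_inv
  obtain ⟨e, he⟩ := h2.exists_right_inv
  refine .of_comp_surjective fun B _ _ I hI g ↦ ?_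
  obtain ⟨x, hx⟩ := Ideal.Quotient.mk_surjective (g (v 0))
  obtain ⟨y, hy⟩ := Ideal.Quotient.mk_surjective (g (v 1))
  set n := y ^ 2 - x ^ 3 + algebraMap R B u * x with hn
  -- The value of the equation at an arbitrary lift of the solution lies in `I`, so its square is
  -- zero.
  have hnI : n ∈ I := by
    have h1 : MvPolynomial.aeval v (weierstrassPoly u) = 0 := by
      change weierstrassPoly u ∈ RingHom.ker (MvPolynomial.aeval v : MvPolynomial (Fin 2) R →ₐ[R] A)
      rw [hker]
      exact Ideal.mem_span_singleton_self _
    rw [aeval_weierstrassPoly] at h1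
    have h3 := congrArg g h1
    rw [map_add, map_sub, map_pow, map_pow, map_mul, map_zero, AlgHom.commutes, ← hx, ← hy] at h3
    exact Ideal.Quotient.eq_zero_iff_mem.mp h3
  have hn2 : n ^ 2 = 0 := by
    have := Ideal.pow_mem_pow hnI 2
    rwa [hI] at this
  have hjac := jacobian_identity x y hw he
  set a := algebraMap R B (9 * e * w ^ 2) * x
  set b := algebraMap R B w * (1 - algebraMap R B (3 * e * w) * x ^ 2)
  set c := algebraMap R B (9 * e ^ 2 * w ^ 2) * x * y
  -- The Newton correction: the linear part of the change of the value is `-n` by the Jacobian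
  -- identity.
  let v' : Fin 2 → B := ![x - n * b, y + n * c]
  have hv' : MvPolynomial.aeval v' (weierstrassPoly u) = 0 := by
    rw [aeval_weierstrassPoly]
    change (y + n * c) ^ 2 - (x - n * b) ^ 3 + algebraMap R B u * (x - n * b) = 0
    rw [← hn] at hjac
    linear_combination (a + c ^ 2 - 3 * x * b ^ 2 + n * b ^ 3) * hn2 - n * hjac - hn
  let ψ := Ideal.Quotient.liftₐ (RingHom.ker (MvPolynomial.aeval v : MvPolynomial (Fin 2) R →ₐ[R] A))
    (MvPolynomial.aeval v') (fun p hp ↦ by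
      rw [hker, Ideal.mem_span_singleton] at hp
      obtain ⟨q, rfl⟩ := hp
      rw [map_mul, hv', zero_mul])
  let E := Ideal.quotientKerAlgEquivOfSurjective hv
  refine ⟨ψ.comp E.symm.toAlgHom, (AlgHom.cancel_right hv).mp (MvPolynomial.algHom_ext fun i ↦ ?_)⟩
  have hE : E.symm (MvPolynomial.aeval v (.X i : MvPolynomial (Fin 2) R)) = Ideal.Quotient.mk _ (.X i) :=
    E.symm_apply_eq.mpr rfl
  have hψ : ψ (E.symm (MvPolynomial.aeval v (.X i : MvPolynomial (Fin 2) R))) = v' i := by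
    rw [hE]
    exact MvPolynomial.aeval_X v' i
  change Ideal.Quotient.mk I (ψ (E.symm (MvPolynomial.aeval v (.X i : MvPolynomial (Fin 2) R)))) =
    g (MvPolynomial.aeval v (.X i : MvPolynomial (Fin 2) R))
  rw [hψ, MvPolynomial.aeval_X]
  fin_cases i
  · change Ideal.Quotient.mk I (x - n * b) = g (v 0)
    rw [← hx, map_sub, Ideal.Quotient.eq_zero_iff_mem.mpr (I.mul_mem_right b hnI), sub_zero]
  · change Ideal.Quotient.mk I (y + n * c) = g (v 1)
    rw [← hy, map_add, Ideal.Quotient.eq_zero_iff_mem.mpr (I.mul_mem_right c hnI), add_zero]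

end Weierstrass

/-! ### Good reduction -/

section Generators

variable {R F : Type u} [CommRing R] [Field F] [Algebra R F]

lemma chart_span (S : Set F) (s : F) :
    chart (Submodule.span R S) s = Algebra.adjoin R ((fun a ↦ a / s) '' S) := by
  refine le_antisymm (Algebra.adjoin_le ?_) (Algebra.adjoin_mono
    (Set.image_mono Submodule.subset_span))
  rintro _ ⟨a, ha, rfl⟩
  simp only [SetLike.mem_coe]
  induction ha using Submodule.span_induction with
  | mem a ha => exact Algebra.subset_adjoin ⟨a, ha, rfl⟩
  | zero => rw [zero_div]; exact Subalgebra.zero_mem _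
  | add a b _ _ ha hb => rw [add_div]; exact Subalgebra.add_mem _ ha hb
  | smul r a _ ha => rw [smul_div_assoc]; exact Subalgebra.smul_mem _ ha r

end Generators

section Good

variable {K F : Type u} [Field K] [Field F] [Algebra K F] {O : ValuationSubring K} [Algebra O F]
variable [IsScalarTower O K F] {k : ℕ} {π u : O} {x y : F} {V W : ValuationSubring F}

namespace IsCurve

section
variable (h : IsCurve 0 π u x y)

/-- The coordinates as elements of the ring which they generate. -/
abbrev coordinates (O : ValuationSubring K) [Algebra O F] (x y : F) :
    Fin 2 → Algebra.adjoin O {x, y} :=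
  ![⟨x, Algebra.subset_adjoin (by simp)⟩, ⟨y, Algebra.subset_adjoin (by simp)⟩]

omit [Algebra K F] [IsScalarTower O K F] in
lemma surjective_aeval_coordinates : Function.Surjective
    (MvPolynomial.aeval (coordinates O x y) : MvPolynomial (Fin 2) O →ₐ[O] _) := by
  have h1 : Algebra.adjoin O {x, y} ≤ (MvPolynomial.aeval (coordinates O x y) :
      MvPolynomial (Fin 2) O →ₐ[O] _).range.map (Algebra.adjoin O {x, y}).val := by
    refine Algebra.adjoin_le ?_
    rintro _ (rfl | rfl)
    · exact ⟨_, ⟨.X 0, MvPolynomial.aeval_X _ _⟩, rfl⟩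
    · exact ⟨_, ⟨.X 1, MvPolynomial.aeval_X _ _⟩, rfl⟩
  intro a
  obtain ⟨b, ⟨p, hp⟩, hb⟩ := h1 a.2
  exact ⟨p, hp.trans (Subtype.ext hb)⟩

include h

/-- The Weierstrass equation generates the ideal of relations between the coordinates: modulo the
equation a polynomial is of the form `P + Q Y`, and its norm is a polynomial in `X`. -/
lemma ker_aeval_coordinates : RingHom.ker
    (MvPolynomial.aeval (coordinates O x y) : MvPolynomial (Fin 2) O →ₐ[O] _) =
      Ideal.span {weierstrassPoly u} := by
  have hf : MvPolynomial.aeval (coordinates O x y) (weierstrassPoly u) = 0 := by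
    refine Subtype.ext ?_
    rw [aeval_weierstrassPoly]
    have := h.equation
    change y ^ 2 - x ^ 3 + algebraMap O F u * x = 0
    linear_combination this
  refine le_antisymm (fun p hp ↦ ?_) ((Ideal.span_singleton_le_iff_mem _).mpr hf)
  -- Division by the equation, which is monic in `Y`.
  have key (p : MvPolynomial (Fin 2) O) : ∃ P Q : O[X], p - (Polynomial.aeval (.X 0) P +
      Polynomial.aeval (.X 0) Q * .X 1) ∈ Ideal.span {weierstrassPoly u} := by
    induction p using MvPolynomial.induction_on with
    | C a => exact ⟨C a, 0, by simp [MvPolynomial.algebraMap_eq]⟩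
    | add p q hp hq =>
      obtain ⟨P, Q, h1⟩ := hp
      obtain ⟨P', Q', h2⟩ := hq
      refine ⟨P + P', Q + Q', ?_⟩
      convert Ideal.add_mem _ h1 h2 using 1
      rw [map_add, map_add]
      ring
    | mul_X p i hp =>
      obtain ⟨P, Q, h1⟩ := hp
      fin_cases i
      · refine ⟨P * X, Q * X, ?_⟩
        convert Ideal.mul_mem_right (.X 0) _ h1 using 1
        rw [map_mul, map_mul, aeval_X]
        simp only [Fin.zero_eta]
        ring
      · refine ⟨Q * (X ^ 3 - C u * X), P, ?_⟩
        convert Ideal.add_mem _ (Ideal.mul_mem_right (.X 1) _ h1) (Ideal.mul_mem_left _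
          (Polynomial.aeval (.X 0) Q) (Ideal.mem_span_singleton_self (weierstrassPoly u))) using 1
        rw [weierstrassPoly, map_mul, map_sub, map_pow, map_mul, aeval_X, aeval_C,
          MvPolynomial.algebraMap_eq]
        simp only [Fin.mk_one]
        ring
  obtain ⟨P, Q, hPQ⟩ := key p
  have h1 : aeval x P + aeval x Q * y = 0 := by
    obtain ⟨c, hc⟩ := Ideal.mem_span_singleton.mp hPQ
    have h2 := congrArg (MvPolynomial.aeval (coordinates O x y)) hc
    rw [map_mul, hf, zero_mul, map_sub, show MvPolynomial.aeval (coordinates O x y) p = 0 from hp,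
      zero_sub, neg_eq_zero, map_add, map_mul, ← aeval_algHom_apply, ← aeval_algHom_apply,
      MvPolynomial.aeval_X, MvPolynomial.aeval_X] at h2
    have h3 := congrArg Subtype.val h2
    rw [Subalgebra.coe_add, Subalgebra.coe_mul, ← Subalgebra.aeval_coe,
      ← Subalgebra.aeval_coe] at h3
    exact h3
  have h2 (G : O[X]) : aeval x G = aeval x (G.map (algebraMap O K)) := (aeval_map_algebraMap _ _ _).symm
  have hinj : Function.Injective (Polynomial.map (algebraMap O K)) :=
    Polynomial.map_injective _ Subtype.val_injective
  rw [h2, h2] at h1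
  have h3 := h.isFunctionField.aeval_norm (P.map (algebraMap O K)) (Q.map (algebraMap O K))
  rw [h1, zero_mul] at h3
  -- The norm of `P + Q y` is a nonzero polynomial in `x` unless `P = Q = 0`.
  have h4 : P = 0 ∧ Q = 0 := by
    by_contra h4
    refine h.isFunctionField.aeval_ne_zero (norm_ne_zero (π ^ 0 * u : K) (P := P.map (algebraMap O K))
      (Q := Q.map (algebraMap O K)) ?_) h3.symm
    by_contra! h5
    exact h4 ⟨hinj (by rw [h5.1, Polynomial.map_zero]), hinj (by rw [h5.2, Polynomial.map_zero])⟩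
  rw [h4.1, h4.2, map_zero, zero_mul, add_zero, sub_zero] at hPQ
  exact hPQ

variable [IsDiscreteValuationRing O]

omit [IsDiscreteValuationRing O] in
lemma formallySmooth_adjoin : Algebra.FormallySmooth O (Algebra.adjoin O {x, y}) :=
  formallySmooth_weierstrass h.isUnit h.isUnit_two _ surjective_aeval_coordinates
    h.ker_aeval_coordinates

lemma isRegularRing_adjoin : IsRegularRing (Algebra.adjoin O {x, y}) := by
  have h1 : IsRegularRing O := inferInstance
  have h2 := isRegularRing_weierstrass h.isUnit h.isUnit_two
  rw [← h.ker_aeval_coordinates] at h2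
  exact IsRegularRing.of_ringEquiv (R := MvPolynomial (Fin 2) O ⧸ RingHom.ker
      (MvPolynomial.aeval (coordinates O x y) : MvPolynomial (Fin 2) O →ₐ[O] _))
    (Ideal.quotientKerAlgEquivOfSurjective surjective_aeval_coordinates).toRingEquiv

omit [IsDiscreteValuationRing O] in
/-- The function `y` is integral over `O[x]`. -/
lemma mem_of_equation {W : ValuationSubring F} (hO : ∀ r : O, algebraMap O F r ∈ W)
    (hx : x ∈ W) : y ∈ W := by
  have h1 : y ^ 2 ∈ W := by
    rw [h.equation, pow_zero, one_mul]
    exact W.sub_mem (W.pow_mem hx 3) (W.mul_mem _ _ (hO u) hx)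
  refine (W.mem_or_inv_mem y).elim id fun h2 ↦ ?_
  have h3 : y = y ^ 2 * y⁻¹ := by
    rw [pow_two, mul_assoc, mul_inv_cancel₀ h.y_ne_zero, mul_one]
  rw [h3]
  exact W.mul_mem _ _ h1 h2

omit [IsDiscreteValuationRing O] [IsScalarTower O K F] [Algebra K F] h in
lemma chart_one : chart (Submodule.span O {1, x, y, x ^ 2}) 1 = Algebra.adjoin O {x, y} := by
  rw [chart_span]
  refine le_antisymm (Algebra.adjoin_le ?_) (Algebra.adjoin_mono ?_)
  · rintro _ ⟨_, (rfl | rfl | rfl | rfl), rfl⟩ <;> simp only [div_one, SetLike.mem_coe]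
    · exact Subalgebra.one_mem _
    · exact Algebra.subset_adjoin (by simp)
    · exact Algebra.subset_adjoin (by simp)
    · exact Subalgebra.pow_mem _ (Algebra.subset_adjoin (by simp)) 2
  · rintro a ha
    exact ⟨a, by obtain rfl | rfl := ha <;> simp, div_one a⟩

omit [IsDiscreteValuationRing O] [IsScalarTower O K F] in
/-- The chart of the section `x²` is the affine part of the translated curve. -/
lemma chart_sq : chart (Submodule.span O {1, x, y, x ^ 2}) (x ^ 2) =
    Algebra.adjoin O {translateX 0 π u x, translateY 0 π u x y} := by
  have hx0 := h.x_ne_zero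
  obtain ⟨w, hw⟩ := h.isUnit.exists_right_inv
  have hw' : algebraMap O F u * algebraMap O F w = 1 := by rw [← map_mul, hw, map_one]
  rw [chart_span]
  refine le_antisymm (Algebra.adjoin_le ?_) (Algebra.adjoin_le ?_)
  · set A := Algebra.adjoin O {translateX 0 π u x, translateY 0 π u x y}
    have h1 : x⁻¹ ∈ A := by
      have : x⁻¹ = algebraMap O F (-w) * translateX 0 π u x := by
        rw [translateX, map_neg]
        field_simp
        linear_combination -hw'
      rw [this]
      exact A.mul_mem (A.algebraMap_mem _) (Algebra.subset_adjoin (by simp))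
    rintro _ ⟨a, ha, rfl⟩
    simp only [SetLike.mem_coe]
    obtain ha | ha | ha | ha := ha <;> rw [ha]
    · rw [one_div, ← inv_pow]
      exact A.pow_mem h1 2
    · rwa [pow_two, div_self_mul_self']
    · have : y / x ^ 2 = algebraMap O F w * translateY 0 π u x y := by
        rw [translateY]
        field_simp
        linear_combination -y * hw'
      rw [this]
      exact A.mul_mem (A.algebraMap_mem _) (Algebra.subset_adjoin (by simp))
    · rw [div_self (pow_ne_zero 2 hx0)]
      exact A.one_mem
  · set A := Algebra.adjoin O ((fun a ↦ a / x ^ 2) '' {1, x, y, x ^ 2})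
    rintro _ (rfl | rfl)
    · have : translateX 0 π u x = algebraMap O F (-u) * (x / x ^ 2) := by
        rw [translateX, map_neg]
        field_simp
      rw [this]
      exact A.mul_mem (A.algebraMap_mem _) (Algebra.subset_adjoin ⟨x, by simp⟩)
    · have : translateY 0 π u x y = algebraMap O F u * (y / x ^ 2) := by
        rw [translateY, pow_zero, one_mul, mul_div_assoc]
      rw [this]
      exact A.mul_mem (A.algebraMap_mem _) (Algebra.subset_adjoin ⟨y, by simp⟩)

omit [IsDiscreteValuationRing O] in
lemma exists_chart_eq (c : Fin 2) : ∃ x' y' : F, IsCurve 0 π u x' y' ∧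
    chart (Submodule.span O {1, x, y, x ^ 2}) ((![1, x ^ 2] : Fin 2 → F) c) =
      Algebra.adjoin O {x', y'} := by
  fin_cases c
  · exact ⟨x, y, h, chart_one⟩
  · exact ⟨_, _, h.translate, h.chart_sq⟩

/-- An elliptic curve with good reduction is covered by its affine part and the translate of the
latter by the point `(0, 0)`. -/
lemma isRegularAtlas_good : IsRegularAtlas (Submodule.span O {1, x, y, x ^ 2})
    (![1, x ^ 2] : Fin 2 → F) where
  fg := Submodule.fg_span (by simp)
  mem c := by
    fin_cases c
    · exact Submodule.subset_span (by simp)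
    · exact Submodule.subset_span (by simp)
  ne_zero c := by
    fin_cases c
    · exact one_ne_zero
    · exact pow_ne_zero 2 h.x_ne_zero
  cover W hW := by
    have key {x' y' : F} (h' : IsCurve 0 π u x' y') (hx' : x' ∈ W) (a : F)
        (ha : a ∈ Algebra.adjoin O {x', y'}) : a ∈ W := by
      induction ha using Algebra.adjoin_induction with
      | mem a ha =>
        obtain rfl | rfl := ha
        · exact hx'
        · exact h'.mem_of_equation hW hx'
      | algebraMap r => exact hW r
      | add a b _ _ ha hb => exact W.add_mem _ _ ha hb
      | mul a b _ _ ha hb => exact W.mul_mem _ _ ha hb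
    -- Where `x` is integral, so is `y`. Otherwise the first coordinate `-u / x` of the translate
    -- is integral.
    obtain hx | hx := W.mem_or_inv_mem x
    · refine ⟨0, fun a ha ↦ key h hx a ?_⟩
      rwa [← chart_one]
    · refine ⟨1, fun a ha ↦ key h.translate ?_ a ?_⟩
      · rw [translateX, pow_zero, one_mul, neg_div, div_eq_mul_inv]
        exact W.neg_mem _ (W.mul_mem _ _ (hW u) hx)
      · rwa [← h.chart_sq]
  isFractionRing := ⟨0, h.isFunctionField.isFractionRing
    (chart_one.ge (Algebra.subset_adjoin (by simp)))
    (chart_one.ge (Algebra.subset_adjoin (by simp)))⟩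
  regular c M _ := by
    obtain ⟨x', y', h', hc⟩ := h.exists_chart_eq c
    revert M
    rw [hc]
    intro M _
    have := h'.isRegularRing_adjoin
    exact IsRegularRing.isRegularLocalRing_localization M

end

end IsCurve

omit [Algebra K F] [IsScalarTower O K F] in
/-- Smoothness can be checked on charts. -/
lemma smooth_blowupToBase [IsNoetherianRing O] {I : Submodule O F} {σ : Type} {s : σ → F}
    (hs : ∀ c, s c ∈ I) (hs0 : ∀ c, s c ≠ 0)
    (hcover : ∀ x : blowup I, ∃ c, x ∈ Set.range (chartMap (hs c) (hs0 c)))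
    (hfin : ∀ c, Algebra.FiniteType O (chart I (s c)))
    (hsmooth : ∀ c, Algebra.FormallySmooth O (chart I (s c))) : Smooth (blowupToBase I) := by
  have : IsZariskiLocalAtSource @Smooth.{u} :=
    HasRingHomProperty.instIsZariskiLocalAtSource (Q := RingHom.Smooth)
  rw [IsZariskiLocalAtSource.iff_of_openCover (P := @Smooth) (.mkOfCovers σ (fun c ↦ _)
    (fun c ↦ chartMap (hs c) (hs0 c)) hcover (fun c ↦ inferInstance))]
  intro c
  change Smooth (chartMap (hs c) (hs0 c) ≫ blowupToBase I)
  rw [chartMap_blowupToBase, HasRingHomProperty.Spec_iff (P := @Smooth)]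
  change (algebraMap O (chart I (s c))).Smooth
  have := hfin c
  have := hsmooth c
  have := Algebra.FinitePresentation.of_finiteType.mp (hfin c)
  exact RingHom.smooth_algebraMap.mpr ⟨hsmooth c, this⟩

lemma IsCurve.smooth_good [IsDiscreteValuationRing O] (h : IsCurve 0 π u x y) :
    Smooth (blowupToBase (Submodule.span O {1, x, y, x ^ 2})) := by
  refine smooth_blowupToBase h.isRegularAtlas_good.mem h.isRegularAtlas_good.ne_zero
    h.isRegularAtlas_good.exists_mem_range (fun c ↦ ?_) (fun c ↦ ?_)
  · obtain ⟨x', y', h', hc⟩ := h.exists_chart_eq c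
    rw [hc]
    exact Algebra.FiniteType.adjoin_of_finite (by simp)
  · obtain ⟨x', y', h', hc⟩ := h.exists_chart_eq c
    rw [hc]
    exact h'.formallySmooth_adjoin

end Good

/-- If the equation defines an elliptic curve over the residue field, then the fibration is
smooth. -/
lemma IsCurve.hasSmoothFibre {K : Type u} [Field K] {O : ValuationSubring K}
    [IsDiscreteValuationRing O] {W : WeierstrassCurve K}
    {π u : O} {x y : W.toAffine.FunctionField} (h : IsCurve 0 π u x y) : HasSmoothFibre O W :=
  ⟨h.isRegularAtlas_good.model, h.smooth_good⟩

/-! ### The fibre types in terms of the equation -/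

section FibreType

variable {K : Type u} [Field K] {O : ValuationSubring K}
variable [IsDiscreteValuationRing O] {W : WeierstrassCurve K} {π u : O}
variable {x y : W.toAffine.FunctionField}

namespace IsCurve

section
variable {F : Type u} [Field F] [Algebra K F] [Algebra O F] [IsScalarTower O K F] {k : ℕ} {x y : F}
variable (h : IsCurve k π u x y)
include h

omit [IsDiscreteValuationRing O] h in
lemma algebraMap_mem_subfield {L : Subfield F} (hL : ∀ c, algebraMap K F c ∈ L) (r : O) :
    algebraMap O F r ∈ L :=
  IsScalarTower.algebraMap_apply O K F r ▸ hL _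

omit [IsDiscreteValuationRing O] in
lemma transcendental_of_mem {z : F}
    (hz : ∀ L : Subfield F, (∀ r : O, algebraMap O F r ∈ L) → z ∈ L → x ∈ L) :
    Transcendental O z :=
  (h.isFunctionField.transcendental_of_mem
    fun L hL ↦ hz L (algebraMap_mem_subfield hL)).restrictScalars Subtype.val_injective

omit [IsDiscreteValuationRing O] in
lemma transcendental_x : Transcendental O x :=
  h.transcendental_of_mem fun _ _ hx ↦ hx

end

/-- The equation `y² = x³ - π u x` has a fibre of type `III`. -/
theorem hasFibre_typeIII (h : IsCurve 1 π u x y) : HasFibre O W typeIII := by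
  obtain ⟨V₀, h₀⟩ := exists_isResTranscendental h.transcendental_x
  obtain ⟨V₁, h₁⟩ := exists_isResTranscendental h.translate.transcendental_x
  exact (h.isPencilAtlas_signsIII h₀ h₁).hasFibre

/-- The equation `y² = x³ - π² u x` has a fibre of type `I₀*`. The unit `u` has to be a square
modulo `π` for all components to be defined over the residue field. -/
theorem hasFibre_typeI0star (h : IsCurve 2 π u x y) {c d : O} (hc : IsUnit c)
    (hu : u = c ^ 2 + π * d) : HasFibre O W typeI0star := by
  have hp := h.p_ne_zero
  have t₀ : Transcendental O (mon π x y (1, -1, 0)) := h.transcendental_of_mem fun L hL hz ↦ by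
    have := L.mul_mem (hL π) (L.inv_mem hz)
    rwa [mon, monom, zpow_one, zpow_neg_one, zpow_zero, mul_one, mul_inv, inv_inv,
      mul_inv_cancel_left₀ hp] at this
  have t₃ {c : O} (hc : IsUnit c) : Transcendental O (branchCoord π c x) :=
    h.transcendental_of_mem fun L hL hz ↦ by
      have hc' := algebraMap_unit_ne_zero (F := W.toAffine.FunctionField) hc
      have hx := h.x_ne_zero
      have h1 : algebraMap O W.toAffine.FunctionField c * algebraMap O _ π *
          (1 - branchCoord π c x * algebraMap O _ π)⁻¹ ∈ L :=
        L.mul_mem (L.mul_mem (hL c) (hL π))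
          (L.inv_mem (L.sub_mem L.one_mem (L.mul_mem hz (hL π))))
      have h2 : 1 - branchCoord π c x * algebraMap O _ π = algebraMap O _ c * algebraMap O _ π / x := by
        rw [branchCoord, div_mul_cancel₀ _ hp]
        ring
      rwa [h2, inv_div, mul_div_cancel₀ _ (mul_ne_zero hc' hp)] at h1
  obtain ⟨V₀, h₀⟩ := exists_isResTranscendental t₀
  obtain ⟨V₁, h₁⟩ := exists_isResTranscendental h.transcendental_x
  obtain ⟨V₂, h₂⟩ := exists_isResTranscendental h.translate.transcendental_x
  obtain ⟨V₃, h₃⟩ := exists_isResTranscendental (t₃ hc)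
  obtain ⟨V₄, h₄⟩ := exists_isResTranscendental (t₃ hc.neg)
  exact (h.isPencilAtlas_signsI0star hc hu (V := ![V₀, V₁, V₂, V₃, V₄]) h₀ h₁ h₂ h₃ h₄).hasFibre

/-- The equation `y² = x³ - π³ u x` has a fibre of type `III*`. -/
theorem hasFibre_typeIIIstar (h : IsCurve 3 π u x y) : HasFibre O W typeIIIstar := by
  have t₁ {x y : W.toAffine.FunctionField} (h : IsCurve 3 π u x y) :
      Transcendental O (mon π x y (-1, 1, 0)) := h.transcendental_of_mem fun L hL hz ↦ by
    have := L.mul_mem (hL π) hz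
    rwa [mon, monom, zpow_one, zpow_neg_one, zpow_zero, mul_one,
      mul_inv_cancel_left₀ h.p_ne_zero] at this
  have t₂ {x y : W.toAffine.FunctionField} (h : IsCurve 3 π u x y) :
      Transcendental O (mon π x y (-2, 0, 1)) := fun h1 ↦ by
    refine h.isFunctionField.transcendental_y.restrictScalars (R := O) Subtype.val_injective ?_
    have h2 := (isAlgebraic_algebraMap (A := W.toAffine.FunctionField) (π ^ 2 : O)).mul h1
    rwa [mon, monom, map_pow, zpow_one, zpow_zero, mul_one, zpow_neg, zpow_ofNat,
      mul_inv_cancel_left₀ (pow_ne_zero 2 h.p_ne_zero)] at h2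
  have t₃ : Transcendental O (mon π x y (3, -2, 0)) := fun h1 ↦ by
    refine h.transcendental_x (.of_pow two_pos ?_)
    have h2 := (isAlgebraic_algebraMap (A := W.toAffine.FunctionField) (π ^ 3 : O)).mul h1.inv
    rwa [mon, monom, map_pow, zpow_ofNat, zpow_zero, mul_one, zpow_neg, zpow_ofNat, mul_inv,
      inv_inv, mul_inv_cancel_left₀ (pow_ne_zero 3 h.p_ne_zero)] at h2
  have t₇ : Transcendental O (mon π x y (-1, -1, 1)) := fun h1 ↦ by
    refine h.isFunctionField.transcendental_slope.restrictScalars (R := O) Subtype.val_injective ?_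
    have h2 := (isAlgebraic_algebraMap (A := W.toAffine.FunctionField) π).mul h1
    rwa [mon, monom, zpow_one, zpow_neg_one, zpow_neg_one, mul_assoc,
      mul_inv_cancel_left₀ h.p_ne_zero, mul_comm, ← div_eq_mul_inv] at h2
  obtain ⟨V₀, h₀⟩ := exists_isResTranscendental h.transcendental_x
  obtain ⟨V₁, h₁⟩ := exists_isResTranscendental (t₁ h)
  obtain ⟨V₂, h₂⟩ := exists_isResTranscendental (t₂ h)
  obtain ⟨V₃, h₃⟩ := exists_isResTranscendental t₃
  obtain ⟨V₄, h₄⟩ := exists_isResTranscendental (t₂ h.translate)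
  obtain ⟨V₅, h₅⟩ := exists_isResTranscendental (t₁ h.translate)
  obtain ⟨V₆, h₆⟩ := exists_isResTranscendental h.translate.transcendental_x
  obtain ⟨V₇, h₇⟩ := exists_isResTranscendental t₇
  exact (h.isPencilAtlas_signsIIIstar (V := ![V₀, V₁, V₂, V₃, V₄, V₅, V₆, V₇])
    h₀ h₁ h₂ h₃ h₄ h₅ h₆ h₇).hasFibre

end IsCurve
end FibreType

section FunctionField

variable {K : Type u} [Field K]

/-- The change of variables which multiplies the coefficient by a fourth power. -/
lemma IsFunctionField.rescale {F : Type u} [Field F] [Algebra K F] {a d : K} {x y : F}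
    (h : IsFunctionField a x y) (hd : d ≠ 0) :
    IsFunctionField (d ^ 4 * a) (algebraMap K F d ^ 2 * x) (algebraMap K F d ^ 3 * y) := by
  have hd' : algebraMap K F d ≠ 0 := (_root_.map_ne_zero _).mpr hd
  have hx {L : Subfield F} (hL : ∀ c, algebraMap K F c ∈ L) (n : ℕ) (z : F)
      (hz : algebraMap K F d ^ n * z ∈ L) : z ∈ L := by
    have := L.mul_mem (L.inv_mem (L.pow_mem (hL d) n)) hz
    rwa [inv_mul_cancel_left₀ (pow_ne_zero n hd')] at this
  refine ⟨mul_ne_zero (pow_ne_zero 4 hd) h.ne_zero, h.two_ne_zero,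
    h.transcendental_of_mem fun L hL ↦ hx hL 2 x, ?_, fun L hL h1 h2 ↦
    h.generate L hL (hx hL 2 x h1) (hx hL 3 y h2)⟩
  rw [map_mul, map_pow, mul_pow, h.equation]
  ring

/-- The coordinate functions of a Weierstrass curve. -/
lemma exists_isFunctionField {W : WeierstrassCurve K} (h1 : W.a₁ = 0) (h2 : W.a₂ = 0)
    (h3 : W.a₃ = 0) (h6 : W.a₆ = 0) (h4 : W.a₄ ≠ 0) (h : (2 : K) ≠ 0) :
    ∃ x y : W.toAffine.FunctionField, IsFunctionField (-W.a₄) x y := by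
  let A := W.toAffine.CoordinateRing
  let F := W.toAffine.FunctionField
  have hinj : Function.Injective (algebraMap K[X] F) := by
    rw [IsScalarTower.algebraMap_eq K[X] A F]
    exact (IsFractionRing.injective A F).comp (FaithfulSMul.algebraMap_injective K[X] A)
  refine ⟨algebraMap K[X] F X, algebraMap A F (WeierstrassCurve.Affine.CoordinateRing.mk _ X),
    neg_ne_zero.mpr h4, h, ?_, ?_, fun L hL hx hy ↦ ?_⟩
  · exact transcendental_iff.mpr fun p hp ↦ (map_eq_zero_iff _ hinj).mp <| by
      rwa [aeval_algebraMap_apply, aeval_X_left_apply] at hp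
  · have hA : WeierstrassCurve.Affine.CoordinateRing.mk W.toAffine X ^ 2 =
        algebraMap K[X] A X ^ 3 - algebraMap K A (-W.a₄) * algebraMap K[X] A X := by
      have := WeierstrassCurve.Affine.CoordinateRing.smul_basis_mul_Y (W' := W.toAffine) 0 1
      simp only [h1, h2, h3, h6, zero_mul, mul_zero, add_zero, sub_zero, one_mul, mul_one,
        Algebra.smul_def, map_zero, map_one, zero_add] at this
      rw [← pow_two] at this
      rw [this, map_add, map_mul, map_pow, map_neg, neg_mul, sub_neg_eq_add]
      rfl
    rw [← map_pow, hA, map_sub, map_pow, map_mul]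
    rfl
  · rw [eq_top_iff]
    intro z _
    have hK (p : K[X]) : algebraMap K[X] F p ∈ L := by
      induction p using Polynomial.induction_on' with
      | add p q hp hq => rw [map_add]; exact L.add_mem hp hq
      | monomial n c =>
        rw [← C_mul_X_pow_eq_monomial, map_mul, map_pow]
        exact L.mul_mem (hL c) (L.pow_mem hx n)
    have hA (a : A) : algebraMap A F a ∈ L := by
      obtain ⟨p, q, rfl⟩ := WeierstrassCurve.Affine.CoordinateRing.exists_smul_basis_eq a
      rw [map_add, Algebra.smul_def, Algebra.smul_def, map_mul, map_mul, map_one, mul_one]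
      exact L.add_mem (hK p) (L.mul_mem (hK q) hy)
    obtain ⟨a, b, _, rfl⟩ := IsFractionRing.div_surjective (A := A) z
    exact L.div_mem (hA a) (hA b)

end FunctionField

section Places

variable {K : Type u} [Field K] {v : Valuation K (WithZero (Multiplicative ℤ))}

lemma isUnit_iff_valuation_eq_one {t : v.valuationSubring} : IsUnit t ↔ v t = 1 :=
  (Valuation.valuationSubring.integers v).isUnit_iff_valuation_eq_one

lemma irreducible_of_valuation_eq {t : v.valuationSubring} (ht : v t = WithZero.exp (-1)) :
    Irreducible t := by
  refine ⟨fun h ↦ ?_, fun a b h ↦ ?_⟩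
  · rw [isUnit_iff_valuation_eq_one, ht] at h
    exact absurd h (by decide)
  -- A product of two nonunits has value at most `exp (-2)`.
  · by_contra! hab
    rw [isUnit_iff_valuation_eq_one, isUnit_iff_valuation_eq_one] at hab
    have ha := lt_of_le_of_ne a.2 hab.1
    have hb := lt_of_le_of_ne b.2 hab.2
    have h1 : v a ≤ WithZero.exp (-1) := by
      rwa [← WithZero.lt_mul_exp_iff_le WithZero.exp_ne_zero, ← WithZero.exp_add, neg_add_cancel,
        WithZero.exp_zero]
    have h2 : v a * v b < WithZero.exp (-1) * 1 :=
      mul_lt_mul_of_le_of_lt_of_nonneg_of_pos h1 hb zero_le WithZero.exp_pos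
    rw [mul_one, ← ht, h] at h2
    exact h2.ne (map_mul v _ _).symm

end Places

/-! ### The points of the projective line -/

section AffinePoint

/-- Polynomials as elements of the local ring at `c`. -/
def polyAt (c : ℂ) : ℂ[X] →+* localRingAt c :=
  (algebraMap ℂ[X] (RatFunc ℂ)).codRestrict (localRingAt c).toSubring
    (fun f ↦ (affinePoint c).valuation_le_one f)

lemma isUnit_polyAt {c : ℂ} {f : ℂ[X]} (hf : f.eval c ≠ 0) : IsUnit (polyAt c f) := by
  refine isUnit_iff_valuation_eq_one.mpr ((affinePoint c).valuation_eq_one_iff_notMem.mpr fun h ↦ hf ?_)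
  exact dvd_iff_isRoot.mp (Ideal.mem_span_singleton.mp h)

lemma irreducible_polyAt (c : ℂ) : Irreducible (polyAt c (X - C c)) := by
  refine irreducible_of_valuation_eq (((affinePoint c).valuation_of_algebraMap _).trans ?_)
  exact (affinePoint c).intValuation_singleton (X_sub_C_ne_zero c) rfl

variable {α : ℂ}

/-- The coefficient `λ³ (λ² + 2λ + α)²` of the equation, as a polynomial. -/
def coefficient (α : ℂ) : ℂ[X] := X ^ 3 * (X ^ 2 + 2 * X + C α) ^ 2

lemma coefficient_ne_zero : coefficient α ≠ 0 := by
  refine mul_ne_zero (pow_ne_zero 3 X_ne_zero) (pow_ne_zero 2 ?_)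
  rw [show (X ^ 2 + 2 * X + C α : ℂ[X]) = X ^ 2 + C 2 * X + C α from rfl]
  refine (Monic.ne_zero (by monicity!) )

lemma weierstrass_a₄ : -(weierstrass α).a₄ = algebraMap ℂ[X] (RatFunc ℂ) (coefficient α) := by
  rw [weierstrass, coefficient, neg_neg]
  simp only [map_mul, map_pow, map_add, map_ofNat, RatFunc.algebraMap_X, RatFunc.algebraMap_C]

lemma exists_isFunctionField_weierstrass : ∃ x y : (weierstrass α).toAffine.FunctionField,
    IsFunctionField (algebraMap ℂ[X] (RatFunc ℂ) (coefficient α)) x y := by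
  rw [← weierstrass_a₄]
  refine exists_isFunctionField rfl rfl rfl rfl ?_ ?_
  · rw [← neg_ne_zero, weierstrass_a₄]
    exact (map_ne_zero_iff _ (IsFractionRing.injective _ _)).mpr coefficient_ne_zero
  · exact two_ne_zero

lemma exists_isCurve {c : ℂ} {k : ℕ} {g : ℂ[X]} (hg : coefficient α = (X - C c) ^ k * g)
    (hc : g.eval c ≠ 0) : ∃ x y : (weierstrass α).toAffine.FunctionField,
      IsCurve k (polyAt c (X - C c)) (polyAt c g) x y := by
  obtain ⟨x, y, h⟩ := exists_isFunctionField_weierstrass (α := α)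
  refine ⟨x, y, irreducible_polyAt c, isUnit_polyAt hc, ?_, ?_⟩
  · have : (2 : localRingAt c) = polyAt c (C 2) := (map_ofNat (polyAt c) 2).symm
    rw [this]
    exact isUnit_polyAt (by simp)
  · rw [hg, map_mul, map_pow] at h
    exact h

/-- At `λ = 0` the coefficient is `π³ u` with `u = (λ² + 2λ + α)²`, which is a unit as `α ≠ 0`. -/
theorem hasFibre_weierstrass_zero (h0 : α ≠ 0) :
    HasFibre (localRingAt 0) (weierstrass α) typeIIIstar := by
  obtain ⟨x, y, h⟩ := exists_isCurve (α := α) (c := 0) (k := 3) (g := (X ^ 2 + 2 * X + C α) ^ 2)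
    (by rw [C_0, sub_zero, coefficient]) (by simpa using h0)
  exact h.hasFibre_typeIIIstar

/-- At a simple root `r` of `λ² + 2λ + α` the coefficient is `π² u` with a unit `u`, which is a
square modulo `π` because the residue field is algebraically closed. -/
theorem hasFibre_weierstrass_root {r s : ℂ} (hrs : r ≠ s) (hr : r ≠ 0)
    (h : X ^ 2 + 2 * X + C α = (X - C r) * (X - C s)) :
    HasFibre (localRingAt r) (weierstrass α) typeI0star := by
  have hc : (X ^ 3 * (X - C s) ^ 2 : ℂ[X]).eval r ≠ 0 := by simp [hr, sub_ne_zero.mpr hrs]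
  obtain ⟨x, y, h'⟩ := exists_isCurve (α := α) (c := r) (k := 2) (g := X ^ 3 * (X - C s) ^ 2)
    (by rw [coefficient, h]; ring) hc
  obtain ⟨e, he⟩ := IsAlgClosed.exists_pow_nat_eq ((X ^ 3 * (X - C s) ^ 2 : ℂ[X]).eval r) two_pos
  obtain ⟨d, hd⟩ := X_sub_C_dvd_sub_C_eval (a := r) (p := X ^ 3 * (X - C s) ^ 2)
  refine h'.hasFibre_typeI0star (c := polyAt r (C e)) (d := polyAt r d) (isUnit_polyAt ?_) ?_
  · rw [eval_C]
    rintro rfl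
    exact hc (by rw [← he]; simp)
  · rw [← map_pow, ← map_mul, ← map_add, ← hd, ← he, C_pow, add_sub_cancel]

/-- At all other finite points the coefficient is a unit. -/
theorem hasSmoothFibre_weierstrass {c : ℂ} (hc : c ≠ 0) (hc' : c ^ 2 + 2 * c + α ≠ 0) :
    HasSmoothFibre (localRingAt c) (weierstrass α) := by
  obtain ⟨x, y, h⟩ := exists_isCurve (α := α) (c := c) (k := 0) (g := coefficient α)
    (by rw [pow_zero, one_mul]) (by simp [coefficient, hc, hc'])
  exact h.hasSmoothFibre

end AffinePoint

section Infinity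

open Classical in
lemma hasFibre_weierstrass_infty (α : ℂ) : HasFibre localRingAtInfty (weierstrass α) typeIII := by
  let v := RatFunc.inftyValuation ℂ
  have hC (c : ℂ) : v (RatFunc.C c) ≤ 1 := by
    obtain rfl | hc := eq_or_ne c 0
    · simp
    · exact (RatFunc.inftyValuation.C ℂ hc).le
  let C' (c : ℂ) : localRingAtInfty := ⟨RatFunc.C c, hC c⟩
  have hX : v (1 / RatFunc.X) = WithZero.exp (-1) := RatFunc.inftyValuation.X_inv ℂ
  let π : localRingAtInfty := ⟨1 / RatFunc.X, hX.trans_le (by decide)⟩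
  have hπ : Irreducible π := irreducible_of_valuation_eq hX
  have hu : IsUnit (1 + π * (C' 2 + C' α * π)) := by
    refine (IsLocalRing.isUnit_or_isUnit_of_add_one (a := 1 + π * (C' 2 + C' α * π)) (b := -(π * (C' 2 + C' α * π)))
      (by ring)).resolve_right fun h ↦ hπ.not_isUnit ?_
    exact isUnit_of_mul_isUnit_left (IsUnit.neg_iff _ |>.mp h)
  have h2 : IsUnit (2 : localRingAtInfty) :=
    isUnit_iff_valuation_eq_one.mpr (by
      have := RatFunc.inftyValuation.C ℂ (two_ne_zero (α := ℂ))
      rwa [map_ofNat] at this)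
  obtain ⟨x, y, h⟩ := exists_isFunctionField_weierstrass (α := α)
  have hx0 : (RatFunc.X : RatFunc ℂ) ≠ 0 := RatFunc.X_ne_zero
  -- The weights `(λ⁻⁴, λ⁻⁶)` multiply the coefficient by `λ⁻⁸`, which turns it into `π (1 + 2π +
  -- α π²)²`.
  have h' := h.rescale (d := (1 / RatFunc.X) ^ 2) (pow_ne_zero 2 (one_div_ne_zero hx0))
  have ha : ((1 / RatFunc.X) ^ 2) ^ 4 * algebraMap ℂ[X] (RatFunc ℂ) (coefficient α) =
      (π ^ 1 * ((1 + π * (C' 2 + C' α * π)) ^ 2 : localRingAtInfty) : RatFunc ℂ) := by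
    rw [coefficient]
    change _ = (1 / RatFunc.X) ^ 1 * (1 + (1 / RatFunc.X) *
      (RatFunc.C 2 + RatFunc.C α * (1 / RatFunc.X))) ^ 2
    simp only [map_mul, map_pow, map_add, map_ofNat, RatFunc.algebraMap_X, RatFunc.algebraMap_C]
    field_simp
    ring
  rw [ha] at h'
  exact IsCurve.hasFibre_typeIII ⟨hπ, hu.pow 2, h2, h'⟩

end Infinity

/-- The discriminant is `64` times the cube of the coefficient. -/
lemma isElliptic_weierstrass (α : ℂ) : (weierstrass α).IsElliptic := by
  have h : (weierstrass α).Δ =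
      algebraMap ℂ[X] (RatFunc ℂ) (coefficient α) ^ 3 * 64 := by
    rw [← weierstrass_a₄]
    simp only [WeierstrassCurve.Δ, WeierstrassCurve.b₂, WeierstrassCurve.b₄, WeierstrassCurve.b₆,
      WeierstrassCurve.b₈, show (weierstrass α).a₁ = 0 from rfl, show (weierstrass α).a₂ = 0 from rfl,
      show (weierstrass α).a₃ = 0 from rfl, show (weierstrass α).a₆ = 0 from rfl]
    ring
  refine ⟨h ▸ IsUnit.mk0 _ (mul_ne_zero (pow_ne_zero 3 ?_) (by norm_num))⟩
  exact (map_ne_zero_iff _ (IsFractionRing.injective _ _)).mpr coefficient_ne_zero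

end EllipticFibre

end

open EllipticFibre in
theorem mainTheorem12 (α : ℂ) (h0 : α ≠ 0) (h1 : α ≠ 1) :
    (weierstrass α).IsElliptic ∧
    HasFibre (localRingAt 0) (weierstrass α) typeIIIstar ∧
    (∃ r₁ r₂ : ℂ, r₁ ≠ r₂ ∧ (∀ a : ℂ, a ^ 2 + 2 * a + α = 0 ↔ a = r₁ ∨ a = r₂) ∧
      HasFibre (localRingAt r₁) (weierstrass α) typeI0star ∧
      HasFibre (localRingAt r₂) (weierstrass α) typeI0star) ∧
    HasFibre localRingAtInfty (weierstrass α) typeIII ∧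
    (∀ a : ℂ, a ≠ 0 → a ^ 2 + 2 * a + α ≠ 0 →
      HasSmoothFibre (localRingAt a) (weierstrass α)) := by
  -- The roots of `λ² + 2λ + α` are `-1 + s` and `-1 - s`, where `s² = 1 - α`; they are distinct
  -- as `α ≠ 1`, and nonzero as `α ≠ 0`.
  obtain ⟨s, hs⟩ := IsAlgClosed.exists_pow_nat_eq (1 - α) two_pos
  have hs0 : s ≠ 0 := fun h ↦ h1 (by rw [h] at hs; linear_combination hs)
  have hα : α = (-1 + s) * (-1 - s) := by linear_combination hs
  have hr : -1 + s ≠ 0 := fun h ↦ h0 (by rw [hα, h, zero_mul])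
  have hr' : -1 - s ≠ 0 := fun h ↦ h0 (by rw [hα, h, mul_zero])
  have hrs : -1 + s ≠ -1 - s := fun h ↦ hs0 (by linear_combination h / 2)
  have hp : (X ^ 2 + 2 * X + C α : ℂ[X]) = (X - C (-1 + s)) * (X - C (-1 - s)) := by
    rw [hα]
    simp only [C_mul, C_add, C_sub, C_neg, C_1]
    ring
  refine ⟨isElliptic_weierstrass α, hasFibre_weierstrass_zero h0,
    ⟨-1 + s, -1 - s, hrs, fun a ↦ ?_, hasFibre_weierstrass_root hrs hr hp,
      hasFibre_weierstrass_root hrs.symm hr' (hp.trans (mul_comm _ _))⟩,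
    hasFibre_weierstrass_infty α, fun a ↦ hasSmoothFibre_weierstrass⟩
  rw [hα, ← sub_eq_zero (a := a), ← sub_eq_zero (a := a) (b := -1 - s), ← mul_eq_zero]
  ring_nf
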